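/- **Setting.** Let $k=\mathbb{C}((\tau))$, let $F\neq 0$ be a finite étale commutative $k$-algebra, $\zeta$ a $k$-automorphism of $F$ of order $n$ with $F^{\zeta}=k$, $m$ a positive multiple of $n$, and $\beta\in k^\times$. Let $\sigma$ be a ring involution of $F$ (possibly trivial) commuting with $\zeta$; it restricts to $k$, and we assume that $\sigma|_k$ is $\mathbb{C}$-linear. Let $V$ be a finitely generated $F$-module with a $\zeta$-semilinear automorphism $\theta$ with $\theta^m=\beta$. Let $\epsilon\in\{\pm1\}$ and let $\langle\,,\rangle:V\times V\to F$ be a non-degenerate pairing, $F$-linear in the first variable, with $\langle x,y\rangle=\epsilon\,\sigma\langle y,x\rangle$ and $\langle\theta x,\theta y\rangle=c\,\zeta\langle x,y\rangle$, where $c\in (F^\times)^\sigma$ and $\gamma:=\mathrm{Nm}_{F/k}(c)$ satisfies $\gamma^{m/n}=\beta\sigma(\beta)$. Let $\xi\in(F^\times)^{\sigma}$ be such that $\nu:=\mathrm{Nm}_{F/k}(\xi)$ is a primitive $m/n$-th root of unity. Let $H$ be the algebraic group over $k^\sigma$ of $F$-linear automorphisms of $V$ which commute with $\theta$ and preserve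 $\langle\,,\rangle$, and let $\mathfrak g(\xi)$ be the $k^\sigma$-space of $\varphi\in\mathrm{End}_F(V)$ with $\theta\varphi\theta^{-1}=\xi\varphi$ and $\langle\varphi x,y\rangle+\langle x,\varphi y\rangle=0$. Let $A_\beta=F\langle\theta\rangle/(\theta^m-\beta)$ (with $\theta a=\zeta(a)\theta$ for $a\in F$), $b=\theta^n$, $L=k[b]/(b^{m/n}-\beta)$ its centre, $I=\mathrm{Spec}\,L$, $L_i$ ($i\in I$) the residue fields and $b_i\in L_i$ the image of $b$. Let $\mu_\xi:L\to L$ be the $k$-linear automorphism $b\mapsto\nu b$, let $\sigma_c$ (resp. $\sigma_{c\xi^{-1}}$) be the automorphism of $L$ that is $\sigma$ on $k$ and sends $b$ to $\gamma b^{-1}$ (resp. $\gamma\nu^{-1}b^{-1}$), and let $i\mapsto\bar\xi(i)$, $i\mapsto i^\dagger$ be the maps $I\to I$ induced by $\mu_\xi$, $\sigma_c$. The quiver $Q_\xi$ has vertex set $I$ and arrows $i\to\bar\xi(i)$; ${}^\dagger$ is an arrow-reversing involution of it. A single directed cycle with such an involution has type (VE) if exactly one vertex and one arrow are fixed, (VV)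 if exactly two vertices and no arrow are fixed, (EE) if exactly two arrows and no vertex are fixed. For each $i$ let $S_i$ be a simple $A_\beta$-module on which $L$ acts through $L_i$, $D_i=\mathrm{End}_{A_\beta}(S_i)^{\rm opp}$ and $M_i=\mathrm{Hom}_{A_\beta}(S_i,V)$. Choose perfect pairings $\langle\,,\rangle_i:S_i\times S_{i^\dagger}\to F$, $F$-linear in the first and $\sigma$-semilinear in the second variable, with $\langle\theta u,\theta v\rangle_i=c\,\zeta\langle u,v\rangle_i$; if $i=i^\dagger$, choose it Hermitian if possible and skew-Hermitian otherwise. For each arrow $e:i\to\bar\xi(i)$ choose an $F$-linear isomorphism $\eta_e:S_i\to S_{\bar\xi(i)}$ with $\eta_e\circ\xi\theta=\theta\circ\eta_e$; if $e=e^\dagger$ (that is, $\bar\xi(i)=i^\dagger$), choose it with $\langle u,\eta_e(v)\rangle_i=\epsilon_e\,\sigma\langle v,\eta_e(u)\rangle_i$, where $\epsilon_e=1$ if possible and $\epsilon_e=-1$ otherwise. **Theorem.** (0) $L=\prod_i L_i$, and $D_i=L_i$ for all $i$. For all $i$ there is a unique pairing $\{\,,\}_i:M_i\times M_{i^\dagger}\to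 L_i$ with $\langle x(u),y(v)\rangle=\langle \{x,y\}_iu,v\rangle_i$, and it is non-degenerate. The group $H$ is the product, over representatives $i$ of the vertices modulo ${}^\dagger$, of the factors $\mathbf{Aut}_{L_i/k^\sigma}(M_i,\{\,,\}_i)$ if $i=i^\dagger$ and $\mathbf{GL}_{L_i/k^\sigma}(M_i)$ if $i\ne i^\dagger$, where $g\in H$ corresponds to $(g_i)$ with $g(x(u))=g_i(x)(u)$. The space $\mathfrak g(\xi)$ is the direct sum, over representatives $e:j\to\bar\xi(j)$ of the arrows modulo ${}^\dagger$, of the spaces $\mathrm{Hom}(M_j,M_{\bar\xi(j)})$ of $k^\sigma$-linear maps $\varphi_e$ with $\varphi_e(\mu_\xi(l)x)=l\varphi_e(x)$ for $l\in L$ if $e\ne e^\dagger$, and, if $e=e^\dagger$, of their subspaces $\mathfrak h_e$ of those $\varphi_e$ that satisfy $\{y,\varphi_e(x)\}_j=-\epsilon\epsilon_e\,\sigma_{c\xi^{-1}}\{x,\varphi_e(y)\}_j$; here $\varphi$ corresponds to $(\varphi_e)$ with $\varphi(x(u))=\varphi_e(x)(\eta_e(u))$. Below, "$i$ is of type O/Sp"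 means: $i=i^\dagger$, $\sigma_c|_{L_i}=\mathrm{id}$, and the factor of $H$ at $i$ is (the Weil restriction to $k$ of) the orthogonal or the symplectic group of the non-degenerate symmetric or alternating form $\{\,,\}_i$ over $L_i$; if $\sigma=\mathrm{id}_F$ it is orthogonal when $\epsilon=1$ and symplectic when $\epsilon=-1$. "$i$ is of type U" means: $i=i^\dagger$, $\sigma_c|_{L_i}$ is a non-trivial involution with fixed field $k^\sigma$, and the factor of $H$ at $i$ is the unitary group over $k^\sigma$ of a non-degenerate $L_i/k^\sigma$-Hermitian form on $M_i$. "$e:j\to j^\dagger$ is of type $\wedge^2/\mathrm{Sym}^2$" means: $e=e^\dagger$, $\sigma_{c\xi^{-1}}|_{L_j}=\mathrm{id}$, and $\mathfrak h_e$ is isomorphic, $GL(M_j)$-equivariantly, to $\wedge^2_{L_{j^\dagger}}(M_{j^\dagger})$ or to $\mathrm{Sym}^2_{L_{j^\dagger}}(M_{j^\dagger})$; if $\sigma=\mathrm{id}_F$ it is the former when $\epsilon=1$ and the latter when $\epsilon=-1$. "$e:j\to j^\dagger$ is of type Herm" means: $e=e^\dagger$, $\sigma_{c\xi^{-1}}|_{L_j}$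 is a non-trivial involution with fixed field $k^\sigma$, and $\mathfrak h_e$ is isomorphic, $GL(M_j)$-equivariantly, to the space of $L_j/k^\sigma$-Hermitian forms on $M_j$. (1) *$\sigma|_k=\mathrm{id}$, $m/n$ odd.* Then $m/n$ divides $\mathrm{val}_\tau(\beta)$, all $L_i=k$, and $Q_\xi$ is a single cycle of length $m/n$ of type (VE). At the fixed vertex $i$, $b_i$ is the unique $a\in k$ with $a^2=\gamma$, $a^{m/n}=\beta$, and $i$ is of type O/Sp. At the fixed arrow $j\to j^\dagger$, $b_j$ is the unique $a\in k$ with $a^2=\gamma\nu^{-1}$, $a^{m/n}=\beta$, and the arrow is of type $\wedge^2/\mathrm{Sym}^2$. (2) *$\sigma|_k=\mathrm{id}$, $m/n$ even.* Then $\beta=\pm\gamma^{m/2n}$. (2a) If $\mathrm{val}_\tau(\gamma)$ is even, all $L_i=k$ and $Q_\xi$ is a single cycle of length $m/n$. If $\beta=\gamma^{m/2n}$ it has type (VV), and both fixed vertices are of type O/Sp. If $\beta=-\gamma^{m/2n}$ it has type (EE), and both fixed arrows are of type $\wedge^2/\mathrm{Sym}^2$. (2b) If $\mathrm{val}_\tau(\gamma)$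 is odd, all $L_i$ are isomorphic to the quadratic extension $k(\sqrt\tau)$ of $k$, and $Q_\xi$ is a single cycle of length $m/2n$. - If $m/2n$ is odd and $\beta=\gamma^{m/2n}$: type (VE); the fixed vertex $i$ has $b_i^2=\gamma$ and is of type O/Sp; the fixed arrow $j\to j^\dagger$ has $b_j^2=-\gamma\nu^{-1}$ and is of type Herm. - If $m/2n$ is odd and $\beta=-\gamma^{m/2n}$: type (VE); the fixed vertex $i$ has $b_i^2=-\gamma$ and is of type U; the fixed arrow has $b_j^2=\gamma\nu^{-1}$ and is of type $\wedge^2/\mathrm{Sym}^2$. - If $m/2n$ is even and $\beta=\gamma^{m/2n}$: type (VV); one fixed vertex has $b_i^2=\gamma$ and is of type O/Sp, the other has $b_{i'}^2=-\gamma$ and is of type U. - If $m/2n$ is even and $\beta=-\gamma^{m/2n}$: type (EE); one fixed arrow has $b_j^2=\gamma\nu^{-1}$ and is of type $\wedge^2/\mathrm{Sym}^2$, the other has $b_{j'}^2=-\gamma\nu^{-1}$ and is of type Herm. (3) *$\sigma|_k\neq\mathrm{id}$.* Then $k^\sigma=\mathbb{C}((t^2))$ for a uniformizer $t$ of $k$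 with $\sigma(t)=-t$, $\mathrm{val}_\tau(\gamma)$ is even, $m/n$ divides $\mathrm{val}_\tau(\beta)$, all $L_i=k$, and $Q_\xi$ is a single cycle of length $m/n$. (3a) If $m/n$ is odd, the type is (VE). At the fixed vertex $i$, $b_i$ is the unique $a\in k$ with $a\sigma(a)=\gamma$, $a^{m/n}=\beta$, and $i$ is of type U. At the fixed arrow $j\to j^\dagger$, $b_j$ is the unique $a\in k$ with $a\sigma(a)=\gamma\nu^{-1}$, $a^{m/n}=\beta$, and the arrow is of type Herm. (3b) If $m/n$ is even and the equations $a\sigma(a)=\gamma$, $a^{m/n}=\beta$ have a common solution $a\in k^\times$, the type is (VV); for the two fixed vertices $i,i'$ the elements $b_i$ and $b_{i'}=-b_i$ are the two solutions, and both vertices are of type U. (3c) If $m/n$ is even and these equations have no common solution, the type is (EE); for the two fixed arrows, with sources $j,j'$, the elements $b_j$ and $b_{j'}=-b_j$ are the two solutions of $a\sigma(a)=\gamma\nu^{-1}$, $a^{m/n}=\beta$, and both arrows are of type Herm. -/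

import Mathlib

open scoped TensorProduct Polynomial

universe u v w

noncomputable section

namespace LoopGrading

/-! ### The algebra `F`, the modules over `A_β`, and the centre `L_β` -/

/-- An automorphism `ζ` of the `k`-algebra `F` of order `n` with `F^ζ = k`, a multiple `m` of `n`
with `m / n` invertible in `k`, and `β ∈ kˣ`. -/
structure CyclicDatum (k : Type) [Field k] (F : Type u) [CommRing F] [Algebra k F] where
  ζ : F ≃ₐ[k] F
  n : ℕ
  m : ℕ
  β : k
  orderOf_ζ : orderOf ζ = n
  fixed : ∀ x : F, ζ x = x → ∃ a : k, algebraMap k F a = x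
  n_dvd_m : n ∣ m
  m_div_n_ne_zero : ((m / n : ℕ) : k) ≠ 0
  β_ne_zero : β ≠ 0

namespace CyclicDatum

variable {k : Type} [Field k] {F : Type u} [CommRing F] [Algebra k F] (E : CyclicDatum k F)

/-- The integer `m / n`. -/
def r : ℕ := E.m / E.n

theorem n_mul_r : E.n * E.r = E.m := Nat.mul_div_cancel' E.n_dvd_m

theorem r_pos : 0 < E.r :=
  Nat.pos_of_ne_zero fun h => E.m_div_n_ne_zero (by
    change ((E.r : ℕ) : k) = 0
    rw [h, Nat.cast_zero])

/-- `L_β = k[b]/(b^{m/n} - β)`, the centre `k[θ^n]` of `A_β`. -/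
def L : Type := AdjoinRoot (Polynomial.X ^ E.r - Polynomial.C E.β : k[X])

instance : CommRing E.L :=
  inferInstanceAs (CommRing (AdjoinRoot (Polynomial.X ^ E.r - Polynomial.C E.β : k[X])))

instance : Algebra k E.L :=
  inferInstanceAs (Algebra k (AdjoinRoot (Polynomial.X ^ E.r - Polynomial.C E.β : k[X])))

/-- The element `b = θ^n` of `L_β`. -/
def b : E.L := AdjoinRoot.root (Polynomial.X ^ E.r - Polynomial.C E.β : k[X])

theorem b_pow : E.b ^ E.r = algebraMap k E.L E.β := by
  have h := AdjoinRoot.eval₂_root (Polynomial.X ^ E.r - Polynomial.C E.β : k[X])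
  simp only [Polynomial.eval₂_sub, Polynomial.eval₂_pow, Polynomial.eval₂_X,
    Polynomial.eval₂_C] at h
  exact sub_eq_zero.mp h

/-- The inverse `b⁻¹ = β⁻¹ b^{m/n - 1}` of `b`. -/
def bInv : E.L := algebraMap k E.L E.β⁻¹ * E.b ^ (E.r - 1)

theorem b_mul_bInv : E.b * E.bInv = 1 := by
  have h : E.b * E.b ^ (E.r - 1) = E.b ^ E.r := by
    rw [← pow_succ', Nat.sub_add_cancel E.r_pos]
  rw [bInv, mul_left_comm, h, b_pow, ← map_mul, inv_mul_cancel₀ E.β_ne_zero, map_one]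

/-- The index set `I = Spec L_β`. -/
abbrev I : Type := PrimeSpectrum E.L

/-- The factor `L_i` of `L_β`. -/
def Li (i : E.I) : Type := E.L ⧸ i.asIdeal

instance (i : E.I) : CommRing (E.Li i) := inferInstanceAs (CommRing (E.L ⧸ i.asIdeal))
instance (i : E.I) : Algebra E.L (E.Li i) := inferInstanceAs (Algebra E.L (E.L ⧸ i.asIdeal))
instance (i : E.I) : Algebra k (E.Li i) := inferInstanceAs (Algebra k (E.L ⧸ i.asIdeal))
instance (i : E.I) : IsScalarTower k E.L (E.Li i) :=
  inferInstanceAs (IsScalarTower k E.L (E.L ⧸ i.asIdeal))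

/-- The image `b_i` of `b` in `L_i`. -/
def bi (i : E.I) : E.Li i := algebraMap E.L (E.Li i) E.b

/-- An `A_β`-module, `A_β = F⟨θ⟩/(θ^m - β)` with `θ a = ζ(a) θ`: an `F`-module with an
`(F, ζ)`-semilinear map `T` (the action of `θ`, automatically bijective) with `T^m = β`. -/
structure AMod where
  carrier : Type v
  [addCommGroup : AddCommGroup carrier]
  [module : Module F carrier]
  T : carrier →+ carrier
  T_smul : ∀ (a : F) (x : carrier), T (a • x) = E.ζ a • T x
  T_iterate : ∀ x : carrier, T^[E.m] x = algebraMap k F E.β • x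

end CyclicDatum

namespace CyclicDatum.AMod

variable {k : Type} [Field k] {F : Type u} [CommRing F] [Algebra k F] {E : CyclicDatum k F}

instance : CoeSort (AMod.{u, v} E) (Type v) := ⟨carrier⟩

instance (X : AMod.{u, v} E) : AddCommGroup X := X.addCommGroup
instance (X : AMod.{u, v} E) : Module F X := X.module
instance (X : AMod.{u, v} E) : Module k X := Module.compHom X (algebraMap k F)
instance (X : AMod.{u, v} E) : IsScalarTower k F X :=
  ⟨fun a b x => by rw [Algebra.smul_def, mul_smul]; rfl⟩

variable (X : AMod.{u, v} E)

theorem T_iterate_smul (j : ℕ) (a : F) (x : X) :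
    X.T^[j] (a • x) = (E.ζ ^ j) a • X.T^[j] x := by
  induction j with
  | zero => simp
  | succ j ih =>
    rw [Function.iterate_succ_apply', ih, X.T_smul, Function.iterate_succ_apply', pow_succ']
    rfl

/-- The action of `b = θ^n`. -/
def bAct : Module.End F X where
  toFun := X.T^[E.n]
  map_add' := by intro x y; exact iterate_map_add X.T E.n x y
  map_smul' := by
    intro a x
    rw [T_iterate_smul, ← E.orderOf_ζ, pow_orderOf_eq_one]
    rfl

theorem bAct_pow (j : ℕ) (x : X) : (X.bAct ^ j) x = X.T^[E.n * j] x := by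
  rw [Module.End.pow_apply, Function.iterate_mul]
  rfl

/-- The action of `L_β` on an `A_β`-module, `b` acting by `θ^n`. -/
def act : E.L →ₐ[k] Module.End F X :=
  Ideal.Quotient.liftₐ _ (Polynomial.aeval X.bAct) (by
    intro p hp
    obtain ⟨q, rfl⟩ := Ideal.mem_span_singleton.mp hp
    have h : Polynomial.aeval X.bAct
        (Polynomial.X ^ E.r - Polynomial.C E.β : k[X]) = 0 := by
      refine LinearMap.ext fun x => ?_
      simp only [map_sub, map_pow, Polynomial.aeval_X, Polynomial.aeval_C, LinearMap.sub_apply]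
      rw [bAct_pow, E.n_mul_r, X.T_iterate, algebraMap_smul]
      exact sub_self _
    rw [map_mul, h, zero_mul])

instance : Module E.L X := Module.compHom X (X.act : E.L →+* Module.End F X)


theorem L_smul_def (l : E.L) (x : X) : l • x = X.act l x := rfl

theorem act_comm_T (l : E.L) (x : X) : X.act l (X.T x) = X.T (X.act l x) := by
  obtain ⟨p, rfl⟩ := AdjoinRoot.mk_surjective l
  change Polynomial.aeval X.bAct p (X.T x) = X.T (Polynomial.aeval X.bAct p x)
  induction p using Polynomial.induction_on' with
  | add p q hp hq => simp only [map_add, LinearMap.add_apply, hp, hq]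
  | monomial j a =>
    have hs : ∀ (a : k) (y : X), X.T (a • y) = a • X.T y := fun a y => by
      change X.T (algebraMap k F a • y) = algebraMap k F a • X.T y
      rw [X.T_smul, AlgEquiv.commutes]
    rw [Polynomial.aeval_monomial, Module.End.mul_apply, Module.End.mul_apply, bAct_pow, bAct_pow,
      Module.algebraMap_end_apply, Module.algebraMap_end_apply, hs,
      ← Function.iterate_succ_apply, ← Function.iterate_succ_apply' X.T]

instance : SMulCommClass F E.L X :=
  ⟨fun a l x => ((X.act l).map_smul a x).symm⟩

instance : SMulCommClass E.L F X := SMulCommClass.symm F E.L X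

instance : IsScalarTower k E.L X :=
  ⟨fun a l x => by
    rw [L_smul_def, map_smul]
    rfl⟩

/-- `Hom_{A_β}(S, X)`: the `F`-linear maps commuting with `θ`. It is an `L_β`-module. -/
def AHom (S : AMod.{u, w} E) (X : AMod.{u, v} E) : Submodule E.L (S →ₗ[F] X) where
  carrier := {f | ∀ s, f (S.T s) = X.T (f s)}
  add_mem' := by
    intro f g hf hg s
    rw [LinearMap.add_apply, LinearMap.add_apply, map_add, hf, hg]
  zero_mem' := by
    intro s
    simp
  smul_mem' := by
    intro l f hf s
    rw [LinearMap.smul_apply, LinearMap.smul_apply, hf]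
    exact act_comm_T X l (f s)

/-- `End_{A_β}(X)`, as a `k`-subalgebra of `End_F(X)`. -/
def AEnd (X : AMod.{u, v} E) : Subalgebra k (Module.End F X) where
  carrier := {f | ∀ x, f (X.T x) = X.T (f x)}
  mul_mem' := by
    intro f g hf hg x
    rw [Module.End.mul_apply, Module.End.mul_apply, hg, hf]
  add_mem' := by
    intro f g hf hg x
    rw [LinearMap.add_apply, LinearMap.add_apply, map_add, hf, hg]
  algebraMap_mem' := by
    intro a x
    rw [Module.algebraMap_end_apply, Module.algebraMap_end_apply]
    change _ = X.T (algebraMap k F a • x)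
    rw [X.T_smul, AlgEquiv.commutes]
    rfl

/-- `X` is a simple `A_i`-module: a simple `A_β`-module on which `L_β` acts through `L_i`. -/
structure IsSimpleAt (X : AMod.{u, v} E) (i : E.I) : Prop where
  nontrivial : Nontrivial X
  eq_bot_or_top : ∀ N : Submodule F X, (∀ x ∈ N, X.T x ∈ N) → N = ⊥ ∨ N = ⊤
  smul_eq_zero : ∀ l ∈ i.asIdeal, ∀ x : X, l • x = 0

end CyclicDatum.AMod

/-! ### Groups of automorphisms, as functors of points -/

section Points

variable {k₀ : Type} [Field k₀] {M : Type v} [AddCommGroup M] [Module k₀ M]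
  (R : Type) [CommRing R] [Algebra k₀ R]

/-- The `R`-linear automorphisms of `R ⊗ M` commuting with the endomorphisms of `M` in `S`. -/
def commPoints (S : Set (Module.End k₀ M)) : Subgroup ((R ⊗[k₀] M) ≃ₗ[R] (R ⊗[k₀] M)) where
  carrier := {g | ∀ f ∈ S, ∀ z, g (f.baseChange R z) = f.baseChange R (g z)}
  mul_mem' := by
    intro g h hg hh f hf z
    rw [LinearEquiv.mul_apply, LinearEquiv.mul_apply, hh f hf, hg f hf]
  one_mem' := fun _ _ _ => rfl
  inv_mem' := by
    intro g hg f hf z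
    apply g.injective
    rw [hg f hf]
    change g (g.symm _) = f.baseChange R (g (g.symm z))
    rw [g.apply_symm_apply, g.apply_symm_apply]

/-- The `R`-linear automorphisms of `R ⊗ M` preserving the `R`-bilinear extension of `p`. -/
def isometryPoints {Q : Type w} [AddCommGroup Q] [Module k₀ Q] (p : LinearMap.BilinMap k₀ M Q) :
    Subgroup ((R ⊗[k₀] M) ≃ₗ[R] (R ⊗[k₀] M)) where
  carrier := {g | ∀ z z', p.baseChange R (g z) (g z') = p.baseChange R z z'}
  mul_mem' := by
    intro g h hg hh z z'
    rw [LinearEquiv.mul_apply, LinearEquiv.mul_apply, hg, hh]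
  one_mem' := fun _ _ => rfl
  inv_mem' := by
    intro g hg z z'
    rw [← hg]
    change p.baseChange R (g (g.symm z)) (g (g.symm z')) = _
    rw [g.apply_symm_apply, g.apply_symm_apply]

/-- The automorphisms of `R ⊗ M` which are linear over the commutative ring `A` acting on `M`:
the `R`-points of `GL_{A/k₀}(M)`. -/
def glPoints (A : Type w) [CommRing A] [Module A M] [SMulCommClass A k₀ M] :
    Subgroup ((R ⊗[k₀] M) ≃ₗ[R] (R ⊗[k₀] M)) :=
  commPoints R (Set.range (Module.toModuleEnd k₀ (S := A) M))

end Points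

/-! ### Polarizations -/

/-- The standing data: an involution `σ` of `F` commuting with `ζ`, inducing `σk` on `k`, an
`A_β`-module `V` of finite type over `F` (the action of `θ` is the semilinear automorphism of `V`
under consideration), an `ε`-Hermitian non-degenerate pairing on `V` which `θ` multiplies by
`c ∈ (Fˣ)^σ` (up to the twist by `ζ`), and `ξ ∈ (Fˣ)^σ` with `Nm(ξ)^{m/n} = 1`. -/
structure PolarizedDatum (k : Type) [Field k] (F : Type u) [CommRing F] [Algebra k F] extends
    CyclicDatum k F where
  σ : F →+* F
  σ_σ : ∀ x, σ (σ x) = x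
  σ_ζ : ∀ x, σ (ζ x) = ζ (σ x)
  σk : k →+* k
  σ_algebraMap : ∀ a : k, σ (algebraMap k F a) = algebraMap k F (σk a)
  V : CyclicDatum.AMod.{u, v} toCyclicDatum
  finite_V : Module.Finite F V
  ε : ℤˣ
  form : V →ₗ[F] V →ₛₗ[σ] F
  form_swap : ∀ x y, form x y = ((ε : ℤ) : F) * σ (form y x)
  form_nondegenerate : ∀ x, (∀ y, form x y = 0) → x = 0
  c : Fˣ
  σ_c : σ c = c
  form_T : ∀ x y, form (V.T x) (V.T y) = c * ζ (form x y)
  norm_c_pow : Algebra.norm k (c : F) ^ (m / n) = β * σk β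
  ξ : Fˣ
  σ_ξ : σ ξ = ξ
  norm_ξ_pow : Algebra.norm k (ξ : F) ^ (m / n) = 1

namespace PolarizedDatum

open CyclicDatum CyclicDatum.AMod

variable {k : Type} [Field k] {F : Type u} [CommRing F] [Algebra k F]
  (D : PolarizedDatum.{u, v} k F)

/-- `γ = Nm_{F/k}(c)`. -/
def γ : k := Algebra.norm k (D.c : F)

/-- `Nm_{F/k}(ξ)`. -/
def ν : k := Algebra.norm k (D.ξ : F)

/-- The fixed field `k^σ`. -/
def k₀ : Subfield k := D.σk.eqLocusField (RingHom.id k)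

theorem ν_pow : D.ν ^ D.r = 1 := D.norm_ξ_pow

theorem γ_pow : D.γ ^ D.r = D.β * D.σk D.β := D.norm_c_pow

/-- `μ_ξ : L_β → L_β`, the `k`-linear automorphism `b ↦ Nm(ξ) b`. -/
def mu : D.L →+* D.L :=
  AdjoinRoot.lift (algebraMap k D.L) (algebraMap k D.L D.ν * D.b) (by
    simp only [Polynomial.eval₂_sub, Polynomial.eval₂_pow, Polynomial.eval₂_X, Polynomial.eval₂_C]
    rw [mul_pow, ← map_pow, D.ν_pow, map_one, one_mul, D.b_pow, sub_self])

/-- `σ_c : L_β → L_β`, the automorphism which is `σ` on `k` and sends `b` to `γ b⁻¹`. -/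
def sigmaC : D.L →+* D.L :=
  AdjoinRoot.lift ((algebraMap k D.L).comp D.σk) (algebraMap k D.L D.γ * D.bInv) (by
    simp only [Polynomial.eval₂_sub, Polynomial.eval₂_pow, Polynomial.eval₂_X, Polynomial.eval₂_C]
    have h : algebraMap k D.L D.β * D.bInv ^ D.r = 1 := by
      rw [← D.b_pow, ← mul_pow, D.b_mul_bInv, one_pow]
    rw [mul_pow, ← map_pow, D.γ_pow, map_mul, mul_comm (algebraMap k D.L D.β), mul_assoc, h,
      mul_one, RingHom.comp_apply, sub_self])

theorem mu_algebraMap (a : k) : D.mu (algebraMap k D.L a) = algebraMap k D.L a :=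
  AdjoinRoot.lift_of _

theorem mu_b : D.mu D.b = algebraMap k D.L D.ν * D.b :=
  AdjoinRoot.lift_root _

theorem sigmaC_algebraMap (a : k) : D.sigmaC (algebraMap k D.L a) = algebraMap k D.L (D.σk a) :=
  AdjoinRoot.lift_of _

theorem sigmaC_b : D.sigmaC D.b = algebraMap k D.L D.γ * D.bInv :=
  AdjoinRoot.lift_root _

theorem σk_σk [Nontrivial F] (a : k) : D.σk (D.σk a) = a := by
  apply (algebraMap k F).injective
  rw [← D.σ_algebraMap, ← D.σ_algebraMap, D.σ_σ]

theorem σk_γ [Nontrivial F] : D.σk D.γ = D.γ := by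
  let e₁ : k ≃+* k := RingEquiv.ofRingHom D.σk D.σk (RingHom.ext D.σk_σk) (RingHom.ext D.σk_σk)
  let e₂ : F ≃+* F := RingEquiv.ofRingHom D.σ D.σ (RingHom.ext D.σ_σ) (RingHom.ext D.σ_σ)
  have h := Algebra.norm_eq_of_equiv_equiv e₁ e₂
    (RingHom.ext fun a => (D.σ_algebraMap a).symm) (D.c : F)
  have h2 : e₂ (D.c : F) = D.c := D.σ_c
  rw [h2] at h
  conv_lhs => rw [γ, h]
  exact e₁.apply_symm_apply _

theorem sigmaC_sigmaC [Nontrivial F] (l : D.L) : D.sigmaC (D.sigmaC l) = l := by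
  have hb : D.sigmaC (D.sigmaC D.b) = D.b := by
    have h1 : D.sigmaC D.b * D.sigmaC D.bInv = 1 := by
      rw [← map_mul, D.b_mul_bInv, map_one]
    rw [sigmaC_b] at h1
    rw [sigmaC_b, map_mul, sigmaC_algebraMap, σk_γ]
    have h2 : D.bInv * D.b = 1 := by rw [mul_comm, D.b_mul_bInv]
    calc algebraMap k D.L D.γ * D.sigmaC D.bInv
        = (D.bInv * D.b) * (algebraMap k D.L D.γ * D.sigmaC D.bInv) := by rw [h2, one_mul]
      _ = D.b * (algebraMap k D.L D.γ * D.bInv * D.sigmaC D.bInv) := by ring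
      _ = D.b := by rw [h1, mul_one]
  have h : D.sigmaC.comp D.sigmaC = RingHom.id D.L := by
    refine Ideal.Quotient.ringHom_ext (Polynomial.ringHom_ext (fun a => ?_) hb)
    change D.sigmaC (D.sigmaC (algebraMap k D.L a)) = algebraMap k D.L a
    rw [sigmaC_algebraMap, sigmaC_algebraMap, σk_σk]
  exact RingHom.congr_fun h l

/-- The permutation `i ↦ ξ̄(i)` of `I = Spec L_β` induced by `μ_ξ`; the quiver `Q_ξ` has vertex
set `I` and one arrow `i → ξ̄(i)` for each `i`, which we denote by its source `i`. -/
def rot (i : D.I) : D.I := PrimeSpectrum.comap D.mu i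

/-- The involution `i ↦ i†` of `I = Spec L_β` induced by `σ_c`. It reverses the arrows of `Q_ξ`:
the arrow `e : i → ξ̄(i)` goes to `e† : ξ̄(i)† → i†`, and `e = e†` if and only if `ξ̄(i) = i†`. -/
def dag (i : D.I) : D.I := PrimeSpectrum.comap D.sigmaC i

/-- `σ_{cξ⁻¹} : L_β → L_β`, which is `σ` on `k` and sends `b` to `γ Nm(ξ)⁻¹ b⁻¹`. -/
def sigmaCXi : D.L →+* D.L := D.mu.comp D.sigmaC

theorem dag_dag [Nontrivial F] (i : D.I) : D.dag (D.dag i) = i := by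
  apply PrimeSpectrum.ext
  ext l
  change D.sigmaC (D.sigmaC l) ∈ i.asIdeal ↔ l ∈ i.asIdeal
  rw [sigmaC_sigmaC]

theorem comap_sigmaC {i : D.I} (h : D.dag i = i) : i.asIdeal = i.asIdeal.comap D.sigmaC :=
  (congrArg PrimeSpectrum.asIdeal h).symm

theorem comap_sigmaCXi [Nontrivial F] {j : D.I} (h : D.rot j = D.dag j) :
    j.asIdeal = j.asIdeal.comap D.sigmaCXi := by
  have h1 : D.dag (D.rot j) = j := by rw [h, dag_dag]
  exact (congrArg PrimeSpectrum.asIdeal h1).symm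

theorem sigmaC_k₀ (a : D.k₀) : D.sigmaC (algebraMap k D.L a) = algebraMap k D.L a := by
  rw [sigmaC_algebraMap]
  exact congrArg _ a.2

theorem sigmaCXi_k₀ (a : D.k₀) : D.sigmaCXi (algebraMap k D.L a) = algebraMap k D.L a := by
  change D.mu (D.sigmaC _) = _
  rw [sigmaC_k₀, mu_algebraMap]

instance (i : D.I) : Algebra D.k₀ (D.Li i) := Algebra.ofSubsemiring D.k₀
instance (i : D.I) : Module D.k₀ (D.Li i) := Algebra.toModule

/-- The endomorphism `σ_c|_{L_i}` of `L_i` for a vertex `i = i†`. -/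
def sigmaVertex (i : D.I) (h : D.dag i = i) : D.Li i →ₐ[D.k₀] D.Li i where
  __ := Ideal.quotientMap i.asIdeal D.sigmaC (D.comap_sigmaC h).le
  commutes' a := congrArg (Ideal.Quotient.mk i.asIdeal) (D.sigmaC_k₀ a)

/-- The endomorphism `σ_{cξ⁻¹}|_{L_j}` of `L_j` for an arrow `e : j → ξ̄(j) = j†`. -/
def sigmaArrow [Nontrivial F] (j : D.I) (h : D.rot j = D.dag j) : D.Li j →ₐ[D.k₀] D.Li j where
  __ := Ideal.quotientMap j.asIdeal D.sigmaCXi (D.comap_sigmaCXi h).le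
  commutes' a := congrArg (Ideal.Quotient.mk j.asIdeal) (D.sigmaCXi_k₀ a)

/-! ### The group `H` and the space `𝔤(ξ)` -/

/-- The pairing on `V` as a `k^σ`-bilinear map. -/
def formBil : LinearMap.BilinMap D.k₀ D.V F :=
  LinearMap.mk₂ D.k₀ (fun x y => D.form x y)
    (fun x x' y => by rw [map_add, LinearMap.add_apply])
    (fun a x y => by
      change D.form ((a : k) • x) y = (a : k) • D.form x y
      rw [← algebraMap_smul F (a : k) x, ← algebraMap_smul F (a : k) (D.form x y), map_smul,
        LinearMap.smul_apply])
    (fun x y y' => map_add _ _ _)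
    (fun a x y => by
      change D.form x ((a : k) • y) = (a : k) • D.form x y
      rw [← algebraMap_smul F (a : k) y, ← algebraMap_smul F (a : k) (D.form x y),
        LinearMap.map_smulₛₗ, D.σ_algebraMap]
      exact congrArg (fun t => algebraMap k F t • D.form x y) a.2)

/-- The action of `θ` on `V` as a `k^σ`-linear map. -/
def thetaLin : Module.End D.k₀ D.V where
  toFun := D.V.T
  map_add' := map_add _
  map_smul' := by
    intro a x
    change D.V.T (algebraMap k F a • x) = algebraMap k F a • D.V.T x
    rw [D.V.T_smul, AlgEquiv.commutes]

/-- The `R`-points of the algebraic group `H = (R_{F^σ/k^σ} G)^{Ad(θ)}` over `k^σ`, for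
`G = Aut_{F/F^σ}(V, ⟨,⟩)`: the `R ⊗ F`-linear automorphisms of `R ⊗ V` which commute with `θ` and
preserve the pairing. -/
def H (R : Type) [CommRing R] [Algebra D.k₀ R] :
    Subgroup ((R ⊗[D.k₀] D.V) ≃ₗ[R] (R ⊗[D.k₀] D.V)) :=
  glPoints R F ⊓ commPoints R {D.thetaLin} ⊓ isometryPoints R D.formBil

/-- The `k^σ`-vector space `𝔤(ξ)` of the `F`-linear `φ` with `θ φ θ⁻¹ = ξ φ` which are skew for
the pairing on `V`. -/
def gXi : Submodule D.k₀ (Module.End F D.V) where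
  carrier := {φ | (∀ x, D.V.T (φ x) = (D.ξ : F) • φ (D.V.T x)) ∧
    ∀ x y, D.form (φ x) y + D.form x (φ y) = 0}
  add_mem' := by
    rintro φ ψ ⟨h1, h2⟩ ⟨h3, h4⟩
    refine ⟨fun x => ?_, fun x y => ?_⟩
    · rw [LinearMap.add_apply, LinearMap.add_apply, map_add, h1, h3, smul_add]
    · rw [LinearMap.add_apply, LinearMap.add_apply, map_add, map_add, LinearMap.add_apply,
        add_add_add_comm, h2, h4, add_zero]
  zero_mem' := by
    refine ⟨fun x => ?_, fun x y => ?_⟩ <;> simp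
  smul_mem' := by
    rintro a φ ⟨h1, h2⟩
    refine ⟨fun x => ?_, fun x y => ?_⟩
    · change D.thetaLin (a • φ x) = (D.ξ : F) • a • φ (D.V.T x)
      rw [map_smul, smul_comm]
      exact congrArg _ (h1 x)
    · change D.formBil (a • φ x) y + D.formBil x (a • φ y) = 0
      rw [map_smul, map_smul, LinearMap.smul_apply, ← smul_add]
      exact (congrArg _ (h2 x y)).trans (smul_zero a)

/-! ### Admissible pairings, multiplicity spaces and their pairings -/

section Pairings

variable {S : AMod.{u, w} D.toCyclicDatum} {S' : AMod.{u, w} D.toCyclicDatum}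

/-- Admissible pairings `S × S' → F`. -/
def IsAdmissible (B : S →ₗ[F] S' →ₛₗ[D.σ] F) : Prop :=
  ∀ u v, B (S.T u) (S'.T v) = D.c * D.ζ (B u v)

/-- The pairing identifies `S'` with the (`σ`-twisted) `F`-dual of `S`. -/
def IsPerfect (B : S →ₗ[F] S' →ₛₗ[D.σ] F) : Prop :=
  Function.Bijective fun v : S' => B.flip v

/-- Hermitian pairings on `S`. -/
def IsHermitian (B : S →ₗ[F] S →ₛₗ[D.σ] F) : Prop := ∀ u v, B v u = D.σ (B u v)

/-- Skew-Hermitian pairings on `S`. -/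
def IsSkewHermitian (B : S →ₗ[F] S →ₛₗ[D.σ] F) : Prop := ∀ u v, B v u = -D.σ (B u v)

/-- `η` is an isomorphism of `A_β`-modules `S^ξ ≅ S'`; the action of `θ` on `S^ξ` is `ξ θ`. -/
def IsTwistIso (η : S ≃ₗ[F] S') : Prop := ∀ u, η ((D.ξ : F) • S.T u) = S'.T (η u)

/-- `η` is self-adjoint for `B`. -/
def IsSelfAdj (B : S →ₗ[F] S' →ₛₗ[D.σ] F) (η : S ≃ₗ[F] S') : Prop :=
  ∀ u v, B u (η v) = D.σ (B v (η u))

/-- `η` is skew-self-adjoint for `B`. -/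
def IsSkewSelfAdj (B : S →ₗ[F] S' →ₛₗ[D.σ] F) (η : S ≃ₗ[F] S') : Prop :=
  ∀ u v, B u (η v) = -D.σ (B v (η u))

variable (S) in
/-- The multiplicity space `M = Hom_{A_β}(S, V)`. -/
abbrev Mult : Submodule D.L (S →ₗ[F] D.V) := AHom S D.V

/-- `p` is the pairing `{,}_i : M × M' → L_i = D_i` induced by `B : S × S' → F` (with `S` a module
over `L_i`) and the pairing on `V`: `⟨x(u), y(v)⟩ = B(u {x,y}_i, v)`. -/
def IsInduced (i : D.I) (B : S →ₗ[F] S' →ₛₗ[D.σ] F)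
    (p : D.Mult S →ₗ[D.k₀] D.Mult S' →ₗ[D.k₀] D.Li i) : Prop :=
  ∀ (x : D.Mult S) (y : D.Mult S') (u : S) (v : S') (l : D.L),
    algebraMap D.L (D.Li i) l = p x y → D.form (x.1 u) (y.1 v) = B (l • u) v

/-- The pairing `{,}_i` induced by `B` (a choice of a pairing with `IsInduced`). -/
def pairing (i : D.I) (B : S →ₗ[F] S' →ₛₗ[D.σ] F) :
    D.Mult S →ₗ[D.k₀] D.Mult S' →ₗ[D.k₀] D.Li i :=
  @Classical.epsilon _ ⟨0⟩ (D.IsInduced i B)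

variable (S S') in
/-- The maps `φ : M → M'` with `φ(l x) = η♭(l) φ(x)`, where `η♭` is the isomorphism of centres
induced by any `η : S^ξ ≅ S'`, that is, `η♭ = μ_ξ⁻¹`. -/
def TwHom : Submodule D.k₀ (D.Mult S →ₗ[D.k₀] D.Mult S') where
  carrier := {φ | ∀ (l : D.L) (x : D.Mult S), φ (D.mu l • x) = l • φ x}
  add_mem' := by
    intro φ ψ h1 h2 l x
    rw [LinearMap.add_apply, LinearMap.add_apply, h1, h2, smul_add]
  zero_mem' := by
    intro l x
    simp
  smul_mem' := by
    intro a φ h l x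
    rw [LinearMap.smul_apply, LinearMap.smul_apply, h, smul_comm]

/-- The space `𝔥^δ(M, M')` attached to an arrow `e : j → ξ̄(j) = j†`. -/
def hSpace [Nontrivial F] (j : D.I) (h : D.rot j = D.dag j) (B : S →ₗ[F] S' →ₛₗ[D.σ] F)
    (δ : ℤˣ) : Submodule D.k₀ (D.Mult S →ₗ[D.k₀] D.Mult S') where
  carrier := {φ | φ ∈ D.TwHom S S' ∧
    ∀ x y, D.pairing j B y (φ x) = (δ : ℤ) • D.sigmaArrow j h (D.pairing j B x (φ y))}
  add_mem' := by
    rintro φ ψ ⟨h1, h2⟩ ⟨h3, h4⟩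
    refine ⟨add_mem h1 h3, fun x y => ?_⟩
    rw [LinearMap.add_apply, LinearMap.add_apply, map_add, map_add, h2, h4, map_add, smul_add]
  zero_mem' := by
    refine ⟨zero_mem _, fun x y => ?_⟩
    simp
  smul_mem' := by
    rintro a φ ⟨h1, h2⟩
    refine ⟨Submodule.smul_mem _ a h1, fun x y => ?_⟩
    rw [LinearMap.smul_apply, LinearMap.smul_apply, map_smul, map_smul, h2, map_smul, smul_comm]

/-- `g' = g^{*,-1}`: the automorphism `g'` of `M'` is contragredient to the automorphism `g` of
`M` with respect to `{,}_i`. -/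
def IsContragredient (i : D.I) (B : S →ₗ[F] S' →ₛₗ[D.σ] F)
    (g : D.Mult S ≃ₗ[D.L] D.Mult S) (g' : D.Mult S' ≃ₗ[D.L] D.Mult S') : Prop :=
  ∀ x y, D.pairing i B (g x) (g' y) = D.pairing i B x y

end Pairings

/-! ### Types of forms and of spaces of forms -/

section Forms

variable {S : AMod.{u, w} D.toCyclicDatum} {S' : AMod.{u, w} D.toCyclicDatum} {i : D.I}

/-- `p` is a non-degenerate symmetric `L_i`-bilinear form on `M`. -/
structure IsOrthogonalForm (p : LinearMap.BilinMap D.k₀ (D.Mult S) (D.Li i)) : Prop where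
  smul_left : ∀ (l : D.L) x y, p (l • x) y = l • p x y
  symm : ∀ x y, p y x = p x y
  nondegenerate : ∀ x, (∀ y, p x y = 0) → x = 0

/-- `p` is a non-degenerate alternating `L_i`-bilinear form on `M`. -/
structure IsSymplecticForm (p : LinearMap.BilinMap D.k₀ (D.Mult S) (D.Li i)) : Prop where
  smul_left : ∀ (l : D.L) x y, p (l • x) y = l • p x y
  alternating : ∀ x, p x x = 0
  nondegenerate : ∀ x, (∀ y, p x y = 0) → x = 0

variable (S) in
/-- The `k^σ`-space of `ρ`-Hermitian forms `M × M → L_i`. -/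
def hermitianForms (ρ : D.Li i →ₐ[D.k₀] D.Li i) :
    Submodule D.k₀ (LinearMap.BilinMap D.k₀ (D.Mult S) (D.Li i)) where
  carrier := {f | (∀ (l : D.L) x y, f (l • x) y = l • f x y) ∧ ∀ x y, f y x = ρ (f x y)}
  add_mem' := by
    rintro f g ⟨h1, h2⟩ ⟨h3, h4⟩
    refine ⟨fun l x y => ?_, fun x y => ?_⟩
    · simp only [LinearMap.add_apply, h1, h3, smul_add]
    · simp only [LinearMap.add_apply, h2 x y, h4 x y, map_add]
  zero_mem' := by
    refine ⟨fun l x y => ?_, fun x y => ?_⟩ <;> simp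
  smul_mem' := by
    rintro a f ⟨h1, h2⟩
    refine ⟨fun l x y => ?_, fun x y => ?_⟩
    · simp only [LinearMap.smul_apply, h1]
      rw [smul_comm]
    · simp only [LinearMap.smul_apply, h2 x y, map_smul]

/-- `ρ` is non-trivial and its fixed field is (the image of) `k^σ`. -/
def IsConjugation (ρ : D.Li i →ₐ[D.k₀] D.Li i) : Prop :=
  (∃ z, ρ z ≠ z) ∧ (∀ z, ρ (ρ z) = z) ∧ ∀ z, ρ z = z → ∃ a : D.k₀, algebraMap D.k₀ (D.Li i) a = z

/-- The group `Aut_{L_i/k^σ}(M, p)` is the unitary group over `k^σ` of some non-degenerate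
`ρ`-Hermitian form on `M`. -/
def IsUnitaryGroup (ρ : D.Li i →ₐ[D.k₀] D.Li i)
    (p : LinearMap.BilinMap D.k₀ (D.Mult S) (D.Li i)) : Prop :=
  ∃ f ∈ D.hermitianForms S ρ, (∀ x, (∀ y, f x y = 0) → x = 0) ∧
    ∀ (R : Type) [CommRing R] [Algebra D.k₀ R],
      (glPoints R D.L ⊓ isometryPoints R p : Subgroup _) = glPoints R D.L ⊓ isometryPoints R f

variable [Nontrivial F]

/-- `𝔥^δ(M, M')` is an `L_{j†}`-subspace of the maps `M → M'`, isomorphic to `∧²(M')`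
compatibly with the action of `GL(M)` (which acts on `M'` by the contragredient action). -/
def IsWedge (j : D.I) (h : D.rot j = D.dag j) (B : S →ₗ[F] S' →ₛₗ[D.σ] F) (δ : ℤˣ) : Prop :=
  ∃ e : D.hSpace j h B δ ≃+ ⋀[D.L]^2 (D.Mult S'),
    (∀ (l : D.L) (φ : D.hSpace j h B δ),
      ∃ ψ : D.hSpace j h B δ, (∀ x, ψ.1 x = l • φ.1 x) ∧ e ψ = l • e φ) ∧
    ∀ g g', D.IsContragredient j B g g' → ∀ φ : D.hSpace j h B δ,
      ∃ ψ : D.hSpace j h B δ, (∀ x, ψ.1 (g x) = g' (φ.1 x)) ∧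
        e ψ = exteriorPower.map 2 (g' : D.Mult S' →ₗ[D.L] D.Mult S') (e φ)

/-- `𝔥^δ(M, M')` is an `L_{j†}`-subspace of the maps `M → M'`, isomorphic to `Sym²(M')`
compatibly with the action of `GL(M)` (which acts on `M'` by the contragredient action). -/
def IsSym (j : D.I) (h : D.rot j = D.dag j) (B : S →ₗ[F] S' →ₛₗ[D.σ] F) (δ : ℤˣ) : Prop :=
  ∃ e : D.hSpace j h B δ ≃+ Sym[D.L]^2 (D.Mult S'),
    (∀ (l : D.L) (φ : D.hSpace j h B δ),
      ∃ ψ : D.hSpace j h B δ, (∀ x, ψ.1 x = l • φ.1 x) ∧ e ψ = l • e φ) ∧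
    ∀ g g', D.IsContragredient j B g g' → ∀ φ : D.hSpace j h B δ,
      ∃ ψ : D.hSpace j h B δ, (∀ x, ψ.1 (g x) = g' (φ.1 x)) ∧
        ∀ t : ⨂[D.L] _ : Fin 2, D.Mult S', SymmetricPower.mk D.L (Fin 2) (D.Mult S') t = e φ →
          e ψ = SymmetricPower.mk D.L (Fin 2) (D.Mult S')
            (PiTensorProduct.map (fun _ => (g' : D.Mult S' →ₗ[D.L] D.Mult S')) t)

/-- `𝔥^δ(M, M')` is isomorphic to the `k^σ`-space of Hermitian forms on `M` (for the conjugation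
`σ_{cξ⁻¹}` of `L_j`), compatibly with the action of `GL(M)`. -/
def IsHermitianSpace (j : D.I) (h : D.rot j = D.dag j) (B : S →ₗ[F] S' →ₛₗ[D.σ] F) (δ : ℤˣ) :
    Prop :=
  ∃ e : D.hSpace j h B δ ≃ₗ[D.k₀] D.hermitianForms S (D.sigmaArrow j h),
    ∀ g g', D.IsContragredient j B g g' → ∀ φ : D.hSpace j h B δ,
      ∃ ψ : D.hSpace j h B δ, (∀ x, ψ.1 (g x) = g' (φ.1 x)) ∧
        ∀ x y, (e ψ).1 (g x) (g y) = (e φ).1 x y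

end Forms

/-! ### The choices -/

/-- The choices: simple `A_i`-modules `S_i`, perfect admissible pairings `S_i × S_{i†} → F` which
for `i = i†` are Hermitian if possible and skew-Hermitian otherwise, and isomorphisms
`η_e : S_i^ξ ≅ S_{ξ̄(i)}` which for `e = e†` are self-adjoint if possible (`ε_e = 1`) and
skew-self-adjoint otherwise (`ε_e = -1`). Only the values `B i j` with `j = i†` matter. -/
structure Choices where
  S : D.I → AMod.{u, w} D.toCyclicDatum
  isSimpleAt : ∀ i, (S i).IsSimpleAt i
  B : ∀ i j, S i →ₗ[F] S j →ₛₗ[D.σ] F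
  admissible : ∀ i j, D.dag i = j → D.IsAdmissible (B i j)
  perfect : ∀ i j, D.dag i = j → D.IsPerfect (B i j)
  B_vertex : ∀ i, D.dag i = i → D.IsHermitian (B i i) ∨
    D.IsSkewHermitian (B i i) ∧ ¬ ∃ B' : S i →ₗ[F] S i →ₛₗ[D.σ] F,
      D.IsAdmissible B' ∧ D.IsPerfect B' ∧ D.IsHermitian B'
  η : ∀ i, S i ≃ₗ[F] S (D.rot i)
  η_T : ∀ i, D.IsTwistIso (η i)
  εe : D.I → ℤˣ
  η_arrow : ∀ j, D.rot j = D.dag j →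
    εe j = 1 ∧ D.IsSelfAdj (B j (D.rot j)) (η j) ∨
    εe j = -1 ∧ D.IsSkewSelfAdj (B j (D.rot j)) (η j) ∧ ¬ ∃ η' : S j ≃ₗ[F] S (D.rot j),
      D.IsTwistIso η' ∧ D.IsSelfAdj (B j (D.rot j)) η'

namespace Choices

variable {D} (C : Choices.{u, v, w} D)

/-- The multiplicity space `M_i = Hom_{A_β}(S_i, V)`. -/
abbrev M (i : D.I) : Submodule D.L (C.S i →ₗ[F] D.V) := D.Mult (C.S i)

/-- The form `{,}_i` on `M_i` for a vertex `i = i†`. -/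
def form (i : D.I) : LinearMap.BilinMap D.k₀ (C.M i) (D.Li i) := D.pairing i (C.B i i)

/-- Evaluation at `u ∈ S_i`, that is, `x ↦ u ⊗ x` in `S_i ⊗ M_i ⊆ V`. -/
def ev (i : D.I) (u : C.S i) : C.M i →ₗ[D.k₀] D.V where
  toFun x := x.1 u
  map_add' _ _ := rfl
  map_smul' _ _ := rfl

/-- The factor of `H` at the vertex `i`: `Aut_{L_i/k^σ}(M_i, {,}_i)` if `i = i†`, and
`GL_{L_i/k^σ}(M_i)` otherwise. -/
def vertexFactor (i : D.I) (R : Type) [CommRing R] [Algebra D.k₀ R] :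
    Subgroup ((R ⊗[D.k₀] C.M i) ≃ₗ[R] (R ⊗[D.k₀] C.M i)) :=
  glPoints R D.L ⊓ ⨅ _ : D.dag i = i, isometryPoints R (C.form i)

/-- The space `𝔥^{-ε ε_e}(M_j, M_{j†})` for an arrow `e = e† : j → j†`. -/
def arrowSpace [Nontrivial F] (j : D.I) (h : D.rot j = D.dag j) :
    Submodule D.k₀ (C.M j →ₗ[D.k₀] C.M (D.rot j)) :=
  D.hSpace j h (C.B j (D.rot j)) (-D.ε * C.εe j)

/-- The factor of `𝔤(ξ)` at the arrow `e : j → ξ̄(j)`: `𝔥^{-ε ε_e}(M_j, M_{j†})` if `e = e†`, and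
`Hom(M_j, M_{ξ̄(j)})` otherwise. -/
def arrowFactor [Nontrivial F] (j : D.I) : Submodule D.k₀ (C.M j →ₗ[D.k₀] C.M (D.rot j)) :=
  D.TwHom (C.S j) (C.S (D.rot j)) ⊓ ⨅ h : D.rot j = D.dag j, C.arrowSpace j h

/-- `D_i = L_i` for all `i`, where `D_i = End_{A_β}(S_i)^opp`, via the action of `L_β` on `S_i`. -/
def DivisionAlgebrasTrivial : Prop :=
  ∀ i, ∃ e : D.Li i ≃ₐ[k] (AEnd (C.S i))ᵐᵒᵖ,
    ∀ (l : D.L) (u : C.S i), (e (algebraMap D.L (D.Li i) l)).unop.1 u = l • u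

/-- The pairings `{,}_i : M_i × M_{i†} → L_i` exist, are unique, and are non-degenerate. -/
def PairingsWellDefined : Prop :=
  ∀ i j, D.dag i = j →
    D.IsInduced i (C.B i j) (D.pairing i (C.B i j)) ∧
    (∀ p, D.IsInduced i (C.B i j) p → p = D.pairing i (C.B i j)) ∧
    (∀ x, (∀ y, D.pairing i (C.B i j) x y = 0) → x = 0) ∧
    (∀ y, (∀ x, D.pairing i (C.B i j) x y = 0) → y = 0)

/-- `H` is the product of its vertex factors over any set `P` of representatives of the vertices
modulo `†`: `g ∈ H` corresponds to the `g_i` with `g(u ⊗ x) = u ⊗ g_i(x)`. -/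
def HIsProduct : Prop :=
  ∀ P : Set D.I, (∀ i, i ∈ P ∨ D.dag i ∈ P) → (∀ i, i ∈ P → D.dag i ∈ P → D.dag i = i) →
    ∀ (R : Type) [CommRing R] [Algebra D.k₀ R],
      ∃ Φ : D.H R ≃* ∀ i : P, C.vertexFactor i.1 R,
        ∀ (g : D.H R) (i : P) (u : C.S i.1) (z : R ⊗[D.k₀] C.M i.1),
          g.1 ((C.ev i.1 u).baseChange R z) = (C.ev i.1 u).baseChange R ((Φ g i).1 z)

/-- `𝔤(ξ)` is the sum of its arrow factors over any set `P` of representatives of the arrows modulo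
`†`: `φ ∈ 𝔤(ξ)` corresponds to the `φ_e` with `φ(u ⊗ x) = η_e(u) ⊗ φ_e(x)`. -/
def GXiIsSum [Nontrivial F] : Prop :=
  ∀ P : Set D.I, (∀ j, j ∈ P ∨ D.dag (D.rot j) ∈ P) →
    (∀ j, j ∈ P → D.dag (D.rot j) ∈ P → D.dag (D.rot j) = j) →
      ∃ Ψ : D.gXi ≃ₗ[D.k₀] ∀ j : P, C.arrowFactor j.1,
        ∀ (φ : D.gXi) (j : P) (x : C.M j.1) (u : C.S j.1),
          φ.1 (x.1 u) = ((Ψ φ j).1 x).1 (C.η j.1 u)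

/-- The factor of `H` at `i = i†` is (the Weil restriction of) an orthogonal or symplectic group
over `L_i`, on which `σ_c` is trivial; if `σ = id_F` it is orthogonal for `ε = 1` and symplectic for
`ε = -1`. -/
def VertexOrthogonalOrSymplectic (i : D.I) (h : D.dag i = i) : Prop :=
  (∀ z, D.sigmaVertex i h z = z) ∧
  (D.IsOrthogonalForm (C.form i) ∨ D.IsSymplecticForm (C.form i)) ∧
  ((∀ x, D.σ x = x) → (D.ε = 1 → D.IsOrthogonalForm (C.form i)) ∧
    (D.ε = -1 → D.IsSymplecticForm (C.form i)))

/-- The factor of `H` at `i = i†` is a unitary group over `k^σ`, for the conjugation `σ_c` of `L_i`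
over `k^σ`. -/
def VertexUnitary (i : D.I) (h : D.dag i = i) : Prop :=
  D.IsConjugation (D.sigmaVertex i h) ∧ D.IsUnitaryGroup (D.sigmaVertex i h) (C.form i)

/-- The factor of `𝔤(ξ)` at `e = e† : j → j†` is `∧²` or `Sym²` of `M_{j†}` over `L_{j†}`, and
`σ_{cξ⁻¹}` is trivial on `L_j`; if `σ = id_F` it is `∧²` for `ε = 1` and `Sym²` for `ε = -1`. -/
def ArrowWedgeOrSym [Nontrivial F] (j : D.I) (h : D.rot j = D.dag j) : Prop :=
  (∀ z, D.sigmaArrow j h z = z) ∧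
  (D.IsWedge j h (C.B j (D.rot j)) (-D.ε * C.εe j) ∨
    D.IsSym j h (C.B j (D.rot j)) (-D.ε * C.εe j)) ∧
  ((∀ x, D.σ x = x) → (D.ε = 1 → D.IsWedge j h (C.B j (D.rot j)) (-D.ε * C.εe j)) ∧
    (D.ε = -1 → D.IsSym j h (C.B j (D.rot j)) (-D.ε * C.εe j)))

/-- The factor of `𝔤(ξ)` at `e = e† : j → j†` is the space of `L_j/k^σ`-Hermitian forms on `M_j`,
for the conjugation `σ_{cξ⁻¹}` of `L_j` over `k^σ`. -/
def ArrowHermitian [Nontrivial F] (j : D.I) (h : D.rot j = D.dag j) : Prop :=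
  D.IsConjugation (D.sigmaArrow j h) ∧
  D.IsHermitianSpace j h (C.B j (D.rot j)) (-D.ε * C.εe j)

end Choices

/-! ### Shapes of the quiver with involution -/

/-- `Q_ξ` is a single cycle of type (VE-ℓ): labelling the vertices `0, 1, …, ℓ, ℓ†, …, 1†` along
the cycle by `ℤ/(2ℓ+1)`, the involution is `a ↦ -a`. It fixes the vertex `0` and the arrow
`ℓ → -ℓ`, and no other. -/
def IsVE (ℓ : ℕ) : Prop :=
  ∃ e : D.I ≃ ZMod (2 * ℓ + 1), (∀ i, e (D.rot i) = e i + 1) ∧ ∀ i, e (D.dag i) = -e i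

/-- `Q_ξ` is a single cycle of type (VV-ℓ): labelling the vertices `0, 1, …, ℓ, (ℓ-1)†, …, 1†`
along the cycle by `ℤ/2ℓ`, the involution is `a ↦ -a`. It fixes the vertices `0` and `ℓ`, and no
arrow. -/
def IsVV (ℓ : ℕ) : Prop :=
  ∃ e : D.I ≃ ZMod (2 * ℓ), (∀ i, e (D.rot i) = e i + 1) ∧ ∀ i, e (D.dag i) = -e i

/-- `Q_ξ` is a single cycle of type (EE-ℓ): labelling the vertices `1, …, ℓ, ℓ†, …, 1†` along the
cycle by `ℤ/2ℓ`, the involution is `a ↦ 1 - a`. It fixes the arrows `0 → 1` and `ℓ → ℓ + 1`, and no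
vertex. -/
def IsEE (ℓ : ℕ) : Prop :=
  ∃ e : D.I ≃ ZMod (2 * ℓ), (∀ i, e (D.rot i) = e i + 1) ∧ ∀ i, e (D.dag i) = 1 - e i

/-- `L_β` is the product of the `L_i`. -/
def LIsProduct : Prop := Function.Bijective fun (l : D.L) (i : D.I) => algebraMap D.L (D.Li i) l

/-- All the fields `L_i` are `k`. -/
def AllSplit : Prop := ∀ i, Function.Bijective (algebraMap k (D.Li i))

end PolarizedDatum

/-- All the fields `L_i` are isomorphic to the quadratic extension `k(√τ)` of `k = ℂ((τ))`. -/
def PolarizedDatum.AllQuadratic {F : Type u} [CommRing F] [Algebra (LaurentSeries ℂ) F]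
    (D : PolarizedDatum.{u, v} (LaurentSeries ℂ) F) : Prop :=
  ∀ i, Nonempty (D.Li i ≃ₐ[LaurentSeries ℂ]
    AdjoinRoot (Polynomial.X ^ 2 - Polynomial.C (HahnSeries.single (1 : ℤ) (1 : ℂ)) :
      Polynomial (LaurentSeries ℂ)))

/-- `k^σ = ℂ((t²))` for a uniformizer `t` of `k = ℂ((τ))` with `σ(t) = -t`: the elements fixed by
`s = σ|_k` are the `τ`-adic sums of series `∑_{i ≥ N} a_i t^{2i}` with coefficients in `ℂ`. -/
def IsLaurentInSquare (s : LaurentSeries ℂ →+* LaurentSeries ℂ) : Prop :=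
  ∃ t : LaurentSeries ℂ, t.order = 1 ∧ s t = -t ∧
    ∀ x, s x = x ↔ ∃ (a : ℤ → ℂ) (N : ℤ), ∀ M : ℕ, ∀ d < 2 * (N + M),
      (x - ∑ i ∈ Finset.Ico N (N + M), a i • t ^ (2 * i)).coeff d = 0

end LoopGrading

end

noncomputable section

namespace LoopGrading

/-! ### Roots of Laurent series -/

/-! Splitting. Finite extensions of `k = ℂ((τ))` have trivial Brauer group, so the algebra `A_β` is
split over its centre `L`. The proof makes this explicit: `exists_splitting` gives a unit `a` of `F
⊗ L` whose cyclic norm for `ζ ⊗ 1` is `b = θ^n`. Then `a⁻¹θ` is `ζ`-semilinear of order `n` and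
commutes with `L`. With a Kummer generator `y` of `F`, `ζ(y) = ω y`, every `A_β`-module is the
direct sum of the `y^a · Fix`, `a < n`, where `Fix` is the `L`-module of vectors fixed by `a⁻¹θ`.
Hence `A_β`-modules amount to `L`-modules: endomorphisms of `S_i` are scalars from `L_i`
(`exists_AEnd_eq_smul`), and `V` is the sum of the `S_i ⊗ M_i` (`exists_frame`).

Decomposition. If `θ` multiplies a pairing by `c`, iterating `n` times shows that `b` multiplies it
by `γ = Nm(c)`; so the adjoint of `l ∈ L` is `σ_c(l)` (`adm_adjoint`). Therefore the parts of `V` at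
`i` and `j` are orthogonal unless `j = i†`, and every admissible pairing of `S_i` with `S_{i†}` is
`B(l u, v)` with `l` unique modulo the ideal `i` (`exists_of_adm`). Applied to `⟨x(u), y(v)⟩` this
defines `{x, y}_i`. Automorphisms of `V` commuting with `F` and `θ` are families of automorphisms of
the `M_i`, and they are isometries when the components at `i` and `i†` are contragredient
(`mem_isometryPoints_iff`). Likewise an element of `𝔤(ξ)` carries the part at `j` to that at
`ξ̄(j)`, and skewness ties the components at `e` and `e†` to each other (`skew_iff`); for `e = e†`
it becomes the symmetry with sign `-ε ε_e` (`isSkew_self_iff`).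

Types. At a fixed vertex or arrow the involution acts on `L_i` trivially or as a conjugation. If it
is trivial, forms are symmetric or alternating, and the space of an arrow consists of symmetrized
rank one operators, that is, of `Sym²` or `∧²` (`exists_squareEquiv`); for `σ = id_F` the sign is
found from `symm_of_self_adjoint`. If it is a conjugation, multiplication by a suitable unit of
`L_i` turns skew-Hermitian into Hermitian (`vertexUnitary`, `exists_hermitianEquiv`).

The quiver. Write `m/n = g e` with `X^e - ρ` irreducible for all solutions `ρ ∈ k` of `ρ^g = β`
(`RootDatum`). The points of `I` correspond to these `ρ`; `ξ̄` multiplies `ρ` by `ν^e`, a primitive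
`g`-th root of unity, and `†` sends `ρ` to `γ^e / σ(ρ)`. So `Q_ξ` is one cycle, `†` is a reflection
of `ℤ/g`, and a single fixed vertex or arrow determines the shape. Valuations decide between `e = 1`
and `e = 2`: the latter is needed only if `val(γ)` is odd, which forces `m/n` even and `σ|_k = id`.
For `e = 2` one has `b_i² = ρ` and `b_i σ_c(b_i) = γ` at a fixed vertex, so `σ_c` is trivial on
`L_i` for `ρ = γ` and a conjugation for `ρ = -γ`; the same holds for arrows with `γ ν⁻¹`. -/

theorem powerSeries_exists_pow_eq (u : PowerSeries ℂ) {n : ℕ} (hn : 0 < n)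
    (hu : PowerSeries.constantCoeff u ≠ 0) : ∃ y : PowerSeries ℂ, y ^ n = u := by
  obtain ⟨c, hc⟩ := IsAlgClosed.exists_pow_nat_eq (PowerSeries.constantCoeff u) hn
  have hmem : ∀ x : PowerSeries ℂ, x ∈ Ideal.span {(PowerSeries.X : PowerSeries ℂ)} ↔
      PowerSeries.constantCoeff x = 0 := fun x => by
    rw [Ideal.mem_span_singleton, PowerSeries.X_dvd_iff]
  have hc0 : c ≠ 0 := by
    rintro rfl
    rw [zero_pow hn.ne'] at hc
    exact hu hc.symm
  -- Hensel's lemma for the ideal `(X)`: the constant `c` is a simple root of the reduction, since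
  -- `n c^(n-1) ≠ 0`.
  obtain ⟨a, ha, -⟩ := HenselianRing.is_henselian
    (I := Ideal.span {(PowerSeries.X : PowerSeries ℂ)})
    (Polynomial.X ^ n - Polynomial.C u) (Polynomial.monic_X_pow_sub_C u hn.ne')
    (PowerSeries.C c) (by
      rw [hmem]
      simp [hc]) (by
      apply IsUnit.map
      rw [PowerSeries.isUnit_iff_constantCoeff]
      simp [Polynomial.derivative_X_pow, hn.ne', hc0])
  refine ⟨a, ?_⟩
  simpa [Polynomial.IsRoot, sub_eq_zero] using ha

/-- The uniformizer `τ`. -/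
def tau : LaurentSeries ℂ := HahnSeries.single (1 : ℤ) (1 : ℂ)

theorem tau_ne_zero : tau ≠ 0 := by
  simp [tau]

theorem order_tau : tau.order = 1 := HahnSeries.order_single one_ne_zero

theorem order_zpow {x : LaurentSeries ℂ} (hx : x ≠ 0) (j : ℤ) : (x ^ j).order = j * x.order := by
  have hp : ∀ j : ℕ, (x ^ j).order = j * x.order := fun j => by
    rw [HahnSeries.order_pow, nsmul_eq_mul]
  have hi : ∀ y : LaurentSeries ℂ, y ≠ 0 → (y⁻¹).order = -y.order := fun y hy => by
    have h := HahnSeries.order_mul hy (inv_ne_zero hy)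
    rw [mul_inv_cancel₀ hy, HahnSeries.order_one] at h
    omega
  obtain ⟨j, rfl | rfl⟩ := j.eq_nat_or_neg
  · rw [zpow_natCast, hp]
  · rw [zpow_neg, zpow_natCast, hi _ (pow_ne_zero _ hx), hp, neg_mul]

theorem laurent_exists_pow_eq (x : LaurentSeries ℂ) {n : ℕ} (hn : 0 < n) (hx : x ≠ 0)
    (h : (n : ℤ) ∣ x.order) : ∃ y : LaurentSeries ℂ, y ^ n = x := by
  obtain ⟨d, hd⟩ := h
  obtain ⟨y, hy⟩ := powerSeries_exists_pow_eq x.powerSeriesPart hn (by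
    rw [← PowerSeries.coeff_zero_eq_constantCoeff_apply, LaurentSeries.powerSeriesPart_coeff]
    simpa using hx)
  refine ⟨HahnSeries.single d 1 * HahnSeries.ofPowerSeries ℤ ℂ y, ?_⟩
  rw [mul_pow, ← map_pow (HahnSeries.ofPowerSeries ℤ ℂ), hy, HahnSeries.single_pow, one_pow,
    nsmul_eq_mul, ← hd]
  exact x.single_order_mul_powerSeriesPart

/-- The valuation is reduced modulo `n`; the quotient has valuation divisible by `n`, hence is an
`n`-th power. Questions about norms thus reduce to powers of `τ`. -/
theorem laurent_exists_scale (x : LaurentSeries ℂ) {n : ℕ} (hn : 0 < n) (hx : x ≠ 0) :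
    ∃ (w : ℕ) (u : LaurentSeries ℂ), u ≠ 0 ∧ x = tau ^ w * u ^ n := by
  have hn' : (0 : ℤ) < n := by exact_mod_cast hn
  obtain ⟨w, hw⟩ := Int.eq_ofNat_of_zero_le (Int.emod_nonneg x.order hn'.ne')
  have h0 : tau ^ w ≠ 0 := pow_ne_zero _ tau_ne_zero
  have h1 : x * (tau ^ w)⁻¹ ≠ 0 := mul_ne_zero hx (inv_ne_zero h0)
  obtain ⟨u, hu⟩ := laurent_exists_pow_eq (x * (tau ^ w)⁻¹) hn h1 (by
    rw [HahnSeries.order_mul hx (inv_ne_zero h0), ← zpow_natCast, ← zpow_neg,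
      order_zpow tau_ne_zero, order_tau, ← hw]
    exact ⟨x.order / n, by have := Int.emod_add_mul_ediv x.order n; linarith⟩)
  refine ⟨w, u, ?_, ?_⟩
  · rintro rfl
    rw [zero_pow hn.ne'] at hu
    exact h1 hu.symm
  · rw [hu, mul_comm x, mul_inv_cancel_left₀ h0]

/-- Choose an `n`-th root of each complex `g`-th root of unity and interpolate by a polynomial `p`.
Then `p^n - X` vanishes at all zeros of `X^g - 1`, hence is divisible by it, and `p(χ)` is the
wanted root. This is applied to `L`, which need not be a field. -/
theorem exists_pow_eq_of_pow_eq_one {R : Type*} [CommRing R] [Algebra ℂ R] {χ : R} {g : ℕ}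
    (hg : 0 < g) (h : χ ^ g = 1) {n : ℕ} (hn : 0 < n) : ∃ u : R, u ^ n = χ := by
  choose rt hrt using fun z : ℂ => IsAlgClosed.exists_pow_nat_eq z hn
  let p := Lagrange.interpolate (Polynomial.nthRootsFinset g (1 : ℂ)) id rt
  refine ⟨Polynomial.aeval χ p, ?_⟩
  have hd : (Polynomial.X ^ g - 1 : ℂ[X]) ∣ p ^ n - Polynomial.X := by
    rw [Polynomial.X_pow_sub_one_eq_prod hg (Complex.isPrimitiveRoot_exp g hg.ne')]
    refine Finset.prod_dvd_of_coprime ?_ fun z hz => ?_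
    · intro a _ b _ hab
      exact Polynomial.isCoprime_X_sub_C_of_isUnit_sub (sub_ne_zero.mpr hab).isUnit
    · rw [Polynomial.dvd_iff_isRoot, Polynomial.IsRoot, Polynomial.eval_sub, Polynomial.eval_pow,
        Polynomial.eval_X]
      have := Lagrange.eval_interpolate_at_node (v := id) rt Function.injective_id.injOn hz
      simp only [id] at this
      rw [this, hrt, sub_self]
  obtain ⟨q, hq⟩ := hd
  have := congrArg (Polynomial.aeval χ) hq
  simp only [map_sub, map_pow, Polynomial.aeval_X, map_mul, map_one, h, sub_self, zero_mul] at this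
  exact sub_eq_zero.mp this

theorem coeff_order_ne_zero' {x : LaurentSeries ℂ} (hx : x ≠ 0) : x.coeff x.order ≠ 0 := by
  simpa using hx

/-! ### Involutions of `ℂ((τ))` -/

section Involution

variable {s : LaurentSeries ℂ →+* LaurentSeries ℂ}

/-- A series of valuation `0` has roots of every exponent, so the valuation of its image is
divisible by every positive integer. No continuity of `s` is assumed. -/
theorem order_eq_zero_of_unit (x : LaurentSeries ℂ) (hx : x ≠ 0) (h : x.order = 0) :
    (s x).order = 0 := by
  by_contra h0
  have hn : 0 < (s x).order.natAbs + 1 := Nat.succ_pos _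
  obtain ⟨y, hy⟩ := laurent_exists_pow_eq x hn hx (by rw [h]; exact dvd_zero _)
  have h1 : (s x).order = ((s x).order.natAbs + 1 : ℕ) * (s y).order := by
    conv_lhs => rw [← hy, map_pow, HahnSeries.order_pow, nsmul_eq_mul]
  have h2 : (((s x).order.natAbs + 1 : ℕ) : ℤ) ∣ (s x).order := ⟨_, h1⟩
  have h3 := Int.natAbs_dvd_natAbs.mpr h2
  rw [Int.natAbs_natCast] at h3
  have := Nat.le_of_dvd (Int.natAbs_pos.mpr h0) h3
  omega

theorem order_map_eq_mul (x : LaurentSeries ℂ) (hx : x ≠ 0) :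
    (s x).order = x.order * (s tau).order := by
  have h0 : tau ^ x.order ≠ 0 := zpow_ne_zero _ tau_ne_zero
  have h1 : x * (tau ^ x.order)⁻¹ ≠ 0 := mul_ne_zero hx (inv_ne_zero h0)
  have h2 := order_eq_zero_of_unit (s := s) _ h1 (by
    rw [HahnSeries.order_mul hx (inv_ne_zero h0), ← zpow_neg, order_zpow tau_ne_zero, order_tau]
    ring)
  have hs : ∀ {y : LaurentSeries ℂ}, y ≠ 0 → s y ≠ 0 := fun hy => by simpa using hy
  have h3 : x = (x * (tau ^ x.order)⁻¹) * tau ^ x.order := by field_simp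
  conv_lhs => rw [h3]
  rw [map_mul, HahnSeries.order_mul (hs h1) (hs h0), h2, map_zpow₀, order_zpow (hs tau_ne_zero),
    zero_add]

/-- By `order_map_eq_mul`, `s` multiplies valuations by that of `s τ`, which is `±1` because `s` is
an involution. The sign `-1` is impossible: `1 + τ` has valuation `0`, whereas `1 + s τ` would have
a pole. -/
theorem order_map (hss : ∀ x, s (s x) = x) (x : LaurentSeries ℂ) : (s x).order = x.order := by
  rcases eq_or_ne x 0 with rfl | hx
  · simp
  have hτ : s tau ≠ 0 := by simpa using tau_ne_zero
  have h1 : (s tau).order * (s tau).order = 1 := by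
    rw [← order_map_eq_mul _ hτ, hss, order_tau]
  rcases Int.isUnit_iff.mp (IsUnit.of_mul_eq_one _ h1) with h | h
  · rw [order_map_eq_mul x hx, h, mul_one]
  · exfalso
    have h2 : (1 + tau).coeff 0 = 1 := by
      simp [tau]
    have h3 : (1 + tau : LaurentSeries ℂ) ≠ 0 := by
      intro h
      rw [h] at h2
      simp at h2
    have h4 : (1 + tau).order = 0 := by
      refine le_antisymm (HahnSeries.order_le_of_coeff_ne_zero (by rw [h2]; exact one_ne_zero)) ?_
      have := HahnSeries.min_order_le_order_add (x := (1 : LaurentSeries ℂ)) (y := tau) h3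
      simpa [order_tau] using this
    have h5 := order_eq_zero_of_unit (s := s) _ h3 h4
    have h6 : (s (1 + tau)).coeff (-1) ≠ 0 := by
      rw [map_add, map_one, HahnSeries.coeff_add, ← h]
      have := coeff_order_ne_zero' hτ
      simp only [HahnSeries.coeff_one, h] at this ⊢
      simpa using this
    have := HahnSeries.order_le_of_coeff_ne_zero h6
    omega

/-- This is the `τ`-adic continuity of `s`. -/
theorem coeff_map_eq_zero (hss : ∀ x, s (s x) = x) {x : LaurentSeries ℂ} {D : ℤ}
    (h : ∀ d < D, x.coeff d = 0) : ∀ d < D, (s x).coeff d = 0 := by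
  intro d hd
  rcases eq_or_ne x 0 with rfl | hx
  · simp
  apply HahnSeries.coeff_eq_zero_of_lt_order
  rw [order_map hss]
  by_contra hlt
  exact coeff_order_ne_zero' hx (h _ (by omega))

theorem eq_zero_of_coeff {x : LaurentSeries ℂ} (D : ℤ)
    (h : ∀ M : ℕ, ∀ d < D + M, x.coeff d = 0) : x = 0 := by
  ext d
  exact h (d - D + 1).toNat d (by omega)

theorem algebraMap_eq_C (z : ℂ) : algebraMap ℂ (LaurentSeries ℂ) z = HahnSeries.C z := by
  rw [HahnSeries.algebraMap_apply']
  exact HahnSeries.ofPowerSeries_C z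

theorem map_complex_smul (hσ : ∀ z : ℂ, s (algebraMap ℂ (LaurentSeries ℂ) z) = algebraMap ℂ (LaurentSeries ℂ) z)
    (z : ℂ) (x : LaurentSeries ℂ) : s (z • x) = z • s x := by
  rw [← HahnSeries.C_mul_eq_smul, ← HahnSeries.C_mul_eq_smul, map_mul, ← algebraMap_eq_C, hσ]

theorem coeff_zpow_self {p : LaurentSeries ℂ} (hp : p.order = 1) (hp0 : p ≠ 0) (d : ℤ) :
    (p ^ d).coeff d ≠ 0 ∧ ∀ d' < d, (p ^ d).coeff d' = 0 := by
  have h := order_zpow hp0 d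
  rw [hp, mul_one] at h
  refine ⟨?_, fun d' hd => HahnSeries.coeff_eq_zero_of_lt_order (by rw [h]; exact hd)⟩
  have := coeff_order_ne_zero' (zpow_ne_zero d hp0)
  rwa [h] at this

/-- Every `x` is approximated to any order by finite `ℂ`-combinations of powers of `p`, and `s`
fixes these combinations. So `s x - x` vanishes to every order. -/
theorem eq_id_of_fixed (hss : ∀ x, s (s x) = x)
    (hσ : ∀ z : ℂ, s (algebraMap ℂ (LaurentSeries ℂ) z) = algebraMap ℂ (LaurentSeries ℂ) z)
    {p : LaurentSeries ℂ} (hp : p.order = 1) (hp0 : p ≠ 0) (hps : s p = p)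
    (x : LaurentSeries ℂ) : s x = x := by
  have key : ∀ M : ℕ, ∃ q, s q = q ∧ ∀ d < x.order + M, (x - q).coeff d = 0 := by
    intro M
    induction M with
    | zero =>
      exact ⟨0, map_zero _, fun d hd => by
        rw [sub_zero]; exact HahnSeries.coeff_eq_zero_of_lt_order (by simpa using hd)⟩
    | succ M ih =>
      obtain ⟨q, hq, h⟩ := ih
      obtain ⟨h1, h2⟩ := coeff_zpow_self hp hp0 (x.order + M)
      set D := x.order + M with hD
      refine ⟨q + ((x - q).coeff D / (p ^ D).coeff D) • p ^ D, ?_, fun d hd => ?_⟩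
      · rw [map_add, hq, map_complex_smul hσ, map_zpow₀, hps]
      · rw [← sub_sub, HahnSeries.coeff_sub, HahnSeries.coeff_smul]
        rcases (show d ≤ D by push_cast at hd; omega).lt_or_eq with h3 | rfl
        · rw [h _ h3, h2 _ h3, smul_zero, sub_zero]
        · rw [smul_eq_mul, div_mul_cancel₀ _ h1, sub_self]
  rw [← sub_eq_zero]
  refine eq_zero_of_coeff x.order fun M d hd => ?_
  obtain ⟨q, hq, h⟩ := key M
  have h1 : s x - x = s (x - q) - (x - q) := by rw [map_sub, hq]; ring
  rw [h1, HahnSeries.coeff_sub, coeff_map_eq_zero hss h d hd, h d hd, sub_zero]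

/-- If `s τ` has leading coefficient `1`, then `τ + s τ` is a fixed uniformizer and `s` is trivial
by `eq_id_of_fixed`. Otherwise `τ - s τ` has valuation `1`. -/
theorem exists_antiinvariant_uniformizer (hss : ∀ x, s (s x) = x)
    (hσ : ∀ z : ℂ, s (algebraMap ℂ (LaurentSeries ℂ) z) = algebraMap ℂ (LaurentSeries ℂ) z)
    (hne : ∃ a, s a ≠ a) : ∃ t : LaurentSeries ℂ, t.order = 1 ∧ s t = -t := by
  have hlow : ∀ d < 1, tau.coeff d = 0 := fun d hd =>
    HahnSeries.coeff_eq_zero_of_lt_order (by rw [order_tau]; exact hd)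
  have hlow' := coeff_map_eq_zero hss hlow
  have hord : ∀ x : LaurentSeries ℂ, (∀ d < 1, x.coeff d = 0) → x.coeff 1 ≠ 0 → x.order = 1 := by
    intro x h1 h2
    refine le_antisymm (HahnSeries.order_le_of_coeff_ne_zero h2) ?_
    by_contra h
    have hx : x ≠ 0 := by rintro rfl; simp at h2
    exact coeff_order_ne_zero' hx (h1 _ (by omega))
  have h1 : tau.coeff 1 = 1 := by simp [tau]
  by_cases hl : (s tau).coeff 1 = 1
  · exfalso
    obtain ⟨a, ha⟩ := hne
    have hp : (tau + s tau).order = 1 := hord _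
      (fun d hd => by rw [HahnSeries.coeff_add, hlow d hd, hlow' d hd, add_zero])
      (by rw [HahnSeries.coeff_add, hl, h1]; norm_num)
    refine ha (eq_id_of_fixed hss hσ hp ?_ (by rw [map_add, hss, add_comm]) a)
    intro h
    rw [h, HahnSeries.order_zero] at hp
    exact zero_ne_one hp
  · refine ⟨tau - s tau, hord _
      (fun d hd => by rw [HahnSeries.coeff_sub, hlow d hd, hlow' d hd, sub_zero])
      (by rw [HahnSeries.coeff_sub, h1, sub_ne_zero]; exact Ne.symm hl), ?_⟩
    rw [map_sub, hss, neg_sub]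

theorem mul_inv_neg_zpow {K : Type*} [Field K] {d : ℤ} (hd : Odd d) (x t : K) :
    x * ((-t) ^ d)⁻¹ = -(x * (t ^ d)⁻¹) := by
  rw [hd.neg_zpow, inv_neg, mul_neg]

/-- If the valuation were odd, dividing `x` by the power of `t` with the same valuation would give
`w` of valuation `0` with `s w = -w`. But `s` fixes constants and preserves positive valuation, so
it does not change the constant term of `w`. -/
theorem even_order_of_fixed (hss : ∀ x, s (s x) = x)
    (hσ : ∀ z : ℂ, s (algebraMap ℂ (LaurentSeries ℂ) z) = algebraMap ℂ (LaurentSeries ℂ) z)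
    {t : LaurentSeries ℂ} (ht : t.order = 1) (hst : s t = -t) {x : LaurentSeries ℂ}
    (hx : s x = x) : Even x.order := by
  rcases eq_or_ne x 0 with rfl | hx0
  · simp
  have ht0 : t ≠ 0 := by
    rintro rfl
    simp at ht
  by_contra hodd
  rw [Int.not_even_iff_odd] at hodd
  have h0 : t ^ x.order ≠ 0 := zpow_ne_zero _ ht0
  set w := x * (t ^ x.order)⁻¹ with hw
  have hw0 : w ≠ 0 := mul_ne_zero hx0 (inv_ne_zero h0)
  have hwo : w.order = 0 := by
    rw [hw, HahnSeries.order_mul hx0 (inv_ne_zero h0), ← zpow_neg, order_zpow ht0, ht]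
    ring
  have hsw : s w = -w := by
    rw [hw, map_mul, map_inv₀, map_zpow₀, hst, hx]
    exact mul_inv_neg_zpow hodd x t
  set κ := w.coeff 0
  have hκ : κ ≠ 0 := by
    have := coeff_order_ne_zero' hw0
    rwa [hwo] at this
  have h1 : ∀ d < 1, (w - algebraMap ℂ (LaurentSeries ℂ) κ).coeff d = 0 := by
    intro d hd
    rw [HahnSeries.coeff_sub, algebraMap_eq_C]
    rcases (show d ≤ 0 by omega).lt_or_eq with h | rfl
    · rw [HahnSeries.coeff_eq_zero_of_lt_order (by omega)]
      simp [h.ne]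
    · simp [κ]
  have h2 := coeff_map_eq_zero hss h1 0 one_pos
  rw [map_sub, hσ, hsw, HahnSeries.coeff_sub, HahnSeries.coeff_neg, algebraMap_eq_C]
    at h2
  simp only [HahnSeries.C_apply, HahnSeries.coeff_single_same] at h2
  apply hκ
  have : -κ - κ = 0 := h2
  linear_combination (-1 / 2 : ℂ) * this

theorem isLaurentInSquare (hss : ∀ x, s (s x) = x)
    (hσ : ∀ z : ℂ, s (algebraMap ℂ (LaurentSeries ℂ) z) = algebraMap ℂ (LaurentSeries ℂ) z)
    (hne : ∃ a, s a ≠ a) : IsLaurentInSquare s := by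
  obtain ⟨t, ht, hst⟩ := exists_antiinvariant_uniformizer hss hσ hne
  have ht0 : t ≠ 0 := by
    rintro rfl
    simp at ht
  have hst2 : ∀ i : ℤ, s (t ^ (2 * i)) = t ^ (2 * i) := fun i => by
    rw [map_zpow₀, hst]
    exact (even_two_mul i).neg_zpow t
  refine ⟨t, ht, hst, fun x => ⟨fun hx => ?_, ?_⟩⟩
  · obtain ⟨N, hN⟩ := even_order_of_fixed hss hσ ht hst hx
    -- The remainders after removing the terms in `t^(2i)` one at a time, each coefficient being
    -- chosen to cancel the lowest one left.
    let rem : ℕ → LaurentSeries ℂ := fun M => Nat.rec x (fun M y =>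
      y - (y.coeff (2 * (N + M)) / (t ^ (2 * (N + M : ℤ))).coeff (2 * (N + M))) •
        t ^ (2 * (N + M : ℤ))) M
    let a : ℤ → ℂ := fun i => (rem (i - N).toNat).coeff (2 * i) / (t ^ (2 * i)).coeff (2 * i)
    have hrem : ∀ M : ℕ, rem (M + 1) = rem M - a (N + M) • t ^ (2 * (N + M : ℤ)) := by
      intro M
      simp only [a, add_sub_cancel_left, Int.toNat_natCast]
      rfl
    have hsum : ∀ M : ℕ, rem M = x - ∑ i ∈ Finset.Ico N (N + M), a i • t ^ (2 * i) := by
      intro M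
      induction M with
      | zero => simp [rem]
      | succ M ih =>
        have : Finset.Ico N (N + (M + 1 : ℕ)) = insert (N + M : ℤ) (Finset.Ico N (N + M)) := by
          ext i
          simp only [Finset.mem_Ico, Finset.mem_insert]
          push_cast
          omega
        rw [hrem, ih, this, Finset.sum_insert (by simp)]
        ring
    have hfix : ∀ M, s (rem M) = rem M := by
      intro M
      induction M with
      | zero => exact hx
      | succ M ih => rw [hrem, map_sub, ih, map_complex_smul hσ, hst2]
    have hvan : ∀ M : ℕ, ∀ d < 2 * (N + M : ℤ), (rem M).coeff d = 0 := by
      intro M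
      induction M with
      | zero =>
        intro d hd
        exact HahnSeries.coeff_eq_zero_of_lt_order (by push_cast at hd; change d < x.order; omega)
      | succ M ih =>
        have h1 : ∀ d < 2 * (N + M : ℤ) + 1, (rem (M + 1)).coeff d = 0 := by
          intro d hd
          obtain ⟨h2, h3⟩ := coeff_zpow_self ht ht0 (2 * (N + M : ℤ))
          rw [hrem, HahnSeries.coeff_sub, HahnSeries.coeff_smul]
          rcases (show d ≤ 2 * (N + M : ℤ) by omega).lt_or_eq with h4 | rfl
          · rw [ih _ h4, h3 _ h4, smul_zero, sub_zero]
          · simp only [a, add_sub_cancel_left, Int.toNat_natCast]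
            rw [smul_eq_mul, div_mul_cancel₀ _ h2, sub_self]
        intro d hd
        rcases eq_or_ne (rem (M + 1)) 0 with h0 | h0
        · rw [h0, HahnSeries.coeff_zero]
        -- The remainder is again fixed by `s`, so its valuation is even: cancelling one coefficient
        -- gains two orders.
        obtain ⟨e, he⟩ := even_order_of_fixed hss hσ ht hst (hfix (M + 1))
        apply HahnSeries.coeff_eq_zero_of_lt_order
        have : ¬ (rem (M + 1)).order < 2 * (N + M : ℤ) + 1 := fun h =>
          coeff_order_ne_zero' h0 (h1 _ h)
        push_cast at hd
        omega
    exact ⟨a, N, fun M d hd => by rw [← hsum]; exact hvan M d hd⟩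
  · rintro ⟨a, N, h⟩
    rw [← sub_eq_zero]
    refine eq_zero_of_coeff (2 * N) fun M d hd => ?_
    set q := ∑ i ∈ Finset.Ico N (N + M), a i • t ^ (2 * i) with hq
    have hsq : s q = q := by
      rw [hq, map_sum]
      exact Finset.sum_congr rfl fun i _ => by rw [map_complex_smul hσ, hst2]
    have h1 : s x - x = s (x - q) - (x - q) := by rw [map_sub, hsq]; ring
    have hd' : d < 2 * (N + M : ℤ) := by omega
    rw [h1, HahnSeries.coeff_sub, coeff_map_eq_zero hss (h M) d hd', h M d hd', sub_zero]

end Involution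

end LoopGrading

end

noncomputable section

namespace LoopGrading

/-! ### Kummer theory for the cyclic algebra `F` -/

theorem sum_root_pow {k : Type*} [Field k] {χ : k} {n : ℕ} (h : χ ^ n = 1) (h1 : χ ≠ 1) :
    ∑ a ∈ Finset.range n, χ ^ a = 0 := by
  have := mul_geom_sum χ n
  rw [h, sub_self] at this
  exact (mul_eq_zero.mp this).resolve_left (sub_ne_zero.mpr h1)

theorem sum_primitiveRoot_pow {k : Type*} [Field k] {ω : k} {n : ℕ} (hω : IsPrimitiveRoot ω n)
    {i j : ℕ} (hi : i < n) (hj : j < n) :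
    ∑ a ∈ Finset.range n, (ω ^ i * (ω⁻¹) ^ j) ^ a = if i = j then (n : k) else 0 := by
  have hω0 : ω ≠ 0 := hω.ne_zero (by omega)
  split_ifs with h
  · subst h
    rw [← mul_pow, mul_inv_cancel₀ hω0]
    simp
  · refine sum_root_pow ?_ ?_
    · rw [mul_pow, ← pow_mul, ← pow_mul, mul_comm i, mul_comm j, pow_mul, pow_mul, inv_pow,
        hω.pow_eq_one]
      simp
    · intro h1
      apply h
      apply hω.pow_inj hi hj
      rw [inv_pow] at h1
      exact mul_inv_eq_one₀ (pow_ne_zero _ hω0) |>.mp h1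

namespace CyclicDatum

variable {k : Type} [Field k] {F : Type u} [CommRing F] [Algebra k F] (E : CyclicDatum k F)

theorem n_pos : 0 < E.n := by
  rcases Nat.eq_zero_or_pos E.n with h | h
  · exact absurd (by rw [h, Nat.div_zero, Nat.cast_zero]) E.m_div_n_ne_zero
  · exact h

theorem ζ_pow_n : E.ζ ^ E.n = 1 := by
  rw [← E.orderOf_ζ, pow_orderOf_eq_one]

theorem ζ_pow_apply_succ (j : ℕ) (x : F) : (E.ζ ^ (j + 1)) x = E.ζ ((E.ζ ^ j) x) := by
  rw [pow_succ']
  rfl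

/-- A primitive `n`-th root of unity `ω` and a unit `y` of `F` with `ζ(y) = ω y`. -/
structure KummerGenerator where
  ω : k
  isPrimitiveRoot : IsPrimitiveRoot ω E.n
  y : Fˣ
  ζ_y : E.ζ y = algebraMap k F ω * y

theorem sum_ζ_pow_succ {A : Type*} [AddCommGroup A] (f : ℕ → A) {n : ℕ} (h : f n = f 0) :
    ∑ i ∈ Finset.range n, f (i + 1) = ∑ i ∈ Finset.range n, f i := by
  have h1 := Finset.sum_range_succ f n
  rw [Finset.sum_range_succ', h] at h1
  exact add_right_cancel h1

/-- The power `x^n` is fixed by `ζ`, hence lies in `k`, and it is non-zero because `F` is reduced.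
-/
theorem isUnit_of_eigenvector [Nontrivial F] [IsReduced F] {χ : k} (hχ : χ ^ E.n = 1) {x : F}
    (hx : x ≠ 0) (h : E.ζ x = algebraMap k F χ * x) : IsUnit x := by
  obtain ⟨c, hc⟩ := E.fixed (x ^ E.n) (by
    rw [map_pow, h, mul_pow, ← map_pow, hχ, map_one, one_mul])
  have h0 : c ≠ 0 := by
    rintro rfl
    rw [map_zero] at hc
    exact hx (eq_zero_of_pow_eq_zero hc.symm)
  have : IsUnit (x ^ E.n) := by
    rw [← hc]
    exact (isUnit_iff_ne_zero.mpr h0).map _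
  exact (isUnit_pow_iff E.n_pos.ne').mp this

/-- The exponents `a` for which `ω^a` is the eigenvalue of a unit form a subgroup `dℤ` of `ℤ`
containing `n`. As `F` is the sum of its eigenspaces and non-zero eigenvectors are units, all
eigenvalues are powers of `ω^d`, so `ζ^(n/|d|) = 1`. Since `ζ` has exact order `n`, this forces `|d|
= 1`. -/
theorem exists_kummerGenerator [Nontrivial F] [IsReduced F] [CharZero k] {ω : k}
    (hω : IsPrimitiveRoot ω E.n) : ∃ K : E.KummerGenerator, K.ω = ω := by
  have hω0 : ω ≠ 0 := hω.ne_zero E.n_pos.ne'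
  have hn0 : (E.n : k) ≠ 0 := Nat.cast_ne_zero.mpr E.n_pos.ne'
  let G : AddSubgroup ℤ :=
    { carrier := {a | ∃ x : Fˣ, E.ζ x = algebraMap k F (ω ^ a) * x}
      zero_mem' := ⟨1, by simp⟩
      add_mem' := by
        rintro a b ⟨x, hx⟩ ⟨z, hz⟩
        refine ⟨x * z, ?_⟩
        rw [Units.val_mul, map_mul, hx, hz, zpow_add₀ hω0, map_mul]
        ring
      neg_mem' := by
        rintro a ⟨x, hx⟩
        refine ⟨x⁻¹, ?_⟩
        have h1 : E.ζ x * E.ζ (x⁻¹ : Fˣ) = 1 := by rw [← map_mul, Units.mul_inv, map_one]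
        rw [hx] at h1
        rw [zpow_neg]
        have h2 : algebraMap k F (ω ^ a)⁻¹ * algebraMap k F (ω ^ a) = 1 := by
          rw [← map_mul, inv_mul_cancel₀ (zpow_ne_zero _ hω0), map_one]
        calc E.ζ (x⁻¹ : Fˣ) = algebraMap k F (ω ^ a)⁻¹ * algebraMap k F (ω ^ a) *
              ((x⁻¹ : Fˣ) * x) * E.ζ (x⁻¹ : Fˣ) := by rw [h2, Units.inv_mul]; ring
          _ = algebraMap k F (ω ^ a)⁻¹ * (x⁻¹ : Fˣ) *
              (algebraMap k F (ω ^ a) * x * E.ζ (x⁻¹ : Fˣ)) := by ring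
          _ = _ := by rw [h1, mul_one] }
  obtain ⟨d, hd⟩ := Int.subgroup_cyclic G
  have hmem : ∀ a, a ∈ G ↔ d ∣ a := fun a => by
    rw [hd, ← AddSubgroup.zmultiples_eq_closure, Int.mem_zmultiples_iff]
  obtain ⟨n', hn'⟩ : (d.natAbs) ∣ E.n := by
    have h1 : (E.n : ℤ) ∈ G := ⟨1, by simp [hω.pow_eq_one]⟩
    rw [hmem] at h1
    simpa using Int.natAbs_dvd_natAbs.mpr h1
  have hz : E.ζ ^ n' = 1 := by
    ext x
    have hn0F : ∀ z : F, (E.n : k) • z = 0 → z = 0 := fun z hz => by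
      simpa [smul_smul, hn0] using congrArg ((E.n : k)⁻¹ • ·) hz
    -- Up to the factor `n`, the projection of `x` to the eigenspace for `ω^j`.
    let e : ℕ → F := fun j => ∑ i ∈ Finset.range E.n, ((ω⁻¹) ^ j) ^ i • (E.ζ ^ i) x
    have he : ∀ j, E.ζ (e j) = algebraMap k F (ω ^ j) * e j := by
      intro j
      have h1 : E.ζ (e j) =
          ω ^ j • ∑ i ∈ Finset.range E.n, ((ω⁻¹) ^ j) ^ (i + 1) • (E.ζ ^ (i + 1)) x := by
        rw [map_sum, Finset.smul_sum]
        refine Finset.sum_congr rfl fun i _ => ?_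
        rw [map_smul, ζ_pow_apply_succ, smul_smul, pow_succ', ← mul_assoc, inv_pow,
          mul_inv_cancel₀ (pow_ne_zero _ hω0), one_mul]
      rw [h1, sum_ζ_pow_succ (fun i => ((ω⁻¹) ^ j) ^ i • (E.ζ ^ i) x), Algebra.smul_def]
      rw [E.ζ_pow_n, ← pow_mul, mul_comm, pow_mul, inv_pow, hω.pow_eq_one]
      simp
    have he2 : ∀ j, (E.ζ ^ n') (e j) = e j := by
      intro j
      rcases eq_or_ne (e j) 0 with h0 | h0
      · rw [h0, map_zero]
      have hu := E.isUnit_of_eigenvector (χ := ω ^ j)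
        (by rw [← pow_mul, mul_comm, pow_mul, hω.pow_eq_one, one_pow]) h0 (he j)
      have hj : (j : ℤ) ∈ G := ⟨hu.unit, by simpa using he j⟩
      rw [hmem] at hj
      obtain ⟨q, hq⟩ : d.natAbs ∣ j := by simpa using Int.natAbs_dvd_natAbs.mpr hj
      have h3 : ∀ i, (E.ζ ^ i) (e j) = algebraMap k F ((ω ^ j) ^ i) * e j := by
        intro i
        induction i with
        | zero => simp
        | succ i ih =>
          rw [ζ_pow_apply_succ, ih, map_mul, AlgEquiv.commutes, he, ← mul_assoc, ← map_mul,
            pow_succ]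
      rw [h3, hq, ← pow_mul, mul_right_comm, ← hn', pow_mul, hω.pow_eq_one]
      simp
    have hsum : ∑ j ∈ Finset.range E.n, e j = (E.n : k) • x := by
      rw [Finset.sum_comm]
      rw [Finset.sum_eq_single_of_mem 0 (Finset.mem_range.mpr E.n_pos)]
      · simp [← Nat.cast_smul_eq_nsmul k]
      · intro i hi hi0
        rw [← Finset.sum_smul]
        have := sum_primitiveRoot_pow hω E.n_pos (Finset.mem_range.mp hi)
        rw [if_neg (Ne.symm hi0)] at this
        rw [← zero_smul k ((E.ζ ^ i) x), ← this]
        congr 1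
        refine Finset.sum_congr rfl fun j _ => ?_
        rw [pow_zero, one_mul, ← pow_mul, ← pow_mul, mul_comm]
    have h4 : (E.n : k) • ((E.ζ ^ n') x - x) = 0 := by
      rw [smul_sub, ← map_smul, ← hsum, map_sum, sub_eq_zero]
      exact Finset.sum_congr rfl fun j _ => he2 j
    exact sub_eq_zero.mp (hn0F _ h4)
  have h5 : E.n ∣ n' := by
    rw [← E.orderOf_ζ]
    exact orderOf_dvd_of_pow_eq_one hz
  have hn'0 : n' ≠ 0 := by
    rintro rfl
    exact E.n_pos.ne' (by rw [hn', mul_zero])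
  have h6 : d.natAbs = 1 := by
    have h7 := Nat.le_of_dvd (Nat.pos_of_ne_zero hn'0) h5
    rw [hn'] at h7
    have h8 : d.natAbs ≠ 0 := by
      intro h
      rw [h, zero_mul] at hn'
      exact E.n_pos.ne' hn'
    nlinarith [Nat.pos_of_ne_zero hn'0, Nat.pos_of_ne_zero h8]
  obtain ⟨y, hy⟩ : (1 : ℤ) ∈ G := by
    rw [hmem]
    exact Int.natAbs_dvd.mp (by rw [h6]; simp)
  exact ⟨⟨ω, hω, y, by simpa using hy⟩, rfl⟩

variable {E} (K : E.KummerGenerator)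

/-- The sum `∑ ζ^j(x)`. -/
def tr : F →ₗ[k] F := ∑ j ∈ Finset.range E.n, ((E.ζ ^ j : F ≃ₐ[k] F) : F →ₗ[k] F)

theorem tr_apply (x : F) : tr (E := E) x = ∑ j ∈ Finset.range E.n, (E.ζ ^ j) x := by
  simp [tr]

theorem exists_tr (x : F) : ∃ c : k, algebraMap k F c = tr (E := E) x := by
  apply E.fixed
  rw [tr_apply, map_sum]
  simp_rw [← ζ_pow_apply_succ]
  exact sum_ζ_pow_succ (fun i => (E.ζ ^ i) x) (by rw [ζ_pow_n, pow_zero])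

namespace KummerGenerator

theorem ω_ne_zero : K.ω ≠ 0 := K.isPrimitiveRoot.ne_zero E.n_pos.ne'

theorem ζ_pow_y (j : ℕ) : (E.ζ ^ j) K.y = algebraMap k F (K.ω ^ j) * K.y := by
  induction j with
  | zero => simp
  | succ j ih =>
    rw [ζ_pow_apply_succ, ih, map_mul, AlgEquiv.commutes, K.ζ_y, ← mul_assoc, ← map_mul, pow_succ]

theorem ζ_pow_yInv (j : ℕ) :
    (E.ζ ^ j) (K.y⁻¹ : Fˣ) = algebraMap k F ((K.ω⁻¹) ^ j) * (K.y⁻¹ : Fˣ) := by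
  have h1 : (E.ζ ^ j) K.y * (E.ζ ^ j) (K.y⁻¹ : Fˣ) = 1 := by
    rw [← map_mul, Units.mul_inv, map_one]
  rw [ζ_pow_y] at h1
  have h2 : algebraMap k F ((K.ω⁻¹) ^ j) * algebraMap k F (K.ω ^ j) = 1 := by
    rw [← map_mul, ← mul_pow, inv_mul_cancel₀ K.ω_ne_zero, one_pow, map_one]
  calc (E.ζ ^ j) (K.y⁻¹ : Fˣ) = algebraMap k F ((K.ω⁻¹) ^ j) * algebraMap k F (K.ω ^ j) *
        ((K.y⁻¹ : Fˣ) * K.y) * (E.ζ ^ j) (K.y⁻¹ : Fˣ) := by rw [h2, Units.inv_mul]; ring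
    _ = algebraMap k F ((K.ω⁻¹) ^ j) * (K.y⁻¹ : Fˣ) *
        (algebraMap k F (K.ω ^ j) * K.y * (E.ζ ^ j) (K.y⁻¹ : Fˣ)) := by ring
    _ = _ := by rw [h1, mul_one]

theorem exists_y_pow : ∃ f : k, algebraMap k F f = (K.y : F) ^ E.n := by
  apply E.fixed
  rw [map_pow, K.ζ_y, mul_pow, ← map_pow, K.isPrimitiveRoot.pow_eq_one, map_one, one_mul]

/-- Orthogonality of characters: the conjugates of the `y^a` and those of the `y^(-a)` form matrices
that are inverse up to the factor `n`. All descent below rests on this relation, and `F` may be a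
product of fields. -/
theorem sum_y_pow {j l : ℕ} (hj : j < E.n) (hl : l < E.n) :
    ∑ a ∈ Finset.range E.n, (E.ζ ^ j) ((K.y : F) ^ a) * (E.ζ ^ l) (((K.y⁻¹ : Fˣ) : F) ^ a) =
      if j = l then (E.n : F) else 0 := by
  have h := sum_primitiveRoot_pow K.isPrimitiveRoot hj hl
  have h2 : (if j = l then (E.n : F) else 0) = algebraMap k F (if j = l then (E.n : k) else 0) := by
    split_ifs <;> simp
  rw [h2, ← h, map_sum]
  refine Finset.sum_congr rfl fun a _ => ?_
  rw [map_pow, map_pow, ζ_pow_y, ζ_pow_yInv, ← mul_pow, mul_mul_mul_comm, Units.mul_inv, mul_one,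
    ← map_mul, map_pow]

theorem expand (x : F) :
    ∑ a ∈ Finset.range E.n, (K.y : F) ^ a * tr (E := E) (((K.y⁻¹ : Fˣ) : F) ^ a * x) =
      (E.n : F) * x := by
  simp_rw [tr_apply, Finset.mul_sum, map_mul]
  rw [Finset.sum_comm]
  have : ∀ j ∈ Finset.range E.n, ∑ a ∈ Finset.range E.n, (K.y : F) ^ a *
      ((E.ζ ^ j) (((K.y⁻¹ : Fˣ) : F) ^ a) * (E.ζ ^ j) x) =
        if 0 = j then (E.n : F) * x else 0 := by
    intro j hj
    have h := K.sum_y_pow E.n_pos (Finset.mem_range.mp hj)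
    simp_rw [← mul_assoc]
    rw [← Finset.sum_mul]
    have h1 : ∀ a, (E.ζ ^ 0) ((K.y : F) ^ a) = (K.y : F) ^ a := fun a => rfl
    simp_rw [h1] at h
    rw [h]
    split_ifs with h0
    · subst h0; rfl
    · rw [zero_mul]
  rw [Finset.sum_congr rfl this, Finset.sum_ite_eq, if_pos (Finset.mem_range.mpr E.n_pos)]

theorem tr_y_pow {a b : ℕ} (ha : a < E.n) (hb : b < E.n) :
    tr (E := E) (((K.y⁻¹ : Fˣ) : F) ^ a * (K.y : F) ^ b) = if b = a then (E.n : F) else 0 := by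
  have h := sum_primitiveRoot_pow K.isPrimitiveRoot hb ha
  rw [tr_apply]
  have h1 : ∀ j, (E.ζ ^ j) (((K.y⁻¹ : Fˣ) : F) ^ a * (K.y : F) ^ b) =
      algebraMap k F ((K.ω ^ b * (K.ω⁻¹) ^ a) ^ j) * (((K.y⁻¹ : Fˣ) : F) ^ a * (K.y : F) ^ b) := by
    intro j
    rw [map_mul, map_pow, map_pow, ζ_pow_y, ζ_pow_yInv]
    simp only [map_mul, map_pow, mul_pow, ← pow_mul]
    rw [mul_comm a j, mul_comm b j]
    ring
  simp_rw [h1]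
  rw [← Finset.sum_mul, ← map_sum, h]
  split_ifs with hab
  · subst hab
    rw [← mul_pow, Units.inv_mul, one_pow, mul_one, map_natCast]
  · rw [map_zero, zero_mul]

variable [CharZero k]

theorem natCast_ne_zero (E : CyclicDatum k F) : (E.n : k) ≠ 0 :=
  Nat.cast_ne_zero.mpr E.n_pos.ne'

theorem natCast_mul_inv (E : CyclicDatum k F) : (E.n : F) * algebraMap k F (E.n : k)⁻¹ = 1 := by
  rw [← map_natCast (algebraMap k F), ← map_mul, mul_inv_cancel₀ (natCast_ne_zero E), map_one]

theorem exists_coeff (x : F) : ∃ c : ℕ → k,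
    x = ∑ a ∈ Finset.range E.n, c a • (K.y : F) ^ a := by
  choose t ht using exists_tr (E := E)
  refine ⟨fun a => (E.n : k)⁻¹ * t (((K.y⁻¹ : Fˣ) : F) ^ a * x), ?_⟩
  have h := K.expand x
  have h1 := natCast_mul_inv E
  calc x = algebraMap k F (E.n : k)⁻¹ * ((E.n : F) * x) := by
        rw [← mul_assoc, mul_comm (algebraMap k F _), h1, one_mul]
    _ = _ := by
        rw [← h, Finset.mul_sum]
        refine Finset.sum_congr rfl fun a _ => ?_
        rw [Algebra.smul_def, map_mul (algebraMap k F), ht]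
        ring

/-- The basis `y^a` of `F` over `k`. -/
def basis [Nontrivial F] : Module.Basis (Fin E.n) k F :=
  Module.Basis.mk (v := fun a => (K.y : F) ^ (a : ℕ)) (by
    rw [Fintype.linearIndependent_iff]
    intro c hc a
    have h := congrArg (fun x => tr (E := E) (((K.y⁻¹ : Fˣ) : F) ^ (a : ℕ) * x)) hc
    simp only [mul_zero, map_zero, Finset.mul_sum, map_sum, mul_smul_comm, map_smul] at h
    rw [Finset.sum_eq_single a] at h
    · rw [K.tr_y_pow a.2 a.2, if_pos rfl, Algebra.smul_def, ← map_natCast (algebraMap k F),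
        ← map_mul, FaithfulSMul.algebraMap_eq_zero_iff] at h
      exact (mul_eq_zero.mp h).resolve_right (natCast_ne_zero E)
    · intro b _ hba
      rw [K.tr_y_pow a.2 b.2, if_neg (fun h => hba (Fin.ext h)), smul_zero]
    · simp) (by
    rintro x -
    obtain ⟨c, rfl⟩ := K.exists_coeff x
    refine Submodule.sum_mem _ fun a ha => Submodule.smul_mem _ _ (Submodule.subset_span ?_)
    exact ⟨⟨a, Finset.mem_range.mp ha⟩, rfl⟩)

/-- The matrix `W` of conjugates of the basis vectors intertwines multiplication by `x` with the
diagonal matrix of the conjugates of `x`, and it is invertible by `sum_y_pow`; take determinants.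
This is how `γ` and `ν` appear when `θ` is iterated `n` times. -/
theorem norm_eq_prod [Nontrivial F] (K : E.KummerGenerator) (x : F) :
    algebraMap k F (Algebra.norm k x) = ∏ j ∈ Finset.range E.n, (E.ζ ^ j) x := by
  have hb : ∀ a : Fin E.n, K.basis a = (K.y : F) ^ (a : ℕ) := fun a => by simp [basis]
  let W : Matrix (Fin E.n) (Fin E.n) F := Matrix.of fun j a => (E.ζ ^ (j : ℕ)) (K.y ^ (a : ℕ))
  let U : Matrix (Fin E.n) (Fin E.n) F := Matrix.of fun a j =>
    algebraMap k F (E.n : k)⁻¹ * (E.ζ ^ (j : ℕ)) (((K.y⁻¹ : Fˣ) : F) ^ (a : ℕ))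
  have hWU : W * U = 1 := by
    ext j l
    rw [Matrix.mul_apply, Matrix.one_apply]
    have h := K.sum_y_pow j.2 l.2
    rw [Finset.sum_range] at h
    simp only [W, U, Matrix.of_apply]
    simp_rw [mul_left_comm _ (algebraMap k F _)]
    rw [← Finset.mul_sum, h]
    simp only [Fin.ext_iff]
    split_ifs
    · rw [mul_comm, natCast_mul_inv]
    · rw [mul_zero]
  let M := (Algebra.leftMulMatrix K.basis x).map (algebraMap k F)
  have hWM : Matrix.diagonal (fun j : Fin E.n => (E.ζ ^ (j : ℕ)) x) * W = W * M := by
    ext j a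
    rw [Matrix.diagonal_mul, Matrix.mul_apply]
    simp only [W, M, Matrix.of_apply, Matrix.map_apply]
    rw [← map_mul]
    have h1 : x * K.y ^ (a : ℕ) =
        ∑ b, Algebra.leftMulMatrix K.basis x b a • (K.y : F) ^ (b : ℕ) := by
      have := K.basis.sum_repr (x * K.basis a)
      rw [← hb, ← this]
      refine Finset.sum_congr rfl fun b _ => ?_
      rw [Algebra.leftMulMatrix_eq_repr_mul, hb, hb]
    rw [h1, map_sum]
    refine Finset.sum_congr rfl fun b _ => ?_
    rw [map_smul, Algebra.smul_def, mul_comm]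
  have hdet := congrArg Matrix.det hWM
  rw [Matrix.det_mul, Matrix.det_mul, Matrix.det_diagonal, mul_comm] at hdet
  have hu : IsUnit W.det := by
    have := congrArg Matrix.det hWU
    rw [Matrix.det_mul, Matrix.det_one] at this
    exact IsUnit.of_mul_eq_one _ this
  have h2 := hu.mul_left_cancel hdet
  rw [Algebra.norm_eq_matrix_det K.basis, Finset.prod_range, h2]
  exact RingHom.map_det _ _

end KummerGenerator

end CyclicDatum

end LoopGrading

end

noncomputable section

namespace LoopGrading

/-! ### The structure of `L_β` -/

namespace CyclicDatum

variable {k : Type} [Field k] {F : Type u} [CommRing F] [Algebra k F] (E : CyclicDatum k F)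

instance : Module.Finite k E.L :=
  (Polynomial.monic_X_pow_sub_C E.β E.r_pos.ne').finite_adjoinRoot

instance : IsArtinianRing E.L := IsArtinianRing.of_finite k E.L

/-- The polynomial `X^r - β` is separable, since `r` and `β` are non-zero in `k`. -/
instance : IsReduced E.L := by
  have hr : ((E.r : ℕ) : k) ≠ 0 := E.m_div_n_ne_zero
  have h := (Polynomial.separable_X_pow_sub_C E.β hr E.β_ne_zero).squarefree.isRadical
  exact (Ideal.isRadical_iff_quotient_reduced _).mp (isRadical_iff_span_singleton.mp h)

instance (i : E.I) : i.asIdeal.IsMaximal := inferInstance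

instance : Finite E.I := inferInstance

instance (i : E.I) : IsDomain (E.Li i) := inferInstanceAs (IsDomain (E.L ⧸ i.asIdeal))

theorem algebraMap_Li_surjective (i : E.I) : Function.Surjective (algebraMap E.L (E.Li i)) :=
  Ideal.Quotient.mk_surjective

theorem algebraMap_Li_eq_zero {i : E.I} {l : E.L} :
    algebraMap E.L (E.Li i) l = 0 ↔ l ∈ i.asIdeal :=
  Ideal.Quotient.eq_zero_iff_mem

theorem exists_inv_of_not_mem {i : E.I} {l : E.L} (h : l ∉ i.asIdeal) :
    ∃ l' : E.L, l' * l - 1 ∈ i.asIdeal := by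
  obtain ⟨l', hl⟩ := (inferInstance : i.asIdeal.IsMaximal).exists_inv h
  obtain ⟨z, hz, h⟩ := hl
  refine ⟨l', ?_⟩
  rw [← h, sub_add_cancel_left]
  exact neg_mem hz

theorem L_eq_zero {l : E.L} (h : ∀ i : E.I, l ∈ i.asIdeal) : l = 0 := by
  apply IsReduced.eq_zero l
  rw [nilpotent_iff_mem_prime]
  intro J hJ
  exact h ⟨J, hJ⟩

theorem pairwise_isCoprime : Pairwise fun i j : E.I => IsCoprime i.asIdeal j.asIdeal := by
  intro i j hij
  rw [Ideal.isCoprime_iff_sup_eq]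
  exact Ideal.IsMaximal.coprime_of_ne inferInstance inferInstance
    fun h => hij (PrimeSpectrum.ext h)

theorem L_bijective :
    Function.Bijective fun (l : E.L) (i : E.I) => algebraMap E.L (E.Li i) l := by
  constructor
  · intro l l' h
    rw [← sub_eq_zero]
    refine E.L_eq_zero fun i => ?_
    rw [← algebraMap_Li_eq_zero, map_sub, sub_eq_zero]
    exact congrFun h i
  · intro x
    obtain ⟨l, hl⟩ := Ideal.pi_quotient_surjective E.pairwise_isCoprime x
    exact ⟨l, funext hl⟩

theorem exists_idem (i : E.I) : ∃ l : E.L, algebraMap E.L (E.Li i) l = 1 ∧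
    ∀ j, j ≠ i → algebraMap E.L (E.Li j) l = 0 := by
  classical
  obtain ⟨l, hl⟩ := E.L_bijective.2 (Pi.single i 1)
  refine ⟨l, ?_, fun j hij => ?_⟩
  · simpa using congrFun hl i
  · simpa [hij] using congrFun hl j

/-- The idempotent of `L_β` at `i`. -/
def idem (i : E.I) : E.L := (E.exists_idem i).choose

theorem algebraMap_idem_self (i : E.I) : algebraMap E.L (E.Li i) (E.idem i) = 1 :=
  (E.exists_idem i).choose_spec.1

theorem algebraMap_idem_of_ne {i j : E.I} (hij : j ≠ i) :
    algebraMap E.L (E.Li j) (E.idem i) = 0 :=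
  (E.exists_idem i).choose_spec.2 j hij

theorem idem_mem {i j : E.I} (hij : j ≠ i) : E.idem i ∈ j.asIdeal :=
  E.algebraMap_Li_eq_zero.mp (E.algebraMap_idem_of_ne hij)

theorem idem_sub_one_mem (i : E.I) : E.idem i - 1 ∈ i.asIdeal := by
  rw [← algebraMap_Li_eq_zero, map_sub, algebraMap_idem_self, map_one, sub_self]

theorem mul_idem_eq_zero {i : E.I} {l : E.L} (h : l ∈ i.asIdeal) : l * E.idem i = 0 := by
  refine E.L_eq_zero fun j => ?_
  rcases eq_or_ne j i with rfl | hj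
  · exact Ideal.mul_mem_right _ _ h
  · exact Ideal.mul_mem_left _ _ (E.idem_mem hj)

instance : Fintype E.I := Fintype.ofFinite _

theorem sum_idem : ∑ i, E.idem i = 1 := by
  classical
  rw [← sub_eq_zero]
  refine E.L_eq_zero fun j => ?_
  rw [← algebraMap_Li_eq_zero, map_sub, map_sum, Finset.sum_eq_single j, algebraMap_idem_self,
    map_one, sub_self]
  · exact fun i _ hi => E.algebraMap_idem_of_ne hi.symm
  · simp

/-- The quotient map `k[X] → L_β`. -/
def mkL : k[X] →ₐ[k] E.L :=
  AdjoinRoot.mkₐ (Polynomial.X ^ E.r - Polynomial.C E.β : k[X])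

theorem mkL_surjective : Function.Surjective (mkL E) := AdjoinRoot.mk_surjective

theorem mkL_X_pow_sub_C (ρ : k) (e : ℕ) :
    mkL E (Polynomial.X ^ e - Polynomial.C ρ) = E.b ^ e - algebraMap k E.L ρ := by
  rw [map_sub, map_pow]
  rfl

/-- Writing `m / n = g e`, the equation `ρ^g = β` has `g` solutions in `k`, for which
`X^e - ρ` is irreducible. -/
structure RootDatum where
  g : ℕ
  e : ℕ
  r_eq : E.r = g * e
  κ : k
  isPrimitiveRoot : IsPrimitiveRoot κ g
  ρ₀ : k
  ρ₀_pow : ρ₀ ^ g = E.β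
  irreducible : ∀ ρ : k, ρ ^ g = E.β → Irreducible (Polynomial.X ^ e - Polynomial.C ρ)

namespace RootDatum

variable {E} (R : E.RootDatum)

theorem g_pos : 0 < R.g := Nat.pos_of_ne_zero fun h => E.r_pos.ne' (by rw [R.r_eq, h, zero_mul])

theorem ne_zero {ρ : k} (h : ρ ^ R.g = E.β) : ρ ≠ 0 := by
  rintro rfl
  rw [zero_pow R.g_pos.ne'] at h
  exact E.β_ne_zero h.symm

/-- In the domain `L_i` the quotient `b_i^e / ρ₀` is a `g`-th root of unity, and these are all
powers of `κ ∈ k`. -/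
theorem exists_rho (i : E.I) : ∃ ρ : k, ρ ^ R.g = E.β ∧ E.b ^ R.e - algebraMap k E.L ρ ∈
    i.asIdeal := by
  have h0 := R.ne_zero R.ρ₀_pow
  have : NeZero R.g := ⟨R.g_pos.ne'⟩
  have h1 : (E.bi i ^ R.e * algebraMap k (E.Li i) R.ρ₀⁻¹) ^ R.g = 1 := by
    rw [mul_pow, ← pow_mul, mul_comm R.e, ← R.r_eq, ← map_pow, inv_pow, R.ρ₀_pow, bi, ← map_pow,
      E.b_pow, ← IsScalarTower.algebraMap_apply, ← map_mul, mul_inv_cancel₀ E.β_ne_zero, map_one]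
  have hprim : IsPrimitiveRoot (algebraMap k (E.Li i) R.κ) R.g :=
    R.isPrimitiveRoot.map_of_injective (algebraMap k (E.Li i)).injective
  obtain ⟨j, -, h2⟩ := hprim.eq_pow_of_pow_eq_one h1
  refine ⟨R.κ ^ j * R.ρ₀, ?_, ?_⟩
  · rw [mul_pow, ← pow_mul, mul_comm, mul_comm j, pow_mul, R.isPrimitiveRoot.pow_eq_one, one_pow,
      mul_one, R.ρ₀_pow]
  · rw [← algebraMap_Li_eq_zero, map_sub, sub_eq_zero, map_pow, ← IsScalarTower.algebraMap_apply,
      map_mul, map_pow, h2, mul_assoc, ← map_mul, inv_mul_cancel₀ h0, map_one, mul_one]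
    rfl

/-- The `ρ ∈ k` with `b_i^e = ρ`. -/
def rho (i : E.I) : k := (R.exists_rho i).choose

theorem rho_pow (i : E.I) : R.rho i ^ R.g = E.β := (R.exists_rho i).choose_spec.1

theorem b_pow_sub_rho_mem (i : E.I) : E.b ^ R.e - algebraMap k E.L (R.rho i) ∈ i.asIdeal :=
  (R.exists_rho i).choose_spec.2

theorem bi_pow (i : E.I) : E.bi i ^ R.e = algebraMap k (E.Li i) (R.rho i) := by
  have h := E.algebraMap_Li_eq_zero.mpr (R.b_pow_sub_rho_mem i)
  rw [map_sub, sub_eq_zero, map_pow, ← IsScalarTower.algebraMap_apply] at h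
  exact h

theorem eq_rho {i : E.I} {ρ : k} (h : E.b ^ R.e - algebraMap k E.L ρ ∈ i.asIdeal) :
    ρ = R.rho i := by
  rw [← algebraMap_Li_eq_zero, map_sub, sub_eq_zero, map_pow, ← IsScalarTower.algebraMap_apply] at h
  apply (algebraMap k (E.Li i)).injective
  rw [← R.bi_pow, ← h]
  rfl

/-- The ideal contains `X^e - ρ`, which generates a maximal ideal by irreducibility. In particular
`i` is determined by `rho i`. -/
theorem comap_mkL (i : E.I) : i.asIdeal.comap (mkL E) =
    Ideal.span {Polynomial.X ^ R.e - Polynomial.C (R.rho i)} := by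
  have : (Ideal.span {(Polynomial.X ^ R.e - Polynomial.C (R.rho i) : k[X])}).IsMaximal :=
    PrincipalIdealRing.isMaximal_of_irreducible (R.irreducible _ (R.rho_pow i))
  symm
  apply Ideal.IsMaximal.eq_of_le this
  · exact (Ideal.comap_isPrime (mkL E) i.asIdeal).ne_top
  · rw [Ideal.span_singleton_le_iff_mem, Ideal.mem_comap, mkL_X_pow_sub_C]
    exact R.b_pow_sub_rho_mem i

theorem rho_injective : Function.Injective R.rho := by
  intro i j h
  apply PrimeSpectrum.ext
  apply Ideal.comap_injective_of_surjective (mkL E) E.mkL_surjective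
  rw [R.comap_mkL, R.comap_mkL, h]

theorem exists_rho_eq {ρ : k} (h : ρ ^ R.g = E.β) : ∃ i, R.rho i = ρ := by
  have hp : (Ideal.span {(Polynomial.X ^ R.e - Polynomial.C ρ : k[X])}).IsPrime :=
    (PrincipalIdealRing.isMaximal_of_irreducible (R.irreducible _ h)).isPrime
  have hle : RingHom.ker (mkL E) ≤ Ideal.span {(Polynomial.X ^ R.e - Polynomial.C ρ : k[X])} := by
    have h1 : RingHom.ker (mkL E) = Ideal.span {Polynomial.X ^ E.r - Polynomial.C E.β} :=
      Ideal.mk_ker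
    rw [h1, Ideal.span_singleton_le_span_singleton, R.r_eq, mul_comm, pow_mul, ← h, map_pow]
    exact sub_dvd_pow_sub_pow _ _ _
  refine ⟨⟨_, Ideal.map_isPrime_of_surjective E.mkL_surjective hle⟩, ?_⟩
  symm
  apply R.eq_rho
  rw [← mkL_X_pow_sub_C]
  exact Ideal.mem_map_of_mem _ (Ideal.mem_span_singleton_self _)

theorem rho_eq_iff {i j : E.I} : R.rho i = R.rho j ↔ i = j := R.rho_injective.eq_iff

end RootDatum

end CyclicDatum

namespace PolarizedDatum

variable {k : Type} [Field k] {F : Type u} [CommRing F] [Algebra k F]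
  (D : PolarizedDatum.{u, v} k F) (R : D.toCyclicDatum.RootDatum)

theorem ν_ne_zero : D.ν ≠ 0 := by
  intro h
  have := D.ν_pow
  rw [h, zero_pow D.r_pos.ne'] at this
  exact zero_ne_one this

theorem γ_ne_zero [Nontrivial F] : D.γ ≠ 0 := by
  intro h
  have := D.γ_pow
  rw [h, zero_pow D.r_pos.ne'] at this
  rcases mul_eq_zero.mp this.symm with h | h
  · exact D.β_ne_zero h
  · exact D.β_ne_zero ((map_eq_zero _).mp h)

theorem σk_ν [Nontrivial F] : D.σk D.ν = D.ν := by
  let e₁ : k ≃+* k := RingEquiv.ofRingHom D.σk D.σk (RingHom.ext D.σk_σk) (RingHom.ext D.σk_σk)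
  let e₂ : F ≃+* F := RingEquiv.ofRingHom D.σ D.σ (RingHom.ext D.σ_σ) (RingHom.ext D.σ_σ)
  have h := Algebra.norm_eq_of_equiv_equiv e₁ e₂
    (RingHom.ext fun a => (D.σ_algebraMap a).symm) (D.ξ : F)
  have h2 : e₂ (D.ξ : F) = D.ξ := D.σ_ξ
  rw [h2] at h
  conv_lhs => rw [ν, h]
  exact e₁.apply_symm_apply _

theorem rho_rot (i : D.I) : R.rho (D.rot i) = D.ν ^ R.e * R.rho i := by
  symm
  apply R.eq_rho
  change D.mu _ ∈ i.asIdeal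
  rw [map_sub, map_pow, mu_b, mu_algebraMap, mul_pow, ← map_pow, map_mul, ← mul_sub]
  exact Ideal.mul_mem_left _ _ (R.b_pow_sub_rho_mem i)

/-- Up to a factor, `σ_c` maps `b^e - γ^e / σ(ρ_i)` to `b^(-e) - ρ_i⁻¹`, which lies in the ideal `i`
because `b^e - ρ_i` does. Together with `rho_rot` this turns the quiver and its involution into
arithmetic of the roots. -/
theorem rho_dag [Nontrivial F] (i : D.I) : R.rho (D.dag i) * D.σk (R.rho i) = D.γ ^ R.e := by
  have h0 := R.ne_zero (R.rho_pow i)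
  have h1 : D.σk (R.rho i) ≠ 0 := by simpa using h0
  have : D.γ ^ R.e / D.σk (R.rho i) = R.rho (D.dag i) := by
    apply R.eq_rho
    change D.sigmaC _ ∈ i.asIdeal
    have h2 : D.σk (D.γ ^ R.e / D.σk (R.rho i)) = D.γ ^ R.e * (R.rho i)⁻¹ := by
      rw [map_div₀, map_pow, σk_γ, σk_σk, div_eq_mul_inv]
    rw [map_sub, map_pow, sigmaC_b, sigmaC_algebraMap, h2, mul_pow, map_mul, map_pow, ← mul_sub]
    apply Ideal.mul_mem_left
    have h3 : D.bInv ^ R.e - algebraMap k D.L (R.rho i)⁻¹ =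
        -(D.bInv ^ R.e * algebraMap k D.L (R.rho i)⁻¹) *
          (D.b ^ R.e - algebraMap k D.L (R.rho i)) := by
      have h4 : D.b ^ R.e * D.bInv ^ R.e = 1 := by rw [← mul_pow, D.b_mul_bInv, one_pow]
      have h5 : algebraMap k D.L (R.rho i)⁻¹ * algebraMap k D.L (R.rho i) = 1 := by
        rw [← map_mul, inv_mul_cancel₀ h0, map_one]
      linear_combination (algebraMap k D.L (R.rho i)⁻¹) * h4 - D.bInv ^ R.e * h5
    rw [h3]
    exact Ideal.mul_mem_left _ _ (R.b_pow_sub_rho_mem i)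
  rw [← this, div_mul_cancel₀ _ h1]

theorem dag_eq_self_iff [Nontrivial F] (i : D.I) :
    D.dag i = i ↔ R.rho i * D.σk (R.rho i) = D.γ ^ R.e := by
  have h1 : D.σk (R.rho i) ≠ 0 := by simpa using R.ne_zero (R.rho_pow i)
  rw [← R.rho_eq_iff, ← D.rho_dag R i]
  constructor
  · intro h; rw [h]
  · intro h; exact (mul_right_cancel₀ h1 h).symm

theorem rot_eq_dag_iff [Nontrivial F] (j : D.I) :
    D.rot j = D.dag j ↔ D.ν ^ R.e * (R.rho j * D.σk (R.rho j)) = D.γ ^ R.e := by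
  have h1 : D.σk (R.rho j) ≠ 0 := by simpa using R.ne_zero (R.rho_pow j)
  rw [← R.rho_eq_iff, ← D.rho_dag R j, rho_rot, ← mul_assoc]
  constructor
  · intro h; rw [h]
  · intro h; exact mul_right_cancel₀ h1 h

end PolarizedDatum

end LoopGrading

end

noncomputable section

namespace LoopGrading

/-! ### Norms -/

section Norm

variable {k : Type*} [Field k] {A : Type*} [CommRing A] [Algebra k A]

theorem algHom_pow_succ_apply (Z : A →ₐ[k] A) (j : ℕ) (x : A) :
    (Z ^ (j + 1)) x = Z ((Z ^ j) x) := by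
  rw [pow_succ']
  rfl

theorem algHom_pow_fixed {Z : A →ₐ[k] A} {x : A} (h : Z x = x) (j : ℕ) : (Z ^ j) x = x := by
  induction j with
  | zero => rfl
  | succ j ih => rw [algHom_pow_succ_apply, ih, h]

theorem algHom_pow_eigen {Z : A →ₐ[k] A} {x : A} {χ : k} (h : Z x = algebraMap k A χ * x) (j : ℕ) :
    (Z ^ j) x = algebraMap k A (χ ^ j) * x := by
  induction j with
  | zero => simp
  | succ j ih =>
    rw [algHom_pow_succ_apply, ih, map_mul, AlgHom.commutes, h, ← mul_assoc, ← map_mul, pow_succ]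

/-- The norm `x ↦ ∏ Z^j(x)`. -/
def cyclicNorm (Z : A →ₐ[k] A) (n : ℕ) : A →* A where
  toFun x := ∏ j ∈ Finset.range n, (Z ^ j) x
  map_one' := by simp
  map_mul' x y := by simp [Finset.prod_mul_distrib]

theorem cyclicNorm_apply (Z : A →ₐ[k] A) (n : ℕ) (x : A) :
    cyclicNorm Z n x = ∏ j ∈ Finset.range n, (Z ^ j) x := rfl

theorem cyclicNorm_of_fixed {Z : A →ₐ[k] A} {x : A} (h : Z x = x) (n : ℕ) :
    cyclicNorm Z n x = x ^ n := by
  rw [cyclicNorm_apply, Finset.prod_congr rfl fun j _ => algHom_pow_fixed h j]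
  simp

theorem cyclicNorm_mul (Z : A →ₐ[k] A) (d n : ℕ) (x : A) :
    cyclicNorm Z (d * n) x = cyclicNorm Z d (cyclicNorm (Z ^ d) n x) := by
  induction n with
  | zero => simp [cyclicNorm_apply]
  | succ n ih =>
    rw [mul_add, mul_one, cyclicNorm_apply, Finset.prod_range_add, ← cyclicNorm_apply, ih,
      cyclicNorm_apply (Z ^ d) (n + 1), Finset.prod_range_succ, map_mul, ← cyclicNorm_apply,
      cyclicNorm_apply Z d (((Z ^ d) ^ n) x)]
    congr 1
    refine Finset.prod_congr rfl fun i _ => ?_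
    rw [add_comm, pow_add, pow_mul]
    rfl

theorem prod_one_add_orthogonal {ι : Type*} [DecidableEq ι] (s : Finset ι) (e : ι → A) (c : A)
    (h : ∀ i ∈ s, ∀ j ∈ s, i ≠ j → e i * e j = 0) :
    ∏ i ∈ s, (1 + e i * c) = 1 + (∑ i ∈ s, e i) * c := by
  induction s using Finset.induction_on with
  | empty => simp
  | insert a s ha ih =>
    rw [Finset.prod_insert ha, Finset.sum_insert ha, ih fun i hi j hj =>
      h i (Finset.mem_insert_of_mem hi) j (Finset.mem_insert_of_mem hj)]
    have h0 : e a * ∑ i ∈ s, e i = 0 := by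
      rw [Finset.mul_sum]
      refine Finset.sum_eq_zero fun i hi => h a (Finset.mem_insert_self _ _) i
        (Finset.mem_insert_of_mem hi) ?_
      rintro rfl
      exact ha hi
    linear_combination c ^ 2 * h0

/-- On the factor `eA` the element `1 + e (x - 1)` is `x`, and on the complement it is `1`. Its norm
for `Z^d` is therefore `s` on `eA` and `1` elsewhere, and the product over the `d` conjugates
spreads the value `s` over all of `A`. -/
theorem cyclicNorm_idempotent {Z : A →ₐ[k] A} {e : A} {d n : ℕ} (he : (Z ^ d) e = e)
    (hee : e * e = e) (horth : ∀ i < d, ∀ j < d, i ≠ j → (Z ^ i) e * (Z ^ j) e = 0)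
    (hsum : ∑ i ∈ Finset.range d, (Z ^ i) e = 1) {x s : A} (hs : Z s = s)
    (hx : e * cyclicNorm (Z ^ d) n x = e * s) :
    cyclicNorm Z (d * n) (1 + e * (x - 1)) = s := by
  have h1 : cyclicNorm (Z ^ d) n (1 + e * (x - 1)) = 1 + e * (s - 1) := by
    have h2 : ∀ n, cyclicNorm (Z ^ d) n (1 + e * (x - 1)) =
        1 + e * (cyclicNorm (Z ^ d) n x - 1) := by
      intro n
      induction n with
      | zero => simp [cyclicNorm_apply]
      | succ n ih =>
        rw [cyclicNorm_apply, Finset.prod_range_succ, ← cyclicNorm_apply, ih,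
          cyclicNorm_apply _ (n + 1), Finset.prod_range_succ, ← cyclicNorm_apply, map_add, map_mul,
          map_sub, map_one, algHom_pow_fixed he]
        linear_combination ((cyclicNorm (Z ^ d) n x - 1) * (((Z ^ d) ^ n) x - 1)) * hee
    rw [h2]
    linear_combination hx
  rw [cyclicNorm_mul, h1, cyclicNorm_apply]
  have h3 : ∀ i, (Z ^ i) (1 + e * (s - 1)) = 1 + (Z ^ i) e * (s - 1) := fun i => by
    rw [map_add, map_mul, map_sub, map_one, algHom_pow_fixed hs]
  simp_rw [h3]
  rw [prod_one_add_orthogonal _ _ _ fun i hi j hj => horth i (Finset.mem_range.mp hi) j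
    (Finset.mem_range.mp hj), hsum]
  ring

theorem isUnit_of_cyclicNorm {Z : A →ₐ[k] A} {n : ℕ} (hn : 0 < n) {x : A}
    (h : IsUnit (cyclicNorm Z n x)) : IsUnit x := by
  refine isUnit_of_dvd_unit ?_ h
  exact Finset.dvd_prod_of_mem (fun j => (Z ^ j) x) (Finset.mem_range.mpr hn)

variable [CharZero k]

/-- If `z^d = 1` and `Z z = χ z` for a primitive `d`-th root of unity `χ`, then there is an
idempotent `e` with `z e = e` and whose conjugates are orthogonal with sum `1`. -/
theorem exists_idempotent {Z : A →ₐ[k] A} {z : A} {d : ℕ} (hd : 0 < d) {χ : k}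
    (hχ : IsPrimitiveRoot χ d) (hz : z ^ d = 1) (hZ : Z z = algebraMap k A χ * z) :
    ∃ e : A, e * z = e ∧ (Z ^ d) e = e ∧ e * e = e ∧
      (∀ i < d, ∀ j < d, i ≠ j → (Z ^ i) e * (Z ^ j) e = 0) ∧
      ∑ i ∈ Finset.range d, (Z ^ i) e = 1 := by
  have hχ0 : χ ≠ 0 := hχ.ne_zero hd.ne'
  have hd0 : (d : k) ≠ 0 := Nat.cast_ne_zero.mpr hd.ne'
  -- The projector to the part of `A` where `z = 1`; its conjugate under `Z^i` projects to `z =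
  -- χ^(-i)`.
  set e : A := algebraMap k A (d : k)⁻¹ * ∑ j ∈ Finset.range d, z ^ j with he
  have hez : e * z = e := by
    have h1 : (∑ j ∈ Finset.range d, z ^ j) * z = ∑ j ∈ Finset.range d, z ^ j := by
      have := geom_sum_mul z d
      rw [hz, sub_self, mul_sub, mul_one, sub_eq_zero] at this
      exact this
    rw [he, mul_assoc, h1]
  have hezj : ∀ j, e * z ^ j = e := by
    intro j
    induction j with
    | zero => simp
    | succ j ih => rw [pow_succ, ← mul_assoc, ih, hez]
  have hZe : ∀ i, (Z ^ i) e =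
      algebraMap k A (d : k)⁻¹ * ∑ j ∈ Finset.range d, algebraMap k A ((χ ^ i) ^ j) * z ^ j := by
    intro i
    rw [he, map_mul, AlgHom.commutes, map_sum]
    congr 1
    refine Finset.sum_congr rfl fun j _ => ?_
    rw [map_pow, algHom_pow_eigen hZ, mul_pow, ← map_pow]
  have hZd : (Z ^ d) e = e := by
    rw [hZe, hχ.pow_eq_one]
    simp [he]
  have hmul : ∀ i, e * (Z ^ i) e =
      algebraMap k A ((d : k)⁻¹ * ∑ j ∈ Finset.range d, (χ ^ i) ^ j) * e := by
    intro i
    rw [hZe, mul_left_comm, Finset.mul_sum, map_mul, map_sum, mul_assoc, Finset.sum_mul]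
    congr 1
    refine Finset.sum_congr rfl fun j _ => ?_
    rw [mul_left_comm, hezj]
  have horth : ∀ i, 0 < i → i < d → e * (Z ^ i) e = 0 := by
    intro i hi hid
    rw [hmul, sum_root_pow (by rw [← pow_mul, mul_comm, pow_mul, hχ.pow_eq_one, one_pow])
      (hχ.pow_ne_one_of_pos_of_lt hi.ne' hid), mul_zero, map_zero, zero_mul]
  have horth' : ∀ i j, i < j → j < d → (Z ^ i) e * (Z ^ j) e = 0 := by
    intro i j hij hj
    obtain ⟨l, rfl⟩ := Nat.exists_eq_add_of_lt hij
    have h1 : (Z ^ (i + l + 1)) e = (Z ^ i) ((Z ^ (l + 1)) e) := by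
      rw [add_assoc, pow_add]; rfl
    rw [h1, ← map_mul, horth _ (Nat.succ_pos _) (by omega), map_zero]
  refine ⟨e, hez, hZd, ?_, fun i hi j hj hij => ?_, ?_⟩
  · have := hmul 0
    simpa [hd0] using this
  · rcases lt_or_gt_of_ne hij with h | h
    · exact horth' _ _ h hj
    · rw [mul_comm]; exact horth' _ _ h hi
  · simp_rw [hZe]
    rw [← Finset.mul_sum, Finset.sum_comm, Finset.sum_eq_single_of_mem 0 (Finset.mem_range.mpr hd)]
    · simp only [pow_zero, map_one, mul_one, Finset.sum_const, Finset.card_range, nsmul_eq_mul]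
      rw [← map_natCast (algebraMap k A), ← map_mul, inv_mul_cancel₀ hd0, map_one]
    · intro j hj hj0
      rw [← Finset.sum_mul, ← map_sum]
      have : ∀ i, (χ ^ i) ^ j = (χ ^ j) ^ i := fun i => by rw [← pow_mul, mul_comm, pow_mul]
      simp_rw [this]
      rw [sum_root_pow (by rw [← pow_mul, mul_comm, pow_mul, hχ.pow_eq_one, one_pow])
        (hχ.pow_ne_one_of_pos_of_lt hj0 (Finset.mem_range.mp hj)), map_zero, zero_mul]

/-- It is enough that `t` is a norm, as `u^n` is the norm of `u`. Let `d = gcd(n, w)` and `y' = y /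
u'`. Then `y'^(n/d) t^(-w/d)` is a `d`-th root of unity, whose idempotent splits `A` into `d`
factors permuted by `Z`. By `cyclicNorm_idempotent` norms may be computed for `Z^d` on one factor.
There `t` has norm `t^(n/d)` and a multiple of `y'` has norm `t^(w/d)`, and the two exponents are
coprime. -/
theorem exists_cyclicNorm_eq [Algebra ℂ k] {Z : A →ₐ[k] A} {n : ℕ} (hn : 0 < n) {ω : k}
    (hω : IsPrimitiveRoot ω n) {y t u u' : Aˣ} {v w : ℕ}
    (hy : Z y = algebraMap k A ω * y) (ht : Z t = t) (hu : Z u = u) (hu' : Z u' = u')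
    (hyn : y ^ n = t ^ w * u' ^ n) : ∃ a : Aˣ, cyclicNorm Z n a = (t ^ v * u ^ n : Aˣ) := by
  have hinv : ∀ x : Aˣ, Z x = x → Z (x⁻¹ : Aˣ) = (x⁻¹ : Aˣ) := by
    intro x hx
    have h1 : Z x * Z (x⁻¹ : Aˣ) = 1 := by rw [← map_mul, Units.mul_inv, map_one]
    rw [hx] at h1
    calc Z (x⁻¹ : Aˣ) = (x⁻¹ : Aˣ) * (x * Z (x⁻¹ : Aˣ)) := by rw [← mul_assoc]; simp
      _ = _ := by rw [h1, mul_one]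
  let N := (Units.map (cyclicNorm Z n)).range
  suffices h : t ∈ N by
    have hun : u ^ n ∈ N := ⟨u, Units.ext (by
      rw [Units.coe_map, cyclicNorm_of_fixed hu, Units.val_pow_eq_pow_val])⟩
    obtain ⟨a, ha⟩ := N.mul_mem (N.pow_mem h v) hun
    exact ⟨a, congrArg Units.val ha⟩
  obtain ⟨d, n', w', hd, hcop, rfl, rfl⟩ : ∃ d n' w', 0 < d ∧ Nat.Coprime n' w' ∧ n = d * n' ∧
      w = d * w' :=
    ⟨Nat.gcd n w, n / Nat.gcd n w, w / Nat.gcd n w, Nat.gcd_pos_of_pos_left _ hn,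
      Nat.coprime_div_gcd_div_gcd (Nat.gcd_pos_of_pos_left _ hn),
      (Nat.mul_div_cancel' (Nat.gcd_dvd_left _ _)).symm,
      (Nat.mul_div_cancel' (Nat.gcd_dvd_right _ _)).symm⟩
  have hn' : 0 < n' := Nat.pos_of_mul_pos_left hn
  set y' : Aˣ := y * u'⁻¹ with hy'
  have hyn' : y' ^ (d * n') = t ^ (d * w') := by
    rw [hy', mul_pow, hyn, mul_assoc, ← mul_pow, mul_inv_cancel, one_pow, mul_one]
  have hZy' : Z y' = algebraMap k A ω * y' := by
    rw [hy', Units.val_mul, map_mul, hy, hinv _ hu', mul_assoc]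
  have hinvt := hinv t ht
  set z : Aˣ := y' ^ n' * (t⁻¹) ^ w' with hz
  have hzd : z ^ d = 1 := by
    rw [hz, mul_pow, ← pow_mul, ← pow_mul, mul_comm n', hyn', mul_comm w', ← mul_pow,
      mul_inv_cancel, one_pow]
  have hχ : IsPrimitiveRoot (ω ^ n') d := hω.pow hn (mul_comm d n')
  have hZz : Z z = algebraMap k A (ω ^ n') * z := by
    simp only [hz, Units.val_mul, Units.val_pow_eq_pow_val, map_mul, map_pow, hZy', hinvt, mul_pow]
    ring
  obtain ⟨e, hez, hed, hee, horth, hsum⟩ := exists_idempotent hd hχ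
    (by rw [← Units.val_pow_eq_pow_val, hzd, Units.val_one]) hZz
  have hmem : ∀ (x : A) (s : Aˣ), Z s = s → e * cyclicNorm (Z ^ d) n' x = e * s → s ∈ N := by
    intro x s hs hx
    have h1 := cyclicNorm_idempotent hed hee horth hsum hs hx
    have h2 : IsUnit (1 + e * (x - 1)) := isUnit_of_cyclicNorm hn (by rw [h1]; exact s.isUnit)
    exact ⟨h2.unit, Units.ext h1⟩
  have h1 : t ^ n' ∈ N := hmem t _ (by rw [Units.val_pow_eq_pow_val, map_pow, ht]) (by
    rw [cyclicNorm_of_fixed (algHom_pow_fixed ht d), Units.val_pow_eq_pow_val])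
  have h2 : t ^ w' ∈ N := by
    -- The norm of `y'` for `Z^d` is `c y'^n'`, with `c` a root of unity; scaling `y'` by an `n'`-th
    -- root of `c⁻¹` removes this constant.
    set c : k := ∏ l ∈ Finset.range n', (ω ^ d) ^ l with hc
    have hcn : c ^ (d * n') = 1 := by
      rw [hc, ← Finset.prod_pow]
      refine Finset.prod_eq_one fun l _ => ?_
      rw [← pow_mul, ← pow_mul, show d * (l * (d * n')) = d * n' * (d * l) by ring, pow_mul,
        hω.pow_eq_one, one_pow]
    obtain ⟨c₀, hc₀⟩ := exists_pow_eq_of_pow_eq_one hn (χ := c⁻¹) (by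
      rw [inv_pow, hcn, inv_one]) hn'
    have hc0 : c ≠ 0 := by
      intro h
      rw [h, zero_pow hn.ne'] at hcn
      exact zero_ne_one hcn
    refine hmem (algebraMap k A c₀ * y') _ (by rw [Units.val_pow_eq_pow_val, map_pow, ht]) ?_
    have h3 : cyclicNorm (Z ^ d) n' y' = algebraMap k A c * (y' : A) ^ n' := by
      have h4 : ∀ l, ((Z ^ d) ^ l) y' = algebraMap k A ((ω ^ d) ^ l) * y' :=
        algHom_pow_eigen (algHom_pow_eigen hZy' d)
      rw [cyclicNorm_apply, Finset.prod_congr rfl fun l _ => h4 l, Finset.prod_mul_distrib,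
        ← map_prod]
      simp [hc]
    have h5 : (y' : A) ^ n' = z * t ^ w' := by
      rw [← Units.val_pow_eq_pow_val, ← Units.val_pow_eq_pow_val, ← Units.val_mul, hz, mul_assoc,
        ← mul_pow, inv_mul_cancel, one_pow, mul_one]
    rw [map_mul, cyclicNorm_of_fixed (AlgHom.commutes _ _), h3, ← map_pow, hc₀, ← mul_assoc
      (algebraMap k A _), ← map_mul, inv_mul_cancel₀ hc0, map_one, one_mul, h5, ← mul_assoc, hez,
      Units.val_pow_eq_pow_val]
  have h3 := Nat.gcd_eq_gcd_ab n' w'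
  rw [hcop] at h3
  have h4 : t = (t ^ n') ^ (Nat.gcdA n' w') * (t ^ w') ^ (Nat.gcdB n' w') := by
    rw [← zpow_natCast, ← zpow_natCast, ← zpow_mul, ← zpow_mul, ← zpow_add, ← h3]
    simp
  rw [h4]
  exact N.mul_mem (N.zpow_mem h1 _) (N.zpow_mem h2 _)

end Norm

end LoopGrading

end

noncomputable section

namespace LoopGrading

/-! ### Descent for `A_β`-modules -/

namespace CyclicDatum

variable {k : Type} [Field k] {F : Type u} [CommRing F] [Algebra k F] (E : CyclicDatum k F)

/-- The automorphism `ζ ⊗ 1` of `F ⊗ L_β`. -/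
def ζL : F ⊗[k] E.L →ₐ[k] F ⊗[k] E.L :=
  Algebra.TensorProduct.map (E.ζ : F →ₐ[k] F) (AlgHom.id k E.L)

@[simp]
theorem ζL_tmul (f : F) (l : E.L) : E.ζL (f ⊗ₜ l) = E.ζ f ⊗ₜ l := rfl

/-- A Kummer generator of `F`, and a unit `a` of `F ⊗ L_β` of norm `b`. -/
structure Splitting where
  K : E.KummerGenerator
  a : (F ⊗[k] E.L)ˣ
  norm_a : cyclicNorm E.ζL E.n a = (1 : F) ⊗ₜ[k] E.b

namespace AMod

variable {E} (X : AMod.{u, v} E)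

instance : Module (F ⊗[k] E.L) X := TensorProduct.Algebra.module

theorem tmul_smul (f : F) (l : E.L) (x : X) : (f ⊗ₜ[k] l) • x = f • l • x := rfl

/-- The operators on `X` generated by `F` and `θ`. -/
inductive IsNat : (X → X) → Prop
  | smul (f : F) : IsNat (fun x => f • x)
  | T : IsNat X.T
  | add {N N' : X → X} : IsNat N → IsNat N' → IsNat (fun x => N x + N' x)
  | comp {N N' : X → X} : IsNat N → IsNat N' → IsNat (fun x => N (N' x))

variable {X}

theorem IsNat.id : IsNat X fun x => x := by
  have := IsNat.smul (X := X) (1 : F)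
  simpa using this

theorem IsNat.zero : IsNat X fun _ => 0 := by
  have := IsNat.smul (X := X) (0 : F)
  simpa using this

theorem IsNat.sum {ι : Type*} (s : Finset ι) {N : ι → X → X} (h : ∀ i ∈ s, IsNat X (N i)) :
    IsNat X fun x => ∑ i ∈ s, N i x := by
  classical
  induction s using Finset.induction_on with
  | empty => simpa using IsNat.zero
  | insert i s hi ih =>
    simp only [Finset.sum_insert hi]
    exact (h i (Finset.mem_insert_self _ _)).add
      (ih fun j hj => h j (Finset.mem_insert_of_mem hj))

theorem IsNat.T_iterate (j : ℕ) : IsNat X X.T^[j] := by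
  induction j with
  | zero => exact IsNat.id
  | succ j ih =>
    rw [Function.iterate_succ']
    exact IsNat.T.comp ih

theorem k_smul_def (c : k) (x : X) : c • x = algebraMap k F c • x := rfl

theorem IsNat.L_smul (l : E.L) : IsNat X fun x => l • x := by
  obtain ⟨p, rfl⟩ := AdjoinRoot.mk_surjective l
  change IsNat X fun x => Polynomial.aeval X.bAct p x
  induction p using Polynomial.induction_on' with
  | add p q hp hq =>
    simp only [map_add, LinearMap.add_apply]
    exact hp.add hq
  | monomial j c =>
    simp only [Polynomial.aeval_monomial, Module.End.mul_apply, bAct_pow,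
      Module.algebraMap_end_apply]
    exact (IsNat.smul (algebraMap k F c)).comp (IsNat.T_iterate _)

theorem IsNat.FL_smul (e : F ⊗[k] E.L) : IsNat X fun x => e • x := by
  induction e with
  | zero => simpa using IsNat.zero
  | tmul f l => exact (IsNat.smul f).comp (IsNat.L_smul l)
  | add e e' h h' =>
    simp only [add_smul]
    exact h.add h'

theorem T_L_smul (l : E.L) (x : X) : X.T (l • x) = l • X.T x := (act_comm_T X l x).symm

theorem T_FL_smul (e : F ⊗[k] E.L) (x : X) : X.T (e • x) = E.ζL e • X.T x := by
  induction e with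
  | zero => simp
  | tmul f l => rw [tmul_smul, X.T_smul, T_L_smul, ζL_tmul, tmul_smul]
  | add e e' h h' => rw [add_smul, map_add, h, h', map_add, add_smul]

theorem T_iterate_n (x : X) : X.T^[E.n] x = E.b • x := by
  change X.bAct x = X.act E.b x
  have : X.act E.b = Polynomial.aeval X.bAct (Polynomial.X : k[X]) := rfl
  rw [this, Polynomial.aeval_X]

end AMod

namespace Splitting

variable {E} (A : E.Splitting)

open AMod

variable {X : AMod.{u, v} E}

instance (X : AMod.{u, v} E) : SMulCommClass E.L (F ⊗[k] E.L) X := ⟨fun l e x => by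
  induction e with
  | zero => simp
  | tmul f l' => rw [tmul_smul, tmul_smul, smul_comm l f, smul_comm l l']
  | add e e' h h' => rw [add_smul, add_smul, smul_add, h, h']⟩

instance (X : AMod.{u, v} E) : SMulCommClass (F ⊗[k] E.L) E.L X := SMulCommClass.symm _ _ _

/-- The semilinear operator `a⁻¹ θ`, of order `n`. -/
def Tp (X : AMod.{u, v} E) : X →ₗ[E.L] X where
  toFun x := (A.a⁻¹ : (F ⊗[k] E.L)ˣ).1 • X.T x
  map_add' x y := by rw [map_add, smul_add]
  map_smul' l x := by rw [T_L_smul, smul_comm, RingHom.id_apply]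

theorem T_eq (x : X) : X.T x = A.a.1 • A.Tp X x := by
  change _ = A.a.1 • (A.a⁻¹ : (F ⊗[k] E.L)ˣ).1 • X.T x
  rw [smul_smul, Units.mul_inv, one_smul]

theorem Tp_smul (f : F) (x : X) : A.Tp X (f • x) = E.ζ f • A.Tp X x := by
  change (A.a⁻¹ : (F ⊗[k] E.L)ˣ).1 • X.T (f • x) = E.ζ f • (A.a⁻¹ : (F ⊗[k] E.L)ˣ).1 • X.T x
  have h : ∀ (f : F) (x : X), f • x = (f ⊗ₜ[k] (1 : E.L)) • x := fun f x => by
    rw [tmul_smul, one_smul]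
  rw [X.T_smul, h, h, smul_smul, smul_smul, mul_comm]

theorem Tp_pow_smul (j : ℕ) (f : F) (x : X) :
    (A.Tp X ^ j) (f • x) = (E.ζ ^ j) f • (A.Tp X ^ j) x := by
  induction j with
  | zero => rfl
  | succ j ih =>
    rw [pow_succ', Module.End.mul_apply, Module.End.mul_apply, ih, Tp_smul, ζ_pow_apply_succ]

theorem T_iterate_eq (j : ℕ) (x : X) : X.T^[j] x = cyclicNorm E.ζL j A.a • (A.Tp X ^ j) x := by
  induction j with
  | zero => simp [cyclicNorm_apply]
  | succ j ih =>
    rw [Function.iterate_succ_apply', ih, T_FL_smul, A.T_eq, smul_smul, pow_succ',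
      Module.End.mul_apply]
    congr 1
    rw [cyclicNorm_apply, cyclicNorm_apply, Finset.prod_range_succ', map_prod]
    congr 1
    exact Finset.prod_congr rfl fun i _ => (algHom_pow_succ_apply _ _ _).symm

/-- Both `θ^n` and the norm of `a` act as `b`; this is the purpose of the condition on `a`. -/
theorem Tp_pow_n (x : X) : (A.Tp X ^ E.n) x = x := by
  have h := A.T_iterate_eq E.n x
  rw [A.norm_a, T_iterate_n, tmul_smul, one_smul] at h
  have h2 := congrArg (E.bInv • ·) h
  simp only [smul_smul] at h2
  rw [mul_comm, E.b_mul_bInv, one_smul, one_smul] at h2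
  exact h2.symm

theorem isNat_Tp : IsNat X (A.Tp X) := (IsNat.FL_smul _).comp IsNat.T

/-- The vectors fixed by `a⁻¹ θ`. -/
def Fix (X : AMod.{u, v} E) : Submodule E.L X := LinearMap.eqLocus (A.Tp X) LinearMap.id

theorem mem_Fix {x : X} : x ∈ A.Fix X ↔ A.Tp X x = x := Iff.rfl

theorem Tp_pow_of_mem {x : X} (h : x ∈ A.Fix X) (j : ℕ) : (A.Tp X ^ j) x = x := by
  induction j with
  | zero => rfl
  | succ j ih => rw [pow_succ', Module.End.mul_apply, ih, A.mem_Fix.mp h]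

/-- The sum of the powers of `a⁻¹ θ`. -/
def avg (X : AMod.{u, v} E) : X →ₗ[E.L] X := ∑ j ∈ Finset.range E.n, A.Tp X ^ j

theorem avg_apply (x : X) : A.avg X x = ∑ j ∈ Finset.range E.n, (A.Tp X ^ j) x := by
  simp [avg]

theorem avg_mem (x : X) : A.avg X x ∈ A.Fix X := by
  rw [mem_Fix, avg_apply, map_sum]
  have : ∀ j, A.Tp X ((A.Tp X ^ j) x) = (A.Tp X ^ (j + 1)) x := fun j => by
    rw [pow_succ', Module.End.mul_apply]
  simp_rw [this]
  exact sum_ζ_pow_succ (fun j => (A.Tp X ^ j) x) (by rw [Tp_pow_n]; rfl)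

theorem avg_smul_of_mem {x : X} (h : x ∈ A.Fix X) (f : F) :
    A.avg X (f • x) = tr (E := E) f • x := by
  rw [avg_apply, tr_apply, Finset.sum_smul]
  exact Finset.sum_congr rfl fun j _ => by rw [Tp_pow_smul, A.Tp_pow_of_mem h]

theorem isNat_avg : IsNat X (A.avg X) := by
  have h : (A.avg X : X → X) = fun x => ∑ j ∈ Finset.range E.n, (A.Tp X ^ j) x :=
    funext A.avg_apply
  rw [h]
  refine IsNat.sum _ ?_
  rintro j -
  induction j with
  | zero => exact IsNat.id
  | succ j ih =>
    have : ((A.Tp X ^ (j + 1) : X →ₗ[E.L] X) : X → X) = fun x => A.Tp X ((A.Tp X ^ j) x) :=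
      funext fun x => by rw [pow_succ', Module.End.mul_apply]
    rw [this]
    exact A.isNat_Tp.comp ih

/-- The coordinates of a vector with respect to the basis `y^a` of `F`. -/
def coord (X : AMod.{u, v} E) (a : ℕ) : X →ₗ[E.L] X where
  toFun x := A.avg X ((algebraMap k F (E.n : k)⁻¹ * ((A.K.y⁻¹ : Fˣ) : F) ^ a) • x)
  map_add' x y := by rw [smul_add, map_add]
  map_smul' l x := by rw [smul_comm, map_smul, RingHom.id_apply]

theorem coord_apply (a : ℕ) (x : X) : A.coord X a x =
    A.avg X ((algebraMap k F (E.n : k)⁻¹ * ((A.K.y⁻¹ : Fˣ) : F) ^ a) • x) := rfl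

theorem coord_mem (a : ℕ) (x : X) : A.coord X a x ∈ A.Fix X := A.avg_mem _

theorem isNat_coord (a : ℕ) : IsNat X (A.coord X a) := A.isNat_avg.comp (IsNat.smul _)

variable [CharZero k]

/-- Descent for the semilinear operator `a⁻¹θ` of order `n`: by `sum_y_pow`, a module is spanned by
the `y^a` times fixed vectors. The coordinates are unique by `coord_y_pow_smul`. -/
theorem sum_coord (x : X) : ∑ a ∈ Finset.range E.n, (A.K.y : F) ^ a • A.coord X a x = x := by
  simp_rw [coord_apply, avg_apply, Finset.smul_sum, Tp_pow_smul]
  rw [Finset.sum_comm]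
  have : ∀ j ∈ Finset.range E.n, ∑ a ∈ Finset.range E.n, (A.K.y : F) ^ a •
      (E.ζ ^ j) (algebraMap k F (E.n : k)⁻¹ * ((A.K.y⁻¹ : Fˣ) : F) ^ a) • (A.Tp X ^ j) x =
        if 0 = j then x else 0 := by
    intro j hj
    have h := A.K.sum_y_pow E.n_pos (Finset.mem_range.mp hj)
    have h1 : ∀ a, (E.ζ ^ 0) ((A.K.y : F) ^ a) = (A.K.y : F) ^ a := fun a => rfl
    simp_rw [h1] at h
    simp_rw [smul_smul]
    rw [← Finset.sum_smul]
    simp_rw [map_mul, AlgEquiv.commutes, mul_left_comm _ (algebraMap k F _)]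
    rw [← Finset.mul_sum, h]
    split_ifs with h0
    · subst h0
      rw [mul_comm, KummerGenerator.natCast_mul_inv, one_smul]
      rfl
    · rw [mul_zero, zero_smul]
  rw [Finset.sum_congr rfl this, Finset.sum_ite_eq, if_pos (Finset.mem_range.mpr E.n_pos)]

theorem coord_y_pow_smul {x : X} (h : x ∈ A.Fix X) {a b : ℕ} (ha : a < E.n) (hb : b < E.n) :
    A.coord X a ((A.K.y : F) ^ b • x) = if b = a then x else 0 := by
  rw [coord_apply, smul_smul, A.avg_smul_of_mem h, mul_assoc, ← Algebra.smul_def, map_smul,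
    A.K.tr_y_pow ha hb, Algebra.smul_def]
  split_ifs
  · rw [mul_comm, KummerGenerator.natCast_mul_inv, one_smul]
  · rw [mul_zero, zero_smul]

theorem coord_zero_of_mem {x : X} (h : x ∈ A.Fix X) : A.coord X 0 x = x := by
  have := A.coord_y_pow_smul h E.n_pos E.n_pos
  simpa using this

theorem exists_FL_eq_sum (e : F ⊗[k] E.L) : ∃ l : ℕ → E.L,
    e = ∑ a ∈ Finset.range E.n, ((A.K.y : F) ^ a) ⊗ₜ[k] l a := by
  induction e with
  | zero => exact ⟨0, by simp⟩
  | tmul f l =>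
    obtain ⟨c, hc⟩ := A.K.exists_coeff f
    refine ⟨fun a => c a • l, ?_⟩
    conv_lhs => rw [hc, TensorProduct.sum_tmul]
    exact Finset.sum_congr rfl fun a _ => by rw [TensorProduct.smul_tmul]
  | add e e' h h' =>
    obtain ⟨l, hl⟩ := h
    obtain ⟨l', hl'⟩ := h'
    refine ⟨l + l', ?_⟩
    conv_lhs => rw [hl, hl', ← Finset.sum_add_distrib]
    exact Finset.sum_congr rfl fun a _ => by rw [Pi.add_apply, TensorProduct.tmul_add]

end Splitting

end CyclicDatum

end LoopGrading

end

/-! ### Simple modules and the isotypic decomposition. -/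

noncomputable section

namespace LoopGrading

namespace CyclicDatum

variable {k : Type} [Field k] {F : Type u} [CommRing F] [Algebra k F] {E : CyclicDatum k F}

open AMod

namespace AMod

variable {S : AMod.{u, w} E} {X : AMod.{u, v} E}

theorem AHom_T_iterate (x : AHom S X) (j : ℕ) (u : S) : x.1 (S.T^[j] u) = X.T^[j] (x.1 u) := by
  induction j with
  | zero => rfl
  | succ j ih => rw [Function.iterate_succ_apply', x.2, ih, Function.iterate_succ_apply']

theorem AHom_L_smul (x : AHom S X) (l : E.L) (u : S) : x.1 (l • u) = l • x.1 u := by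
  obtain ⟨p, rfl⟩ := AdjoinRoot.mk_surjective l
  change x.1 (Polynomial.aeval S.bAct p u) = Polynomial.aeval X.bAct p (x.1 u)
  induction p using Polynomial.induction_on' with
  | add p q hp hq => simp only [map_add, LinearMap.add_apply, hp, hq]
  | monomial j c =>
    rw [Polynomial.aeval_monomial, Polynomial.aeval_monomial, Module.End.mul_apply,
      Module.End.mul_apply, bAct_pow, bAct_pow, Module.algebraMap_end_apply,
      Module.algebraMap_end_apply, k_smul_def, map_smul, AHom_T_iterate]
    rfl

theorem AHom_smul_apply (x : AHom S X) (l : E.L) (u : S) : (l • x).1 u = x.1 (l • u) := by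
  rw [AHom_L_smul]
  rfl

theorem AHom_FL_smul (x : AHom S X) (e : F ⊗[k] E.L) (u : S) : x.1 (e • u) = e • x.1 u := by
  induction e with
  | zero => simp
  | tmul f l => rw [tmul_smul, map_smul, AHom_L_smul, tmul_smul]
  | add e e' h h' => rw [add_smul, map_add, h, h', add_smul]

theorem IsSimpleAt.smul_eq_zero_iff {i : E.I} (hS : S.IsSimpleAt i) {l : E.L} {u : S}
    (hu : u ≠ 0) : l • u = 0 ↔ l ∈ i.asIdeal := by
  refine ⟨fun h => ?_, fun h => hS.smul_eq_zero l h u⟩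
  by_contra hl
  obtain ⟨l', hl'⟩ := E.exists_inv_of_not_mem hl
  have h1 := hS.smul_eq_zero _ hl' u
  rw [sub_smul, mul_smul, h, smul_zero, one_smul, zero_sub, neg_eq_zero] at h1
  exact hu h1

theorem IsSimpleAt.smul_eq_smul_iff {i : E.I} (hS : S.IsSimpleAt i) {l l' : E.L} {u : S}
    (hu : u ≠ 0) : l • u = l' • u ↔
      algebraMap E.L (E.Li i) l = algebraMap E.L (E.Li i) l' := by
  rw [← sub_eq_zero, ← sub_smul, hS.smul_eq_zero_iff hu, ← algebraMap_Li_eq_zero, map_sub,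
    sub_eq_zero]

theorem IsSimpleAt.idem_smul {i : E.I} (hS : S.IsSimpleAt i) (u : S) : E.idem i • u = u := by
  have h := hS.smul_eq_zero _ (E.idem_sub_one_mem i) u
  rwa [sub_smul, one_smul, sub_eq_zero] at h

theorem IsSimpleAt.idem_smul_of_ne {i j : E.I} (hS : S.IsSimpleAt j) (hij : j ≠ i) (u : S) :
    E.idem i • u = 0 :=
  hS.smul_eq_zero _ (E.idem_mem hij) u

end AMod

namespace Splitting

variable (A : E.Splitting) {S : AMod.{u, w} E} {X : AMod.{u, v} E} {i : E.I}

theorem map_mem_Fix (x : AHom S X) {s : S} (hs : s ∈ A.Fix S) : x.1 s ∈ A.Fix X := by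
  rw [mem_Fix] at hs ⊢
  conv_rhs => rw [← hs]
  change (A.a⁻¹ : (F ⊗[k] E.L)ˣ).1 • X.T (x.1 s) = x.1 ((A.a⁻¹ : (F ⊗[k] E.L)ˣ).1 • S.T s)
  rw [AHom_FL_smul, x.2]

theorem map_Tp (x : AHom S X) (u : S) : x.1 (A.Tp S u) = A.Tp X (x.1 u) := by
  change x.1 ((A.a⁻¹ : (F ⊗[k] E.L)ˣ).1 • S.T u) = (A.a⁻¹ : (F ⊗[k] E.L)ˣ).1 • X.T (x.1 u)
  rw [AHom_FL_smul, x.2]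

theorem map_coord (x : AHom S X) (a : ℕ) (u : S) : x.1 (A.coord S a u) = A.coord X a (x.1 u) := by
  have h : ∀ (j : ℕ) (u : S), x.1 ((A.Tp S ^ j) u) = (A.Tp X ^ j) (x.1 u) := by
    intro j u
    induction j with
    | zero => rfl
    | succ j ih =>
      rw [pow_succ', pow_succ', Module.End.mul_apply, Module.End.mul_apply, map_Tp, ih]
  rw [coord_apply, coord_apply, avg_apply, avg_apply, map_sum]
  exact Finset.sum_congr rfl fun j _ => by rw [h, map_smul]

/-- The orbit of `s` under `F ⊗ L` is stable under `θ`, because `θ s = a s` for a fixed vector; by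
simplicity it is everything. -/
theorem exists_FL_smul (hS : S.IsSimpleAt i) {s : S} (hs : s ∈ A.Fix S) (hs0 : s ≠ 0) (u : S) :
    ∃ e : F ⊗[k] E.L, e • s = u := by
  let N : Submodule F S :=
    { carrier := {u | ∃ e : F ⊗[k] E.L, e • s = u}
      zero_mem' := ⟨0, zero_smul _ _⟩
      add_mem' := by
        rintro _ _ ⟨e, rfl⟩ ⟨e', rfl⟩
        exact ⟨e + e', add_smul _ _ _⟩
      smul_mem' := by
        rintro f _ ⟨e, rfl⟩
        exact ⟨f ⊗ₜ 1 * e, by rw [mul_smul, tmul_smul, one_smul]⟩ }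
  have hN := hS.eq_bot_or_top N (by
    rintro _ ⟨e, rfl⟩
    exact ⟨E.ζL e * A.a.1, by rw [T_FL_smul, A.T_eq, A.mem_Fix.mp hs, mul_smul]⟩)
  rcases hN with h | h
  · exfalso
    have : s ∈ N := ⟨1, one_smul _ _⟩
    rw [h, Submodule.mem_bot] at this
    exact hs0 this
  · have : u ∈ N := by rw [h]; trivial
    exact this

theorem AHom_ext (hS : S.IsSimpleAt i) {s : S} (hs : s ∈ A.Fix S) (hs0 : s ≠ 0) {x y : AHom S X}
    (h : x.1 s = y.1 s) : x = y := by
  refine Subtype.ext (LinearMap.ext fun u => ?_)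
  obtain ⟨e, rfl⟩ := A.exists_FL_smul hS hs hs0 u
  rw [AHom_FL_smul, AHom_FL_smul, h]

variable [CharZero k]

theorem exists_mem_Fix_ne_zero (A : E.Splitting) (hS : S.IsSimpleAt i) :
    ∃ s ∈ A.Fix S, s ≠ 0 := by
  obtain ⟨u, hu⟩ := @exists_ne _ hS.nontrivial (0 : S)
  by_contra! h
  apply hu
  rw [← A.sum_coord u]
  exact Finset.sum_eq_zero fun a _ => by rw [h _ (A.coord_mem a u), smul_zero]

/-- By uniqueness of coordinates, an element of `F ⊗ L` that kills `s` has all its coefficients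
along the `y^a` in the ideal `i`. -/
theorem FL_smul_eq_zero (hS : S.IsSimpleAt i) {s : S} (hs : s ∈ A.Fix S) (hs0 : s ≠ 0) {x : X}
    (hx : ∀ l ∈ i.asIdeal, l • x = 0) {e : F ⊗[k] E.L} (he : e • s = 0) : e • x = 0 := by
  obtain ⟨l, rfl⟩ := A.exists_FL_eq_sum e
  have hl : ∀ a ∈ Finset.range E.n, l a ∈ i.asIdeal := by
    intro a ha
    rw [← hS.smul_eq_zero_iff hs0]
    have h := congrArg (A.coord S a) he
    rw [Finset.sum_smul, map_sum, map_zero, Finset.sum_eq_single_of_mem a ha] at h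
    · rw [tmul_smul, A.coord_y_pow_smul ((A.Fix S).smul_mem _ hs) (Finset.mem_range.mp ha)
        (Finset.mem_range.mp ha), if_pos rfl] at h
      exact h
    · intro b hb hba
      rw [tmul_smul, A.coord_y_pow_smul ((A.Fix S).smul_mem _ hs) (Finset.mem_range.mp ha)
        (Finset.mem_range.mp hb), if_neg hba]
  rw [Finset.sum_smul]
  exact Finset.sum_eq_zero fun a ha => by rw [tmul_smul, hx _ (hl a ha), smul_zero]

/-- The fixed vectors of a simple module form a line over `L_i`: if `e • s` is fixed, it equals its
coordinate of index `0`, which is an `L`-multiple of `s`. -/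
theorem exists_L_smul (hS : S.IsSimpleAt i) {s : S} (hs : s ∈ A.Fix S) (hs0 : s ≠ 0) {u : S}
    (hu : u ∈ A.Fix S) : ∃ l : E.L, l • s = u := by
  obtain ⟨e, rfl⟩ := A.exists_FL_smul hS hs hs0 u
  obtain ⟨l, hl⟩ := A.exists_FL_eq_sum e
  refine ⟨l 0, ?_⟩
  rw [← A.coord_zero_of_mem hu, hl, Finset.sum_smul, map_sum, Finset.sum_eq_single_of_mem 0
    (Finset.mem_range.mpr E.n_pos)]
  · rw [tmul_smul, A.coord_y_pow_smul ((A.Fix S).smul_mem _ hs) E.n_pos E.n_pos, if_pos rfl]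
  · intro b hb hb0
    rw [tmul_smul, A.coord_y_pow_smul ((A.Fix S).smul_mem _ hs) E.n_pos (Finset.mem_range.mp hb),
      if_neg hb0]

/-- The map `e • s ↦ e • x` is well defined by `FL_smul_eq_zero`. It commutes with `θ` because `θ`
acts on both fixed vectors `s` and `x` as `a`. -/
theorem exists_AHom (hS : S.IsSimpleAt i) {s : S} (hs : s ∈ A.Fix S) (hs0 : s ≠ 0) {x : X}
    (hx : x ∈ A.Fix X) (hx' : ∀ l ∈ i.asIdeal, l • x = 0) : ∃ f : AHom S X, f.1 s = x := by
  choose e he using A.exists_FL_smul hS hs hs0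
  have key : ∀ (e' : F ⊗[k] E.L) (u : S), e' • s = u → e u • x = e' • x := by
    intro e' u h
    rw [← sub_eq_zero, ← sub_smul]
    exact A.FL_smul_eq_zero hS hs hs0 hx' (by rw [sub_smul, he, h, sub_self])
  refine ⟨⟨⟨⟨fun u => e u • x, fun u u' => ?_⟩, fun f u => ?_⟩, fun u => ?_⟩, ?_⟩
  · rw [key (e u + e u') _ (by rw [add_smul, he, he]), add_smul]
  · change e (f • u) • x = f • e u • x
    rw [key (f ⊗ₜ 1 * e u) _ (by rw [mul_smul, tmul_smul, one_smul, he])]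
    rw [mul_smul, tmul_smul, one_smul]
  · change e (S.T u) • x = X.T (e u • x)
    rw [key (E.ζL (e u) * A.a.1) _ ?_, T_FL_smul, A.T_eq, A.mem_Fix.mp hx, mul_smul]
    have h1 : A.a.1 • s = S.T s := by rw [A.T_eq, A.mem_Fix.mp hs]
    rw [mul_smul, h1, ← T_FL_smul, he]
  · change e s • x = x
    rw [key 1 _ (one_smul _ _), one_smul]

/-- Schur's lemma in split form: an endomorphism sends `s` to a fixed vector, hence to some `l • s`,
and the image of `s` determines it. The equality `D_i = L_i` comes from here. -/
theorem exists_AEnd_eq_smul (A : E.Splitting) (hS : S.IsSimpleAt i) (φ : AEnd S) :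
    ∃ l : E.L, ∀ u, φ.1 u = l • u := by
  obtain ⟨s, hs, hs0⟩ := A.exists_mem_Fix_ne_zero hS
  let φ' : AHom S S := ⟨φ.1, φ.2⟩
  obtain ⟨l, hl⟩ := A.exists_L_smul hS hs hs0 (A.map_mem_Fix φ' hs)
  refine ⟨l, fun u => ?_⟩
  obtain ⟨e, rfl⟩ := A.exists_FL_smul hS hs hs0 u
  change φ'.1 (e • s) = _
  rw [AHom_FL_smul, ← hl, smul_comm]

end Splitting

/-- Coordinates on an `A_β`-module `X`, exhibiting it as `⨁ S_i ⊗ Hom(S_i, X)`. -/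
structure Frame (S : E.I → AMod.{u, w} E) (X : AMod.{u, v} E) where
  u : ∀ i, Fin E.n → S i
  q : ∀ i, Fin E.n → X →ₗ[E.L] AHom (S i) X
  lam : ∀ i, Fin E.n → S i → E.L
  expand : ∀ x, ∑ i, ∑ a, (q i a x).1 (u i a) = x
  expand_simple : ∀ i w, ∑ a, lam i a w • u i a = w
  q_of_ne : ∀ i j, j ≠ i → ∀ a (x : AHom (S j) X) w, q i a (x.1 w) = 0
  q_self : ∀ i a (x : AHom (S i) X) w, q i a (x.1 w) = lam i a w • x
  q_u : ∀ i a (x : AHom (S i) X), q i a (x.1 (u i a)) = x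
  isNat : ∀ i a w, X.IsNat fun x => (q i a x).1 w

/-- With `s_i` a non-zero fixed vector of `S_i`, the frame vectors are `y^a s_i`, and `q` sends `x`
to the homomorphism mapping `s_i` to the `a`-th coordinate of the `i`-th component of `x`. The
operators `x ↦ (q x)(w)` are generated by `F` and `θ`; this is recorded in `isNat` so that they
commute with the points of `H` over every `R`. -/
theorem Splitting.exists_frame [CharZero k] (A : E.Splitting) {S : E.I → AMod.{u, w} E}
    (hS : ∀ i, (S i).IsSimpleAt i) (X : AMod.{u, v} E) : Nonempty (Frame S X) := by
  choose s hs hs0 using fun i => A.exists_mem_Fix_ne_zero (hS i)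
  have hidem : ∀ i (x : X), ∀ l ∈ i.asIdeal, l • E.idem i • x = 0 := fun i x l hl => by
    rw [smul_smul, E.mul_idem_eq_zero hl, zero_smul]
  choose f hf using fun (i : E.I) (a : Fin E.n) (x : X) => A.exists_AHom (hS i) (hs i) (hs0 i)
    ((A.Fix X).smul_mem (E.idem i) (A.coord_mem a x)) (hidem i _)
  choose lam hlam using fun i (a : Fin E.n) (w : S i) => A.exists_L_smul (hS i) (hs i) (hs0 i)
    (A.coord_mem a w)
  have hself : ∀ i a (x : AHom (S i) X) w, f i a (x.1 w) = lam i a w • x := by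
    intro i a x w
    apply A.AHom_ext (hS i) (hs i) (hs0 i)
    rw [hf, AHom_smul_apply, hlam, map_coord, ← map_coord, ← AHom_L_smul, (hS i).idem_smul]
  refine ⟨{
    u := fun i a => (A.K.y : F) ^ (a : ℕ) • s i
    q := fun i a =>
      { toFun := f i a
        map_add' := fun x y => by
          apply A.AHom_ext (hS i) (hs i) (hs0 i)
          rw [hf, map_add, smul_add, ← hf, ← hf]
          rfl
        map_smul' := fun l x => by
          apply A.AHom_ext (hS i) (hs i) (hs0 i)
          rw [hf, map_smul, smul_comm, ← hf]
          rfl }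
    lam := lam
    expand := fun x => ?_
    expand_simple := fun i w => ?_
    q_of_ne := fun i j hij a x w => ?_
    q_self := hself
    q_u := fun i a x => ?_
    isNat := fun i a w => ?_ }⟩
  · change ∑ i, ∑ a : Fin E.n, (f i a x).1 ((A.K.y : F) ^ (a : ℕ) • s i) = x
    have h : ∀ i, ∑ a : Fin E.n, (f i a x).1 ((A.K.y : F) ^ (a : ℕ) • s i) = E.idem i • x := by
      intro i
      conv_rhs => rw [← A.sum_coord x, Finset.smul_sum, Finset.sum_range]
      refine Finset.sum_congr rfl fun a _ => ?_
      rw [map_smul, hf, smul_comm]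
    simp_rw [h]
    rw [← Finset.sum_smul, E.sum_idem, one_smul]
  · conv_rhs => rw [← A.sum_coord w, Finset.sum_range]
    refine Finset.sum_congr rfl fun a _ => ?_
    rw [← hlam, smul_comm]
  · apply A.AHom_ext (hS i) (hs i) (hs0 i)
    change (f i a (x.1 w)).1 (s i) = 0
    rw [hf, ← map_coord, ← AHom_L_smul, (hS j).idem_smul_of_ne hij, map_zero]
  · change f i a _ = x
    rw [hself]
    apply A.AHom_ext (hS i) (hs i) (hs0 i)
    rw [AHom_smul_apply, hlam, A.coord_y_pow_smul (hs i) a.2 a.2, if_pos rfl]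
  · obtain ⟨e, rfl⟩ := A.exists_FL_smul (hS i) (hs i) (hs0 i) w
    have : (fun x => (f i a x).1 (e • s i)) = fun x => e • E.idem i • A.coord X a x := by
      funext x
      rw [AHom_FL_smul, hf]
    change X.IsNat fun x => (f i a x).1 (e • s i)
    rw [this]
    exact (IsNat.FL_smul e).comp ((IsNat.L_smul _).comp (A.isNat_coord a))

end CyclicDatum

end LoopGrading

end

noncomputable section

namespace LoopGrading

/-! ### Pairings -/

theorem CyclicDatum.L_induction {k : Type} [Field k] {F : Type u} [CommRing F] [Algebra k F]
    {E : CyclicDatum k F} {p : E.L → Prop} (halg : ∀ a, p (algebraMap k E.L a)) (hb : p E.b)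
    (hadd : ∀ l l', p l → p l' → p (l + l')) (hmul : ∀ l l', p l → p l' → p (l * l'))
    (l : E.L) : p l := by
  have hpow : ∀ j, p (E.b ^ j) := by
    intro j
    induction j with
    | zero => simpa using halg 1
    | succ j ih => rw [pow_succ]; exact hmul _ _ ih hb
  obtain ⟨q, rfl⟩ := E.mkL_surjective l
  induction q using Polynomial.induction_on' with
  | add q q' h h' => rw [map_add]; exact hadd _ _ h h'
  | monomial j a =>
    rw [← Polynomial.C_mul_X_pow_eq_monomial, map_mul, map_pow]
    exact hmul _ _ (halg a) (hpow j)

theorem CyclicDatum.AMod.T_surjective {k : Type} [Field k] {F : Type u} [CommRing F] [Algebra k F]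
    {E : CyclicDatum k F} (X : CyclicDatum.AMod.{u, v} E) : Function.Surjective X.T := by
  intro x
  have hm : 0 < E.m := by
    rw [← E.n_mul_r]
    exact Nat.mul_pos E.n_pos E.r_pos
  refine ⟨X.T^[E.m - 1] (algebraMap k F E.β⁻¹ • x), ?_⟩
  rw [← Function.iterate_succ_apply' X.T, Nat.succ_eq_add_one, Nat.sub_add_cancel hm, X.T_iterate,
    smul_smul, ← map_mul, mul_inv_cancel₀ E.β_ne_zero, map_one, one_smul]

namespace PolarizedDatum

open CyclicDatum CyclicDatum.AMod

variable {k : Type} [Field k] {F : Type u} [CommRing F] [Algebra k F]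
  (D : PolarizedDatum.{u, v} k F)

section Adjoint

universe v' w'

variable {X : AMod.{u, v'} D.toCyclicDatum} {Y : AMod.{u, w'} D.toCyclicDatum}
  (p : X →ₗ[F] Y →ₛₗ[D.σ] F) (hp : ∀ x y, p (X.T x) (Y.T y) = D.c * D.ζ (p x y))

include hp in
theorem adm_iterate (j : ℕ) (x : X) (y : Y) : p (X.T^[j] x) (Y.T^[j] y) =
    (∏ i ∈ Finset.range j, (D.ζ ^ i) (D.c : F)) * (D.ζ ^ j) (p x y) := by
  induction j with
  | zero => simp
  | succ j ih =>
    rw [Function.iterate_succ_apply', Function.iterate_succ_apply', hp, ih, map_mul, map_prod,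
      Finset.prod_range_succ', ← ζ_pow_apply_succ]
    simp_rw [← ζ_pow_apply_succ]
    rw [pow_zero]
    change _ = _ * (D.c : F) * _
    ring

theorem sigma_k_smul (a : k) (x : X) (y : Y) : p x (a • y) = algebraMap k F (D.σk a) * p x y := by
  rw [k_smul_def, LinearMap.map_smulₛₗ, D.σ_algebraMap, smul_eq_mul]

variable [Nontrivial F] [CharZero k] (K : D.toCyclicDatum.KummerGenerator)

include K hp in
-- Only `b` needs an argument. Iterating admissibility `n` times gives `p(b x, b y) = Nm(c) p(x,
-- y)`, because `ζ^n = 1` and the norm is the product of the conjugates. Replacing `y` by `b⁻¹ y`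
-- shows that the adjoint of `b` is `γ b⁻¹`.
theorem adm_adjoint (l : D.L) (x : X) (y : Y) : p (l • x) y = p x (D.sigmaC l • y) := by
  revert x y
  induction l using CyclicDatum.L_induction with
  | halg a =>
    intro x y
    rw [sigmaC_algebraMap, algebraMap_smul, algebraMap_smul, sigma_k_smul, σk_σk, k_smul_def,
      map_smul]
    rfl
  | hb =>
    intro x y
    have h := D.adm_iterate p hp D.n x (D.bInv • y)
    rw [T_iterate_n, T_iterate_n, smul_smul, D.b_mul_bInv, one_smul, ← K.norm_eq_prod, D.ζ_pow_n]
      at h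
    rw [h, sigmaC_b, mul_smul, algebraMap_smul, sigma_k_smul, σk_γ]
    rfl
  | hadd l l' h h' =>
    intro x y
    rw [add_smul, map_add, LinearMap.add_apply, h, h', map_add, add_smul, map_add]
  | hmul l l' h h' =>
    intro x y
    rw [mul_smul, h, h', smul_smul, map_mul, mul_comm]

end Adjoint

end PolarizedDatum

end LoopGrading

end

/-! ### Perfect pairings of simple modules and the induced pairings of multiplicity spaces. -/

noncomputable section

namespace LoopGrading

/-- A left non-degenerate pairing of a finite-dimensional vector space with an additive group
whose image in the dual is stable under scalars admits dual bases. -/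
theorem exists_dual_bases {K M N : Type*} [Field K] [AddCommGroup M] [Module K M]
    [Module.Finite K M] [AddCommGroup N] (p : N →+ Module.Dual K M)
    (hs : ∀ (c : K) (y : N), ∃ y', p y' = c • p y) (hnd : ∀ x, (∀ y, p y x = 0) → x = 0) :
    ∃ (n : ℕ) (xs : Fin n → M) (ys : Fin n → N), (∀ a b, p (ys b) (xs a) = if a = b then 1 else 0) ∧
      ∀ x, x = ∑ a, p (ys a) x • xs a := by
  let W : Submodule K (Module.Dual K M) :=
    { carrier := Set.range p
      zero_mem' := ⟨0, map_zero p⟩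
      add_mem' := by
        rintro _ _ ⟨y, rfl⟩ ⟨y', rfl⟩
        exact ⟨y + y', map_add p y y'⟩
      smul_mem' := by
        rintro c _ ⟨y, rfl⟩
        exact hs c y }
  -- The image of `p` is a subspace of the dual with zero annihilator in `M`, hence the whole dual;
  -- so the coordinate functions of a basis lie in it.
  have hW : W = ⊤ := by
    have h1 : W.dualCoannihilator = ⊥ := by
      rw [eq_bot_iff]
      intro x hx
      rw [Submodule.mem_dualCoannihilator] at hx
      exact hnd x fun y => hx _ ⟨y, rfl⟩
    have h2 : W.dualCoannihilator.dualAnnihilator = W :=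
      Subspace.dualCoannihilator_dualAnnihilator_eq
    rw [← h2, h1, Submodule.dualAnnihilator_bot]
  have hsurj : ∀ f : Module.Dual K M, ∃ y, p y = f := fun f => by
    have : f ∈ W := by rw [hW]; trivial
    exact this
  let e := Module.finBasis K M
  choose ys hys using fun a => hsurj (e.coord a)
  refine ⟨_, e, ys, fun a b => ?_, fun x => ?_⟩
  · rw [hys, Module.Basis.coord_apply, e.repr_self, Finsupp.single_apply]
  · simp_rw [hys, Module.Basis.coord_apply]
    exact (e.sum_repr x).symm

namespace PolarizedDatum

open CyclicDatum CyclicDatum.AMod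

variable {k : Type} [Field k] {F : Type u} [CommRing F] [Algebra k F]
  (D : PolarizedDatum.{u, v} k F)

theorem smul_Li (i : D.I) (l : D.L) (z : D.Li i) : l • z = algebraMap D.L (D.Li i) l * z :=
  Algebra.smul_def l z

theorem smul_algebraMap_Li (i : D.I) (l l' : D.L) :
    l • algebraMap D.L (D.Li i) l' = algebraMap D.L (D.Li i) (l * l') := by
  rw [smul_Li, map_mul]

theorem k₀_smul_def {M : Type*} [AddCommGroup M] [Module k M] (a : D.k₀) (x : M) :
    a • x = (a : k) • x := rfl

theorem k₀_smul_L {X : AMod.{u, w} D.toCyclicDatum} (a : D.k₀) (x : X) :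
    a • x = algebraMap k D.L (a : k) • x := by
  rw [k₀_smul_def, algebraMap_smul]

theorem k₀_smul_algebraMap_Li (i : D.I) (a : D.k₀) (l : D.L) :
    a • algebraMap D.L (D.Li i) l = algebraMap D.L (D.Li i) (algebraMap k D.L (a : k) * l) := by
  rw [k₀_smul_def, ← algebraMap_smul D.L (a : k) (algebraMap D.L (D.Li i) l), smul_algebraMap_Li]

/-- `B` is a perfect admissible pairing of simple modules at `i` and `i†`. -/
structure GoodPairing {S S' : AMod.{u, w} D.toCyclicDatum} (i : D.I)
    (B : S →ₗ[F] S' →ₛₗ[D.σ] F) : Prop where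
  simple : S.IsSimpleAt i
  simple' : S'.IsSimpleAt (D.dag i)
  adm : D.IsAdmissible B
  perfect : D.IsPerfect B

variable [Nontrivial F] [CharZero k]

theorem sigmaC_mem_dag {i : D.I} {l : D.L} : D.sigmaC l ∈ (D.dag i).asIdeal ↔ l ∈ i.asIdeal := by
  change D.sigmaC (D.sigmaC l) ∈ i.asIdeal ↔ _
  rw [sigmaC_sigmaC]

theorem sigmaC_mem {i : D.I} {l : D.L} : D.sigmaC l ∈ i.asIdeal ↔ l ∈ (D.dag i).asIdeal := Iff.rfl

theorem form_adjoint (K : D.toCyclicDatum.KummerGenerator) (l : D.L) (x y : D.V) :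
    D.form (l • x) y = D.form x (D.sigmaC l • y) :=
  D.adm_adjoint D.form D.form_T K l x y

/-- The idempotent of `L` at `i` acts as the identity on `S`, while its adjoint under `σ_c` kills
`S'` as soon as `j ≠ i†`. -/
theorem form_eq_zero (K : D.toCyclicDatum.KummerGenerator) {S S' : AMod.{u, w} D.toCyclicDatum}
    {i j : D.I} (hS : S.IsSimpleAt i) (hS' : S'.IsSimpleAt j) (hij : D.dag i ≠ j)
    (x : D.Mult S) (y : D.Mult S') (s : S) (t : S') : D.form (x.1 s) (y.1 t) = 0 := by
  rw [← hS.idem_smul s, AHom_L_smul, D.form_adjoint K, ← AHom_L_smul, hS'.smul_eq_zero, map_zero,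
    map_zero]
  rw [sigmaC_mem]
  apply D.idem_mem
  intro h
  exact hij (by rw [← h, dag_dag])

variable (A : D.toCyclicDatum.Splitting)

namespace GoodPairing

variable {D} {S S' : AMod.{u, w} D.toCyclicDatum} {i : D.I} {B : S →ₗ[F] S' →ₛₗ[D.σ] F}
  (G : D.GoodPairing i B)

include G

theorem adjoint (K : D.toCyclicDatum.KummerGenerator) (l : D.L) (s : S) (t : S') :
    B (l • s) t = B s (D.sigmaC l • t) :=
  D.adm_adjoint B G.adm K l s t

/-- The left kernel is stable under `θ`, so simplicity applies; were it all of `S`, perfectness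
would make `S'` zero. -/
theorem eq_zero_of_left (s : S) (h : ∀ t, B s t = 0) : s = 0 := by
  let N : Submodule F S := LinearMap.ker B
  have hN := G.simple.eq_bot_or_top N (by
    intro x hx
    rw [LinearMap.mem_ker] at hx ⊢
    ext t
    obtain ⟨t, rfl⟩ := T_surjective S' t
    rw [G.adm, hx]
    simp)
  rcases hN with hN | hN
  · have : s ∈ N := by
      rw [LinearMap.mem_ker]
      ext t
      exact h t
    rwa [hN, Submodule.mem_bot] at this
  · exfalso
    obtain ⟨t, ht⟩ := @exists_ne _ G.simple'.nontrivial (0 : S')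
    apply ht
    apply G.perfect.1
    ext s
    have : s ∈ N := by rw [hN]; trivial
    rw [LinearMap.mem_ker] at this
    simp [this]

theorem algebraMap_eq_iff (l l' : D.L) :
    (∀ s t, B (l • s) t = B (l' • s) t) ↔
      algebraMap D.L (D.Li i) l = algebraMap D.L (D.Li i) l' := by
  obtain ⟨s, hs⟩ := @exists_ne _ G.simple.nontrivial (0 : S)
  rw [← G.simple.smul_eq_smul_iff hs]
  constructor
  · intro h
    rw [← sub_eq_zero]
    refine G.eq_zero_of_left _ fun t => ?_
    rw [map_sub, LinearMap.sub_apply, h, sub_self]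
  · intro h s' t
    rw [G.simple.smul_eq_smul_iff hs] at h
    rw [← sub_eq_zero, ← LinearMap.sub_apply, ← map_sub, ← sub_smul,
      G.simple.smul_eq_zero _ ?_ s', map_zero, LinearMap.zero_apply]
    rw [← algebraMap_Li_eq_zero, map_sub, h, sub_self]

include A

/-- By perfectness `p(s, t) = B(s, f t)` for a unique `f`, which commutes with `F` and `θ` because
both pairings are admissible. So `f` is multiplication by an element of `L`, and its adjoint moves
it to the left. -/
theorem exists_of_adm {p : S →ₗ[F] S' →ₛₗ[D.σ] F} (hp : D.IsAdmissible p) :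
    ∃ l : D.L, ∀ s t, p s t = B (l • s) t := by
  have hB : Function.Bijective fun t : S' => B.flip t := G.perfect
  choose f hf using fun t => hB.2 (p.flip t)
  have hf' : ∀ s t, B s (f t) = p s t := fun s t => LinearMap.congr_fun (hf t) s
  have hinj : ∀ t t', (∀ s, B s t = B s t') → t = t' := fun t t' h =>
    hB.1 (LinearMap.ext h)
  let φ : AEnd S' :=
    ⟨{ toFun := f
       map_add' := fun t t' => hinj _ _ fun s => by rw [hf', map_add, map_add, hf', hf']
       map_smul' := fun a t => hinj _ _ fun s => by
        rw [hf', LinearMap.map_smulₛₗ, RingHom.id_apply, LinearMap.map_smulₛₗ, hf'] },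
      fun t => hinj _ _ fun s => by
        obtain ⟨s, rfl⟩ := T_surjective S s
        change B (S.T s) (f (S'.T t)) = B (S.T s) (S'.T (f t))
        rw [hf', hp, G.adm, hf']⟩
  obtain ⟨l, hl⟩ := A.exists_AEnd_eq_smul G.simple' φ
  refine ⟨D.sigmaC l, fun s t => ?_⟩
  rw [G.adjoint A.K, sigmaC_sigmaC, ← hl, ← hf']
  rfl

theorem exists_L (x : D.Mult S) (y : D.Mult S') :
    ∃ l : D.L, ∀ s t, D.form (x.1 s) (y.1 t) = B (l • s) t := by
  let p : S →ₗ[F] S' →ₛₗ[D.σ] F := (D.form.comp x.1).compl₂ y.1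
  refine G.exists_of_adm A (p := p) fun s t => ?_
  change D.form (x.1 (S.T s)) (y.1 (S'.T t)) = _
  rw [x.2, y.2, D.form_T]
  rfl

/-- The element given by `exists_L` is unique only modulo the ideal `i`; its image in `L_i` is well
defined, and uniqueness yields bilinearity. As `pairing` is a choice, existence must come before all
its properties. -/
theorem isInduced_pairing : D.IsInduced i B (D.pairing i B) := by
  choose f hf using G.exists_L A
  have key : ∀ (x : D.Mult S) (y : D.Mult S') (l : D.L),
      (∀ s t, D.form (x.1 s) (y.1 t) = B (l • s) t) →
        algebraMap D.L (D.Li i) (f x y) = algebraMap D.L (D.Li i) l := by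
    intro x y l h
    rw [← G.algebraMap_eq_iff]
    intro s t
    rw [← hf, h]
  refine Classical.epsilon_spec (p := D.IsInduced i B) ⟨LinearMap.mk₂ D.k₀
    (fun x y => algebraMap D.L (D.Li i) (f x y)) ?_ ?_ ?_ ?_, ?_⟩
  · intro x x' y
    rw [← map_add]
    apply key
    intro s t
    rw [add_smul, map_add, LinearMap.add_apply, ← hf, ← hf, ← LinearMap.add_apply, ← map_add]
    rfl
  · intro a x y
    rw [k₀_smul_algebraMap_Li]
    apply key
    intro s t
    rw [mul_comm, mul_smul, ← hf, ← AHom_smul_apply]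
    congr 2
    rw [algebraMap_smul]
    rfl
  · intro x y y'
    rw [← map_add]
    apply key
    intro s t
    rw [add_smul, map_add, LinearMap.add_apply, ← hf, ← hf, ← map_add]
    rfl
  · intro a x y
    rw [k₀_smul_algebraMap_Li]
    apply key
    intro s t
    have h1 : (a • y).1 t = algebraMap k D.L (a : k) • y.1 t := by
      rw [algebraMap_smul]
      rfl
    have h2 := D.sigmaC_k₀ a
    rw [h1, ← h2, ← D.form_adjoint A.K, h2, mul_comm, mul_smul, ← hf, AHom_L_smul]
  · intro x y s t l h
    have h' : algebraMap D.L (D.Li i) l = algebraMap D.L (D.Li i) (f x y) := h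
    rw [← G.algebraMap_eq_iff] at h'
    rw [h', hf]

theorem pairing_eq_of_forall {x : D.Mult S} {y : D.Mult S'} {l : D.L}
    (h : ∀ s t, D.form (x.1 s) (y.1 t) = B (l • s) t) :
    D.pairing i B x y = algebraMap D.L (D.Li i) l := by
  obtain ⟨l', hl'⟩ := D.algebraMap_Li_surjective i (D.pairing i B x y)
  rw [← hl', ← G.algebraMap_eq_iff]
  intro s t
  rw [← h, G.isInduced_pairing A x y s t l' hl']

theorem pairing_eq_iff {x : D.Mult S} {y : D.Mult S'} {l : D.L} :
    D.pairing i B x y = algebraMap D.L (D.Li i) l ↔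
      ∀ s t, D.form (x.1 s) (y.1 t) = B (l • s) t :=
  ⟨fun h s t => G.isInduced_pairing A x y s t l h.symm, G.pairing_eq_of_forall A⟩

theorem pairing_unique {p : D.Mult S →ₗ[D.k₀] D.Mult S' →ₗ[D.k₀] D.Li i}
    (hp : D.IsInduced i B p) : p = D.pairing i B := by
  ext x y
  obtain ⟨l, hl⟩ := D.algebraMap_Li_surjective i (p x y)
  rw [← hl]
  exact (G.pairing_eq_of_forall A fun s t => hp x y s t l hl).symm

theorem exists_lift (x : D.Mult S) (y : D.Mult S') : ∃ l : D.L,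
    D.pairing i B x y = algebraMap D.L (D.Li i) l ∧
      ∀ s t, D.form (x.1 s) (y.1 t) = B (l • s) t := by
  obtain ⟨l, hl⟩ := G.exists_L A x y
  exact ⟨l, G.pairing_eq_of_forall A hl, hl⟩

theorem pairing_smul_left (l : D.L) (x : D.Mult S) (y : D.Mult S') :
    D.pairing i B (l • x) y = l • D.pairing i B x y := by
  obtain ⟨l', h, h'⟩ := G.exists_lift A x y
  rw [h, smul_algebraMap_Li]
  apply G.pairing_eq_of_forall A
  intro s t
  rw [AHom_smul_apply, h', smul_smul, mul_comm]

theorem pairing_smul_right (l : D.L) (x : D.Mult S) (y : D.Mult S') :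
    D.pairing i B x (l • y) = D.sigmaC l • D.pairing i B x y := by
  obtain ⟨l', h, h'⟩ := G.exists_lift A x y
  rw [h, smul_algebraMap_Li]
  apply G.pairing_eq_of_forall A
  intro s t
  rw [AHom_smul_apply, h', mul_comm, mul_smul, G.adjoint A.K _ (D.sigmaC l • s),
    G.adjoint A.K _ s, G.adjoint A.K, sigmaC_sigmaC, smul_comm]

end GoodPairing

/-! ### Multiplicity spaces -/

section Mult

variable {S S' : AMod.{u, w} D.toCyclicDatum} {i : D.I}

theorem mult_smul_eq_zero (hS : S.IsSimpleAt i) {l : D.L} (hl : l ∈ i.asIdeal) (x : D.Mult S) :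
    l • x = 0 := by
  refine Subtype.ext (LinearMap.ext fun s => ?_)
  rw [AHom_smul_apply, hS.smul_eq_zero l hl, map_zero]
  rfl

theorem mult_smul_congr (hS : S.IsSimpleAt i) {l l' : D.L}
    (h : algebraMap D.L (D.Li i) l = algebraMap D.L (D.Li i) l') (x : D.Mult S) :
    l • x = l' • x := by
  refine sub_eq_zero.mp ((sub_smul l l' x).symm.trans (D.mult_smul_eq_zero hS ?_ x))
  rw [← algebraMap_Li_eq_zero, map_sub, h, sub_self]

theorem finite_mult (A : D.toCyclicDatum.Splitting) [Module.Finite k F] (hS : S.IsSimpleAt i) : Module.Finite D.L (D.Mult S) := by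
  obtain ⟨s, hs, hs0⟩ := A.exists_mem_Fix_ne_zero hS
  have h1 : Module.Finite F D.V := D.finite_V
  have h2 : Module.Finite k D.V := Module.Finite.trans F D.V
  have h3 : Module.Finite D.L D.V := Module.Finite.of_restrictScalars_finite k D.L D.V
  let f : D.Mult S →ₗ[D.L] D.V :=
    { toFun := fun x => x.1 s
      map_add' := fun _ _ => rfl
      map_smul' := fun _ _ => rfl }
  exact Module.Finite.of_injective f fun x y h => A.AHom_ext hS hs hs0 h

end Mult

end PolarizedDatum

end LoopGrading

end

/-! ### Non-degeneracy, division algebras and dual frames. -/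

noncomputable section

namespace LoopGrading

namespace PolarizedDatum

open CyclicDatum CyclicDatum.AMod

variable {k : Type} [Field k] {F : Type u} [CommRing F] [Algebra k F]
  {D : PolarizedDatum.{u, v} k F}

/-- A lift to `L` of an element of `L_i`. -/
def lift (D : PolarizedDatum.{u, v} k F) (i : D.I) (z : D.Li i) : D.L :=
  Function.surjInv (D.algebraMap_Li_surjective i) z

@[simp]
theorem algebraMap_lift (i : D.I) (z : D.Li i) : algebraMap D.L (D.Li i) (D.lift i z) = z :=
  Function.surjInv_eq _ z

theorem lift_smul_one (i : D.I) (z z' : D.Li i) : D.lift i z • z' = z * z' := by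
  rw [smul_Li, algebraMap_lift]

namespace Choices

variable (C : Choices.{u, v, w} D)

theorem good {i j : D.I} (h : D.dag i = j) : D.GoodPairing i (C.B i j) where
  simple := C.isSimpleAt i
  simple' := h ▸ C.isSimpleAt j
  adm := C.admissible i j h
  perfect := C.perfect i j h

variable [Nontrivial F] [CharZero k]

/-- By a frame, `V` is spanned by values of homomorphisms from the `S_j`, and only `j = i†` pairs
non-trivially with the part at `i`. -/
theorem eq_zero_of_form_left (A : D.toCyclicDatum.Splitting) {i j : D.I} (h : D.dag i = j)
    (x : C.M i) (s : C.S i) (hx : ∀ (y : C.M j) t, D.form (x.1 s) (y.1 t) = 0) : x.1 s = 0 := by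
  obtain ⟨Fr⟩ := A.exists_frame C.isSimpleAt D.V
  refine D.form_nondegenerate _ fun v => ?_
  rw [← Fr.expand v, map_sum]
  refine Finset.sum_eq_zero fun j' _ => ?_
  rw [map_sum]
  refine Finset.sum_eq_zero fun a _ => ?_
  by_cases hj : D.dag i = j'
  · obtain rfl : j = j' := h.symm.trans hj
    exact hx _ _
  · exact D.form_eq_zero A.K (C.isSimpleAt i) (C.isSimpleAt j') hj _ _ _ _

theorem eq_zero_of_form_right (A : D.toCyclicDatum.Splitting) {i j : D.I} (h : D.dag i = j)
    (y : C.M j) (t : C.S j) (hy : ∀ (x : C.M i) s, D.form (x.1 s) (y.1 t) = 0) : y.1 t = 0 := by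
  refine C.eq_zero_of_form_left A (by rw [← h, dag_dag]) y t fun x s => ?_
  rw [D.form_swap, hy, map_zero, mul_zero]

theorem pairing_nondegenerate_left (A : D.toCyclicDatum.Splitting) {i j : D.I} (h : D.dag i = j)
    (x : C.M i) (hx : ∀ y, D.pairing i (C.B i j) x y = 0) : x = 0 := by
  refine Subtype.ext (LinearMap.ext fun s => C.eq_zero_of_form_left A h x s fun y t => ?_)
  have h1 := ((C.good h).pairing_eq_iff A (l := 0)).mp ((hx y).trans (map_zero _).symm) s t
  rw [h1, zero_smul, map_zero, LinearMap.zero_apply]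

theorem pairing_nondegenerate_right (A : D.toCyclicDatum.Splitting) {i j : D.I} (h : D.dag i = j)
    (y : C.M j) (hy : ∀ x, D.pairing i (C.B i j) x y = 0) : y = 0 := by
  refine Subtype.ext (LinearMap.ext fun t => C.eq_zero_of_form_right A h y t fun x s => ?_)
  have h1 := ((C.good h).pairing_eq_iff A (l := 0)).mp ((hy x).trans (map_zero _).symm) s t
  rw [h1, zero_smul, map_zero, LinearMap.zero_apply]

theorem pairingsWellDefined (A : D.toCyclicDatum.Splitting) : C.PairingsWellDefined :=
  fun _ _ h => ⟨(C.good h).isInduced_pairing A, fun _ => (C.good h).pairing_unique A,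
    C.pairing_nondegenerate_left A h, C.pairing_nondegenerate_right A h⟩

theorem divisionAlgebrasTrivial (A : D.toCyclicDatum.Splitting) : C.DivisionAlgebrasTrivial := by
  intro i
  let f : D.L →ₐ[k] (AEnd (C.S i))ᵐᵒᵖ := AlgHom.ofLinearMap
    { toFun := fun l => MulOpposite.op ⟨(C.S i).act l, fun x => act_comm_T (C.S i) l x⟩
      map_add' := fun l l' => by
        apply MulOpposite.unop_injective
        exact Subtype.ext (map_add (C.S i).act l l')
      map_smul' := fun a l => by
        apply MulOpposite.unop_injective
        exact Subtype.ext (map_smul (C.S i).act a l) }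
    (by
      apply MulOpposite.unop_injective
      exact Subtype.ext (map_one (C.S i).act))
    (fun l l' => by
      apply MulOpposite.unop_injective
      refine Subtype.ext ?_
      rw [mul_comm]
      exact map_mul (C.S i).act l' l)
  have hf : ∀ l u, (f l).unop.1 u = l • u := fun l u => rfl
  have hker : ∀ l ∈ i.asIdeal, f l = 0 := by
    intro l hl
    apply MulOpposite.unop_injective
    refine Subtype.ext (LinearMap.ext fun u => ?_)
    rw [hf, (C.isSimpleAt i).smul_eq_zero l hl]
    rfl
  let g : D.Li i →ₐ[k] (AEnd (C.S i))ᵐᵒᵖ := Ideal.Quotient.liftₐ i.asIdeal f hker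
  have hg : ∀ l, g (algebraMap D.L (D.Li i) l) = f l := fun l => rfl
  obtain ⟨s, hs⟩ := @exists_ne _ (C.isSimpleAt i).nontrivial (0 : C.S i)
  refine ⟨AlgEquiv.ofBijective g ⟨?_, ?_⟩, fun l u => hf l u⟩
  · rw [injective_iff_map_eq_zero]
    intro z hz
    obtain ⟨l, rfl⟩ := D.algebraMap_Li_surjective i z
    rw [D.algebraMap_Li_eq_zero, ← (C.isSimpleAt i).smul_eq_zero_iff hs, ← hf, ← hg, hz]
    rfl
  · intro φ
    obtain ⟨l, hl⟩ := A.exists_AEnd_eq_smul (C.isSimpleAt i) φ.unop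
    refine ⟨algebraMap D.L (D.Li i) l, ?_⟩
    apply MulOpposite.unop_injective
    refine Subtype.ext (LinearMap.ext fun u => ?_)
    rw [hg, hf, hl]

/-- Dual frames of `M_i` and `M_{i†}`. -/
theorem exists_dual_frame [Module.Finite k F] (A : D.toCyclicDatum.Splitting) {i j : D.I}
    (h : D.dag i = j) : ∃ (n : ℕ) (xs : Fin n → C.M i) (ys : Fin n → C.M j),
      (∀ x, ∑ a, D.lift i (D.pairing i (C.B i j) x (ys a)) • xs a = x) ∧
      (∀ y, ∑ a, D.sigmaC (D.lift i (D.pairing i (C.B i j) (xs a) y)) • ys a = y) := by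
  have G := C.good h
  -- `M_i` is viewed as a vector space over the field `L_i` in order to apply `exists_dual_bases`;
  -- the result is then stated with lifts to `L`.
  letI : Field (D.Li i) :=
    { (inferInstance : CommRing (D.Li i)), (Ideal.Quotient.field i.asIdeal) with }
  letI : Module (D.Li i) (C.M i) := Module.IsTorsionBySet.module (I := i.asIdeal)
    fun x l => D.mult_smul_eq_zero (C.isSimpleAt i) l.2 x
  have : IsScalarTower D.L (D.Li i) (C.M i) := Module.IsTorsionBySet.isScalarTower _
  have := D.finite_mult A (C.isSimpleAt i)
  have : Module.Finite (D.Li i) (C.M i) := Module.Finite.of_restrictScalars_finite D.L _ _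
  let p : C.M j →+ Module.Dual (D.Li i) (C.M i) :=
    { toFun := fun y =>
        { toFun := fun x => D.pairing i (C.B i j) x y
          map_add' := fun x x' => by rw [map_add]; rfl
          map_smul' := fun z x => by
            obtain ⟨l, rfl⟩ := D.algebraMap_Li_surjective i z
            rw [algebraMap_smul, G.pairing_smul_left A, smul_Li]
            rfl }
      map_zero' := by
        ext x
        exact map_zero (D.pairing i (C.B i j) x)
      map_add' := fun y y' => by
        ext x
        exact map_add (D.pairing i (C.B i j) x) _ _ }
  obtain ⟨n, xs, ys, -, hx⟩ := exists_dual_bases p (fun z y => by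
    obtain ⟨l, rfl⟩ := D.algebraMap_Li_surjective i z
    refine ⟨D.sigmaC l • y, ?_⟩
    ext x
    change D.pairing i (C.B i j) x _ = algebraMap D.L (D.Li i) l * D.pairing i (C.B i j) x y
    rw [G.pairing_smul_right A, sigmaC_sigmaC, smul_Li]) fun x hx =>
      C.pairing_nondegenerate_left A h x hx
  have hx' : ∀ x, ∑ a, D.lift i (D.pairing i (C.B i j) x (ys a)) • xs a = x := by
    intro x
    conv_rhs => rw [hx x]
    refine Finset.sum_congr rfl fun a _ => ?_
    rw [← algebraMap_smul (D.Li i), algebraMap_lift]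
    rfl
  refine ⟨n, xs, ys, hx', fun y => ?_⟩
  rw [← sub_eq_zero]
  refine C.pairing_nondegenerate_right A h _ fun x => ?_
  rw [map_sub, sub_eq_zero, map_sum]
  conv_rhs => rw [← hx' x, map_sum, LinearMap.sum_apply]
  refine Finset.sum_congr rfl fun a _ => ?_
  rw [G.pairing_smul_right A, sigmaC_sigmaC, G.pairing_smul_left A, lift_smul_one, lift_smul_one,
    mul_comm]

/-- Every `L`-linear map `M_i → L_i` is represented by an element of `M_{i†}`. -/
theorem exists_pairing_eq [Module.Finite k F] (A : D.toCyclicDatum.Splitting) {i j : D.I}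
    (h : D.dag i = j) (f : C.M i →ₗ[D.L] D.Li i) : ∃ y, ∀ x, D.pairing i (C.B i j) x y = f x := by
  obtain ⟨n, xs, ys, hx, -⟩ := C.exists_dual_frame A h
  refine ⟨∑ a, D.sigmaC (D.lift i (f (xs a))) • ys a, fun x => ?_⟩
  conv_rhs => rw [← hx x, map_sum]
  rw [map_sum]
  refine Finset.sum_congr rfl fun a _ => ?_
  rw [(C.good h).pairing_smul_right A, sigmaC_sigmaC, map_smul, lift_smul_one, lift_smul_one,
    mul_comm]

/-- The pairing at a fixed vertex is Hermitian or skew-Hermitian according to the pairing on `S_i`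
and to `ε`. -/
theorem form_swap_vertex (A : D.toCyclicDatum.Splitting) {i : D.I} (h : D.dag i = i) {δ : ℤˣ}
    (hδ : ∀ u v, C.B i i v u = ((δ : ℤ) : F) * D.σ (C.B i i u v)) (x y : C.M i) :
    C.form i y x = ((D.ε * δ : ℤˣ) : ℤ) • D.sigmaVertex i h (C.form i x y) := by
  obtain ⟨l, hl, hl'⟩ := (C.good h).exists_lift A x y
  have h1 : C.form i x y = algebraMap D.L (D.Li i) l := hl
  have h2 : D.sigmaVertex i h (algebraMap D.L (D.Li i) l) =
    algebraMap D.L (D.Li i) (D.sigmaC l) := rfl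
  rw [h1, h2, ← map_zsmul]
  refine (C.good h).pairing_eq_of_forall A fun s t => ?_
  rw [smul_assoc, map_zsmul, LinearMap.smul_apply, (C.good h).adjoint A.K, sigmaC_sigmaC, hδ,
    ← hl', D.form_swap, zsmul_eq_mul, ← mul_assoc, ← Int.cast_mul, Units.val_mul, mul_assoc]
  rw [Int.units_coe_mul_self, mul_one]

end Choices

end PolarizedDatum

end LoopGrading

end

noncomputable section

namespace LoopGrading

/-! ### Base change of bilinear maps -/

section BaseChange

variable {K : Type} [Field K] (R : Type) [CommRing R] [Algebra K R]
  {M N Q X : Type*} [AddCommGroup M] [Module K M] [AddCommGroup N] [Module K N]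
  [AddCommGroup Q] [Module K Q] [AddCommGroup X] [Module R X]

/-- The `R`-bilinear extension of a `K`-bilinear map. -/
def bilinBaseChange (p : M →ₗ[K] N →ₗ[K] Q) : R ⊗[K] M →ₗ[R] R ⊗[K] N →ₗ[R] R ⊗[K] Q :=
  LinearMap.liftBaseChange R (LinearMap.baseChangeHom K R N Q ∘ₗ p)

@[simp]
theorem bilinBaseChange_tmul (p : M →ₗ[K] N →ₗ[K] Q) (r s : R) (x : M) (y : N) :
    bilinBaseChange R p (r ⊗ₜ x) (s ⊗ₜ y) = (r * s) ⊗ₜ p x y := by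
  rw [bilinBaseChange, LinearMap.liftBaseChange_tmul, LinearMap.smul_apply]
  change r • (s ⊗ₜ p x y) = _
  rw [TensorProduct.smul_tmul', smul_eq_mul]

variable {R}

theorem linear_ext_tmul {f g : R ⊗[K] M →ₗ[R] X} (h : ∀ x, f (1 ⊗ₜ x) = g (1 ⊗ₜ x)) : f = g := by
  refine LinearMap.ext fun z => ?_
  induction z with
  | zero => rw [map_zero, map_zero]
  | tmul r x =>
    have : r ⊗ₜ[K] x = r • (1 : R) ⊗ₜ[K] x := by rw [TensorProduct.smul_tmul', smul_eq_mul, mul_one]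
    rw [this, map_smul, map_smul, h]
  | add z z' hz hz' => rw [map_add, map_add, hz, hz']

theorem bilinear_ext_tmul {f g : R ⊗[K] M →ₗ[R] R ⊗[K] N →ₗ[R] X}
    (h : ∀ x y, f (1 ⊗ₜ x) (1 ⊗ₜ y) = g (1 ⊗ₜ x) (1 ⊗ₜ y)) : f = g :=
  linear_ext_tmul fun x => linear_ext_tmul fun y => h x y

theorem baseChange_eq_bilinBaseChange (p : LinearMap.BilinMap K M Q) (z z' : R ⊗[K] M) :
    p.baseChange R z z' = bilinBaseChange R p z z' := by
  have h : p.baseChange R = bilinBaseChange R p := bilinear_ext_tmul fun x y => by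
    rw [LinearMap.BilinMap.baseChange_tmul, bilinBaseChange_tmul]
  rw [h]

theorem bilinBaseChange_comp {M' N' Q' : Type*} [AddCommGroup M'] [Module K M'] [AddCommGroup N']
    [Module K N'] [AddCommGroup Q'] [Module K Q'] {p : M →ₗ[K] N →ₗ[K] Q}
    {p' : M' →ₗ[K] N' →ₗ[K] Q'} {f : M →ₗ[K] M'} {g : N →ₗ[K] N'} {h : Q →ₗ[K] Q'}
    (H : ∀ x y, p' (f x) (g y) = h (p x y)) (z : R ⊗[K] M) (z' : R ⊗[K] N) :
    bilinBaseChange R p' (f.baseChange R z) (g.baseChange R z') =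
      h.baseChange R (bilinBaseChange R p z z') := by
  have : (bilinBaseChange R p').compl₁₂ (f.baseChange R) (g.baseChange R) =
      (bilinBaseChange R p).compr₂ (h.baseChange R) := bilinear_ext_tmul fun x y => by
    simp [H]
  exact LinearMap.congr_fun₂ this z z'

theorem bilinBaseChange_flip (p : M →ₗ[K] N →ₗ[K] Q) (z : R ⊗[K] M) (z' : R ⊗[K] N) :
    bilinBaseChange R p.flip z' z = bilinBaseChange R p z z' := by
  have : (bilinBaseChange R p.flip).flip = bilinBaseChange R p := bilinear_ext_tmul fun x y => by
    simp
  exact LinearMap.congr_fun₂ this z z'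

/-- Jointly injective maps remain jointly injective after base change. -/
theorem eq_zero_of_baseChange {ι : Type*} {W : ι → Type*} [∀ a, AddCommGroup (W a)]
    [∀ a, Module K (W a)] (f : ∀ a, Q →ₗ[K] W a) (hf : ∀ q, (∀ a, f a q = 0) → q = 0)
    (z : R ⊗[K] Q) (hz : ∀ a, (f a).baseChange R z = 0) : z = 0 := by
  classical
  -- Over a field `R` is free, and coordinates along a basis of `R` reduce the claim to `Q`. No
  -- finiteness of the family is needed.
  let ℬ := Module.Basis.ofVectorSpace K R
  have key : ∀ a (z : R ⊗[K] Q) i, TensorProduct.equivFinsuppOfBasisLeft ℬ ((f a).baseChange R z) i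
      = f a (TensorProduct.equivFinsuppOfBasisLeft ℬ z i) := by
    intro a z i
    induction z with
    | zero => simp
    | tmul r q =>
      rw [LinearMap.baseChange_tmul, TensorProduct.equivFinsuppOfBasisLeft_apply_tmul_apply,
        TensorProduct.equivFinsuppOfBasisLeft_apply_tmul_apply, map_smul]
    | add z z' h h' =>
      rw [map_add, map_add, map_add, Finsupp.add_apply, Finsupp.add_apply, map_add, h, h']
  apply (TensorProduct.equivFinsuppOfBasisLeft ℬ).injective
  rw [map_zero]
  ext i
  refine hf _ fun a => ?_
  rw [← key, hz, map_zero]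
  rfl

theorem eq_of_baseChange {ι : Type*} {W : ι → Type*} [∀ a, AddCommGroup (W a)]
    [∀ a, Module K (W a)] (f : ∀ a, Q →ₗ[K] W a) (hf : ∀ q, (∀ a, f a q = 0) → q = 0)
    {z z' : R ⊗[K] Q} (hz : ∀ a, (f a).baseChange R z = (f a).baseChange R z') : z = z' := by
  rw [← sub_eq_zero]
  refine eq_zero_of_baseChange f hf _ fun a => ?_
  rw [map_sub, hz, sub_self]

theorem eq_of_bilinBaseChange_right (p : M →ₗ[K] N →ₗ[K] Q) (hp : ∀ y, (∀ x, p x y = 0) → y = 0)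
    {z z' : R ⊗[K] N} (h : ∀ z₀, bilinBaseChange R p z₀ z = bilinBaseChange R p z₀ z') :
    z = z' := by
  have h1 : ∀ x z, bilinBaseChange R p (1 ⊗ₜ x) z = (p x).baseChange R z := by
    intro x z
    have : bilinBaseChange R p (1 ⊗ₜ x) = (p x).baseChange R := linear_ext_tmul fun y => by simp
    rw [this]
  refine eq_of_baseChange p hp fun x => ?_
  rw [← h1, ← h1, h]

/-- Adjoints for a non-degenerate bilinear form, after base change. -/
theorem exists_adjoint [Module.Finite K M] (p : M →ₗ[K] N →ₗ[K] K)
    (hl : ∀ x, (∀ y, p x y = 0) → x = 0) (hr : ∀ y, (∀ x, p x y = 0) → y = 0)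
    (f : R ⊗[K] M →ₗ[R] R ⊗[K] M) : ∃ f' : R ⊗[K] N →ₗ[R] R ⊗[K] N,
      ∀ z z', bilinBaseChange R p (f z) z' = bilinBaseChange R p z (f' z') := by
  obtain ⟨n, xs, ys, -, hx⟩ := exists_dual_bases (K := K) (M := M) (N := N) p.flip.toAddMonoidHom
    (fun c y => ⟨c • y, map_smul p.flip c y⟩) hl
  let P : R ⊗[K] M →ₗ[R] R ⊗[K] N →ₗ[R] R :=
    (bilinBaseChange R p).compr₂ (TensorProduct.AlgebraTensorModule.rid K R R).toLinearMap
  have hP : ∀ r x s y, P (r ⊗ₜ x) (s ⊗ₜ y) = (p x y) • (r * s) := by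
    intro r x s y
    simp [P]
  have hxR : ∀ z, ∑ a, P z (1 ⊗ₜ ys a) • ((1 : R) ⊗ₜ[K] xs a) = z := by
    intro z
    have : ∑ a, (P.flip (1 ⊗ₜ ys a)).smulRight ((1 : R) ⊗ₜ[K] xs a) = LinearMap.id :=
      linear_ext_tmul fun x => by
        rw [LinearMap.sum_apply, LinearMap.id_apply]
        conv_rhs => rw [hx x, TensorProduct.tmul_sum]
        refine Finset.sum_congr rfl fun a _ => ?_
        rw [LinearMap.smulRight_apply, LinearMap.flip_apply, hP, mul_one,
          TensorProduct.smul_tmul', TensorProduct.tmul_smul, smul_eq_mul, mul_one,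
          TensorProduct.smul_tmul']
        rfl
    simpa using LinearMap.congr_fun this z
  refine ⟨∑ a, (P (f (1 ⊗ₜ xs a))).smulRight ((1 : R) ⊗ₜ[K] ys a), fun z z' => ?_⟩
  apply (TensorProduct.AlgebraTensorModule.rid K R R).injective
  change P (f z) z' = P z _
  conv_lhs => rw [← hxR z]
  rw [map_sum, map_sum, LinearMap.sum_apply, LinearMap.sum_apply, map_sum]
  refine Finset.sum_congr rfl fun a _ => ?_
  rw [map_smul, map_smul, LinearMap.smul_apply, LinearMap.smulRight_apply, map_smul, smul_eq_mul,
    smul_eq_mul, mul_comm]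

end BaseChange

namespace PolarizedDatum

open CyclicDatum CyclicDatum.AMod

variable {k : Type} [Field k] {F : Type u} [CommRing F] [Algebra k F]
  {D : PolarizedDatum.{u, v} k F}

theorem mem_k₀ {a : k} : a ∈ D.k₀ ↔ D.σk a = a := Iff.rfl

/-- If `σ` is not trivial on `k`, then `1` and an anti-invariant element `μ` span `k` over the fixed
field. -/
theorem finite_k₀ [Nontrivial F] [CharZero k] : Module.Finite D.k₀ k := by
  by_cases h : ∃ a, D.σk a ≠ a
  · obtain ⟨a, ha⟩ := h
    let μ := a - D.σk a
    have hμ : D.σk μ = -μ := by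
      rw [map_sub, σk_σk, neg_sub]
    have hμ0 : μ ≠ 0 := sub_ne_zero.mpr ha.symm
    let f : (Fin 2 → D.k₀) →ₗ[D.k₀] k := Fintype.linearCombination D.k₀ ![1, μ]
    have hf : ∀ g, f g = (g 0 : k) + (g 1 : k) * μ := by
      intro g
      simp [f, Fintype.linearCombination_apply, Subfield.smul_def]
    refine Module.Finite.of_surjective f fun x => ?_
    refine ⟨![⟨(x + D.σk x) / 2, ?_⟩, ⟨(x - D.σk x) / (2 * μ), ?_⟩], ?_⟩
    · rw [mem_k₀, map_div₀, map_add, σk_σk, add_comm, map_ofNat]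
    · rw [mem_k₀, map_div₀, map_sub, σk_σk, map_mul, hμ, map_ofNat, mul_neg, div_neg,
        ← neg_div, neg_sub]
    · rw [hf]
      change (x + D.σk x) / 2 + (x - D.σk x) / (2 * μ) * μ = x
      field_simp
      ring
  · push Not at h
    exact Module.Finite.of_surjective (LinearMap.toSpanSingleton D.k₀ k 1) fun x =>
      ⟨⟨x, mem_k₀.mpr (h x)⟩, mul_one x⟩

end PolarizedDatum

end LoopGrading

end

/-! ### Components of automorphisms of `R ⊗ V`. -/

noncomputable section

namespace LoopGrading

namespace PolarizedDatum

open CyclicDatum CyclicDatum.AMod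

variable {k : Type} [Field k] {F : Type u} [CommRing F] [Algebra k F]
  {D : PolarizedDatum.{u, v} k F}

/-- Multiplication by `l ∈ L` on a multiplicity space. -/
abbrev multMul {S : AMod.{u, w} D.toCyclicDatum} (l : D.L) : Module.End D.k₀ (D.Mult S) :=
  Module.toModuleEnd D.k₀ (S := D.L) (D.Mult S) l

namespace Choices

variable (C : Choices.{u, v, w} D)

theorem ev_multMul {i : D.I} (u : C.S i) (l : D.L) :
    C.ev i u ∘ₗ multMul l = C.ev i (l • u) :=
  LinearMap.ext fun x => AHom_smul_apply x l u

theorem smul_ev {i : D.I} (u : C.S i) (a : F) :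
    Module.toModuleEnd D.k₀ (S := F) D.V a ∘ₗ C.ev i u = C.ev i (a • u) :=
  LinearMap.ext fun x => (x.1.map_smul a u).symm

theorem thetaLin_ev {i : D.I} (u : C.S i) : D.thetaLin ∘ₗ C.ev i u = C.ev i ((C.S i).T u) :=
  LinearMap.ext fun x => (x.2 u).symm

theorem ev_sum {i : D.I} {ι : Type*} (s : Finset ι) (u : ι → C.S i) :
    C.ev i (∑ a ∈ s, u a) = ∑ a ∈ s, C.ev i (u a) :=
  LinearMap.ext fun x => by
    rw [LinearMap.sum_apply]
    exact map_sum x.1 u s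

theorem ev_sum_baseChange (R : Type) [CommRing R] [Algebra D.k₀ R] {i : D.I} {ι : Type*}
    (s : Finset ι) (u : ι → C.S i) (z : R ⊗[D.k₀] C.M i) :
    (C.ev i (∑ a ∈ s, u a)).baseChange R z = ∑ a ∈ s, (C.ev i (u a)).baseChange R z := by
  rw [ev_sum, ← LinearMap.sum_apply]
  exact LinearMap.congr_fun (map_sum (LinearMap.baseChangeHom D.k₀ R _ _) _ _) z

/-- The coordinates of a frame, as `k₀`-linear maps. -/
def qLin {C : Choices.{u, v, w} D} (Fr : Frame C.S D.V) (i : D.I) (a : Fin D.n) :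
    D.V →ₗ[D.k₀] C.M i where
  toFun := Fr.q i a
  map_add' := map_add _
  map_smul' c x := by
    rw [k₀_smul_L, map_smul]
    refine Subtype.ext (LinearMap.ext fun s => ?_)
    rw [AHom_smul_apply, AHom_L_smul, ← k₀_smul_L]
    rfl

section Points

variable (R : Type) [CommRing R] [Algebra D.k₀ R]

/-- The automorphisms of `R ⊗ V` commuting with `F` and `θ`. -/
def linPoints (D : PolarizedDatum.{u, v} k F) (R : Type) [CommRing R] [Algebra D.k₀ R] :
    Subgroup ((R ⊗[D.k₀] D.V) ≃ₗ[R] (R ⊗[D.k₀] D.V)) :=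
  glPoints R F ⊓ commPoints R {D.thetaLin}

variable {R} {C}

/-- What commutes with `F` and `θ` commutes with all they generate, in particular with `L` and with
the coordinates of a frame. The inductive predicate `IsNat` makes this an induction, without forming
the ring `A_β`. -/
theorem linPoints_comm {g : (R ⊗[D.k₀] D.V) ≃ₗ[R] (R ⊗[D.k₀] D.V)} (hg : g ∈ linPoints D R)
    {N : D.V → D.V} (hN : D.V.IsNat N) : ∃ N' : Module.End D.k₀ D.V, (∀ x, N' x = N x) ∧
      ∀ z, g (N'.baseChange R z) = N'.baseChange R (g z) := by
  induction hN with
  | smul f => exact ⟨Module.toModuleEnd D.k₀ (S := F) D.V f, fun _ => rfl, hg.1 _ ⟨f, rfl⟩⟩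
  | T => exact ⟨D.thetaLin, fun _ => rfl, hg.2 _ rfl⟩
  | add _ _ h h' =>
    obtain ⟨N, h1, h2⟩ := h
    obtain ⟨N', h1', h2'⟩ := h'
    refine ⟨N + N', fun x => by rw [LinearMap.add_apply, h1, h1'], fun z => ?_⟩
    rw [LinearMap.baseChange_add, LinearMap.add_apply, map_add, h2, h2', LinearMap.add_apply]
  | comp _ _ h h' =>
    obtain ⟨N, h1, h2⟩ := h
    obtain ⟨N', h1', h2'⟩ := h'
    refine ⟨N ∘ₗ N', fun x => by rw [LinearMap.comp_apply, h1', h1], fun z => ?_⟩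
    rw [LinearMap.baseChange_comp, LinearMap.comp_apply, h2, h2', LinearMap.comp_apply]

variable (Fr : Frame C.S D.V)

theorem ev_qLin_comm {g : (R ⊗[D.k₀] D.V) ≃ₗ[R] (R ⊗[D.k₀] D.V)} (hg : g ∈ linPoints D R)
    (i : D.I) (a : Fin D.n) (u : C.S i) (z : R ⊗[D.k₀] D.V) :
    g ((C.ev i u).baseChange R ((qLin Fr i a).baseChange R z)) =
      (C.ev i u).baseChange R ((qLin Fr i a).baseChange R (g z)) := by
  obtain ⟨N, h1, h2⟩ := linPoints_comm hg (Fr.isNat i a u)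
  have h3 : C.ev i u ∘ₗ qLin Fr i a = N := LinearMap.ext fun x => (h1 x).symm
  rw [← LinearMap.comp_apply, ← LinearMap.baseChange_comp, h3, h2, ← h3, LinearMap.baseChange_comp,
    LinearMap.comp_apply]

theorem multMul_ev_comm {g : (R ⊗[D.k₀] D.V) ≃ₗ[R] (R ⊗[D.k₀] D.V)} (hg : g ∈ linPoints D R)
    {i : D.I} (u : C.S i) (l : D.L) {f : R ⊗[D.k₀] C.M i → R ⊗[D.k₀] C.M i}
    (hf : ∀ z, g ((C.ev i u).baseChange R z) = (C.ev i u).baseChange R (f z))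
    (z : R ⊗[D.k₀] C.M i) : (C.ev i u).baseChange R (f ((multMul l).baseChange R z)) =
      (C.ev i u).baseChange R ((multMul l).baseChange R (f z)) := by
  obtain ⟨N, h1, h2⟩ := linPoints_comm hg (IsNat.L_smul (X := D.V) l)
  have h3 : C.ev i u ∘ₗ multMul l = N ∘ₗ C.ev i u := LinearMap.ext fun x => (h1 _).symm
  rw [← hf, ← LinearMap.comp_apply, ← LinearMap.baseChange_comp, h3, LinearMap.baseChange_comp,
    LinearMap.comp_apply, h2, hf, ← LinearMap.comp_apply, ← LinearMap.baseChange_comp, ← h3,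
    LinearMap.baseChange_comp, LinearMap.comp_apply]

theorem qLin_ev (i : D.I) (a : Fin D.n) : qLin Fr i a ∘ₗ C.ev i (Fr.u i a) = LinearMap.id :=
  LinearMap.ext fun x => Fr.q_u i a x

theorem ev_injective (i : D.I) (a : Fin D.n) {z z' : R ⊗[D.k₀] C.M i}
    (h : (C.ev i (Fr.u i a)).baseChange R z = (C.ev i (Fr.u i a)).baseChange R z') : z = z' := by
  have h1 := congrArg ((qLin Fr i a).baseChange R) h
  rwa [← LinearMap.comp_apply, ← LinearMap.comp_apply, ← LinearMap.baseChange_comp, qLin_ev,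
    LinearMap.baseChange_id] at h1

theorem sum_ev_qLin (z : R ⊗[D.k₀] D.V) :
    ∑ i, ∑ a, (C.ev i (Fr.u i a)).baseChange R ((qLin Fr i a).baseChange R z) = z := by
  have h : ∑ i, ∑ a, (C.ev i (Fr.u i a)).baseChange R ∘ₗ (qLin Fr i a).baseChange R =
      LinearMap.id := linear_ext_tmul fun x => by
    rw [LinearMap.id_apply]
    conv_rhs => rw [← Fr.expand x]
    simp only [LinearMap.sum_apply, LinearMap.comp_apply, LinearMap.baseChange_tmul,
      TensorProduct.tmul_sum]
    rfl
  simpa using LinearMap.congr_fun h z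

theorem linear_ext_ev {X : Type*} [AddCommGroup X] [Module R X] (Fr : Frame C.S D.V)
    {f g : R ⊗[D.k₀] D.V →ₗ[R] X}
    (h : ∀ i u z, f ((C.ev i u).baseChange R z) = g ((C.ev i u).baseChange R z)) : f = g := by
  refine LinearMap.ext fun z => ?_
  rw [← sum_ev_qLin Fr z]
  simp_rw [map_sum, h]

/-- `f` is the component at `i` of the automorphism `g` of `R ⊗ V`. -/
def IsComponent (C : Choices.{u, v, w} D) {R : Type} [CommRing R] [Algebra D.k₀ R]
    (g : (R ⊗[D.k₀] D.V) ≃ₗ[R] (R ⊗[D.k₀] D.V)) (i : D.I)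
    (f : (R ⊗[D.k₀] C.M i) ≃ₗ[R] (R ⊗[D.k₀] C.M i)) : Prop :=
  ∀ (u : C.S i) (z : R ⊗[D.k₀] C.M i),
    g ((C.ev i u).baseChange R z) = (C.ev i u).baseChange R (f z)

theorem IsComponent.unique (Fr : Frame C.S D.V) {g : (R ⊗[D.k₀] D.V) ≃ₗ[R] (R ⊗[D.k₀] D.V)}
    {i : D.I} {f f' : (R ⊗[D.k₀] C.M i) ≃ₗ[R] (R ⊗[D.k₀] C.M i)} (h : C.IsComponent g i f)
    (h' : C.IsComponent g i f') (a : Fin D.n) : f = f' :=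
  LinearEquiv.ext fun z => ev_injective Fr i a (by rw [← h, ← h'])

/-- Compress `g` along one frame vector, for which `q` after evaluation is the identity of `M_i`.
The result is the component for every other `u` as well, because evaluation at `u` after `q`
commutes with `g`. -/
theorem exists_isComponent (Fr : Frame C.S D.V) (a : Fin D.n)
    {g : (R ⊗[D.k₀] D.V) ≃ₗ[R] (R ⊗[D.k₀] D.V)} (hg : g ∈ linPoints D R) (i : D.I) :
    ∃ f ∈ glPoints (k₀ := D.k₀) (M := C.M i) R D.L, C.IsComponent g i f := by
  let f (g : (R ⊗[D.k₀] D.V) ≃ₗ[R] (R ⊗[D.k₀] D.V)) : R ⊗[D.k₀] C.M i →ₗ[R] R ⊗[D.k₀] C.M i :=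
    (qLin Fr i a).baseChange R ∘ₗ g.toLinearMap ∘ₗ (C.ev i (Fr.u i a)).baseChange R
  have hf : ∀ {g}, g ∈ linPoints D R → ∀ u z, g ((C.ev i u).baseChange R z) =
      (C.ev i u).baseChange R (f g z) := by
    intro g hg u z
    change _ = (C.ev i u).baseChange R ((qLin Fr i a).baseChange R (g _))
    rw [← ev_qLin_comm Fr hg, ← LinearMap.comp_apply (LinearMap.baseChange R (qLin Fr i a)),
      ← LinearMap.baseChange_comp, qLin_ev, LinearMap.baseChange_id, LinearMap.id_apply]
  have hg' : g⁻¹ ∈ linPoints D R := inv_mem hg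
  have hinv1 : ∀ z, g (g⁻¹ z) = z := g.apply_symm_apply
  have hinv2 : ∀ z, g⁻¹ (g z) = z := g.symm_apply_apply
  refine ⟨LinearEquiv.ofLinearMap (f g) (f g⁻¹) ?_ ?_, ?_, fun u z => hf hg u z⟩
  · refine LinearMap.ext fun z => ev_injective Fr i a ?_
    rw [LinearMap.comp_apply, ← hf hg, ← hf hg', hinv1, LinearMap.id_apply]
  · refine LinearMap.ext fun z => ev_injective Fr i a ?_
    rw [LinearMap.comp_apply, ← hf hg', ← hf hg, hinv2, LinearMap.id_apply]
  · rintro _ ⟨l, rfl⟩ z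
    exact ev_injective Fr i a (multMul_ev_comm hg _ l (hf hg _) z)

/-- The automorphism is the sum over the frame of `ev ∘ f_i ∘ q`. It has the right effect on every
`u`, since on the part at `i` the map `q` is multiplication by elements of `L` and `f_i` is
`L`-linear. -/
theorem exists_of_components (Fr : Frame C.S D.V)
    (f : ∀ i, (R ⊗[D.k₀] C.M i) ≃ₗ[R] (R ⊗[D.k₀] C.M i))
    (hf : ∀ i, f i ∈ glPoints (k₀ := D.k₀) (M := C.M i) R D.L) :
    ∃ g ∈ linPoints D R, ∀ i, C.IsComponent g i (f i) := by
  let G (f : ∀ i, (R ⊗[D.k₀] C.M i) ≃ₗ[R] (R ⊗[D.k₀] C.M i)) :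
      R ⊗[D.k₀] D.V →ₗ[R] R ⊗[D.k₀] D.V :=
    ∑ i, ∑ a, (C.ev i (Fr.u i a)).baseChange R ∘ₗ (f i).toLinearMap ∘ₗ (qLin Fr i a).baseChange R
  have hG : ∀ f : ∀ i, (R ⊗[D.k₀] C.M i) ≃ₗ[R] (R ⊗[D.k₀] C.M i),
      (∀ i, f i ∈ glPoints (k₀ := D.k₀) (M := C.M i) R D.L) → ∀ i u z,
      G f ((C.ev i u).baseChange R z) = (C.ev i u).baseChange R (f i z) := by
    intro f hf i u z
    simp only [G, LinearMap.sum_apply, LinearMap.comp_apply, LinearEquiv.coe_coe]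
    rw [Finset.sum_eq_single_of_mem i (Finset.mem_univ i)]
    · have h1 : ∀ a, (qLin Fr i a).baseChange R ((C.ev i u).baseChange R z) =
          (multMul (Fr.lam i a u)).baseChange R z := by
        intro a
        rw [← LinearMap.comp_apply, ← LinearMap.baseChange_comp]
        congr 2
        exact LinearMap.ext fun x => Fr.q_self i a x u
      simp_rw [h1]
      conv_rhs => rw [← Fr.expand_simple i u, ev_sum_baseChange]
      refine Finset.sum_congr rfl fun a _ => ?_
      rw [hf i _ ⟨_, rfl⟩, ← ev_multMul, LinearMap.baseChange_comp, LinearMap.comp_apply]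
    · intro j _ hj
      refine Finset.sum_eq_zero fun a _ => ?_
      have h1 : qLin Fr j a ∘ₗ C.ev i u = 0 :=
        LinearMap.ext fun x => Fr.q_of_ne j i hj.symm a x u
      rw [← LinearMap.comp_apply (LinearMap.baseChange R (qLin Fr j a)),
        ← LinearMap.baseChange_comp, h1, LinearMap.baseChange_zero, LinearMap.zero_apply, map_zero,
        map_zero]
  have hf' : ∀ i, (f i)⁻¹ ∈ glPoints (k₀ := D.k₀) (M := C.M i) R D.L := fun i => inv_mem (hf i)
  let g : (R ⊗[D.k₀] D.V) ≃ₗ[R] (R ⊗[D.k₀] D.V) := LinearEquiv.ofLinearMap (G f) (G fun i => (f i)⁻¹)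
    (linear_ext_ev Fr fun i u z => by
      rw [LinearMap.comp_apply, hG _ hf', hG _ hf]
      exact congrArg _ ((f i).apply_symm_apply z))
    (linear_ext_ev Fr fun i u z => by
      rw [LinearMap.comp_apply, hG _ hf, hG _ hf']
      exact congrArg _ ((f i).symm_apply_apply z))
  have hg : ∀ z, g z = G f z := fun _ => rfl
  have hcomm : ∀ (N : Module.End D.k₀ D.V), (∀ i u, ∃ u', N ∘ₗ C.ev i u = C.ev i u') → ∀ z,
      g (N.baseChange R z) = N.baseChange R (g z) := by
    intro N hN
    refine LinearMap.congr_fun (f := g.toLinearMap ∘ₗ N.baseChange R)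
      (g := N.baseChange R ∘ₗ g.toLinearMap) (linear_ext_ev Fr fun i u z => ?_)
    obtain ⟨u', hu'⟩ := hN i u
    simp only [LinearMap.comp_apply, LinearEquiv.coe_coe]
    rw [← LinearMap.comp_apply (LinearMap.baseChange R N), ← LinearMap.baseChange_comp, hu', hg,
      hg, hG _ hf, hG _ hf, ← LinearMap.comp_apply (LinearMap.baseChange R N),
      ← LinearMap.baseChange_comp, hu']
  refine ⟨g, ⟨?_, ?_⟩, fun i u z => hG f hf i u z⟩
  · rintro _ ⟨a, rfl⟩
    exact hcomm _ fun i u => ⟨_, C.smul_ev u a⟩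
  · rintro _ rfl
    exact hcomm _ fun i u => ⟨_, C.thetaLin_ev u⟩

end Points

end Choices

end PolarizedDatum

end LoopGrading

end

/-! ### The group `H` as a product of its vertex factors. -/

noncomputable section

namespace LoopGrading

theorem bilinBaseChange_adjoint {K : Type} [Field K] {R : Type} [CommRing R] [Algebra K R]
    {M N Q : Type*} [AddCommGroup M] [Module K M] [AddCommGroup N] [Module K N] [AddCommGroup Q]
    [Module K Q] {p : M →ₗ[K] N →ₗ[K] Q} {f : Module.End K M} {g : Module.End K N}
    (H : ∀ x y, p (f x) y = p x (g y)) (z : R ⊗[K] M) (z' : R ⊗[K] N) :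
    bilinBaseChange R p (f.baseChange R z) z' = bilinBaseChange R p z (g.baseChange R z') := by
  have : (bilinBaseChange R p).compl₁₂ (f.baseChange R) LinearMap.id =
      (bilinBaseChange R p).compl₁₂ LinearMap.id (g.baseChange R) := bilinear_ext_tmul fun x y => by
    simp [H]
  exact LinearMap.congr_fun₂ this z z'

theorem bilinBaseChange_comp_left {K : Type} [Field K] {R : Type} [CommRing R] [Algebra K R]
    {M N Q Q' : Type*} [AddCommGroup M] [Module K M] [AddCommGroup N] [Module K N] [AddCommGroup Q]
    [Module K Q] [AddCommGroup Q'] [Module K Q'] {p : M →ₗ[K] N →ₗ[K] Q} {p' : M →ₗ[K] N →ₗ[K] Q'}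
    {f : Module.End K M} {h : Q →ₗ[K] Q'} (H : ∀ x y, p' (f x) y = h (p x y)) (z : R ⊗[K] M)
    (z' : R ⊗[K] N) :
    bilinBaseChange R p' (f.baseChange R z) z' = h.baseChange R (bilinBaseChange R p z z') := by
  have : (bilinBaseChange R p').comp (f.baseChange R) =
      (bilinBaseChange R p).compr₂ (h.baseChange R) := bilinear_ext_tmul fun x y => by
    simp [H]
  exact LinearMap.congr_fun₂ this z z'

namespace PolarizedDatum

open CyclicDatum CyclicDatum.AMod

variable {k : Type} [Field k] {F : Type u} [CommRing F] [Algebra k F]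
  {D : PolarizedDatum.{u, v} k F}

theorem finite_mult_k₀ [Nontrivial F] [CharZero k] [Module.Finite k F]
    (A : D.toCyclicDatum.Splitting) {S : AMod.{u, w} D.toCyclicDatum} {i : D.I}
    (hS : S.IsSimpleAt i) : Module.Finite D.k₀ (D.Mult S) := by
  obtain ⟨s, hs, hs0⟩ := A.exists_mem_Fix_ne_zero hS
  have h0 := D.finite_k₀
  have h1 : Module.Finite F D.V := D.finite_V
  have h2 : Module.Finite k D.V := Module.Finite.trans F D.V
  have h3 : Module.Finite D.k₀ D.V := Module.Finite.trans k D.V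
  let f : D.Mult S →ₗ[D.k₀] D.V :=
    { toFun := fun x => x.1 s
      map_add' := fun _ _ => rfl
      map_smul' := fun _ _ => rfl }
  exact Module.Finite.of_injective f fun x y h => A.AHom_ext hS hs hs0 h

/-- Any functional with `τ(1) ≠ 0` works, as every non-zero `z` has `1` among its multiples. It
makes pairings with values in `L_i` into pairings with values in `k^σ` without losing
non-degeneracy. -/
theorem exists_functional (i : D.I) : ∃ τ : D.Li i →ₗ[D.k₀] D.k₀, ∀ z, (∀ l : D.L, τ (l • z) = 0) →
    z = 0 := by
  obtain ⟨τ, hτ⟩ : ∃ τ : Module.Dual D.k₀ (D.Li i), τ 1 ≠ 0 := by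
    by_contra! h
    exact one_ne_zero ((Module.forall_dual_apply_eq_zero_iff D.k₀ (1 : D.Li i)).mp h)
  refine ⟨τ, fun z hz => ?_⟩
  by_contra hz0
  obtain ⟨l, rfl⟩ := D.algebraMap_Li_surjective i z
  rw [D.algebraMap_Li_eq_zero] at hz0
  obtain ⟨l', hl'⟩ := D.exists_inv_of_not_mem hz0
  apply hτ
  rw [← hz l', smul_algebraMap_Li]
  congr 1
  rw [← sub_eq_zero, ← map_one (algebraMap D.L (D.Li i)), ← map_sub, D.algebraMap_Li_eq_zero,
    ← neg_mem_iff, neg_sub]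
  exact hl'

variable [Nontrivial F] [CharZero k]

namespace GoodPairing

variable {S S' : AMod.{u, w} D.toCyclicDatum} {i : D.I} {B : S →ₗ[F] S' →ₛₗ[D.σ] F}
  (G : D.GoodPairing i B)

/-- The `k₀`-linear map `l ↦ B (l s, t)` on `L_i`. -/
def coeff (s : S) (t : S') : D.Li i →ₗ[D.k₀] F where
  toFun z := B (D.lift i z • s) t
  map_add' z z' := by
    rw [← LinearMap.add_apply, ← map_add, ← add_smul]
    refine (G.algebraMap_eq_iff _ _).mpr ?_ s t
    rw [map_add, algebraMap_lift, algebraMap_lift, algebraMap_lift]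
  map_smul' a z := by
    have h : B (D.lift i (a • z) • s) t = B ((algebraMap k D.L (a : k) * D.lift i z) • s) t :=
      (G.algebraMap_eq_iff _ _).mpr (by
        rw [← k₀_smul_algebraMap_Li, algebraMap_lift, algebraMap_lift]) s t
    rw [h, mul_smul, algebraMap_smul, k_smul_def, map_smul, LinearMap.smul_apply]
    exact algebraMap_smul F (a : k) _

theorem coeff_injective (z : D.Li i) (h : ∀ st : S × S', G.coeff st.1 st.2 z = 0) : z = 0 := by
  rw [← algebraMap_lift i z, ← map_zero (algebraMap D.L (D.Li i)), ← G.algebraMap_eq_iff]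
  intro s t
  rw [zero_smul, map_zero]
  exact h (s, t)

end GoodPairing

/-- `x ↦ ε σ(x)` on `F`. -/
def swapLin (D : PolarizedDatum.{u, v} k F) : F →ₗ[D.k₀] F where
  toFun x := ((D.ε : ℤ) : F) * D.σ x
  map_add' x y := by rw [map_add, mul_add]
  map_smul' a x := by
    change _ * D.σ ((a : k) • x) = (a : k) • _
    rw [Algebra.smul_def, map_mul, D.σ_algebraMap, mem_k₀.mp a.2, mul_left_comm, Algebra.smul_def]

theorem formBil_swap {R : Type} [CommRing R] [Algebra D.k₀ R] (z z' : R ⊗[D.k₀] D.V) :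
    bilinBaseChange R D.formBil z z' =
      D.swapLin.baseChange R (bilinBaseChange R D.formBil z' z) := by
  have h := bilinBaseChange_comp (R := R) (p := D.formBil.flip) (p' := D.formBil)
    (f := LinearMap.id) (g := LinearMap.id) (h := D.swapLin) (fun x y => D.form_swap x y) z z'
  simp only [LinearMap.baseChange_id, LinearMap.id_apply] at h
  rwa [bilinBaseChange_flip] at h

namespace Choices

variable (C : Choices.{u, v, w} D) {R : Type} [CommRing R] [Algebra D.k₀ R]

variable (R) in
/-- The `R`-bilinear extension of the pairing of `M_i` and `M_j`, for `j = i†`. -/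
abbrev pairR (i j : D.I) : R ⊗[D.k₀] C.M i →ₗ[R] R ⊗[D.k₀] C.M j →ₗ[R] R ⊗[D.k₀] D.Li i :=
  bilinBaseChange R (D.pairing i (C.B i j))

variable {C}

theorem formBil_ev (A : D.toCyclicDatum.Splitting) {i j : D.I} (h : D.dag i = j) (s : C.S i)
    (t : C.S j) (z : R ⊗[D.k₀] C.M i) (z' : R ⊗[D.k₀] C.M j) :
    bilinBaseChange R D.formBil ((C.ev i s).baseChange R z) ((C.ev j t).baseChange R z') =
      ((C.good h).coeff s t).baseChange R (C.pairR R i j z z') :=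
  bilinBaseChange_comp (fun x y =>
    (C.good h).isInduced_pairing A x y s t _ (algebraMap_lift i _)) z z'

theorem formBil_ev_of_ne (A : D.toCyclicDatum.Splitting) {i j : D.I} (h : D.dag i ≠ j) (s : C.S i)
    (t : C.S j) (z : R ⊗[D.k₀] C.M i) (z' : R ⊗[D.k₀] C.M j) :
    bilinBaseChange R D.formBil ((C.ev i s).baseChange R z) ((C.ev j t).baseChange R z') = 0 := by
  rw [bilinBaseChange_comp (p := (0 : C.M i →ₗ[D.k₀] C.M j →ₗ[D.k₀] F)) (h := 0) fun x y =>
    D.form_eq_zero A.K (C.isSimpleAt i) (C.isSimpleAt j) h x y s t, LinearMap.baseChange_zero,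
    LinearMap.zero_apply]

variable (C) in
/-- `f` and `f'` are contragredient for the pairing of `M_i` and `M_j`. -/
def IsIsometric (i j : D.I) (f : (R ⊗[D.k₀] C.M i) ≃ₗ[R] (R ⊗[D.k₀] C.M i))
    (f' : (R ⊗[D.k₀] C.M j) ≃ₗ[R] (R ⊗[D.k₀] C.M j)) : Prop :=
  ∀ z z', C.pairR R i j (f z) (f' z') = C.pairR R i j z z'

/-- The pairings attached to `i` and to `i†` are compared through the form on `V`: composed with the
jointly injective maps `coeff`, both become values of that form, which is `ε`-Hermitian. -/
theorem IsIsometric.swap (A : D.toCyclicDatum.Splitting) {i j : D.I} (h : D.dag i = j)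
    {f : (R ⊗[D.k₀] C.M i) ≃ₗ[R] (R ⊗[D.k₀] C.M i)}
    {f' : (R ⊗[D.k₀] C.M j) ≃ₗ[R] (R ⊗[D.k₀] C.M j)} (H : C.IsIsometric i j f f') :
    C.IsIsometric j i f' f := by
  intro z z'
  have h' : D.dag j = i := by rw [← h, dag_dag]
  refine eq_of_baseChange (fun st : C.S j × C.S i => (C.good h').coeff st.1 st.2)
    (C.good h').coeff_injective fun st => ?_
  rw [← formBil_ev A h', ← formBil_ev A h', formBil_swap, formBil_ev A h, H, ← formBil_ev A h,
    ← formBil_swap]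

/-- Parts at `i` and `j` interact only for `j = i†`, and there the form on `V` is the pairing of
`M_i` and `M_j` followed by the maps `coeff`, which remain jointly injective over `R`. -/
theorem mem_isometryPoints_iff (A : D.toCyclicDatum.Splitting) (Fr : Frame C.S D.V)
    {g : (R ⊗[D.k₀] D.V) ≃ₗ[R] (R ⊗[D.k₀] D.V)}
    {f : ∀ i, (R ⊗[D.k₀] C.M i) ≃ₗ[R] (R ⊗[D.k₀] C.M i)} (hg : ∀ i, C.IsComponent g i (f i)) :
    g ∈ isometryPoints R D.formBil ↔ ∀ i j, D.dag i = j → C.IsIsometric i j (f i) (f j) := by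
  constructor
  · intro H i j h z z'
    refine eq_of_baseChange (fun st : C.S i × C.S j => (C.good h).coeff st.1 st.2)
      (C.good h).coeff_injective fun st => ?_
    rw [← formBil_ev A h, ← formBil_ev A h, ← hg, ← hg, ← baseChange_eq_bilinBaseChange,
      ← baseChange_eq_bilinBaseChange, H]
  · intro H
    have key : (bilinBaseChange R D.formBil).compl₁₂ g.toLinearMap g.toLinearMap =
        bilinBaseChange R D.formBil := by
      refine linear_ext_ev Fr fun i s z => linear_ext_ev Fr fun j t z' => ?_
      rw [LinearMap.compl₁₂_apply, LinearEquiv.coe_coe, hg, hg]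
      by_cases h : D.dag i = j
      · rw [formBil_ev A h, H i j h, formBil_ev A h]
      · rw [formBil_ev_of_ne A h, formBil_ev_of_ne A h]
    intro z z'
    rw [baseChange_eq_bilinBaseChange, baseChange_eq_bilinBaseChange]
    exact LinearMap.congr_fun₂ key z z'

/-- The contragredient `f'` is the adjoint of `f⁻¹` for the `k^σ`-valued pairing `τ ∘ {,}`.
Multiplying by all `l ∈ L` before applying `τ` recovers the identity for the pairing with values in
`L_i`. -/
theorem exists_isIsometric [Module.Finite k F] (A : D.toCyclicDatum.Splitting) {i j : D.I}
    (h : D.dag i = j) {f : (R ⊗[D.k₀] C.M i) ≃ₗ[R] (R ⊗[D.k₀] C.M i)}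
    (hf : f ∈ glPoints (k₀ := D.k₀) (M := C.M i) R D.L) :
    ∃ f' ∈ glPoints (k₀ := D.k₀) (M := C.M j) R D.L, C.IsIsometric i j f f' := by
  obtain ⟨τ, hτ⟩ := D.exists_functional i
  have G := C.good h
  have hfin := finite_mult_k₀ A (C.isSimpleAt i)
  let p : C.M i →ₗ[D.k₀] C.M j →ₗ[D.k₀] D.k₀ := (D.pairing i (C.B i j)).compr₂ τ
  have hp : ∀ x y, p x y = τ (D.pairing i (C.B i j) x y) := fun _ _ => rfl
  have hr : ∀ y, (∀ x, p x y = 0) → y = 0 := fun y hy =>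
    C.pairing_nondegenerate_right A h y fun x => hτ _ fun l => by
      rw [← G.pairing_smul_left A, ← hp, hy]
  have hl : ∀ x, (∀ y, p x y = 0) → x = 0 := fun x hx =>
    C.pairing_nondegenerate_left A h x fun y => hτ _ fun l => by
      rw [← D.sigmaC_sigmaC l, ← G.pairing_smul_right A, ← hp, hx]
  obtain ⟨a, ha⟩ := exists_adjoint p hl hr f.symm.toLinearMap
  obtain ⟨b, hb⟩ := exists_adjoint p hl hr f.toLinearMap
  have ha : ∀ z z', bilinBaseChange R p (f.symm z) z' = bilinBaseChange R p z (a z') := ha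
  have hb : ∀ z z', bilinBaseChange R p (f z) z' = bilinBaseChange R p z (b z') := hb
  have hf' : ∀ l z, f.symm ((multMul l).baseChange R z) = (multMul l).baseChange R (f.symm z) :=
    fun l z => (inv_mem hf) _ ⟨l, rfl⟩ z
  refine ⟨LinearEquiv.ofLinearMap a b ?_ ?_, ?_, fun z z' => ?_⟩
  · refine LinearMap.ext fun z => eq_of_bilinBaseChange_right p hr fun z₀ => ?_
    rw [LinearMap.comp_apply, ← ha, ← hb, f.apply_symm_apply, LinearMap.id_apply]
  · refine LinearMap.ext fun z => eq_of_bilinBaseChange_right p hr fun z₀ => ?_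
    rw [LinearMap.comp_apply, ← hb, ← ha, f.symm_apply_apply, LinearMap.id_apply]
  · rintro _ ⟨l, rfl⟩ z
    have hadj : ∀ x y, p (multMul (D.sigmaC l) x) y = p x (multMul l y) := fun x y => by
      change p (D.sigmaC l • x) y = p x (l • y)
      rw [hp, hp, G.pairing_smul_left A, G.pairing_smul_right A]
    refine eq_of_bilinBaseChange_right p hr fun z₀ => ?_
    change bilinBaseChange R p z₀ (a ((multMul l).baseChange R z)) =
      bilinBaseChange R p z₀ ((multMul l).baseChange R (a z))
    rw [← ha, ← bilinBaseChange_adjoint hadj, ← bilinBaseChange_adjoint hadj, ← ha, hf']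
  · let m : D.L → D.Li i →ₗ[D.k₀] D.k₀ := fun l =>
      τ ∘ₗ Module.toModuleEnd D.k₀ (S := D.L) (D.Li i) l
    have hm : ∀ q, (∀ l, m l q = 0) → q = 0 := fun q hq => hτ q hq
    have hpm : ∀ l x y, p (multMul l x) y = m l (D.pairing i (C.B i j) x y) := fun l x y =>
      congrArg τ (G.pairing_smul_left A l x y)
    have key : ∀ (l : D.L) z z', (m l).baseChange R (C.pairR R i j z z') =
        bilinBaseChange R p ((multMul l).baseChange R z) z' := fun l z z' =>
      (bilinBaseChange_comp_left (hpm l) z z').symm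
    refine eq_of_baseChange m hm fun l => ?_
    have e : bilinBaseChange R p ((multMul l).baseChange R (f z)) (a z') =
        bilinBaseChange R p ((multMul l).baseChange R z) z' := by
      rw [← ha, hf', f.symm_apply_apply]
    exact (key l (f z) (a z')).trans (e.trans (key l z z').symm)

theorem isIsometric_iff_mem {i : D.I} {f : (R ⊗[D.k₀] C.M i) ≃ₗ[R] (R ⊗[D.k₀] C.M i)} :
    f ∈ isometryPoints R (C.form i) ↔ C.IsIsometric i i f f := by
  refine forall₂_congr fun z z' => ?_
  rw [baseChange_eq_bilinBaseChange, baseChange_eq_bilinBaseChange]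
  rfl

theorem mem_vertexFactor_iff {i : D.I} {f : (R ⊗[D.k₀] C.M i) ≃ₗ[R] (R ⊗[D.k₀] C.M i)} :
    f ∈ C.vertexFactor i R ↔ f ∈ glPoints (k₀ := D.k₀) (M := C.M i) R D.L ∧
      (D.dag i = i → C.IsIsometric i i f f) := by
  rw [vertexFactor, Subgroup.mem_inf, Subgroup.mem_iInf]
  simp_rw [isIsometric_iff_mem]

/-- Outside `P` take the contragredient of the component at the dual vertex. If `i` and `i†` both
lie in `P`, they coincide and the definition of the vertex factor gives the isometry condition. -/
theorem exists_extension [Module.Finite k F] (A : D.toCyclicDatum.Splitting) {P : Set D.I}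
    (hP : ∀ i, i ∈ P ∨ D.dag i ∈ P) (hP' : ∀ i, i ∈ P → D.dag i ∈ P → D.dag i = i)
    (t : ∀ i : P, C.vertexFactor i.1 R) :
    ∃ f : ∀ i, (R ⊗[D.k₀] C.M i) ≃ₗ[R] (R ⊗[D.k₀] C.M i),
      (∀ i (hi : i ∈ P), f i = (t ⟨i, hi⟩).1) ∧
      (∀ i, f i ∈ glPoints (k₀ := D.k₀) (M := C.M i) R D.L) ∧
      ∀ i j, D.dag i = j → C.IsIsometric i j (f i) (f j) := by
  classical
  have hcon : ∀ i, i ∉ P → ∃ f' ∈ glPoints (k₀ := D.k₀) (M := C.M i) R D.L,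
      ∀ hi : D.dag i ∈ P, C.IsIsometric (D.dag i) i (t ⟨D.dag i, hi⟩).1 f' := by
    intro i hi
    have hi' := (hP i).resolve_left hi
    obtain ⟨f', h1, h2⟩ := exists_isIsometric (C := C) A (dag_dag D i)
      (mem_vertexFactor_iff.mp (t ⟨D.dag i, hi'⟩).2).1
    exact ⟨f', h1, fun _ => h2⟩
  choose c hcgl hc using hcon
  let F' : ∀ i, (R ⊗[D.k₀] C.M i) ≃ₗ[R] (R ⊗[D.k₀] C.M i) := fun i =>
    if hi : i ∈ P then (t ⟨i, hi⟩).1 else c i hi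
  have hF1 : ∀ i (hi : i ∈ P), F' i = (t ⟨i, hi⟩).1 := fun i hi => dif_pos hi
  have hF2 : ∀ i (hi : i ∉ P), F' i = c i hi := fun i hi => dif_neg hi
  have hFgl : ∀ i, F' i ∈ glPoints (k₀ := D.k₀) (M := C.M i) R D.L := by
    intro i
    by_cases hi : i ∈ P
    · rw [hF1 i hi]
      exact (mem_vertexFactor_iff.mp (t ⟨i, hi⟩).2).1
    · rw [hF2 i hi]
      exact hcgl i hi
  have hFiso' : ∀ i j, D.dag i = j → i ∈ P → C.IsIsometric i j (F' i) (F' j) := by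
    intro i j h hi
    by_cases hj : j ∈ P
    · have hij : D.dag i = i := hP' i hi (h ▸ hj)
      obtain rfl : j = i := h.symm.trans hij
      rw [hF1 j hj]
      exact (mem_vertexFactor_iff.mp (t ⟨j, hi⟩).2).2 hij
    · obtain rfl : i = D.dag j := by rw [← h, dag_dag]
      rw [hF1 _ hi, hF2 j hj]
      exact hc j hj hi
  have hFiso : ∀ i j, D.dag i = j → C.IsIsometric i j (F' i) (F' j) := by
    intro i j h
    rcases hP i with hi | hi
    · exact hFiso' i j h hi
    · have h' : D.dag j = i := by rw [← h, dag_dag]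
      exact (hFiso' j i h' (h ▸ hi)).swap A h'
  exact ⟨F', hF1, hFgl, hFiso⟩

/-- By non-degeneracy, a component outside `P` is determined by the one at the dual vertex. -/
theorem eq_one_of_components (A : D.toCyclicDatum.Splitting) (Fr : Frame C.S D.V) {P : Set D.I}
    (hP : ∀ i, i ∈ P ∨ D.dag i ∈ P) {g : (R ⊗[D.k₀] D.V) ≃ₗ[R] (R ⊗[D.k₀] D.V)}
    {f : ∀ i, (R ⊗[D.k₀] C.M i) ≃ₗ[R] (R ⊗[D.k₀] C.M i)} (hf : ∀ i, C.IsComponent g i (f i))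
    (hiso : ∀ i j, D.dag i = j → C.IsIsometric i j (f i) (f j)) (h1 : ∀ i ∈ P, f i = 1) :
    g = 1 := by
  have h2 : ∀ i z, f i z = z := by
    intro i z
    rcases hP i with hi | hi
    · rw [h1 i hi]
      rfl
    · refine eq_of_bilinBaseChange_right (D.pairing (D.dag i) (C.B (D.dag i) i))
        (C.pairing_nondegenerate_right A (dag_dag D i)) fun z₀ => ?_
      have := hiso (D.dag i) i (dag_dag D i) z₀ z
      rw [h1 _ hi] at this
      exact this
  have h3 : g.toLinearMap = LinearMap.id := linear_ext_ev Fr fun i u z => by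
    rw [LinearEquiv.coe_coe, hf, h2, LinearMap.id_apply]
  exact LinearEquiv.ext fun z => LinearMap.congr_fun h3 z

/-- The components of the elements of `H`. -/
theorem exists_component_hom (A : D.toCyclicDatum.Splitting) (Fr : Frame C.S D.V) (a₀ : Fin D.n)
    (R : Type) [CommRing R] [Algebra D.k₀ R] (i : D.I) :
    ∃ Φ : D.H R →* C.vertexFactor i R, ∀ g : D.H R, C.IsComponent g.1 i (Φ g).1 := by
  choose f hfgl hf using fun (g : D.H R) (i : D.I) =>
    exists_isComponent (C := C) Fr a₀ (Subgroup.mem_inf.mp g.2).1 i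
  have hiso : ∀ g i j, D.dag i = j → C.IsIsometric i j (f g i) (f g j) := fun g =>
    (mem_isometryPoints_iff A Fr (hf g)).mp (Subgroup.mem_inf.mp g.2).2
  have hmul : ∀ g g', f (g * g') i = f g i * f g' i := fun g g' =>
    (hf (g * g') i).unique Fr (fun u z => by
      change g.1 (g'.1 _) = _
      rw [hf g', hf g]
      rfl) a₀
  exact ⟨MonoidHom.mk' (fun g => ⟨f g i, mem_vertexFactor_iff.mpr ⟨hfgl g i, hiso g i i⟩⟩)
    fun g g' => Subtype.ext (hmul g g'), fun g => hf g i⟩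

theorem exists_H_of_components (A : D.toCyclicDatum.Splitting) (Fr : Frame C.S D.V)
    {f : ∀ i, (R ⊗[D.k₀] C.M i) ≃ₗ[R] (R ⊗[D.k₀] C.M i)}
    (hf : ∀ i, f i ∈ glPoints (k₀ := D.k₀) (M := C.M i) R D.L)
    (hiso : ∀ i j, D.dag i = j → C.IsIsometric i j (f i) (f j)) :
    ∃ g : D.H R, ∀ i, C.IsComponent g.1 i (f i) := by
  obtain ⟨g, hg, hg'⟩ := exists_of_components Fr f hf
  exact ⟨⟨g, Subgroup.mem_inf.mpr ⟨hg, (mem_isometryPoints_iff A Fr hg').mpr hiso⟩⟩, hg'⟩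

variable (C) in
theorem hIsProduct [Module.Finite k F] (A : D.toCyclicDatum.Splitting) : C.HIsProduct := by
  intro P hP hP' R _ _
  obtain ⟨Fr⟩ := A.exists_frame C.isSimpleAt D.V
  let a₀ : Fin D.n := ⟨0, D.n_pos⟩
  choose Φ hΦ using exists_component_hom (C := C) A Fr a₀ R
  refine ⟨MulEquiv.ofBijective (MonoidHom.pi fun i : P => Φ i.1) ⟨?_, ?_⟩,
    fun g i u z => hΦ i.1 g u z⟩
  · rw [injective_iff_map_eq_one]
    intro g hg
    refine Subtype.ext (eq_one_of_components A Fr hP (fun i => hΦ i g)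
      ((mem_isometryPoints_iff A Fr fun i => hΦ i g).mp (Subgroup.mem_inf.mp g.2).2) fun i hi => ?_)
    exact congrArg Subtype.val (congrFun hg ⟨i, hi⟩)
  · intro t
    have h := exists_extension (C := C) (R := R) A hP hP' t
    obtain ⟨F', hF1, hFgl, hFiso⟩ := h
    have h' := exists_H_of_components A Fr hFgl hFiso
    obtain ⟨g, hg⟩ := h'
    refine ⟨g, funext fun i => Subtype.ext ?_⟩
    have h'' := (hΦ i.1 g).unique Fr (hg i.1) a₀
    exact h''.trans (hF1 i.1 i.2)

end Choices

end PolarizedDatum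

end LoopGrading

end

/-! ### Twisted isomorphisms and components of the elements of `𝔤(ξ)`. -/

noncomputable section

namespace LoopGrading

namespace PolarizedDatum

open CyclicDatum CyclicDatum.AMod

variable {k : Type} [Field k] {F : Type u} [CommRing F] [Algebra k F]
  {D : PolarizedDatum.{u, v} k F}

theorem mu_surjective [Nontrivial F] [CharZero k] : Function.Surjective D.mu := by
  intro l
  induction l using CyclicDatum.L_induction with
  | halg a => exact ⟨_, D.mu_algebraMap a⟩
  | hb =>
    refine ⟨algebraMap k D.L D.ν⁻¹ * D.b, ?_⟩
    rw [map_mul, mu_algebraMap, mu_b, ← mul_assoc, ← map_mul, inv_mul_cancel₀ D.ν_ne_zero, map_one,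
      one_mul]
  | hadd l l' h h' =>
    obtain ⟨m, rfl⟩ := h
    obtain ⟨m', rfl⟩ := h'
    exact ⟨m + m', map_add _ _ _⟩
  | hmul l l' h h' =>
    obtain ⟨m, rfl⟩ := h
    obtain ⟨m', rfl⟩ := h'
    exact ⟨m * m', map_mul _ _ _⟩

/-- As `σ_c` inverts `b` and `σ(ν) = ν`, the two factors `ν` cancel. It follows that `†` reverses
arrows and that `μ_ξ σ_c = σ_{cξ⁻¹}` is an involution. -/
theorem mu_sigmaC_mu [Nontrivial F] [CharZero k] (l : D.L) :
    D.mu (D.sigmaC (D.mu l)) = D.sigmaC l := by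
  induction l using CyclicDatum.L_induction with
  | halg a => rw [mu_algebraMap, sigmaC_algebraMap, mu_algebraMap]
  | hb =>
    have h1 : D.mu D.bInv * (algebraMap k D.L D.ν * D.b) = 1 := by
      rw [← mu_b, ← map_mul, mul_comm, b_mul_bInv, map_one]
    have h2 : algebraMap k D.L D.ν * D.mu D.bInv = D.bInv := by
      calc algebraMap k D.L D.ν * D.mu D.bInv
          = algebraMap k D.L D.ν * D.mu D.bInv * (D.b * D.bInv) := by rw [b_mul_bInv, mul_one]
        _ = D.mu D.bInv * (algebraMap k D.L D.ν * D.b) * D.bInv := by ring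
        _ = D.bInv := by rw [h1, one_mul]
    rw [mu_b, map_mul, sigmaC_algebraMap, σk_ν, sigmaC_b, map_mul, map_mul, mu_algebraMap,
      mu_algebraMap, mul_left_comm, h2]
  | hadd l l' h h' => rw [map_add, map_add, map_add, map_add, h, h']
  | hmul l l' h h' => rw [map_mul, map_mul, map_mul, map_mul, h, h']

theorem dag_rot_involutive [Nontrivial F] [CharZero k] (j : D.I) :
    D.dag (D.rot (D.dag (D.rot j))) = j := by
  apply PrimeSpectrum.ext
  ext l
  change D.mu (D.sigmaC (D.mu (D.sigmaC l))) ∈ j.asIdeal ↔ _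
  rw [mu_sigmaC_mu, sigmaC_sigmaC]

section Twist

variable {S S' : AMod.{u, w} D.toCyclicDatum} {η : S ≃ₗ[F] S'} (hη : D.IsTwistIso η)

include hη

theorem twist_T (u : S) : S'.T (η u) = (D.ξ : F) • η (S.T u) := by
  rw [← hη, map_smul]

theorem twist_symm_T (u : S') : η.symm (S'.T u) = (D.ξ : F) • S.T (η.symm u) := by
  rw [η.symm_apply_eq, hη, η.apply_symm_apply]

theorem twist_T_iterate (j : ℕ) (u : S) : S'.T^[j] (η u) =
    (∏ i ∈ Finset.range j, (D.ζ ^ i) (D.ξ : F)) • η (S.T^[j] u) := by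
  induction j with
  | zero => simp
  | succ j ih =>
    rw [Function.iterate_succ_apply', ih, S'.T_smul, twist_T hη, Function.iterate_succ_apply',
      smul_smul, map_prod, Finset.prod_range_succ']
    simp_rw [← ζ_pow_apply_succ]
    rfl

variable [Nontrivial F] [CharZero k]

/-- Iterating the twisted commutation relation `n` times produces `Nm(ξ) = ν`, so `b` on `S'`
corresponds to `ν b` on `S`. -/
theorem twist_mu_smul (K : D.toCyclicDatum.KummerGenerator) (l : D.L) (u : S) :
    η (D.mu l • u) = l • η u := by
  revert u
  induction l using CyclicDatum.L_induction with
  | halg a =>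
    intro u
    rw [mu_algebraMap, algebraMap_smul, algebraMap_smul, k_smul_def, map_smul, k_smul_def]
  | hb =>
    intro u
    have h := twist_T_iterate hη D.n u
    rw [T_iterate_n, T_iterate_n, ← K.norm_eq_prod] at h
    rw [h, mu_b, mul_smul, algebraMap_smul, k_smul_def, map_smul]
    rfl
  | hadd l l' h h' =>
    intro u
    rw [map_add, add_smul, map_add, h, h', add_smul]
  | hmul l l' h h' =>
    intro u
    rw [map_mul, mul_smul, h, h', mul_smul]

theorem twist_symm_smul (K : D.toCyclicDatum.KummerGenerator) (l : D.L) (u : S') :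
    η.symm (l • u) = D.mu l • η.symm u := by
  rw [η.symm_apply_eq, twist_mu_smul hη K, η.apply_symm_apply]

end Twist

namespace Choices

variable (C : Choices.{u, v, w} D)

/-- `φ` is the component at `j` of the endomorphism `Φ` of `V`. -/
def IsArrowComponent (Φ : Module.End F D.V) (j : D.I) (φ : C.M j →ₗ[D.k₀] C.M (D.rot j)) : Prop :=
  ∀ (x : C.M j) (u : C.S j), Φ (x.1 u) = (φ x).1 (C.η j u)

variable {C}

theorem IsArrowComponent.unique {Φ : Module.End F D.V} {j : D.I}
    {φ φ' : C.M j →ₗ[D.k₀] C.M (D.rot j)} (h : C.IsArrowComponent Φ j φ)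
    (h' : C.IsArrowComponent Φ j φ') : φ = φ' := by
  refine LinearMap.ext fun x => Subtype.ext (LinearMap.ext fun u => ?_)
  obtain ⟨u, rfl⟩ := (C.η j).surjective u
  rw [← h, ← h']

variable (C) in
/-- `φ` and `φ'`, at the arrows `j` and `j'`, are opposite of each other's adjoints. -/
def IsSkew (j j' : D.I) (φ : C.M j →ₗ[D.k₀] C.M (D.rot j))
    (φ' : C.M j' →ₗ[D.k₀] C.M (D.rot j')) : Prop :=
  ∀ x y u t, D.form ((φ x).1 (C.η j u)) (y.1 t) + D.form (x.1 u) ((φ' y).1 (C.η j' t)) = 0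

theorem IsSkew.swap {j j' : D.I} {φ : C.M j →ₗ[D.k₀] C.M (D.rot j)}
    {φ' : C.M j' →ₗ[D.k₀] C.M (D.rot j')} (h : C.IsSkew j j' φ φ') : C.IsSkew j' j φ' φ := by
  intro x y u t
  have := congrArg (fun z => ((D.ε : ℤ) : F) * D.σ z) (h y x t u)
  simp only [map_add, mul_add, map_zero, mul_zero] at this
  rw [← D.form_swap, ← D.form_swap, add_comm] at this
  exact this

variable [Nontrivial F] [CharZero k]

/-- The component is `x ↦ Φ ∘ x ∘ η⁻¹`: the factors `ξ` from `Φ` and from `η` cancel, so this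
commutes with `θ`. -/
theorem exists_isArrowComponent (K : D.toCyclicDatum.KummerGenerator) {Φ : Module.End F D.V}
    (hΦ : ∀ x, D.V.T (Φ x) = (D.ξ : F) • Φ (D.V.T x)) (j : D.I) :
    ∃ φ ∈ D.TwHom (C.S j) (C.S (D.rot j)), C.IsArrowComponent Φ j φ := by
  refine ⟨
    { toFun := fun x => ⟨Φ ∘ₗ x.1 ∘ₗ (C.η j).symm.toLinearMap, fun u => ?_⟩
      map_add' := fun x x' => Subtype.ext (LinearMap.ext fun u => map_add Φ _ _)
      map_smul' := fun a x => Subtype.ext (LinearMap.ext fun u => ?_) }, fun l x => ?_, fun x u => ?_⟩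
  · change Φ (x.1 ((C.η j).symm _)) = D.V.T (Φ (x.1 ((C.η j).symm u)))
    rw [twist_symm_T (C.η_T j), map_smul, map_smul, x.2, hΦ]
  · change Φ (algebraMap k F (a : k) • x.1 ((C.η j).symm u)) =
      algebraMap k F (a : k) • Φ (x.1 ((C.η j).symm u))
    rw [map_smul]
  · refine Subtype.ext (LinearMap.ext fun u => ?_)
    rw [AHom_smul_apply]
    change Φ ((D.mu l • x).1 ((C.η j).symm u)) = Φ (x.1 ((C.η j).symm (l • u)))
    rw [twist_symm_smul (C.η_T j) K, AHom_smul_apply]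
  · change _ = Φ (x.1 ((C.η j).symm (C.η j u)))
    rw [LinearEquiv.symm_apply_apply]

/-- `Φ` is defined by the coordinates of a frame. It has the right effect on all of `S_j ⊗ M_j`
because the semilinearity demanded in `TwHom` matches that of `η` over `L`. -/
theorem exists_of_arrowComponents (A : D.toCyclicDatum.Splitting)
    (φ : ∀ j, C.M j →ₗ[D.k₀] C.M (D.rot j)) (hφ : ∀ j, φ j ∈ D.TwHom (C.S j) (C.S (D.rot j))) :
    ∃ Φ : Module.End F D.V, (∀ x, D.V.T (Φ x) = (D.ξ : F) • Φ (D.V.T x)) ∧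
      ∀ j, C.IsArrowComponent Φ j (φ j) := by
  obtain ⟨Fr⟩ := A.exists_frame C.isSimpleAt D.V
  let G : D.V →+ D.V :=
    { toFun := fun v => ∑ j, ∑ a, (φ j (Fr.q j a v)).1 (C.η j (Fr.u j a))
      map_zero' := by simp
      map_add' := fun v v' => by
        simp only [map_add]
        rw [← Finset.sum_add_distrib]
        refine Finset.sum_congr rfl fun j _ => ?_
        rw [← Finset.sum_add_distrib]
        rfl }
  have hG : ∀ j (x : C.M j) u, G (x.1 u) = (φ j x).1 (C.η j u) := by
    intro j x u
    change ∑ j', ∑ a, (φ j' (Fr.q j' a (x.1 u))).1 (C.η j' (Fr.u j' a)) = _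
    rw [Finset.sum_eq_single_of_mem j (Finset.mem_univ j)]
    · conv_rhs => rw [← Fr.expand_simple j u, map_sum, map_sum]
      refine Finset.sum_congr rfl fun a _ => ?_
      obtain ⟨l, hl⟩ := mu_surjective (Fr.lam j a u)
      rw [Fr.q_self, ← hl, hφ, twist_mu_smul (C.η_T j) A.K, AHom_smul_apply]
    · intro j' _ hj
      refine Finset.sum_eq_zero fun a _ => ?_
      rw [Fr.q_of_ne j' j hj.symm, map_zero]
      rfl
  have hext : ∀ N N' : D.V →+ D.V, (∀ j (x : C.M j) u, N (x.1 u) = N' (x.1 u)) → ∀ v, N v = N' v := by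
    intro N N' h v
    rw [← Fr.expand v]
    simp_rw [map_sum, h]
  refine ⟨⟨G.toAddHom, fun a v => ?_⟩, fun v => ?_, fun j => hG j⟩
  · refine hext (G.comp (DistribSMul.toAddMonoidHom _ a)) ((DistribSMul.toAddMonoidHom _ a).comp G)
      (fun j x u => ?_) v
    change G (a • x.1 u) = a • G (x.1 u)
    rw [← map_smul, hG, hG, map_smul, map_smul]
  · refine hext (D.V.T.comp G) ((DistribSMul.toAddMonoidHom _ (D.ξ : F)).comp (G.comp D.V.T))
      (fun j x u => ?_) v
    change D.V.T (G (x.1 u)) = (D.ξ : F) • G (D.V.T (x.1 u))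
    rw [← x.2, hG, hG, ← (φ j x).2, ← map_smul, ← twist_T (C.η_T j)]

/-- As `Φ` moves the part at `j` to that at `ξ̄(j)`, both `⟨Φ x, y⟩` and `⟨x, Φ y⟩` vanish between
the parts at `j` and `j'` unless `j' = ξ̄(j)†`. -/
theorem skew_iff (A : D.toCyclicDatum.Splitting) {Φ : Module.End F D.V}
    {φ : ∀ j, C.M j →ₗ[D.k₀] C.M (D.rot j)} (hφ : ∀ j, C.IsArrowComponent Φ j (φ j)) :
    (∀ x y, D.form (Φ x) y + D.form x (Φ y) = 0) ↔
      ∀ j j', D.dag (D.rot j) = j' → C.IsSkew j j' (φ j) (φ j') := by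
  constructor
  · intro h j j' _ x y u t
    rw [← hφ, ← hφ, h]
  · intro h v v'
    obtain ⟨Fr⟩ := A.exists_frame C.isSimpleAt D.V
    let b : D.V →+ D.V →+ F := AddMonoidHom.mk' (fun v => AddMonoidHom.mk'
      (fun v' => D.form (Φ v) v' + D.form v (Φ v')) fun y y' => by
        rw [map_add, map_add, map_add, add_add_add_comm]) fun x x' => AddMonoidHom.ext fun y => by
        change D.form (Φ (x + x')) y + D.form (x + x') (Φ y) =
          (D.form (Φ x) y + D.form x (Φ y)) + (D.form (Φ x') y + D.form x' (Φ y))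
        rw [map_add, map_add, map_add, LinearMap.add_apply, LinearMap.add_apply, add_add_add_comm]
    have hb : ∀ j (x : C.M j) u j' (y : C.M j') t, b (x.1 u) (y.1 t) = 0 := by
      intro j x u j' y t
      change D.form (Φ (x.1 u)) (y.1 t) + D.form (x.1 u) (Φ (y.1 t)) = 0
      rw [hφ, hφ]
      by_cases hj : D.dag (D.rot j) = j'
      · exact h j j' hj x y u t
      · rw [D.form_eq_zero A.K (C.isSimpleAt _) (C.isSimpleAt _) hj,
          D.form_eq_zero A.K (C.isSimpleAt _) (C.isSimpleAt _), add_zero]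
        intro hj'
        apply hj
        rw [← dag_rot_involutive j', ← hj', dag_dag]
    change b v v' = 0
    rw [← Fr.expand v, ← Fr.expand v']
    rw [map_sum]
    refine Finset.sum_eq_zero fun j' _ => ?_
    rw [map_sum]
    refine Finset.sum_eq_zero fun a' _ => ?_
    rw [map_sum, AddMonoidHom.finsetSum_apply]
    refine Finset.sum_eq_zero fun j _ => ?_
    rw [map_sum, AddMonoidHom.finsetSum_apply]
    exact Finset.sum_eq_zero fun a' _ => hb _ _ _ _ _ _

/-- Admissible families of pairings are represented by elements of `M_{i†}`. -/
theorem exists_form_eq [Module.Finite k F] (A : D.toCyclicDatum.Splitting) {i j : D.I}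
    (h : D.dag i = j) (p : C.M i → C.S i →ₗ[F] C.S j →ₛₗ[D.σ] F)
    (hp : ∀ x, D.IsAdmissible (p x)) (hadd : ∀ x x', p (x + x') = p x + p x')
    (hsmul : ∀ (l : D.L) x s t, p (l • x) s t = p x (l • s) t) :
    ∃ y : C.M j, ∀ x s t, D.form (x.1 s) (y.1 t) = p x s t := by
  have G := C.good h
  choose f hf using fun x => G.exists_of_adm A (hp x)
  let Λ : C.M i →ₗ[D.L] D.Li i :=
    { toFun := fun x => algebraMap D.L (D.Li i) (f x)
      map_add' := fun x x' => by
        rw [← map_add, ← G.algebraMap_eq_iff]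
        intro s t
        rw [← hf, hadd, LinearMap.add_apply, LinearMap.add_apply, hf, hf, add_smul, map_add,
          LinearMap.add_apply]
      map_smul' := fun l x => by
        rw [RingHom.id_apply, smul_algebraMap_Li, ← G.algebraMap_eq_iff]
        intro s t
        rw [← hf, hsmul, hf, smul_smul, mul_comm] }
  obtain ⟨y, hy⟩ := C.exists_pairing_eq A h Λ
  refine ⟨y, fun x s t => ?_⟩
  rw [hf, (G.pairing_eq_iff A).mp (hy x)]

theorem eq_of_form_right (A : D.toCyclicDatum.Splitting) {i j : D.I} (h : D.dag i = j)
    {y y' : C.M j} (H : ∀ (x : C.M i) s t, D.form (x.1 s) (y.1 t) = D.form (x.1 s) (y'.1 t)) :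
    y = y' := by
  rw [← sub_eq_zero]
  refine Subtype.ext (LinearMap.ext fun t => C.eq_zero_of_form_right A h _ t fun x s => ?_)
  change D.form (x.1 s) (y.1 t - y'.1 t) = 0
  rw [map_sub, H, sub_self]

/-- The opposite of the adjoint of the component at an arrow. -/
theorem exists_isSkew [Module.Finite k F] (A : D.toCyclicDatum.Splitting) {j j' : D.I}
    (h : D.dag (D.rot j) = j') {φ : C.M j →ₗ[D.k₀] C.M (D.rot j)}
    (hφ : φ ∈ D.TwHom (C.S j) (C.S (D.rot j))) :
    ∃ φ' ∈ D.TwHom (C.S j') (C.S (D.rot j')), C.IsSkew j j' φ φ' := by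
  -- The dual arrow ends at `j†`, so the adjoint takes values in the space paired with `M_j`.
  have h' : D.dag j = D.rot j' := by rw [← h, ← dag_rot_involutive j, dag_dag, dag_rot_involutive]
  have key : ∀ y : C.M j', ∃ z : C.M (D.rot j'), ∀ (x : C.M j) s t, D.form (x.1 s) (z.1 t) =
      -D.form ((φ x).1 (C.η j s)) (y.1 ((C.η j').symm t)) := by
    intro y
    -- The family to be represented by an element of `M_{j†}`. It is admissible because the two
    -- twists contribute `ξ` and `σ(ξ) = ξ`, which cancel.
    refine exists_form_eq A h' (fun x => -(D.form.comp ((φ x).1 ∘ₗ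
      (C.η j).toLinearMap)).compl₂ (y.1 ∘ₗ (C.η j').symm.toLinearMap)) ?_ ?_ ?_
    · intro x s t
      change -D.form ((φ x).1 (C.η j ((C.S j).T s))) (y.1 ((C.η j').symm ((C.S _).T t))) =
        D.c * D.ζ (-D.form ((φ x).1 (C.η j s)) (y.1 ((C.η j').symm t)))
      have h1 : (D.ξ : F) • D.form ((φ x).1 (C.η j ((C.S j).T s)))
          (y.1 ((C.S j').T ((C.η j').symm t))) = D.c * D.ζ (D.form ((φ x).1 (C.η j s))
            (y.1 ((C.η j').symm t))) := by
        rw [← D.form_T, ← (φ x).2, ← y.2, twist_T (C.η_T j), map_smul, map_smul,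
          LinearMap.smul_apply]
      rw [twist_symm_T (C.η_T j'), map_smul, LinearMap.map_smulₛₗ, D.σ_ξ, h1, map_neg, mul_neg]
    · intro x x'
      ext s t
      change -D.form ((φ (x + x')).1 _) _ = -D.form ((φ x).1 _) _ + -D.form ((φ x').1 _) _
      have h1 : (φ (x + x')).1 (C.η j s) = (φ x).1 (C.η j s) + (φ x').1 (C.η j s) := by
        rw [map_add]
        rfl
      rw [LinearEquiv.coe_coe, h1, map_add, LinearMap.add_apply, neg_add]
    · intro l x s t
      change -D.form ((φ (l • x)).1 (C.η j s)) _ = -D.form ((φ x).1 (C.η j (l • s))) _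
      obtain ⟨l, rfl⟩ := mu_surjective l
      rw [hφ, AHom_smul_apply, twist_mu_smul (C.η_T j) A.K]
  choose f hf using key
  have hfu : ∀ (y : C.M j') (z : C.M (D.rot j')), (∀ (x : C.M j) s t, D.form (x.1 s) (z.1 t) =
      -D.form ((φ x).1 (C.η j s)) (y.1 ((C.η j').symm t))) → f y = z := fun y z hz =>
    eq_of_form_right A h' fun x s t => by rw [hf, hz]
  refine ⟨
    { toFun := f
      map_add' := fun y y' => hfu _ _ fun x s t => ?_
      map_smul' := fun a y => hfu _ _ fun x s t => ?_ }, fun l y => hfu _ _ fun x s t => ?_,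
    fun x y u t => ?_⟩
  · change D.form _ ((f y).1 t + (f y').1 t) = -D.form _ (y.1 _ + y'.1 _)
    rw [map_add, map_add, hf, hf, neg_add]
  · have h1 : ∀ v w : D.V, D.form v (a • w) = algebraMap k F (a : k) * D.form v w := fun v w => by
      rw [k₀_smul_def, k_smul_def, LinearMap.map_smulₛₗ, D.σ_algebraMap, mem_k₀.mp a.2, smul_eq_mul]
    change D.form _ (a • (f y).1 t) = -D.form _ (a • y.1 _)
    rw [h1, h1, hf, mul_neg]
  · change D.form (x.1 s) ((l • f y).1 t) = _
    rw [AHom_smul_apply, hf, twist_symm_smul (C.η_T j') A.K, AHom_smul_apply]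
  · change _ + D.form _ ((f y).1 _) = 0
    rw [hf, LinearEquiv.symm_apply_apply, add_neg_cancel]

end Choices

end PolarizedDatum

end LoopGrading

end

/-! ### The space `𝔤(ξ)` as a sum of its arrow factors. -/

noncomputable section

namespace LoopGrading

namespace PolarizedDatum

open CyclicDatum CyclicDatum.AMod

variable {k : Type} [Field k] {F : Type u} [CommRing F] [Algebra k F]
  {D : PolarizedDatum.{u, v} k F} [Nontrivial F] [CharZero k]

namespace Choices

variable {C : Choices.{u, v, w} D}

theorem dag_rot_eq_self_iff {j : D.I} : D.dag (D.rot j) = j ↔ D.rot j = D.dag j :=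
  ⟨fun h => by rw [← h, dag_dag, h], fun h => by rw [h, dag_dag]⟩

/-- `B (u, η v) = ε_e σ B (v, η u)` for `e = e†`. -/
theorem B_η (C : Choices.{u, v, w} D) {j : D.I} (h : D.rot j = D.dag j) (u v : C.S j) :
    C.B j (D.rot j) u (C.η j v) =
      ((C.εe j : ℤ) : F) * D.σ (C.B j (D.rot j) v (C.η j u)) := by
  rcases C.η_arrow j h with ⟨h1, h2⟩ | ⟨h1, h2, -⟩
  · rw [h1, h2 u v]
    simp
  · rw [h1, h2 u v]
    simp

theorem sigmaArrow_algebraMap {j : D.I} (h : D.rot j = D.dag j) (l : D.L) :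
    D.sigmaArrow j h (algebraMap D.L (D.Li j) l) = algebraMap D.L (D.Li j) (D.mu (D.sigmaC l)) :=
  rfl

theorem sigmaArrow_sigmaArrow {j : D.I} (h : D.rot j = D.dag j) (z : D.Li j) :
    D.sigmaArrow j h (D.sigmaArrow j h z) = z := by
  obtain ⟨l, rfl⟩ := D.algebraMap_Li_surjective j z
  rw [sigmaArrow_algebraMap, sigmaArrow_algebraMap, mu_sigmaC_mu, sigmaC_sigmaC]

/-- Lift `{y, φ x}` to `μ_ξ(m)` and put `δ = -ε ε_e`. The symmetry of the form on `V`, the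
adjunction for `B` and the symmetry of `η` turn `⟨φ(x)(η u), y(t)⟩` into `-B(δ σ_c(m) u, η t)`. So
skewness says that `{x, φ y}` is the class of `δ σ_c(m)`, and applying the involution `σ_{cξ⁻¹} =
μ_ξ σ_c` gives the stated symmetry. -/
theorem isSkew_self_iff (A : D.toCyclicDatum.Splitting) {j : D.I} (h : D.rot j = D.dag j)
    {φ : C.M j →ₗ[D.k₀] C.M (D.rot j)} : C.IsSkew j j φ φ ↔
      ∀ x y, D.pairing j (C.B j (D.rot j)) y (φ x) = ((-D.ε * C.εe j : ℤˣ) : ℤ) •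
        D.sigmaArrow j h (D.pairing j (C.B j (D.rot j)) x (φ y)) := by
  have G := C.good h.symm
  refine forall₂_congr fun x y => ?_
  obtain ⟨l, hl, hl'⟩ := G.exists_lift A y (φ x)
  obtain ⟨l₂, hl₂, hl₂'⟩ := G.exists_lift A x (φ y)
  obtain ⟨m, rfl⟩ := mu_surjective l
  let δ : ℤˣ := -D.ε * C.εe j
  have h1 : ∀ u t, D.form ((φ x).1 (C.η j u)) (y.1 t) =
      -C.B j (D.rot j) (((δ : ℤ) • D.sigmaC m) • u) (C.η j t) := by
    intro u t
    have h2 : D.σ (C.B j (D.rot j) (D.mu m • t) (C.η j u)) =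
        ((C.εe j : ℤ) : F) * C.B j (D.rot j) (D.sigmaC m • u) (C.η j t) := by
      rw [G.adjoint A.K (D.sigmaC m), sigmaC_sigmaC, ← twist_mu_smul (C.η_T j) A.K, C.B_η h u, ← mul_assoc,
        ← Int.cast_mul, Int.units_coe_mul_self, Int.cast_one, one_mul]
    rw [D.form_swap, hl', h2, smul_assoc, map_zsmul, LinearMap.smul_apply, zsmul_eq_mul, ← mul_assoc,
      ← Int.cast_mul, ← neg_mul, ← Int.cast_neg]
    congr 2
    simp [δ]
  have h3 : (∀ u t, D.form ((φ x).1 (C.η j u)) (y.1 t) +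
      D.form (x.1 u) ((φ y).1 (C.η j t)) = 0) ↔ algebraMap D.L (D.Li j) l₂ =
        algebraMap D.L (D.Li j) ((δ : ℤ) • D.sigmaC m) := by
    rw [← G.algebraMap_eq_iff]
    constructor
    · intro H u t
      obtain ⟨t, rfl⟩ := (C.η j).surjective t
      have := H u t
      rw [h1, hl₂', neg_add_eq_zero] at this
      exact this.symm
    · intro H u t
      rw [h1, hl₂', H, neg_add_cancel]
  have hδ : (δ : ℤ) * (δ : ℤ) = 1 := Int.units_coe_mul_self δ
  rw [h3, hl, hl₂]
  change _ ↔ _ = (δ : ℤ) • _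
  constructor
  · intro H
    rw [H, sigmaArrow_algebraMap, map_zsmul, map_zsmul, map_zsmul, sigmaC_sigmaC, smul_smul, hδ,
      one_smul]
  · intro H
    have := congrArg (D.sigmaArrow j h) H
    rw [map_zsmul, sigmaArrow_sigmaArrow, sigmaArrow_algebraMap, mu_sigmaC_mu] at this
    rw [map_zsmul, this, smul_smul, hδ, one_smul]

theorem mem_arrowFactor_iff (A : D.toCyclicDatum.Splitting) {j : D.I}
    {φ : C.M j →ₗ[D.k₀] C.M (D.rot j)} : φ ∈ C.arrowFactor j ↔
      φ ∈ D.TwHom (C.S j) (C.S (D.rot j)) ∧ (D.dag (D.rot j) = j → C.IsSkew j j φ φ) := by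
  rw [arrowFactor, Submodule.mem_inf, Submodule.mem_iInf]
  refine and_congr_right fun hφ => ?_
  simp_rw [dag_rot_eq_self_iff]
  refine forall_congr' fun h => ?_
  rw [isSkew_self_iff A h]
  exact and_iff_right hφ

/-- The components of the elements of `𝔤(ξ)`. -/
theorem exists_arrowComponent_hom (A : D.toCyclicDatum.Splitting) (j : D.I) :
    ∃ Ψ : D.gXi →ₗ[D.k₀] C.arrowFactor j, ∀ Φ : D.gXi, C.IsArrowComponent Φ.1 j (Ψ Φ).1 := by
  choose f hf hf' using fun (Φ : D.gXi) (j : D.I) =>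
    exists_isArrowComponent (C := C) A.K Φ.2.1 j
  have hskew : ∀ Φ j j', D.dag (D.rot j) = j' → C.IsSkew j j' (f Φ j) (f Φ j') := fun Φ =>
    (skew_iff A (hf' Φ)).mp Φ.2.2
  have hadd : ∀ Φ Φ', f (Φ + Φ') j = f Φ j + f Φ' j := fun Φ Φ' =>
    (hf' (Φ + Φ') j).unique fun x u =>
      (congrArg₂ (· + ·) (hf' Φ j x u) (hf' Φ' j x u) :)
  have hsmul : ∀ (a : D.k₀) Φ, f (a • Φ) j = a • f Φ j := fun a Φ =>
    (hf' (a • Φ) j).unique fun x u => (congrArg (a • ·) (hf' Φ j x u) :)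
  exact ⟨
    { toFun := fun Φ => ⟨f Φ j, (mem_arrowFactor_iff A).mpr ⟨hf Φ j, hskew Φ j j⟩⟩
      map_add' := fun Φ Φ' => Subtype.ext (hadd Φ Φ')
      map_smul' := fun a Φ => Subtype.ext (hsmul a Φ) },
    fun Φ => hf' Φ j⟩

theorem eq_zero_of_arrowComponents (A : D.toCyclicDatum.Splitting) {P : Set D.I}
    (hP : ∀ j, j ∈ P ∨ D.dag (D.rot j) ∈ P) {Φ : Module.End F D.V}
    {φ : ∀ j, C.M j →ₗ[D.k₀] C.M (D.rot j)} (hφ : ∀ j, C.IsArrowComponent Φ j (φ j))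
    (hskew : ∀ j j', D.dag (D.rot j) = j' → C.IsSkew j j' (φ j) (φ j')) (h0 : ∀ j ∈ P, φ j = 0) :
    Φ = 0 := by
  have h2 : ∀ j (x : C.M j) u, Φ (x.1 u) = 0 := by
    intro j x u
    rw [hφ]
    rcases hP j with hj | hj
    · rw [h0 j hj]
      rfl
    · refine C.eq_zero_of_form_left A rfl _ _ fun y t => ?_
      have := hskew j _ rfl x y u t
      rw [h0 _ hj] at this
      change D.form _ _ + D.form _ 0 = 0 at this
      rwa [map_zero, add_zero] at this
  obtain ⟨Fr⟩ := A.exists_frame C.isSimpleAt D.V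
  refine LinearMap.ext fun v => ?_
  rw [← Fr.expand v, map_sum]
  refine Finset.sum_eq_zero fun j _ => ?_
  rw [map_sum]
  exact Finset.sum_eq_zero fun a _ => h2 _ _ _

/-- Outside `P` the component is minus the adjoint of the one at the dual arrow, provided by
`exists_isSkew`; if both arrows lie in `P`, they are equal. -/
theorem exists_arrow_extension [Module.Finite k F] (A : D.toCyclicDatum.Splitting) {P : Set D.I}
    (hP : ∀ j, j ∈ P ∨ D.dag (D.rot j) ∈ P)
    (hP' : ∀ j, j ∈ P → D.dag (D.rot j) ∈ P → D.dag (D.rot j) = j)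
    (t : ∀ j : P, C.arrowFactor j.1) :
    ∃ φ : ∀ j, C.M j →ₗ[D.k₀] C.M (D.rot j), (∀ j (hj : j ∈ P), φ j = (t ⟨j, hj⟩).1) ∧
      (∀ j, φ j ∈ D.TwHom (C.S j) (C.S (D.rot j))) ∧
      ∀ j j', D.dag (D.rot j) = j' → C.IsSkew j j' (φ j) (φ j') := by
  classical
  have hcon : ∀ j, j ∉ P → ∃ φ' ∈ D.TwHom (C.S j) (C.S (D.rot j)),
      ∀ hj : D.dag (D.rot j) ∈ P, C.IsSkew (D.dag (D.rot j)) j (t ⟨_, hj⟩).1 φ' := by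
    intro j hj
    have hj' := (hP j).resolve_left hj
    obtain ⟨φ', h1, h2⟩ := exists_isSkew (C := C) A (dag_rot_involutive j)
      ((mem_arrowFactor_iff A).mp (t ⟨_, hj'⟩).2).1
    exact ⟨φ', h1, fun _ => h2⟩
  choose c hcT hc using hcon
  let φ : ∀ j, C.M j →ₗ[D.k₀] C.M (D.rot j) := fun j => if hj : j ∈ P then (t ⟨j, hj⟩).1 else c j hj
  have h1 : ∀ j (hj : j ∈ P), φ j = (t ⟨j, hj⟩).1 := fun j hj => dif_pos hj
  have h2 : ∀ j (hj : j ∉ P), φ j = c j hj := fun j hj => dif_neg hj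
  have hT : ∀ j, φ j ∈ D.TwHom (C.S j) (C.S (D.rot j)) := by
    intro j
    by_cases hj : j ∈ P
    · rw [h1 j hj]
      exact ((mem_arrowFactor_iff A).mp (t ⟨j, hj⟩).2).1
    · rw [h2 j hj]
      exact hcT j hj
  have hs' : ∀ j j', D.dag (D.rot j) = j' → j ∈ P → C.IsSkew j j' (φ j) (φ j') := by
    intro j j' h hj
    by_cases hj' : j' ∈ P
    · have hjj : D.dag (D.rot j) = j := hP' j hj (h ▸ hj')
      obtain rfl : j' = j := h.symm.trans hjj
      rw [h1 j' hj]
      exact ((mem_arrowFactor_iff A).mp (t ⟨j', hj⟩).2).2 hjj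
    · obtain rfl : j = D.dag (D.rot j') := by rw [← h, dag_rot_involutive]
      rw [h1 _ hj, h2 j' hj']
      exact hc j' hj' hj
  refine ⟨φ, h1, hT, fun j j' h => ?_⟩
  rcases hP j with hj | hj
  · exact hs' j j' h hj
  · exact (hs' j' j (by rw [← h, dag_rot_involutive]) (h ▸ hj)).swap

variable (C) in
theorem gXiIsSum [Module.Finite k F] (A : D.toCyclicDatum.Splitting) : C.GXiIsSum := by
  intro P hP hP'
  choose Ψ hΨ using exists_arrowComponent_hom (C := C) A
  refine ⟨LinearEquiv.ofBijective (LinearMap.pi fun j : P => Ψ j.1) ⟨?_, ?_⟩,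
    fun Φ j x u => hΨ j.1 Φ x u⟩
  · refine (injective_iff_map_eq_zero _).mpr fun Φ hΦ => ?_
    refine Subtype.ext (eq_zero_of_arrowComponents A hP (fun j => hΨ j Φ)
      ((skew_iff A fun j => hΨ j Φ).mp Φ.2.2) fun j hj => ?_)
    exact congrArg Subtype.val (congrFun hΦ ⟨j, hj⟩)
  · intro t
    have h := exists_arrow_extension (C := C) A hP hP' t
    obtain ⟨φ, h1, hT, hs⟩ := h
    have h' := exists_of_arrowComponents (C := C) A φ hT
    obtain ⟨Φ, hΦ, hΦ'⟩ := h'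
    let Φg : D.gXi := ⟨Φ, hΦ, (skew_iff A hΦ').mpr hs⟩
    refine ⟨Φg, funext fun j => Subtype.ext ?_⟩
    have h'' := (hΨ j.1 Φg).unique (hΦ' j.1)
    exact h''.trans (h1 j.1 j.2)

end Choices

end PolarizedDatum

end LoopGrading

end

/-! ### Types of fixed vertices. -/

noncomputable section

namespace LoopGrading

namespace PolarizedDatum

open CyclicDatum CyclicDatum.AMod

variable {k : Type} [Field k] {F : Type u} [CommRing F] [Algebra k F]
  {D : PolarizedDatum.{u, v} k F} [Nontrivial F] [CharZero k]

/-- A bilinear form on a simple module for which `L` acts by self-adjoint operators is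
symmetric. -/
theorem symm_of_self_adjoint (A : D.toCyclicDatum.Splitting) {S : AMod.{u, w} D.toCyclicDatum}
    {i : D.I} (hS : S.IsSimpleAt i) (b : S →+ S →+ F) (hl : ∀ (f : F) u t, b (f • u) t = f * b u t)
    (hr : ∀ (f : F) u t, b u (f • t) = f * b u t) (hL : ∀ (l : D.L) u t, b (l • u) t = b u (l • t))
    (u t : S) : b u t = b t u := by
  -- `S` is generated by `s` over the commutative ring `F ⊗ L`, whose elements are self-adjoint for
  -- `b`; so `b(e s, e' s) = b(s, e e' s)` is symmetric in `e` and `e'`.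
  obtain ⟨s, hs, hs0⟩ := A.exists_mem_Fix_ne_zero hS
  obtain ⟨e, rfl⟩ := A.exists_FL_smul hS hs hs0 u
  obtain ⟨e', rfl⟩ := A.exists_FL_smul hS hs hs0 t
  induction e with
  | zero => simp
  | add e₁ e₂ h₁ h₂ => rw [add_smul, map_add, map_add, AddMonoidHom.add_apply, h₁, h₂]
  | tmul f l =>
    induction e' with
    | zero => simp
    | add e₁ e₂ h₁ h₂ => rw [add_smul, map_add, map_add, AddMonoidHom.add_apply, h₁, h₂]
    | tmul f' l' =>
      simp only [tmul_smul, hl, hr]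
      rw [hL, hL, smul_smul, smul_smul, mul_comm l, mul_left_comm]

theorem eq_zero_of_eq_neg {i : D.I} {z : D.Li i} (h : z = -z) : z = 0 := by
  have h2 : (2 : k) • z = 0 := by
    rw [two_smul]
    nth_rewrite 2 [h]
    exact add_neg_cancel z
  exact (smul_eq_zero.mp h2).resolve_left two_ne_zero

theorem exists_mul_eq_one {i : D.I} {z : D.Li i} (h : z ≠ 0) : ∃ z', z' * z = 1 := by
  obtain ⟨l, rfl⟩ := D.algebraMap_Li_surjective i z
  rw [Ne, D.algebraMap_Li_eq_zero] at h
  obtain ⟨l', hl'⟩ := D.exists_inv_of_not_mem h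
  refine ⟨algebraMap D.L (D.Li i) l', ?_⟩
  rw [← sub_eq_zero, ← map_mul, ← map_one (algebraMap D.L (D.Li i)), ← map_sub,
    D.algebraMap_Li_eq_zero]
  exact hl'

/-- A conjugation has invertible eigenvectors for both signs. -/
theorem exists_eigenvector {i : D.I} {ρ : D.Li i →ₐ[D.k₀] D.Li i} (hρ : D.IsConjugation ρ)
    (δ : ℤˣ) : ∃ c c' : D.Li i, c' * c = 1 ∧ ρ c = (δ : ℤ) • c := by
  rcases Int.units_eq_one_or δ with rfl | rfl
  · exact ⟨1, 1, mul_one 1, by simp⟩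
  · obtain ⟨z, hz⟩ := hρ.1
    obtain ⟨c', hc'⟩ := exists_mul_eq_one (sub_ne_zero.mpr hz)
    refine ⟨_, c', hc', ?_⟩
    rw [map_sub, hρ.2.1]
    simp

namespace Choices

variable (C : Choices.{u, v, w} D)

theorem exists_vertex_sign {i : D.I} (h : D.dag i = i) : ∃ δ : ℤˣ,
    (∀ u v, C.B i i v u = ((δ : ℤ) : F) * D.σ (C.B i i u v)) ∧
      (D.IsHermitian (C.B i i) → δ = 1) := by
  classical
  -- The Hermitian alternative is tested first, so that the sign is `1` whenever the pairing is
  -- Hermitian.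
  by_cases hH : D.IsHermitian (C.B i i)
  · exact ⟨1, fun u v => by simp [hH u v], fun _ => rfl⟩
  · rcases C.B_vertex i h with h1 | ⟨h1, -⟩
    · exact absurd h1 hH
    · exact ⟨-1, fun u v => by simp [h1 u v], fun h2 => absurd h2 hH⟩

/-- If `σ_c` is trivial on `L_i`, then `L` acts on `S_i` by self-adjoint operators and
`symm_of_self_adjoint` applies. For `σ = id_F` this leaves `ε` alone to decide between orthogonal
and symplectic. -/
theorem isHermitian_of_trivial (A : D.toCyclicDatum.Splitting) {i : D.I} (h : D.dag i = i)
    (hid : ∀ z, D.sigmaVertex i h z = z) (hσ : ∀ x, D.σ x = x) : D.IsHermitian (C.B i i) := by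
  intro u t
  have G := C.good h
  rw [hσ]
  let b : C.S i →+ C.S i →+ F := AddMonoidHom.mk' (fun u => (C.B i i u).toAddMonoidHom) fun u u' =>
    AddMonoidHom.ext fun t => by
      change C.B i i (u + u') t = C.B i i u t + C.B i i u' t
      rw [map_add, LinearMap.add_apply]
  refine symm_of_self_adjoint A (C.isSimpleAt i) b (fun f u t => ?_) (fun f u t => ?_)
    (fun l u t => ?_) t u
  · change C.B i i (f • u) t = f * C.B i i u t
    rw [map_smul]
    rfl
  · change C.B i i u (f • t) = f * C.B i i u t
    rw [LinearMap.map_smulₛₗ, hσ]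
    rfl
  · change C.B i i (l • u) t = C.B i i u (l • t)
    have h1 : algebraMap D.L (D.Li i) (D.sigmaC l) = algebraMap D.L (D.Li i) l :=
      hid (algebraMap D.L (D.Li i) l)
    rw [← (G.algebraMap_eq_iff _ _).mpr h1, G.adjoint A.K, sigmaC_sigmaC]

theorem vertexOrthogonalOrSymplectic (A : D.toCyclicDatum.Splitting) {i : D.I} (h : D.dag i = i)
    (hid : ∀ z, D.sigmaVertex i h z = z) : C.VertexOrthogonalOrSymplectic i h := by
  have G := C.good h
  obtain ⟨δ, hδ, hδ'⟩ := C.exists_vertex_sign h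
  have hswap : ∀ x y, C.form i y x = ((D.ε * δ : ℤˣ) : ℤ) • C.form i x y := fun x y => by
    rw [C.form_swap_vertex A h hδ, hid]
  have hO : D.ε * δ = 1 → D.IsOrthogonalForm (C.form i) := fun h1 =>
    ⟨G.pairing_smul_left A, fun x y => by rw [hswap, h1, Units.val_one, one_smul],
      C.pairing_nondegenerate_left A h⟩
  have hS : D.ε * δ = -1 → D.IsSymplecticForm (C.form i) := fun h1 =>
    ⟨G.pairing_smul_left A, fun x => eq_zero_of_eq_neg (by
        conv_lhs => rw [hswap, h1]
        simp), C.pairing_nondegenerate_left A h⟩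
  refine ⟨hid, (Int.units_eq_one_or _).imp hO hS, fun hσ => ?_⟩
  have h1 := hδ' (C.isHermitian_of_trivial A h hid hσ)
  exact ⟨fun hε => hO (by rw [hε, h1, one_mul]), fun hε => hS (by rw [hε, h1, mul_one])⟩

/-- The form is Hermitian up to the sign `ε δ`. A unit `c` of `L_i` with conjugate `ε δ c` makes `c
{,}` Hermitian, and multiplying the values by a unit does not change the isometries over any `R`. -/
theorem vertexUnitary (A : D.toCyclicDatum.Splitting) {i : D.I} (h : D.dag i = i)
    (hρ : D.IsConjugation (D.sigmaVertex i h)) : C.VertexUnitary i h := by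
  have G := C.good h
  obtain ⟨δ, hδ, -⟩ := C.exists_vertex_sign h
  obtain ⟨c, c', hc, hρc⟩ := exists_eigenvector hρ (D.ε * δ)
  let m (c : D.Li i) : D.Li i →ₗ[D.k₀] D.Li i := LinearMap.mulLeft D.k₀ c
  have hm : m c' ∘ₗ m c = LinearMap.id := LinearMap.ext fun z => by
    change c' * (c * z) = z
    rw [← mul_assoc, hc, one_mul]
  refine ⟨hρ, (C.form i).compr₂ (m c), ⟨fun l x y => ?_, fun x y => ?_⟩, fun x hx => ?_,
    fun R _ _ => ?_⟩
  · change c * D.pairing i (C.B i i) (l • x) y = l • (c * D.pairing i (C.B i i) x y)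
    rw [G.pairing_smul_left A, mul_smul_comm]
  · change c * C.form i y x = D.sigmaVertex i h (c * C.form i x y)
    rw [C.form_swap_vertex A h hδ, map_mul, hρc, mul_smul_comm, smul_mul_assoc]
  · refine C.pairing_nondegenerate_left A h x fun y => ?_
    have := LinearMap.congr_fun hm (C.form i x y)
    rw [LinearMap.comp_apply] at this
    change C.form i x y = 0
    rw [LinearMap.id_apply] at this
    rw [← this, ← map_zero (m c')]
    exact congrArg _ (hx y)
  · congr 1
    ext g
    have hbc : ∀ z z', LinearMap.BilinMap.baseChange R ((C.form i).compr₂ (m c)) z z' =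
        (m c).baseChange R (LinearMap.BilinMap.baseChange R (C.form i) z z') := fun z z' => by
      rw [baseChange_eq_bilinBaseChange, baseChange_eq_bilinBaseChange]
      have := bilinBaseChange_comp_left (R := R) (p := C.form i)
        (p' := (C.form i).compr₂ (m c)) (f := LinearMap.id) (h := m c) (fun _ _ => rfl) z z'
      rwa [LinearMap.baseChange_id] at this
    have hmR : ∀ q, (m c').baseChange R ((m c).baseChange R q) = q := fun q => by
      rw [← LinearMap.comp_apply, ← LinearMap.baseChange_comp, hm, LinearMap.baseChange_id,
        LinearMap.id_apply]
    refine forall₂_congr fun z z' => ?_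
    rw [hbc, hbc]
    refine ⟨fun H => by rw [H], fun H => ?_⟩
    have := congrArg ((m c').baseChange R) H
    rwa [hmR, hmR] at this

end Choices

end PolarizedDatum

end LoopGrading

end

/-! ### Fixed arrows: signs and Hermitian forms. -/

noncomputable section

namespace LoopGrading

namespace PolarizedDatum

open CyclicDatum CyclicDatum.AMod

variable {k : Type} [Field k] {F : Type u} [CommRing F] [Algebra k F]
  {D : PolarizedDatum.{u, v} k F} [Nontrivial F] [CharZero k]

namespace Choices

variable (C : Choices.{u, v, w} D)

/-- For the bilinear form `B(u, η t)` on `S_j` the adjoint of `l` is `μ_ξ(σ_c(l))`, which acts as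
`l` here; so `symm_of_self_adjoint` applies. -/
theorem isSelfAdj_of_trivial (A : D.toCyclicDatum.Splitting) {j : D.I} (h : D.rot j = D.dag j)
    (hid : ∀ z, D.sigmaArrow j h z = z) (hσ : ∀ x, D.σ x = x) :
    D.IsSelfAdj (C.B j (D.rot j)) (C.η j) := by
  intro u t
  have G := C.good h.symm
  rw [hσ]
  let b : C.S j →+ C.S j →+ F := AddMonoidHom.mk'
    (fun u => (C.B j (D.rot j) u).toAddMonoidHom.comp (C.η j).toLinearMap.toAddMonoidHom) fun u u' =>
    AddMonoidHom.ext fun t => by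
      change C.B j (D.rot j) (u + u') _ = C.B j (D.rot j) u _ + C.B j (D.rot j) u' _
      rw [map_add, LinearMap.add_apply]
  refine symm_of_self_adjoint A (C.isSimpleAt j) b (fun f u t => ?_) (fun f u t => ?_)
    (fun l u t => ?_) u t
  · change C.B j (D.rot j) (f • u) (C.η j t) = f * C.B j (D.rot j) u (C.η j t)
    rw [map_smul]
    rfl
  · change C.B j (D.rot j) u (C.η j (f • t)) = f * C.B j (D.rot j) u (C.η j t)
    rw [map_smul, LinearMap.map_smulₛₗ, hσ]
    rfl
  · change C.B j (D.rot j) (l • u) (C.η j t) = C.B j (D.rot j) u (C.η j (l • t))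
    have h1 : algebraMap D.L (D.Li j) (D.mu (D.sigmaC l)) = algebraMap D.L (D.Li j) l :=
      hid (algebraMap D.L (D.Li j) l)
    rw [G.adjoint A.K, ← twist_mu_smul (C.η_T j) A.K]
    obtain ⟨t₀, ht₀⟩ := @exists_ne _ (C.isSimpleAt j).nontrivial (0 : C.S j)
    rw [← sub_eq_zero, ← map_sub, ← map_sub, ← sub_smul, (C.isSimpleAt j).smul_eq_zero, map_zero,
      map_zero]
    rw [← D.algebraMap_Li_eq_zero, map_sub, h1, sub_self]

theorem εe_eq_one_of_trivial (A : D.toCyclicDatum.Splitting) {j : D.I} (h : D.rot j = D.dag j)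
    (hid : ∀ z, D.sigmaArrow j h z = z) (hσ : ∀ x, D.σ x = x) : C.εe j = 1 := by
  rcases C.η_arrow j h with ⟨h1, -⟩ | ⟨-, -, h3⟩
  · exact h1
  · exact absurd ⟨C.η j, C.η_T j, C.isSelfAdj_of_trivial A h hid hσ⟩ h3

section Arrow

variable {C} {j : D.I} (h : D.rot j = D.dag j) {δ : ℤˣ}

/-- The space attached to an arrow is stable under the action of `GL`. -/
theorem exists_conj (φ : D.hSpace j h (C.B j (D.rot j)) δ) {g : C.M j ≃ₗ[D.L] C.M j}
    {g' : C.M (D.rot j) ≃ₗ[D.L] C.M (D.rot j)} (hg : D.IsContragredient j (C.B j (D.rot j)) g g') :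
    ∃ ψ : D.hSpace j h (C.B j (D.rot j)) δ, ∀ x, ψ.1 (g x) = g' (φ.1 x) := by
  have key : ∀ x y, D.pairing j (C.B j (D.rot j)) y (g' (φ.1 (g.symm x))) =
      D.pairing j (C.B j (D.rot j)) (g.symm y) (φ.1 (g.symm x)) := fun x y => by
    conv_lhs => rw [← g.apply_symm_apply y, hg]
  refine ⟨⟨(g'.toLinearMap.restrictScalars D.k₀ : _ →ₗ[D.k₀] _) ∘ₗ φ.1 ∘ₗ
    (g.symm.toLinearMap.restrictScalars D.k₀ : _ →ₗ[D.k₀] _), fun l x => ?_, fun x y => ?_⟩,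
    fun x => ?_⟩
  · change g' (φ.1 (g.symm (D.mu l • x))) = l • g' (φ.1 (g.symm x))
    rw [map_smul, φ.2.1, map_smul]
  · change D.pairing j _ y (g' (φ.1 (g.symm x))) =
      (δ : ℤ) • D.sigmaArrow j h (D.pairing j _ x (g' (φ.1 (g.symm y))))
    rw [key, key, φ.2.2]
  · change g' (φ.1 (g.symm (g x))) = _
    rw [g.symm_apply_apply]

theorem hSpace_ext (A : D.toCyclicDatum.Splitting) {φ φ' : D.hSpace j h (C.B j (D.rot j)) δ}
    (H : ∀ x y, D.pairing j (C.B j (D.rot j)) x (φ.1 y) =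
      D.pairing j (C.B j (D.rot j)) x (φ'.1 y)) : φ = φ' := by
  refine Subtype.ext (LinearMap.ext fun y => sub_eq_zero.mp ?_)
  refine C.pairing_nondegenerate_right A h.symm _ fun x => ?_
  rw [map_sub, H, sub_self]

/-- The functional `c f(·, y)` is `L`-linear, hence represented by an element `φ y` of `M_{j†}`. As
the conjugate of `c` is `δ c`, the Hermitian symmetry of `f` becomes the symmetry of sign `δ`
required of `φ`. -/
theorem exists_hSpace_of_hermitian [Module.Finite k F] (A : D.toCyclicDatum.Splitting)
    {f : LinearMap.BilinMap D.k₀ (C.M j) (D.Li j)}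
    (hf : f ∈ D.hermitianForms (C.S j) (D.sigmaArrow j h)) {c : D.Li j}
    (hc : D.sigmaArrow j h c = (δ : ℤ) • c) : ∃ φ : D.hSpace j h (C.B j (D.rot j)) δ,
      ∀ x y, D.pairing j (C.B j (D.rot j)) x (φ.1 y) = c * f x y := by
  obtain ⟨hf1, hf2⟩ := hf
  have hf3 : ∀ l x y, f x (D.mu l • y) = D.sigmaC l • f x y := by
    intro l x y
    rw [hf2, hf1, smul_Li, map_mul, sigmaArrow_algebraMap, mu_sigmaC_mu, ← hf2, smul_Li]
  have hex := fun y => C.exists_pairing_eq A h.symm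
    { toFun := fun x => c * f x y
      map_add' := fun x x' => by rw [map_add, LinearMap.add_apply, mul_add]
      map_smul' := fun l x => by rw [hf1, mul_smul_comm, RingHom.id_apply] }
  choose φ hφ using hex
  have hφ : ∀ y x, D.pairing j (C.B j (D.rot j)) x (φ y) = c * f x y := hφ
  have huniq : ∀ y z, (∀ x, D.pairing j (C.B j (D.rot j)) x z = c * f x y) → φ y = z := by
    intro y z hz
    rw [← sub_eq_zero]
    refine C.pairing_nondegenerate_right A h.symm _ fun x => ?_
    rw [map_sub, hφ, hz, sub_self]
  let φ' : C.M j →ₗ[D.k₀] C.M (D.rot j) :=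
    { toFun := φ
      map_add' := fun y y' => huniq _ _ fun x => by rw [map_add, map_add, hφ, hφ, mul_add]
      map_smul' := fun a y => huniq _ _ fun x => by
        rw [RingHom.id_apply, map_smul, map_smul, hφ, mul_smul_comm] }
  refine ⟨⟨φ', fun l y => huniq _ _ fun x => ?_, fun x y => ?_⟩, fun x y => hφ y x⟩
  · rw [(C.good h.symm).pairing_smul_right A, hf3, mul_smul_comm]
    exact congrArg _ (hφ y x)
  · have h1 : D.pairing j (C.B j (D.rot j)) y (φ' x) = c * f y x := hφ x y
    have h2 : D.pairing j (C.B j (D.rot j)) x (φ' y) = c * f x y := hφ y x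
    rw [h1, h2, map_mul, hc, smul_mul_assoc, smul_smul, Int.units_coe_mul_self, one_smul, ← hf2]

/-- Both `c` and its inverse `c'` are eigenvectors of sign `δ`, so surjectivity is
`exists_hSpace_of_hermitian` for `c'`. -/
theorem exists_hermitianEquiv [Module.Finite k F] (A : D.toCyclicDatum.Splitting) {c c' : D.Li j}
    (hc : c' * c = 1) (hρc : D.sigmaArrow j h c = (δ : ℤ) • c) :
    ∃ e : D.hSpace j h (C.B j (D.rot j)) δ ≃ₗ[D.k₀] D.hermitianForms (C.S j) (D.sigmaArrow j h),
      ∀ φ x y, (e φ).1 x y = c * D.pairing j (C.B j (D.rot j)) x (φ.1 y) := by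
  have G := C.good h.symm
  let e : D.hSpace j h (C.B j (D.rot j)) δ →ₗ[D.k₀]
      D.hermitianForms (C.S j) (D.sigmaArrow j h) :=
    { toFun := fun φ => ⟨((D.pairing j (C.B j (D.rot j))).compl₂ φ.1).compr₂
          (LinearMap.mulLeft D.k₀ c), fun l x y => by
          change c * D.pairing j (C.B j (D.rot j)) (l • x) (φ.1 y) =
            l • (c * D.pairing j (C.B j (D.rot j)) x (φ.1 y))
          rw [G.pairing_smul_left A, mul_smul_comm], fun x y => by
          change c * D.pairing j (C.B j (D.rot j)) y (φ.1 x) =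
            D.sigmaArrow j h (c * D.pairing j (C.B j (D.rot j)) x (φ.1 y))
          rw [map_mul, hρc, smul_mul_assoc, ← mul_smul_comm]
          exact congrArg (c * ·) (φ.2.2 x y)⟩
      map_add' := fun φ φ' => Subtype.ext (LinearMap.ext₂ fun x y => by
        change c * D.pairing j (C.B j (D.rot j)) x (φ.1 y + φ'.1 y) =
          c * D.pairing j (C.B j (D.rot j)) x (φ.1 y) + c * D.pairing j (C.B j (D.rot j)) x (φ'.1 y)
        rw [map_add, mul_add])
      map_smul' := fun a φ => Subtype.ext (LinearMap.ext₂ fun x y => by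
        change c * D.pairing j (C.B j (D.rot j)) x (a • φ.1 y) =
          a • (c * D.pairing j (C.B j (D.rot j)) x (φ.1 y))
        rw [map_smul, mul_smul_comm]) }
  have he : ∀ φ x y, (e φ).1 x y = c * D.pairing j (C.B j (D.rot j)) x (φ.1 y) :=
    fun _ _ _ => rfl
  clear_value e
  have hcan : ∀ z, c' * (c * z) = z := fun z => by rw [← mul_assoc, hc, one_mul]
  have hcan' : ∀ z, c * (c' * z) = z := fun z => by rw [← mul_assoc, mul_comm c, hc, one_mul]
  have hρc' : D.sigmaArrow j h c' = (δ : ℤ) • c' := by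
    have h1 : D.sigmaArrow j h c' * ((δ : ℤ) • c) = 1 := by
      rw [← hρc, ← map_mul, hc, map_one]
    have h2 : (δ : ℤ) * (δ : ℤ) = 1 := Int.units_coe_mul_self δ
    calc D.sigmaArrow j h c' = (D.sigmaArrow j h c' * ((δ : ℤ) • c)) * ((δ : ℤ) • c') := by
          rw [mul_assoc, smul_mul_smul_comm, h2, one_smul, mul_comm c, hc, mul_one]
      _ = (δ : ℤ) • c' := by rw [h1, one_mul]
  have hinj : Function.Injective e := fun φ φ' hφ => hSpace_ext h A fun x y => by
    rw [← hcan (D.pairing j (C.B j (D.rot j)) x (φ.1 y)), ← he, hφ, he, hcan]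
  have hsurj : Function.Surjective e := by
    intro f
    have hf := exists_hSpace_of_hermitian h A f.2 hρc'
    obtain ⟨φ, hφ⟩ := hf
    refine ⟨φ, Subtype.ext (LinearMap.ext₂ fun x y => ?_)⟩
    rw [he, hφ, hcan']
  exact ⟨LinearEquiv.ofBijective e ⟨hinj, hsurj⟩, he⟩

theorem isHermitianSpace [Module.Finite k F] (A : D.toCyclicDatum.Splitting)
    (hρ : D.IsConjugation (D.sigmaArrow j h)) :
    D.IsHermitianSpace j h (C.B j (D.rot j)) δ := by
  obtain ⟨c, c', hc, hρc⟩ := exists_eigenvector hρ δ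
  obtain ⟨e, he⟩ := exists_hermitianEquiv (C := C) h A hc hρc
  refine ⟨e, fun g g' hg φ => ?_⟩
  obtain ⟨ψ, hψ⟩ := exists_conj h φ hg
  refine ⟨ψ, hψ, fun x y => ?_⟩
  rw [he, he, hψ, hg]

theorem arrowHermitian [Module.Finite k F] (A : D.toCyclicDatum.Splitting)
    (hρ : D.IsConjugation (D.sigmaArrow j h)) : C.ArrowHermitian j h :=
  ⟨hρ, isHermitianSpace h A hρ⟩

end Arrow

end Choices

end PolarizedDatum

end LoopGrading

end

/-! ### Fixed arrows with trivial involution: rank one operators. -/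

noncomputable section

namespace LoopGrading

namespace PolarizedDatum

open CyclicDatum CyclicDatum.AMod

variable {k : Type} [Field k] {F : Type u} [CommRing F] [Algebra k F]
  {D : PolarizedDatum.{u, v} k F} [Nontrivial F] [CharZero k]

namespace GoodPairing

variable {S S' : AMod.{u, w} D.toCyclicDatum} {i : D.I} {B : S →ₗ[F] S' →ₛₗ[D.σ] F}
  (G : D.GoodPairing i B)

include G

theorem sigmaC_smul_congr {l l' : D.L}
    (h : algebraMap D.L (D.Li i) l = algebraMap D.L (D.Li i) l') (y : D.Mult S') :
    D.sigmaC l • y = D.sigmaC l' • y := by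
  refine D.mult_smul_congr G.simple' ?_ y
  rw [← sub_eq_zero, ← map_sub, D.algebraMap_Li_eq_zero] at h ⊢
  rwa [← map_sub, sigmaC_mem_dag]

/-- The operator `x ↦ σ_c {x, y₁} y₂`. -/
def rankOneHom (y₁ y₂ : D.Mult S') : D.Mult S →ₗ[D.k₀] D.Mult S' where
  toFun := fun x => D.sigmaC (D.lift i (D.pairing i B x y₁)) • y₂
  map_add' := fun x x' => by
    rw [← add_smul, ← map_add]
    apply G.sigmaC_smul_congr
    simp only [map_add, algebraMap_lift, LinearMap.add_apply]
  map_smul' := fun a x => by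
    rw [RingHom.id_apply, G.sigmaC_smul_congr (l' := algebraMap k D.L (a : k) *
      D.lift i (D.pairing i B x y₁)), map_mul, sigmaC_k₀, mul_smul]
    · refine Subtype.ext (LinearMap.ext fun s => ?_)
      rw [AHom_smul_apply, AHom_L_smul, ← k₀_smul_L]
      rfl
    · rw [← k₀_smul_algebraMap_Li, algebraMap_lift, algebraMap_lift, map_smul,
        LinearMap.smul_apply]

theorem rankOneHom_apply (y₁ y₂ : D.Mult S') (x : D.Mult S) :
    G.rankOneHom y₁ y₂ x = D.sigmaC (D.lift i (D.pairing i B x y₁)) • y₂ := rfl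

theorem rankOneHom_add_left (y y' y₂ : D.Mult S') :
    G.rankOneHom (y + y') y₂ = G.rankOneHom y y₂ + G.rankOneHom y' y₂ := by
  refine LinearMap.ext fun x => ?_
  rw [LinearMap.add_apply, rankOneHom_apply, rankOneHom_apply, rankOneHom_apply, ← add_smul,
    ← map_add]
  apply G.sigmaC_smul_congr
  simp only [map_add, algebraMap_lift]

theorem rankOneHom_smul_left (A : D.toCyclicDatum.Splitting) (l : D.L) (y y₂ : D.Mult S') :
    G.rankOneHom (l • y) y₂ = l • G.rankOneHom y y₂ := by
  refine LinearMap.ext fun x => ?_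
  rw [LinearMap.smul_apply, rankOneHom_apply, rankOneHom_apply,
    G.sigmaC_smul_congr (l' := D.sigmaC l * D.lift i (D.pairing i B x y)), map_mul, sigmaC_sigmaC,
    mul_smul]
  rw [algebraMap_lift, G.pairing_smul_right A, map_mul, algebraMap_lift, smul_Li]

theorem rankOneHom_add_right (y y₂ y₂' : D.Mult S') :
    G.rankOneHom y (y₂ + y₂') = G.rankOneHom y y₂ + G.rankOneHom y y₂' := by
  refine LinearMap.ext fun x => ?_
  rw [LinearMap.add_apply, rankOneHom_apply, rankOneHom_apply, rankOneHom_apply, smul_add]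

theorem rankOneHom_smul_right (l : D.L) (y y₂ : D.Mult S') :
    G.rankOneHom y (l • y₂) = l • G.rankOneHom y y₂ := by
  refine LinearMap.ext fun x => ?_
  rw [LinearMap.smul_apply, rankOneHom_apply, rankOneHom_apply, smul_smul, smul_smul, mul_comm]

/-- The operator `x ↦ σ_c {x, y₁} y₂`, bilinear in `y₁` and `y₂`. -/
def rankOne (A : D.toCyclicDatum.Splitting) :
    D.Mult S' →ₗ[D.L] D.Mult S' →ₗ[D.L] (D.Mult S →ₗ[D.k₀] D.Mult S') :=
  LinearMap.mk₂ D.L G.rankOneHom G.rankOneHom_add_left (G.rankOneHom_smul_left A)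
    G.rankOneHom_add_right G.rankOneHom_smul_right

theorem rankOne_apply (A : D.toCyclicDatum.Splitting) (y₁ y₂ : D.Mult S') (x : D.Mult S) :
    G.rankOne A y₁ y₂ x = D.sigmaC (D.lift i (D.pairing i B x y₁)) • y₂ := rfl

theorem pairing_rankOne (A : D.toCyclicDatum.Splitting) (y₁ y₂ : D.Mult S') (x x' : D.Mult S) :
    D.pairing i B x' (G.rankOne A y₁ y₂ x) = D.pairing i B x y₁ * D.pairing i B x' y₂ := by
  rw [rankOne_apply, G.pairing_smul_right A, sigmaC_sigmaC, lift_smul_one]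

theorem rankOne_contragredient (A : D.toCyclicDatum.Splitting) {g : D.Mult S ≃ₗ[D.L] D.Mult S}
    {g' : D.Mult S' ≃ₗ[D.L] D.Mult S'} (hg : D.IsContragredient i B g g') (y₁ y₂ : D.Mult S')
    (x : D.Mult S) : G.rankOne A (g' y₁) (g' y₂) (g x) = g' (G.rankOne A y₁ y₂ x) := by
  rw [rankOne_apply, rankOne_apply, hg, map_smul]

end GoodPairing

theorem forall_of_span {R T N : Type*} [CommRing R] [AddCommMonoid T] [Module R T]
    [AddCommMonoid N] [Module R N] {s : Set T} (hs : Submodule.span R s = ⊤) (f : T →ₗ[R] N)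
    {P : N → Prop} (h0 : P 0) (hadd : ∀ a b, P a → P b → P (a + b))
    (hsmul : ∀ (r : R) a, P a → P (r • a)) (hmem : ∀ t ∈ s, P (f t)) (t : T) : P (f t) := by
  have : t ∈ Submodule.span R s := hs ▸ Submodule.mem_top
  induction this using Submodule.span_induction with
  | zero => rwa [map_zero]
  | add t t' _ _ h1 h2 => rw [map_add]; exact hadd _ _ h1 h2
  | smul l t _ h1 => rw [map_smul]; exact hsmul _ _ h1
  | mem t ht => exact hmem t ht

namespace Choices

variable {C : Choices.{u, v, w} D} {j : D.I} (h : D.rot j = D.dag j) {δ : ℤˣ}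

theorem zero_mem_hSpace :
    (0 : C.M j →ₗ[D.k₀] C.M (D.rot j)) ∈ D.hSpace j h (C.B j (D.rot j)) δ :=
  (D.hSpace j h (C.B j (D.rot j)) δ).zero_mem

theorem add_mem_hSpace {φ ψ : C.M j →ₗ[D.k₀] C.M (D.rot j)}
    (hφ : φ ∈ D.hSpace j h (C.B j (D.rot j)) δ) (hψ : ψ ∈ D.hSpace j h (C.B j (D.rot j)) δ) :
    φ + ψ ∈ D.hSpace j h (C.B j (D.rot j)) δ :=
  (D.hSpace j h (C.B j (D.rot j)) δ).add_mem hφ hψ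

section

variable (hid : ∀ z, D.sigmaArrow j h z = z)

include hid

/-- The triviality of `σ_{cξ⁻¹}` on `L_j`, transported to `L_{j†}` by `σ_c`. -/
theorem algebraMap_sigmaC_mu (l : D.L) : algebraMap D.L (D.Li (D.rot j)) (D.sigmaC (D.mu l)) =
    algebraMap D.L (D.Li (D.rot j)) l := by
  have h1 := hid (algebraMap D.L (D.Li j) (D.sigmaC l))
  rw [sigmaArrow_algebraMap, sigmaC_sigmaC] at h1
  rw [← sub_eq_zero, ← map_sub, D.algebraMap_Li_eq_zero] at h1 ⊢
  rw [h, ← sigmaC_mem, map_sub, sigmaC_sigmaC]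
  exact h1

/-- Paired with `x'`, the rank one operator of `y₁, y₂` becomes `{x, y₁} {x', y₂}`; adding `δ` times
the term with `y₁` and `y₂` exchanged gives exactly the required symmetry. -/
theorem rankOne_mem (A : D.toCyclicDatum.Splitting) (y₁ y₂ : C.M (D.rot j)) :
    (C.good h.symm).rankOne A y₁ y₂ + (δ : ℤ) • (C.good h.symm).rankOne A y₂ y₁ ∈
      D.hSpace j h (C.B j (D.rot j)) δ := by
  have G := C.good h.symm
  have hT : ∀ (y₁ y₂ : C.M (D.rot j)) (l : D.L) (x : C.M j),
      G.rankOne A y₁ y₂ (D.mu l • x) = l • G.rankOne A y₁ y₂ x := by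
    intro y₁ y₂ l x
    rw [GoodPairing.rankOne_apply, GoodPairing.rankOne_apply, G.pairing_smul_left A,
      G.sigmaC_smul_congr (l' := D.mu l * D.lift j (D.pairing j (C.B j (D.rot j)) x y₁)) ?_, map_mul,
      mul_smul]
    · exact D.mult_smul_congr (C.isSimpleAt _) (algebraMap_sigmaC_mu h hid l) _
    · rw [map_mul, algebraMap_lift, algebraMap_lift, smul_Li]
  refine ⟨fun l x => ?_, fun x y => ?_⟩
  · have h1 := hT y₁ y₂ l x
    have h2 := hT y₂ y₁ l x
    have h3 : ∀ a b : C.M (D.rot j), l • a + (δ : ℤ) • l • b = l • (a + (δ : ℤ) • b) :=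
      fun a b => by rw [smul_add, smul_comm l]
    exact (congrArg₂ (fun a b => a + (δ : ℤ) • b) h1 h2).trans (h3 _ _)
  rw [hid]
  simp only [LinearMap.add_apply, LinearMap.smul_apply, map_add, map_zsmul, G.pairing_rankOne]
  rw [smul_add, smul_smul, Int.units_coe_mul_self, one_smul, add_comm,
    mul_comm (D.pairing j _ x y₁), mul_comm (D.pairing j _ y y₁)]

theorem smul_mem_hSpace (A : D.toCyclicDatum.Splitting) (l : D.L)
    {φ : C.M j →ₗ[D.k₀] C.M (D.rot j)} (hφ : φ ∈ D.hSpace j h (C.B j (D.rot j)) δ) :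
    l • φ ∈ D.hSpace j h (C.B j (D.rot j)) δ := by
  have G := C.good h.symm
  refine ⟨fun l' x => ?_, fun x y => ?_⟩
  · rw [LinearMap.smul_apply, LinearMap.smul_apply, hφ.1, smul_comm]
  · rw [LinearMap.smul_apply, LinearMap.smul_apply, G.pairing_smul_right A,
      G.pairing_smul_right A, hφ.2, hid, hid, smul_comm]

/-- The decomposition of an element of the space of an arrow along dual frames. -/
theorem sum_rankOne (A : D.toCyclicDatum.Splitting) (φ : D.hSpace j h (C.B j (D.rot j)) δ)
    {n : ℕ} {xs : Fin n → C.M j} {ys : Fin n → C.M (D.rot j)}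
    (hx : ∀ x, ∑ a, D.lift j (D.pairing j (C.B j (D.rot j)) x (ys a)) • xs a = x)
    (hy : ∀ y, ∑ a, D.sigmaC (D.lift j (D.pairing j (C.B j (D.rot j)) (xs a) y)) • ys a = y) :
    ∑ a, ((C.good h.symm).rankOne A (ys a) (φ.1 (xs a)) +
      (δ : ℤ) • (C.good h.symm).rankOne A (φ.1 (xs a)) (ys a)) = (2 : ℤ) • φ.1 := by
  have G := C.good h.symm
  refine LinearMap.ext fun x => ?_
  have h1 : ∑ a, G.rankOne A (ys a) (φ.1 (xs a)) x = φ.1 x := by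
    conv_rhs => rw [← hx x, map_sum]
    refine Finset.sum_congr rfl fun a _ => ?_
    rw [GoodPairing.rankOne_apply, ← φ.2.1]
    congr 1
    refine D.mult_smul_congr (C.isSimpleAt j) ?_ _
    rw [← sigmaArrow_algebraMap h, hid]
  -- Here `φ x` is expanded in the dual frame, and the symmetry of `φ` exchanges `x` with the frame
  -- vector.
  have h2 : ∑ a, (δ : ℤ) • G.rankOne A (φ.1 (xs a)) (ys a) x = φ.1 x := by
    conv_rhs => rw [← hy (φ.1 x)]
    refine Finset.sum_congr rfl fun a _ => ?_
    rw [GoodPairing.rankOne_apply, ← smul_assoc, ← map_zsmul]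
    apply G.sigmaC_smul_congr
    rw [map_zsmul, algebraMap_lift, algebraMap_lift, φ.2.2, hid, smul_smul, Int.units_coe_mul_self,
      one_smul]
  rw [LinearMap.sum_apply]
  simp only [LinearMap.add_apply, LinearMap.smul_apply, Finset.sum_add_distrib]
  rw [h1, h2, two_smul]

section SquareEquiv

variable (A : D.toCyclicDatum.Splitting) {T : Type*} [AddCommMonoid T] [Module D.L T]
  (p : C.M (D.rot j) →ₗ[D.L] C.M (D.rot j) →ₗ[D.L] T)
  (hspan : Submodule.span D.L (Set.range fun y : C.M (D.rot j) × C.M (D.rot j) => p y.1 y.2) = ⊤)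
  (Θ : T →ₗ[D.L] (C.M j →ₗ[D.k₀] C.M (D.rot j)))
  (hΘ : ∀ y₁ y₂, Θ (p y₁ y₂) = (C.good h.symm).rankOne A y₁ y₂ +
    (δ : ℤ) • (C.good h.symm).rankOne A y₂ y₁)

include hspan hΘ

theorem squareMap_mem (t : T) : Θ t ∈ D.hSpace j h (C.B j (D.rot j)) δ := by
  refine forall_of_span hspan Θ (zero_mem_hSpace h) (fun _ _ => add_mem_hSpace h)
    (fun l _ => smul_mem_hSpace h hid A l) ?_ t
  rintro _ ⟨⟨y₁, y₂⟩, rfl⟩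
  rw [hΘ]
  exact rankOne_mem h hid A y₁ y₂

/-- Contraction with the dual frames undoes `Θ` up to the factor `2`: both terms of `Θ (p y₁ y₂)`
contribute `p y₁ y₂`, the second one through the symmetry of `p`. -/
theorem sum_squareMap (hp : ∀ y₁ y₂, p y₂ y₁ = ((δ : ℤ) : D.L) • p y₁ y₂) {n : ℕ}
    {xs : Fin n → C.M j} {ys : Fin n → C.M (D.rot j)}
    (hy : ∀ y, ∑ a, D.sigmaC (D.lift j (D.pairing j (C.B j (D.rot j)) (xs a) y)) • ys a = y)
    (t : T) : ∑ a, p (ys a) (Θ t (xs a)) = (2 : D.L) • t := by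
  have G := C.good h.symm
  let ev : ∀ _ : C.M j, (C.M j →ₗ[D.k₀] C.M (D.rot j)) →ₗ[D.L] C.M (D.rot j) := fun x =>
    { toFun := fun φ => φ x
      map_add' := fun _ _ => rfl
      map_smul' := fun _ _ => rfl }
  have key : ∑ a, (p (ys a)) ∘ₗ (ev (xs a)) ∘ₗ Θ = (2 : D.L) • LinearMap.id := by
    refine LinearMap.ext_on_range hspan fun y => ?_
    have h1 : ∀ y₁ y₂, ∑ a, p (ys a) (G.rankOne A y₁ y₂ (xs a)) = p y₁ y₂ := by
      intro y₁ y₂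
      conv_rhs => rw [← hy y₁, map_sum, LinearMap.sum_apply]
      refine Finset.sum_congr rfl fun a _ => ?_
      rw [GoodPairing.rankOne_apply, map_smul, map_smul, LinearMap.smul_apply]
    have h2 : ∀ (a b : C.M j →ₗ[D.k₀] C.M (D.rot j)) x,
      (a + (δ : ℤ) • b) x = a x + (δ : ℤ) • b x := fun _ _ _ => rfl
    have h3 : ∀ (y a b : C.M (D.rot j)), p y (a + (δ : ℤ) • b) =
        p y a + ((δ : ℤ) : D.L) • p y b := fun y a b => by
      rw [map_add, ← Int.cast_smul_eq_zsmul D.L, map_smul]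
    have h4 : ((δ : ℤ) : D.L) * ((δ : ℤ) : D.L) = 1 := by
      rw [← Int.cast_mul, Int.units_coe_mul_self, Int.cast_one]
    rw [LinearMap.sum_apply]
    calc ∑ a, p (ys a) (Θ (p y.1 y.2) (xs a)) = ∑ a, (p (ys a) (G.rankOne A y.1 y.2 (xs a)) +
          ((δ : ℤ) : D.L) • p (ys a) (G.rankOne A y.2 y.1 (xs a))) := by
          refine Finset.sum_congr rfl fun a _ => ?_
          rw [hΘ]
          exact (congrArg (p (ys a)) (h2 _ _ _)).trans (h3 _ _ _)
      _ = p y.1 y.2 + ((δ : ℤ) : D.L) • p y.2 y.1 := by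
          rw [Finset.sum_add_distrib, ← Finset.smul_sum, h1, h1]
      _ = (2 : D.L) • p y.1 y.2 := by
          rw [hp y.1 y.2, smul_smul, h4, one_smul, two_smul]
  have h5 := LinearMap.congr_fun key t
  rwa [LinearMap.sum_apply] at h5

/-- The space of an arrow is identified with the square of `M_{j†}` if `σ_{cξ⁻¹}` is trivial. -/
theorem exists_squareEquiv [Module.Finite k F]
    (hp : ∀ y₁ y₂, p y₂ y₁ = ((δ : ℤ) : D.L) • p y₁ y₂) :
    ∃ e : D.hSpace j h (C.B j (D.rot j)) δ ≃+ T, ∀ φ, Θ (e φ) = φ.1 := by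
  obtain ⟨n, xs, ys, hx, hy⟩ := C.exists_dual_frame A h.symm
  let c : D.L := algebraMap k D.L 2⁻¹
  have hc : c * 2 = 1 := by
    have h2 : (2 : D.L) = algebraMap k D.L 2 := (map_ofNat _ 2).symm
    rw [h2, ← map_mul, inv_mul_cancel₀ two_ne_zero, map_one]
  -- The inverse of `Θ` is half the contraction with the dual frames.
  let f : (C.M j →ₗ[D.k₀] C.M (D.rot j)) →+ T :=
    { toFun := fun φ => c • ∑ a, p (ys a) (φ (xs a))
      map_zero' := by simp only [LinearMap.zero_apply, map_zero, Finset.sum_const_zero, smul_zero]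
      map_add' := fun φ φ' => by
        simp only [LinearMap.add_apply, map_add, Finset.sum_add_distrib, smul_add] }
  have hf : ∀ φ, f φ = c • ∑ a, p (ys a) (φ (xs a)) := fun _ => rfl
  have hΘf : ∀ φ : D.hSpace j h (C.B j (D.rot j)) δ, Θ (f φ.1) = φ.1 := by
    intro φ
    rw [hf, map_smul, map_sum]
    simp_rw [hΘ]
    rw [sum_rankOne h hid A φ hx hy]
    refine LinearMap.ext fun x => ?_
    change c • (2 : ℤ) • φ.1 x = φ.1 x
    rw [← Int.cast_smul_eq_zsmul D.L, smul_smul, Int.cast_ofNat, hc, one_smul]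
  have hfΘ : ∀ t, f (Θ t) = t := by
    intro t
    rw [hf, sum_squareMap h hid A p hspan Θ hΘ hp hy, smul_smul, hc, one_smul]
  exact ⟨
    { toFun := fun φ => f φ.1
      invFun := fun t => ⟨Θ t, squareMap_mem h hid A p hspan Θ hΘ t⟩
      left_inv := fun φ => Subtype.ext (hΘf φ)
      right_inv := hfΘ
      map_add' := fun φ φ' => map_add f φ.1 φ'.1 }, hΘf⟩

end SquareEquiv

end

end Choices

end PolarizedDatum

end LoopGrading

end

/-! ### Symmetric and exterior squares. -/

noncomputable section

namespace LoopGrading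

section Squares

variable {R : Type} [CommRing R] {M N : Type*} [AddCommMonoid M] [Module R M] [AddCommMonoid N]
  [Module R N]

/-- A bilinear map as a multilinear map in two variables. -/
def bilinToMultilinear (p : M →ₗ[R] M →ₗ[R] N) : MultilinearMap R (fun _ : Fin 2 => M) N :=
  MultilinearMap.mk' (fun v => p (v 0) (v 1))
    (fun v i x y => by fin_cases i <;> simp) (fun v i c x => by fin_cases i <;> simp)

theorem bilinToMultilinear_apply (p : M →ₗ[R] M →ₗ[R] N) (v : Fin 2 → M) :
    bilinToMultilinear p v = p (v 0) (v 1) := rfl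

/-- A multilinear map in two variables as a bilinear map. -/
def multilinearToBilin (f : MultilinearMap R (fun _ : Fin 2 => M) N) : M →ₗ[R] M →ₗ[R] N :=
  have h0 : ∀ x y : M, ![x, y] = Function.update ![0, y] 0 x := fun x y => by
    ext i; fin_cases i <;> simp
  have h1 : ∀ x y : M, ![x, y] = Function.update ![x, 0] 1 y := fun x y => by
    ext i; fin_cases i <;> simp
  LinearMap.mk₂ R (fun x y => f ![x, y])
    (fun x x' y => by rw [h0, f.map_update_add, ← h0, ← h0])
    (fun c x y => by rw [h0, f.map_update_smul, ← h0])
    (fun x y y' => by rw [h1, f.map_update_add, ← h1, ← h1])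
    (fun c x y => by rw [h1, f.map_update_smul, ← h1])

theorem multilinearToBilin_apply (f : MultilinearMap R (fun _ : Fin 2 => M) N) (x y : M) :
    multilinearToBilin f x y = f ![x, y] := rfl

theorem range_multilinearToBilin (f : MultilinearMap R (fun _ : Fin 2 => M) N) :
    (Set.range fun y : M × M => multilinearToBilin f y.1 y.2) = Set.range f := by
  ext t
  constructor
  · rintro ⟨y, rfl⟩
    exact ⟨_, rfl⟩
  · rintro ⟨a, rfl⟩
    refine ⟨(a 0, a 1), congrArg f ?_⟩
    ext i; fin_cases i <;> rfl

/-- A linear map on the tensor power that is invariant under permutations descends to the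
symmetric power. -/
theorem exists_symmetricLift {ι : Type} (f : (⨂[R] _ : ι, M) →ₗ[R] N)
    (hf : ∀ (e : Equiv.Perm ι) (v : ι → M),
      f (PiTensorProduct.tprod R fun i => v (e i)) = f (PiTensorProduct.tprod R v)) :
    ∃ Θ : Sym[R] ι M →ₗ[R] N, ∀ t, Θ (SymmetricPower.mk R ι M t) = f t := by
  have hle : addConGen (SymmetricPower.Rel R ι M) ≤ AddCon.ker (f : (⨂[R] _ : ι, M) →+ N) := by
    refine AddCon.addConGen_le.mpr ?_
    rintro _ _ ⟨e, v⟩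
    exact (hf e v).symm
  let Θ : Sym[R] ι M →+ N := AddCon.lift _ (f : (⨂[R] _ : ι, M) →+ N) hle
  have hΘ : ∀ t, Θ (SymmetricPower.mk R ι M t) = f t := fun t => rfl
  refine ⟨{ Θ with map_smul' := fun r x => ?_ }, hΘ⟩
  change Θ (r • x) = r • Θ x
  obtain ⟨t, rfl⟩ : x ∈ LinearMap.range (SymmetricPower.mk R ι M) := by
    rw [SymmetricPower.range_mk]
    trivial
  rw [← map_smul, hΘ, hΘ, map_smul]

/-- The symmetrization of a bilinear map induces a map on the symmetric square. -/
theorem exists_symmetricSquareLift [Module ℤ N] (r : M →ₗ[R] M →ₗ[R] N) :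
    ∃ Θ : Sym[R]^2 M →ₗ[R] N,
      ∀ y₁ y₂, Θ (multilinearToBilin (SymmetricPower.tprod R (ι := Fin 2)) y₁ y₂) =
        r y₁ y₂ + ((1 : ℤˣ) : ℤ) • r y₂ y₁ := by
  have hone : ∀ x : N, ((1 : ℤˣ) : ℤ) • x = x := fun x => one_smul ℤ x
  simp_rw [hone]
  have hperm : ∀ (e : Equiv.Perm (Fin 2)), e 0 = 0 ∧ e 1 = 1 ∨ e 0 = 1 ∧ e 1 = 0 := by decide
  let p := r + r.flip
  have hp : ∀ y₁ y₂, p y₁ y₂ = r y₁ y₂ + r y₂ y₁ := fun _ _ => rfl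
  obtain ⟨Θ, hΘ⟩ := exists_symmetricLift (PiTensorProduct.lift (bilinToMultilinear p))
    fun e v => by
      rw [PiTensorProduct.lift.tprod, PiTensorProduct.lift.tprod, bilinToMultilinear_apply,
        bilinToMultilinear_apply, hp, hp]
      rcases hperm e with ⟨h0, h1⟩ | ⟨h0, h1⟩
      · rw [h0, h1]
      · rw [h0, h1, add_comm]
  refine ⟨Θ, fun y₁ y₂ => (hΘ _).trans ?_⟩
  rw [PiTensorProduct.lift.tprod]
  rfl

theorem symmetricSquare_symm (y₁ y₂ : M) :
    multilinearToBilin (SymmetricPower.tprod R (ι := Fin 2)) y₂ y₁ =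
      (((1 : ℤˣ) : ℤ) : R) • multilinearToBilin (SymmetricPower.tprod R (ι := Fin 2)) y₁ y₂ := by
  rw [Units.val_one, Int.cast_one, one_smul]
  refine Eq.trans (congrArg (SymmetricPower.tprod R) ?_)
    (SymmetricPower.tprod_equiv (Equiv.swap 0 1) ![y₁, y₂])
  ext1 i; fin_cases i <;> rfl

theorem symmetricSquare_span : Submodule.span R (Set.range fun y : M × M =>
    multilinearToBilin (SymmetricPower.tprod R (ι := Fin 2)) y.1 y.2) = ⊤ := by
  rw [range_multilinearToBilin]
  exact SymmetricPower.span_tprod_eq_top R (Fin 2) M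

end Squares

section ExteriorSquare

variable {R : Type} [CommRing R] {M N : Type*} [AddCommGroup M] [Module R M] [AddCommMonoid N]
  [Module R N]

/-- The antisymmetrization of a bilinear map induces a map on the exterior square. -/
theorem exists_exteriorLift [Module ℤ N] (r : M →ₗ[R] M →ₗ[R] N) :
    ∃ Θ : ⋀[R]^2 M →ₗ[R] N,
      ∀ y₁ y₂, Θ (multilinearToBilin (exteriorPower.ιMulti R 2).toMultilinearMap y₁ y₂) =
        r y₁ y₂ + ((-1 : ℤˣ) : ℤ) • r y₂ y₁ := by
  -- The actions of `ℤ` and `R` on `N` are not assumed to be related; for `-1` they agree because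
  -- additive inverses are unique.
  have hneg : ∀ x : N, ((-1 : ℤˣ) : ℤ) • x = (-1 : R) • x := fun x => by
    have h1 : ((-1 : ℤˣ) : ℤ) • x + x = 0 := by
      nth_rewrite 2 [← one_smul ℤ x]
      rw [← add_smul, Units.val_neg, Units.val_one, neg_add_cancel, zero_smul]
    have h2 : x + (-1 : R) • x = 0 := by
      nth_rewrite 1 [← one_smul R x]
      rw [← add_smul, add_neg_cancel, zero_smul]
    calc _ = ((-1 : ℤˣ) : ℤ) • x + (x + (-1 : R) • x) := by rw [h2, add_zero]
      _ = (-1 : R) • x := by rw [← add_assoc, h1, zero_add]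
  simp_rw [hneg]
  letI : AddCommGroup N := Module.addCommMonoidToAddCommGroup R
  let p := r + (-1 : R) • r.flip
  have hp : ∀ y₁ y₂, p y₁ y₂ = r y₁ y₂ + (-1 : R) • r y₂ y₁ := fun _ _ => rfl
  have hp0 : ∀ y, p y y = 0 := fun y => by
    rw [hp]
    nth_rewrite 1 [← one_smul R (r y y)]
    rw [← add_smul, add_neg_cancel, zero_smul]
  let f : M [⋀^Fin 2]→ₗ[R] N :=
    { bilinToMultilinear p with
      map_eq_zero_of_eq' := by
        intro v i j hv hij
        change p (v 0) (v 1) = 0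
        have : v 0 = v 1 := by
          fin_cases i <;> fin_cases j <;> simp_all
        rw [this, hp0] }
  refine ⟨exteriorPower.alternatingMapLinearEquiv f, fun y₁ y₂ => ?_⟩
  rw [multilinearToBilin_apply, ← hp]
  exact exteriorPower.alternatingMapLinearEquiv_apply_ιMulti f _

theorem exteriorSquare_antisymm (y₁ y₂ : M) :
    multilinearToBilin (exteriorPower.ιMulti R 2).toMultilinearMap y₂ y₁ =
      (((-1 : ℤˣ) : ℤ) : R) •
        multilinearToBilin (exteriorPower.ιMulti R 2).toMultilinearMap y₁ y₂ := by
  rw [Units.val_neg, Units.val_one, Int.cast_neg, Int.cast_one]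
  have h1 := (exteriorPower.ιMulti R 2 (M := M)).map_swap ![y₁, y₂]
    (i := 0) (j := 1) (by decide)
  refine Eq.trans (congrArg (exteriorPower.ιMulti R 2) ?_) (h1.trans (neg_one_smul R _).symm)
  ext1 i; fin_cases i <;> rfl

theorem exteriorSquare_span : Submodule.span R (Set.range fun y : M × M =>
    multilinearToBilin (exteriorPower.ιMulti R 2).toMultilinearMap y.1 y.2) = ⊤ := by
  rw [range_multilinearToBilin]
  exact exteriorPower.ιMulti_span R 2 M

end ExteriorSquare

namespace PolarizedDatum

open CyclicDatum CyclicDatum.AMod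

variable {k : Type} [Field k] {F : Type u} [CommRing F] [Algebra k F]
  {D : PolarizedDatum.{u, v} k F} [Nontrivial F] [CharZero k]

namespace Choices

variable {C : Choices.{u, v, w} D} {j : D.I} (h : D.rot j = D.dag j) {δ : ℤˣ}

/-- By linearity it suffices to look at the generators `p y₁ y₂`, where the claim is
`rankOne_contragredient`. -/
theorem square_equivariant (A : D.toCyclicDatum.Splitting)
    {T : Type*} [AddCommMonoid T] [Module D.L T]
    (p : C.M (D.rot j) →ₗ[D.L] C.M (D.rot j) →ₗ[D.L] T)
    (hspan : Submodule.span D.L (Set.range fun y : C.M (D.rot j) × C.M (D.rot j) => p y.1 y.2) = ⊤)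
    (Θ : T →ₗ[D.L] (C.M j →ₗ[D.k₀] C.M (D.rot j)))
    (hΘ : ∀ y₁ y₂, Θ (p y₁ y₂) = (C.good h.symm).rankOne A y₁ y₂ +
      (δ : ℤ) • (C.good h.symm).rankOne A y₂ y₁)
    {g : C.M j ≃ₗ[D.L] C.M j} {g' : C.M (D.rot j) ≃ₗ[D.L] C.M (D.rot j)}
    (hg : D.IsContragredient j (C.B j (D.rot j)) g g') (μ : T →ₗ[D.L] T)
    (hμ : ∀ y₁ y₂, μ (p y₁ y₂) = p (g' y₁) (g' y₂)) (x : C.M j) (t : T) :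
    Θ (μ t) (g x) = g' (Θ t x) := by
  have G := C.good h.symm
  let ev : ∀ _ : C.M j, (C.M j →ₗ[D.k₀] C.M (D.rot j)) →ₗ[D.L] C.M (D.rot j) := fun x =>
    { toFun := fun φ => φ x
      map_add' := fun _ _ => rfl
      map_smul' := fun _ _ => rfl }
  have h4 : ev (g x) ∘ₗ Θ ∘ₗ μ = g'.toLinearMap ∘ₗ ev x ∘ₗ Θ := by
    refine LinearMap.ext_on_range hspan fun y => ?_
    have h2 := G.rankOne_contragredient A hg y.1 y.2 x
    have h3 := G.rankOne_contragredient A hg y.2 y.1 x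
    change Θ (μ (p y.1 y.2)) (g x) = g' (Θ (p y.1 y.2) x)
    have h5 : ∀ (a b : C.M j →ₗ[D.k₀] C.M (D.rot j)) x,
      (a + (δ : ℤ) • b) x = a x + (δ : ℤ) • b x := fun _ _ _ => rfl
    have h6 : ∀ a b, g' (a + (δ : ℤ) • b) = g' a + (δ : ℤ) • g' b := fun a b => by
      rw [map_add, map_zsmul]
    rw [hμ, hΘ, hΘ]
    refine (h5 _ _ _).trans ?_
    refine (congrArg₂ (fun a b => a + (δ : ℤ) • b) h2 h3).trans ?_
    exact (h6 _ _).symm.trans (congrArg g' (h5 _ _ x).symm)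
  exact LinearMap.congr_fun h4 t

variable (hid : ∀ z, D.sigmaArrow j h z = z)

include hid

/-- The identification of the space of an arrow with the square of `M_{j†}` is equivariant. -/
theorem exists_equivariant_squareEquiv [Module.Finite k F] (A : D.toCyclicDatum.Splitting)
    {T : Type*} [AddCommMonoid T] [Module D.L T]
    (p : C.M (D.rot j) →ₗ[D.L] C.M (D.rot j) →ₗ[D.L] T)
    (hp : ∀ y₁ y₂, p y₂ y₁ = ((δ : ℤ) : D.L) • p y₁ y₂)
    (hspan : Submodule.span D.L (Set.range fun y : C.M (D.rot j) × C.M (D.rot j) => p y.1 y.2) = ⊤)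
    (Θ : T →ₗ[D.L] (C.M j →ₗ[D.k₀] C.M (D.rot j)))
    (hΘ : ∀ y₁ y₂, Θ (p y₁ y₂) = (C.good h.symm).rankOne A y₁ y₂ +
      (δ : ℤ) • (C.good h.symm).rankOne A y₂ y₁) :
    ∃ e : D.hSpace j h (C.B j (D.rot j)) δ ≃+ T,
      (∀ (l : D.L) (φ : D.hSpace j h (C.B j (D.rot j)) δ),
        ∃ ψ : D.hSpace j h (C.B j (D.rot j)) δ, (∀ x, ψ.1 x = l • φ.1 x) ∧ e ψ = l • e φ) ∧
      ∀ g g', D.IsContragredient j (C.B j (D.rot j)) g g' → ∀ μ : T →ₗ[D.L] T,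
        (∀ y₁ y₂, μ (p y₁ y₂) = p (g' y₁) (g' y₂)) → ∀ φ : D.hSpace j h (C.B j (D.rot j)) δ,
          ∃ ψ : D.hSpace j h (C.B j (D.rot j)) δ, (∀ x, ψ.1 (g x) = g' (φ.1 x)) ∧ e ψ = μ (e φ) := by
  have G := C.good h.symm
  have hex := exists_squareEquiv h hid A p hspan Θ hΘ hp
  obtain ⟨e, he⟩ := hex
  have hΘe : ∀ t, Θ t = (e.symm t).1 := fun t => by rw [← he, e.apply_symm_apply]
  have hinj : ∀ t t', Θ t = Θ t' → t = t' := fun t t' ht =>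
    e.symm.injective (Subtype.ext (by rw [← hΘe, ht, hΘe]))
  refine ⟨e, fun l φ => ⟨e.symm (l • e φ), fun x => ?_, e.apply_symm_apply _⟩,
    fun g g' hg μ hμ φ => ?_⟩
  · rw [← hΘe, map_smul, LinearMap.smul_apply, he]
  · have h1 : ∀ x t, Θ (μ t) (g x) = g' (Θ t x) :=
      square_equivariant h A p hspan Θ hΘ hg μ hμ
    have hex := exists_conj h φ hg
    obtain ⟨ψ, hψ⟩ := hex
    refine ⟨ψ, hψ, hinj _ _ (LinearMap.ext fun x => ?_)⟩
    obtain ⟨z, rfl⟩ := g.surjective x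
    calc Θ (e ψ) (g z) = ψ.1 (g z) := LinearMap.congr_fun (he ψ) _
      _ = g' (φ.1 z) := hψ z
      _ = g' (Θ (e φ) z) := congrArg g' (LinearMap.congr_fun (he φ) z).symm
      _ = Θ (μ (e φ)) (g z) := (h1 z (e φ)).symm

theorem isWedge [Module.Finite k F] (A : D.toCyclicDatum.Splitting) :
    D.IsWedge j h (C.B j (D.rot j)) (-1) := by
  let r := (C.good h.symm).rankOne A
  have hw := exists_exteriorLift r
  obtain ⟨Θ, hΘ⟩ := hw
  have hex := exists_equivariant_squareEquiv (C := C) (T := ⋀[D.L]^2 (C.M (D.rot j))) (δ := -1)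
    h hid A (multilinearToBilin (exteriorPower.ιMulti D.L 2 (M := C.M (D.rot j))).toMultilinearMap)
    exteriorSquare_antisymm
    exteriorSquare_span Θ hΘ
  obtain ⟨e, he1, he2⟩ := hex
  refine ⟨e, he1, fun g g' hg φ => he2 g g' hg _ (fun y₁ y₂ => ?_) φ⟩
  rw [multilinearToBilin_apply, multilinearToBilin_apply]
  refine (exteriorPower.map_apply_ιMulti _ _).trans (congrArg _ ?_)
  ext1 i; fin_cases i <;> rfl

theorem isSym [Module.Finite k F] (A : D.toCyclicDatum.Splitting) :
    D.IsSym j h (C.B j (D.rot j)) 1 := by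
  let r := (C.good h.symm).rankOne A
  have hs := exists_symmetricSquareLift r
  obtain ⟨Θ, hΘ⟩ := hs
  have hex := exists_equivariant_squareEquiv (C := C) (T := Sym[D.L]^2 (C.M (D.rot j))) (δ := 1)
    h hid A (multilinearToBilin (SymmetricPower.tprod D.L (ι := Fin 2) (M := C.M (D.rot j))))
    symmetricSquare_symm
    symmetricSquare_span Θ hΘ
  obtain ⟨e, he1, he2⟩ := hex
  refine ⟨e, he1, fun g g' hg φ => ?_⟩
  have hm := exists_symmetricLift ((SymmetricPower.mk D.L (Fin 2) (C.M (D.rot j))) ∘ₗ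
    (PiTensorProduct.map fun _ => (g' : C.M (D.rot j) →ₗ[D.L] C.M (D.rot j)))) fun e v => by
      rw [LinearMap.comp_apply, LinearMap.comp_apply, PiTensorProduct.map_tprod,
        PiTensorProduct.map_tprod]
      exact SymmetricPower.tprod_equiv e fun i => g' (v i)
  obtain ⟨μ, hμ⟩ := hm
  have hex := he2 g g' hg μ (fun y₁ y₂ => by
    refine (hμ _).trans ?_
    rw [LinearMap.comp_apply, PiTensorProduct.map_tprod]
    refine congrArg (SymmetricPower.tprod D.L) ?_
    ext1 i; fin_cases i <;> rfl) φ
  obtain ⟨ψ, hψ, hψe⟩ := hex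
  refine ⟨ψ, hψ, fun t ht => ?_⟩
  rw [hψe, ← ht, hμ, LinearMap.comp_apply]

/-- The sign `-ε ε_e` decides: `1` gives `Sym²` and `-1` gives `∧²`. If `σ = id_F`, then `ε_e = 1`
and the sign is `-ε`. -/
theorem arrowWedgeOrSym [Module.Finite k F] (A : D.toCyclicDatum.Splitting) :
    C.ArrowWedgeOrSym j h := by
  have h1 := isWedge (C := C) h hid A
  have h2 := isSym (C := C) h hid A
  refine ⟨hid, ?_, fun hσ => ?_⟩
  · rcases Int.units_eq_one_or (-D.ε * C.εe j) with h3 | h3 <;> rw [h3]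
    · exact Or.inr h2
    · exact Or.inl h1
  · rw [C.εe_eq_one_of_trivial A h hid hσ, mul_one]
    refine ⟨fun hε => ?_, fun hε => ?_⟩
    · rwa [hε]
    · rwa [hε, neg_neg]

end Choices

end PolarizedDatum

end LoopGrading

end

/-! ### Explicit splittings of `A_β` over `ℂ((τ))`. -/

noncomputable section

namespace LoopGrading

instance : CharZero (LaurentSeries ℂ) :=
  charZero_of_injective_algebraMap (algebraMap ℂ (LaurentSeries ℂ)).injective

namespace CyclicDatum

variable {F : Type u} [CommRing F] [Algebra (LaurentSeries ℂ) F]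
  (E : CyclicDatum (LaurentSeries ℂ) F)

/-- Up to `n`-th powers, both `b` and `y^n` are powers of the same element `t`: the first by
assumption, the second because `y^n` lies in `k` and `τ = t^e`. So `exists_cyclicNorm_eq` makes `b`
a norm. -/
theorem exists_splitting_of_uniformizer [Nontrivial F] [IsReduced F] {t u : E.Lˣ} {d : ℤ} {e : ℕ}
    (ht : (t : E.L) ^ e = algebraMap _ E.L tau) (hb : E.b = ((t ^ d * u ^ E.n : E.Lˣ) : E.L)) :
    Nonempty E.Splitting := by
  have hω := (Complex.isPrimitiveRoot_exp E.n E.n_pos.ne').map_of_injective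
    (algebraMap ℂ (LaurentSeries ℂ)).injective
  obtain ⟨K, hK⟩ := E.exists_kummerGenerator hω
  obtain ⟨f, hf⟩ := K.exists_y_pow
  have hf0 : f ≠ 0 := by
    rintro rfl
    rw [map_zero] at hf
    exact (K.y ^ E.n).ne_zero (by rw [Units.val_pow_eq_pow_val, ← hf])
  obtain ⟨w, u', hu', hfw⟩ := laurent_exists_scale f E.n_pos hf0
  let φ : E.Lˣ →* (F ⊗[LaurentSeries ℂ] E.L)ˣ :=
    Units.map (Algebra.TensorProduct.includeRight :
      E.L →ₐ[LaurentSeries ℂ] F ⊗[LaurentSeries ℂ] E.L).toMonoidHom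
  let ψ : Fˣ →* (F ⊗[LaurentSeries ℂ] E.L)ˣ :=
    Units.map (Algebra.TensorProduct.includeLeft :
      F →ₐ[LaurentSeries ℂ] F ⊗[LaurentSeries ℂ] E.L).toMonoidHom
  have hφ : ∀ l : E.Lˣ, (φ l : F ⊗[LaurentSeries ℂ] E.L) = 1 ⊗ₜ (l : E.L) := fun _ => rfl
  have hψ : ∀ l : Fˣ, (ψ l : F ⊗[LaurentSeries ℂ] E.L) = (l : F) ⊗ₜ 1 := fun _ => rfl
  have hZ : ∀ l : E.Lˣ, E.ζL (φ l) = φ l := fun l => by rw [hφ, ζL_tmul, map_one]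
  let u'' : E.Lˣ := Units.map (algebraMap (LaurentSeries ℂ) E.L) (Units.mk0 u' hu')
  have hu'' : (u'' : E.L) = algebraMap _ E.L u' := rfl
  -- The exponent `d` is reduced modulo `n` to a natural number, and the rest is absorbed into the
  -- `n`-th power.
  obtain ⟨v, hv⟩ := Int.eq_ofNat_of_zero_le (Int.emod_nonneg d
    (Int.natCast_ne_zero.mpr E.n_pos.ne'))
  have hd : t ^ d * u ^ E.n = t ^ v * (t ^ (d / E.n) * u) ^ E.n := by
    rw [mul_pow, ← mul_assoc, ← zpow_natCast t v, ← zpow_natCast (t ^ (d / (E.n : ℤ))), ← zpow_mul,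
      ← zpow_add, ← hv, mul_comm (d / (E.n : ℤ)), Int.emod_add_mul_ediv]
  obtain ⟨a, ha⟩ := exists_cyclicNorm_eq (Z := E.ζL) E.n_pos hω (y := ψ K.y) (t := φ t)
    (u := φ (t ^ (d / (E.n : ℤ)) * u)) (u' := φ u'') (v := v) (w := e * w)
    (by
      rw [hψ, ζL_tmul, K.ζ_y, hK, Algebra.TensorProduct.algebraMap_apply,
        Algebra.TensorProduct.tmul_mul_tmul, one_mul])
    (hZ _) (hZ _) (hZ _) (by
      apply Units.ext
      rw [← map_pow, ← map_pow, ← map_pow, ← map_mul, hφ, hψ, Units.val_pow_eq_pow_val,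
        Units.val_mul, Units.val_pow_eq_pow_val, Units.val_pow_eq_pow_val, hu'', pow_mul, ht,
        ← map_pow, ← map_pow, ← map_mul, ← hfw, ← hf, ← Algebra.TensorProduct.algebraMap_apply']
      exact (Algebra.TensorProduct.algebraMap_apply f).symm)
  refine ⟨K, a, ?_⟩
  rw [ha, ← map_pow, ← map_pow, ← map_mul, ← hd, hφ, hb]

/-- `A_β` splits over its centre if `β` is a power of exponent `m / n`. -/
theorem exists_splitting_of_pow [Nontrivial F] [IsReduced F] {ρ : LaurentSeries ℂ}
    (hρ : ρ ^ E.r = E.β) : Nonempty E.Splitting := by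
  have h0 : ρ ≠ 0 := by
    rintro rfl
    rw [zero_pow E.r_pos.ne'] at hρ
    exact E.β_ne_zero hρ.symm
  obtain ⟨v, u₁, hu₁, hv⟩ := laurent_exists_scale ρ E.n_pos h0
  have h1 : algebraMap (LaurentSeries ℂ) E.L ρ⁻¹ * algebraMap _ E.L ρ = 1 := by
    rw [← map_mul, inv_mul_cancel₀ h0, map_one]
  have hχ : (algebraMap (LaurentSeries ℂ) E.L ρ⁻¹ * E.b) ^ E.r = 1 := by
    rw [mul_pow, E.b_pow, ← hρ, map_pow, ← mul_pow, h1, one_pow]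
  let : Algebra ℂ E.L :=
    ((algebraMap (LaurentSeries ℂ) E.L).comp (algebraMap ℂ (LaurentSeries ℂ))).toAlgebra
  -- `b` is `ρ` times a root of unity of `L`, and the latter is an `n`-th power in `L`; so `b` is a
  -- power of `τ` times an `n`-th power.
  obtain ⟨u₂, hu₂⟩ := exists_pow_eq_of_pow_eq_one E.r_pos hχ E.n_pos
  have hu₂' : IsUnit u₂ := by
    refine IsUnit.of_pow_eq_one (n := E.n * E.r) ?_ (mul_pos E.n_pos E.r_pos).ne'
    rw [pow_mul, hu₂, hχ]
  let k' : ∀ x : LaurentSeries ℂ, x ≠ 0 → E.Lˣ := fun x hx =>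
    Units.map (algebraMap (LaurentSeries ℂ) E.L) (Units.mk0 x hx)
  have hk : ∀ x hx, (k' x hx : E.L) = algebraMap _ E.L x := fun _ _ => rfl
  refine E.exists_splitting_of_uniformizer (t := k' tau tau_ne_zero) (u := k' u₁ hu₁ * hu₂'.unit)
    (d := v) (e := 1) (by rw [pow_one, hk]) ?_
  rw [zpow_natCast, Units.val_mul, Units.val_pow_eq_pow_val, Units.val_pow_eq_pow_val,
    Units.val_mul, hk, hk, IsUnit.unit_spec, mul_pow, hu₂, ← mul_assoc, ← map_pow, ← map_pow,
    ← map_mul, ← hv, ← mul_assoc, mul_comm (algebraMap _ E.L ρ), h1, one_mul]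

/-- `A_β` splits over its centre if `β` is a power of exponent `m / 2n` of an element of odd
valuation. -/
theorem exists_splitting_of_odd [Nontrivial F] [IsReduced F] {ρ : LaurentSeries ℂ} {g : ℕ}
    (hr : E.r = g * 2) (hρ : ρ ^ g = E.β) (hodd : Odd ρ.order) : Nonempty E.Splitting := by
  have hg : 0 < g := Nat.pos_of_ne_zero fun h => E.r_pos.ne' (by rw [hr, h, zero_mul])
  have h0 : ρ ≠ 0 := by
    rintro rfl
    rw [zero_pow hg.ne'] at hρ
    exact E.β_ne_zero hρ.symm
  obtain ⟨d, hd⟩ := hodd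
  have h2 : ρ * (tau ^ ρ.order)⁻¹ ≠ 0 := mul_ne_zero h0 (inv_ne_zero (zpow_ne_zero _ tau_ne_zero))
  have hord : (ρ * (tau ^ ρ.order)⁻¹).order = 0 := by
    rw [HahnSeries.order_mul h0 (inv_ne_zero (zpow_ne_zero _ tau_ne_zero)), ← zpow_neg,
      order_zpow tau_ne_zero, order_tau]
    ring
  obtain ⟨u₁, hu₁⟩ := laurent_exists_pow_eq _ (n := E.n * 2) (mul_pos E.n_pos two_pos) h2
    (by rw [hord]; exact dvd_zero _)
  have hu₁0 : u₁ ≠ 0 := by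
    rintro rfl
    rw [zero_pow (mul_pos E.n_pos two_pos).ne'] at hu₁
    exact h2 hu₁.symm
  have h1 : algebraMap (LaurentSeries ℂ) E.L ρ⁻¹ * algebraMap _ E.L ρ = 1 := by
    rw [← map_mul, inv_mul_cancel₀ h0, map_one]
  have hχ : (algebraMap (LaurentSeries ℂ) E.L ρ⁻¹ * E.b ^ 2) ^ g = 1 := by
    rw [mul_pow, ← pow_mul, mul_comm 2, ← hr, E.b_pow, ← hρ, map_pow, ← mul_pow, h1, one_pow]
  let : Algebra ℂ E.L :=
    ((algebraMap (LaurentSeries ℂ) E.L).comp (algebraMap ℂ (LaurentSeries ℂ))).toAlgebra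
  obtain ⟨u₂, hu₂⟩ := exists_pow_eq_of_pow_eq_one hg hχ (mul_pos E.n_pos two_pos)
  have hu₂' : IsUnit u₂ := by
    refine IsUnit.of_pow_eq_one (n := (E.n * 2) * g) ?_
      (mul_pos (mul_pos E.n_pos two_pos) hg).ne'
    rw [pow_mul, hu₂, hχ]
  let k' : ∀ x : LaurentSeries ℂ, x ≠ 0 → E.Lˣ := fun x hx =>
    Units.map (algebraMap (LaurentSeries ℂ) E.L) (Units.mk0 x hx)
  have hk : ∀ x hx, (k' x hx : E.L) = algebraMap _ E.L x := fun _ _ => rfl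
  have hkp : ∀ x hx (j : ℤ), ((k' x hx ^ j : E.Lˣ) : E.L) = algebraMap _ E.L (x ^ j) :=
    fun x hx j => by
      have : k' x hx ^ j = k' (x ^ j) (zpow_ne_zero _ hx) := by
        change Units.map _ _ ^ j = Units.map _ _
        rw [← map_zpow]
        congr 1
        apply Units.ext
        simp
      rw [this, hk]
  have hb : IsUnit E.b := IsUnit.of_mul_eq_one _ E.b_mul_bInv
  let u : E.Lˣ := k' u₁ hu₁0 * hu₂'.unit
  -- A square root of `τ` in `L`, since `b² = τ^(2d+1) u^(2n)`; it satisfies `b = t^(2d+1) u^n`.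
  let t : E.Lˣ := hb.unit * (k' tau tau_ne_zero ^ d)⁻¹ * (u ^ E.n)⁻¹
  have ht2 : t ^ 2 = k' tau tau_ne_zero := by
    have h3 : hb.unit ^ 2 = k' tau tau_ne_zero ^ (2 * d + 1) * u ^ (E.n * 2) := by
      apply Units.ext
      rw [Units.val_mul, hkp, Units.val_pow_eq_pow_val, Units.val_pow_eq_pow_val, Units.val_mul, hk,
        IsUnit.unit_spec, IsUnit.unit_spec, mul_pow, hu₂, ← map_pow, hu₁, ← hd, ← mul_assoc,
        ← map_mul, mul_comm ρ, mul_inv_cancel_left₀ (zpow_ne_zero _ tau_ne_zero), ← mul_assoc,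
        mul_comm (algebraMap _ E.L ρ), h1, one_mul]
    change (hb.unit * (k' tau tau_ne_zero ^ d)⁻¹ * (u ^ E.n)⁻¹) ^ 2 = _
    rw [mul_pow, mul_pow, h3, inv_pow, inv_pow, ← pow_mul, zpow_add_one, mul_comm 2 d, zpow_mul,
      zpow_ofNat, mul_right_comm, mul_inv_cancel_right, mul_inv_cancel_comm]
  refine E.exists_splitting_of_uniformizer (t := t) (u := u) (d := 2 * d + 1) (e := 2) ?_ ?_
  · rw [← Units.val_pow_eq_pow_val, ht2, hk]
  · have h4 : t ^ (2 * d + 1) * u ^ E.n = hb.unit := by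
      rw [zpow_add_one, zpow_mul, zpow_ofNat, ht2]
      change _ * (hb.unit * _ * (u ^ E.n)⁻¹) * _ = _
      rw [mul_assoc, inv_mul_cancel_right, mul_comm hb.unit, mul_inv_cancel_left]
    rw [h4, IsUnit.unit_spec]

end CyclicDatum

end LoopGrading

end

/-! ### The cycle, its reflection, and the action of the involutions on the fields `L_i`. -/

noncomputable section

namespace LoopGrading

/-- A map that corresponds to the multiplication by a primitive root of unity on a set of roots is
a single cycle. -/
theorem exists_equiv_zmod {K I : Type*} [Field K] {g : ℕ} [NeZero g] {κ : K}
    (hκ : IsPrimitiveRoot κ g) {ρ : I → K} (hρ : Function.Injective ρ) {f : I → I}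
    (hf : ∀ i, ρ (f i) = κ * ρ i) {i₀ : I} (h0 : ρ i₀ ≠ 0)
    (hall : ∀ i, ∃ j < g, ρ i = κ ^ j * ρ i₀) :
    ∃ e : I ≃ ZMod g, e i₀ = 0 ∧ ∀ i, e (f i) = e i + 1 := by
  have hit : ∀ j : ℕ, ρ (f^[j] i₀) = κ ^ j * ρ i₀ := fun j => by
    induction j with
    | zero => simp
    | succ j ih => rw [Function.iterate_succ_apply', hf, ih, pow_succ', mul_assoc]
  choose j hj hρj using hall
  have hfj : ∀ i, f^[j i] i₀ = i := fun i => hρ (by rw [hit, ← hρj])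
  have hmod : ∀ i n, f^[n] i₀ = i → (n : ZMod g) = j i := fun i n h => by
    have h1 := hρj i
    rw [← h, hit, h] at h1
    have h2 := mul_right_cancel₀ h0 h1
    rw [pow_eq_pow_mod n hκ.pow_eq_one] at h2
    rw [← hκ.pow_inj (Nat.mod_lt n (NeZero.pos g)) (hj i) h2, ZMod.natCast_mod]
  refine ⟨⟨fun i => (j i : ZMod g), fun a => f^[a.val] i₀, fun i => ?_, fun a => ?_⟩, ?_,
    fun i => ?_⟩
  · change f^[(j i : ZMod g).val] i₀ = i
    rw [ZMod.val_natCast_of_lt (hj i), hfj]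
  · change (j (f^[a.val] i₀) : ZMod g) = a
    rw [← hmod _ a.val rfl, ZMod.natCast_zmod_val]
  · change (j i₀ : ZMod g) = 0
    rw [← hmod i₀ 0 rfl, Nat.cast_zero]
  · change (j (f i) : ZMod g) = j i + 1
    rw [← hmod (f i) (j i + 1) (by rw [Function.iterate_succ_apply', hfj]), Nat.cast_succ]

namespace PolarizedDatum

open CyclicDatum

variable {k : Type} [Field k] {F : Type u} [CommRing F] [Algebra k F]
  {D : PolarizedDatum.{u, v} k F} [Nontrivial F] [CharZero k] (R : D.toCyclicDatum.RootDatum)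

section Cycle

variable (hκ : IsPrimitiveRoot (D.ν ^ R.e) R.g)

include hκ

theorem exists_rho_eq_pow_mul (i i₀ : D.I) : ∃ j < R.g, R.rho i = (D.ν ^ R.e) ^ j * R.rho i₀ := by
  have h0 := R.ne_zero (R.rho_pow i₀)
  have : NeZero R.g := ⟨R.g_pos.ne'⟩
  obtain ⟨j, hj, h1⟩ := hκ.eq_pow_of_pow_eq_one (ξ := R.rho i / R.rho i₀) (by
    rw [div_pow, R.rho_pow, R.rho_pow, div_self D.β_ne_zero])
  exact ⟨j, hj, by rw [h1, div_mul_cancel₀ _ h0]⟩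

/-- `Q_ξ` is a single directed cycle. -/
theorem exists_cycle (i₀ : D.I) :
    ∃ e : D.I ≃ ZMod R.g, e i₀ = 0 ∧ ∀ i, e (D.rot i) = e i + 1 :=
  have : NeZero R.g := ⟨R.g_pos.ne'⟩
  exists_equiv_zmod hκ R.rho_injective (D.rho_rot R) (R.ne_zero (R.rho_pow i₀))
    fun i => exists_rho_eq_pow_mul R hκ i i₀

/-- Since `†` reverses arrows, the label of `i†` drops by one when that of `i` grows by one. So `†`
is a reflection `a ↦ const - a`; the constant is `0` if `i₀` is a fixed vertex and `1` if `i₀` is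
the source of a fixed arrow. -/
theorem exists_cycle_dag (i₀ : D.I) : ∃ e : D.I ≃ ZMod R.g, e i₀ = 0 ∧
    (∀ i, e (D.rot i) = e i + 1) ∧ ∀ i, e (D.dag i) = e (D.dag i₀) - e i := by
  have : NeZero R.g := ⟨R.g_pos.ne'⟩
  obtain ⟨e, he0, he⟩ := exists_cycle R hκ i₀
  refine ⟨e, he0, he, ?_⟩
  have hd : ∀ i, e (D.dag (D.rot i)) = e (D.dag i) - 1 := fun i => by
    have h1 : D.rot (D.dag (D.rot i)) = D.dag i := by
      have h2 := D.dag_rot_involutive i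
      rw [← h2, D.dag_dag, h2]
    rw [← h1, he, add_sub_cancel_right]
  have hj : ∀ (j : ℕ) (i : D.I), e i = j → e (D.dag i) = e (D.dag i₀) - j := by
    intro j
    induction j with
    | zero =>
      intro i hi
      rw [Nat.cast_zero, ← he0] at hi
      rw [e.injective hi, Nat.cast_zero, sub_zero]
    | succ j ih =>
      intro i hi
      have h1 : i = D.rot (e.symm j) := e.injective (by rw [he, e.apply_symm_apply, hi]; simp)
      rw [h1, hd, ih _ (e.apply_symm_apply _), Nat.cast_succ]
      ring
  intro i
  have h1 := hj (e i).val i (ZMod.natCast_zmod_val _).symm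
  rwa [ZMod.natCast_zmod_val] at h1

theorem isVE_of_fixed {i₀ : D.I} (h : D.dag i₀ = i₀) {ℓ : ℕ} (hℓ : 2 * ℓ + 1 = R.g) :
    D.IsVE ℓ := by
  obtain ⟨e, he0, he, hd⟩ := exists_cycle_dag R hκ i₀
  rw [IsVE, hℓ]
  exact ⟨e, he, fun i => by rw [hd, h, he0, zero_sub]⟩

theorem isVV_of_fixed {i₀ : D.I} (h : D.dag i₀ = i₀) {ℓ : ℕ} (hℓ : 2 * ℓ = R.g) :
    D.IsVV ℓ := by
  obtain ⟨e, he0, he, hd⟩ := exists_cycle_dag R hκ i₀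
  rw [IsVV, hℓ]
  exact ⟨e, he, fun i => by rw [hd, h, he0, zero_sub]⟩

theorem isEE_of_fixed {j₀ : D.I} (h : D.rot j₀ = D.dag j₀) {ℓ : ℕ} (hℓ : 2 * ℓ = R.g) :
    D.IsEE ℓ := by
  obtain ⟨e, he0, he, hd⟩ := exists_cycle_dag R hκ j₀
  rw [IsEE, hℓ]
  exact ⟨e, he, fun i => by rw [hd, ← h, he, he0, zero_add]⟩

/-- Two roots differ by a power of `ν^e`, which `σ` fixes; equality of the products `ρ σ(ρ)` means
that this power has square `1`. -/
theorem rho_eq_or_eq_neg {i i₀ : D.I}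
    (h : R.rho i * D.σk (R.rho i) = R.rho i₀ * D.σk (R.rho i₀)) :
    R.rho i = R.rho i₀ ∨ R.rho i = -R.rho i₀ := by
  obtain ⟨j, -, hj⟩ := exists_rho_eq_pow_mul R hκ i i₀
  have h0 := R.ne_zero (R.rho_pow i₀)
  have h1 : D.σk (R.rho i₀) ≠ 0 := by simpa using h0
  have h2 : D.σk (R.rho i) = (D.ν ^ R.e) ^ j * D.σk (R.rho i₀) := by
    rw [hj, map_mul, map_pow, map_pow, σk_ν]
  have h3 : ((D.ν ^ R.e) ^ j) ^ 2 = 1 := by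
    apply mul_right_cancel₀ (mul_ne_zero h0 h1)
    rw [h2, hj] at h
    linear_combination h
  rcases sq_eq_sq_iff_eq_or_eq_neg.mp (h3.trans (one_pow 2).symm) with h4 | h4
  · left; rw [hj, h4, one_mul]
  · right; rw [hj, h4, neg_one_mul]

/-- For odd `g` the sign is excluded, because `(-ρ)^g = -β`. -/
theorem eq_of_odd (hg : Odd R.g) {i i₀ : D.I}
    (h : R.rho i * D.σk (R.rho i) = R.rho i₀ * D.σk (R.rho i₀)) : i = i₀ := by
  rcases rho_eq_or_eq_neg R hκ h with h1 | h1
  · exact R.rho_injective h1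
  · exfalso
    have h2 := R.rho_pow i
    rw [h1, hg.neg_pow, R.rho_pow] at h2
    exact D.β_ne_zero (self_eq_neg.mp h2.symm)

theorem vertex_unique (hg : Odd R.g) {i₀ : D.I} (h : D.dag i₀ = i₀) (i : D.I)
    (hi : D.dag i = i) : i = i₀ := by
  rw [D.dag_eq_self_iff R] at h hi
  exact eq_of_odd R hκ hg (hi.trans h.symm)

theorem arrow_unique (hg : Odd R.g) {j₀ : D.I} (h : D.rot j₀ = D.dag j₀) (j : D.I)
    (hj : D.rot j = D.dag j) : j = j₀ := by
  rw [D.rot_eq_dag_iff R] at h hj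
  exact eq_of_odd R hκ hg
    (mul_left_cancel₀ (pow_ne_zero R.e D.ν_ne_zero) (hj.trans h.symm))

/-- For even `g`, `-ρ` is also a root, with the same product `ρ σ(ρ)`. Hence fixed vertices come in
pairs, and so do fixed arrows. -/
theorem exists_neg_of_even (hg : Even R.g) (i₀ : D.I) : ∃ i', R.rho i' = -R.rho i₀ ∧ i₀ ≠ i' ∧
    (R.rho i' * D.σk (R.rho i') = R.rho i₀ * D.σk (R.rho i₀)) ∧
    ∀ t, R.rho t * D.σk (R.rho t) = R.rho i₀ * D.σk (R.rho i₀) → t = i₀ ∨ t = i' := by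
  obtain ⟨i', hi'⟩ := R.exists_rho_eq (ρ := -R.rho i₀) (by rw [hg.neg_pow, R.rho_pow])
  refine ⟨i', hi', ?_, by rw [hi', map_neg, neg_mul_neg], fun t ht => ?_⟩
  · rintro rfl
    exact R.ne_zero (R.rho_pow i₀) (self_eq_neg.mp hi')
  · rcases rho_eq_or_eq_neg R hκ ht with h1 | h1
    · exact Or.inl (R.rho_injective h1)
    · exact Or.inr (R.rho_injective (h1.trans hi'.symm))

theorem exists_vertex_pair (hg : Even R.g) {i₀ : D.I} (h : D.dag i₀ = i₀) :
    ∃ i', R.rho i' = -R.rho i₀ ∧ i₀ ≠ i' ∧ D.dag i' = i' ∧ ∀ t, D.dag t = t → t = i₀ ∨ t = i' := by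
  obtain ⟨i', h1, h2, h3, h4⟩ := exists_neg_of_even R hκ hg i₀
  refine ⟨i', h1, h2, ?_, fun t ht => h4 t ?_⟩
  · rw [D.dag_eq_self_iff R] at h ⊢
    exact h3.trans h
  · rw [D.dag_eq_self_iff R] at h ht
    exact ht.trans h.symm

theorem exists_arrow_pair (hg : Even R.g) {j₀ : D.I} (h : D.rot j₀ = D.dag j₀) :
    ∃ j', R.rho j' = -R.rho j₀ ∧ j₀ ≠ j' ∧ D.rot j' = D.dag j' ∧
      ∀ t, D.rot t = D.dag t → t = j₀ ∨ t = j' := by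
  obtain ⟨j', h1, h2, h3, h4⟩ := exists_neg_of_even R hκ hg j₀
  refine ⟨j', h1, h2, ?_, fun t ht => h4 t ?_⟩
  · rw [D.rot_eq_dag_iff R] at h ⊢
    rw [h3, h]
  · rw [D.rot_eq_dag_iff R] at h ht
    exact mul_left_cancel₀ (pow_ne_zero R.e D.ν_ne_zero) (ht.trans h.symm)

/-- The `g`-th powers of `γ^e` and of `ρ σ(ρ)` are both `β σ(β)`, so their quotient is a power of
the primitive root `ν^e`. -/
theorem exists_pow_mul_eq : ∃ (i : D.I) (j : ℕ),
    (D.ν ^ R.e) ^ j * (R.rho i * D.σk (R.rho i)) = D.γ ^ R.e := by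
  have : NeZero R.g := ⟨R.g_pos.ne'⟩
  obtain ⟨i, -⟩ := R.exists_rho_eq R.ρ₀_pow
  have h0 := R.ne_zero (R.rho_pow i)
  have h1 : D.σk (R.rho i) ≠ 0 := by simpa using h0
  obtain ⟨j, -, hj⟩ := hκ.eq_pow_of_pow_eq_one
    (ξ := D.γ ^ R.e / (R.rho i * D.σk (R.rho i))) (by
      rw [div_pow, mul_pow, ← map_pow, R.rho_pow, ← pow_mul, mul_comm R.e, ← R.r_eq, D.γ_pow,
        div_self (mul_ne_zero D.β_ne_zero (by simpa using D.β_ne_zero))])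
  exact ⟨i, j, by rw [hj, div_mul_cancel₀ _ (mul_ne_zero h0 h1)]⟩

theorem exists_rho_rotate (i : D.I) (s : ℕ) : ∃ i', R.rho i' * D.σk (R.rho i') =
    (D.ν ^ R.e) ^ (2 * s) * (R.rho i * D.σk (R.rho i)) := by
  obtain ⟨i', hi'⟩ := R.exists_rho_eq (ρ := (D.ν ^ R.e) ^ s * R.rho i) (by
    rw [mul_pow, R.rho_pow, ← pow_mul, mul_comm s, pow_mul, hκ.pow_eq_one, one_pow, one_mul])
  refine ⟨i', ?_⟩
  rw [hi', map_mul, map_pow, map_pow, σk_ν]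
  ring

/-- Passing to another root changes `ρ σ(ρ)` by an even power of `ν^e`. So only the parity of the
exponent in `exists_pow_mul_eq` matters: even gives a fixed vertex, odd a fixed arrow. -/
theorem exists_vertex_or_arrow : (∃ i, D.dag i = i) ∨ ∃ j, D.rot j = D.dag j := by
  obtain ⟨i, j, h⟩ := exists_pow_mul_eq R hκ
  rcases Nat.even_or_odd' j with ⟨s, rfl | rfl⟩ <;> obtain ⟨i', h1⟩ := exists_rho_rotate R hκ i s
  · exact Or.inl ⟨i', by rw [D.dag_eq_self_iff R, h1, h]⟩
  · exact Or.inr ⟨i', by rw [D.rot_eq_dag_iff R, h1, ← h]; ring⟩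

/-- For odd `g` the exponent may be increased by `g`, which changes its parity; so both exist. -/
theorem exists_vertex_and_arrow (hg : Odd R.g) : (∃ i, D.dag i = i) ∧ ∃ j, D.rot j = D.dag j := by
  obtain ⟨i, j, h⟩ := exists_pow_mul_eq R hκ
  have h' : (D.ν ^ R.e) ^ (j + R.g) * (R.rho i * D.σk (R.rho i)) = D.γ ^ R.e := by
    rw [pow_add, hκ.pow_eq_one, mul_one, h]
  have hv : ∀ s, (D.ν ^ R.e) ^ (2 * s) * (R.rho i * D.σk (R.rho i)) = D.γ ^ R.e →
      ∃ i, D.dag i = i := fun s hs => by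
    obtain ⟨i', h1⟩ := exists_rho_rotate R hκ i s
    exact ⟨i', by rw [D.dag_eq_self_iff R, h1, hs]⟩
  have ha : ∀ s, (D.ν ^ R.e) ^ (2 * s + 1) * (R.rho i * D.σk (R.rho i)) = D.γ ^ R.e →
      ∃ j, D.rot j = D.dag j := fun s hs => by
    obtain ⟨i', h1⟩ := exists_rho_rotate R hκ i s
    exact ⟨i', by rw [D.rot_eq_dag_iff R, h1, ← hs]; ring⟩
  rcases Nat.even_or_odd' j with ⟨s, hs | hs⟩
  · obtain ⟨s', hs'⟩ : Odd (j + R.g) := (hs ▸ even_two_mul s : Even j).add_odd hg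
    exact ⟨hv s (hs ▸ h), ha s' (hs' ▸ h')⟩
  · obtain ⟨s', hs'⟩ := (hs ▸ odd_two_mul_add_one s : Odd j).add_odd hg
    exact ⟨hv s' (by rw [two_mul, ← hs']; exact h'), ha s (hs ▸ h)⟩

end Cycle

section Fields

theorem aeval_bi_surjective (E : CyclicDatum k F) (i : E.I) (z : E.Li i) :
    ∃ p : k[X], Polynomial.aeval (E.bi i) p = z := by
  obtain ⟨l, rfl⟩ := E.algebraMap_Li_surjective i z
  obtain ⟨p, rfl⟩ := E.mkL_surjective l
  refine ⟨p, ?_⟩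
  have h : Polynomial.aeval (E.bi i) =
      (IsScalarTower.toAlgHom k E.L (E.Li i)).comp (mkL E) := Polynomial.algHom_ext (by
    rw [Polynomial.aeval_X]
    rfl)
  rw [h]
  rfl

theorem bi_eq (he : R.e = 1) (i : D.I) : algebraMap k (D.Li i) (R.rho i) = D.bi i := by
  have h := R.bi_pow i
  rwa [he, pow_one, eq_comm] at h

theorem allSplit (he : R.e = 1) : D.AllSplit := by
  refine fun i => ⟨(algebraMap k (D.Li i)).injective, fun z => ?_⟩
  obtain ⟨p, rfl⟩ := aeval_bi_surjective D.toCyclicDatum i z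
  exact ⟨p.eval (R.rho i), by rw [← bi_eq R he, Polynomial.aeval_algebraMap_apply_eq_algebraMap_eval]⟩

theorem exists_add_mul_bi (he : R.e = 2) (i : D.I) (z : D.Li i) :
    ∃ x y : k, z = algebraMap k _ x + algebraMap k _ y * D.bi i := by
  obtain ⟨p, rfl⟩ := aeval_bi_surjective D.toCyclicDatum i z
  have hb : D.bi i * D.bi i = algebraMap k (D.Li i) (R.rho i) := by
    rw [← R.bi_pow i, he, sq]
  induction p using Polynomial.induction_on' with
  | add p q hp hq =>
    obtain ⟨x, y, h1⟩ := hp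
    obtain ⟨x', y', h2⟩ := hq
    refine ⟨x + x', y + y', ?_⟩
    rw [map_add, h1, h2, map_add, map_add]
    ring
  | monomial n a =>
    rw [Polynomial.aeval_monomial]
    rcases Nat.even_or_odd' n with ⟨s, rfl | rfl⟩
    · refine ⟨a * R.rho i ^ s, 0, ?_⟩
      rw [pow_mul, sq, hb, map_zero, zero_mul, add_zero, map_mul, map_pow]
    · refine ⟨0, a * R.rho i ^ s, ?_⟩
      rw [pow_succ, pow_mul, sq, hb, map_zero, zero_add, map_mul, map_pow, mul_assoc]

variable {i : D.I} {s : D.Li i →ₐ[D.k₀] D.Li i}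
  (hs : ∀ a, s (algebraMap k _ a) = algebraMap k _ (D.σk a))

include hs

theorem eq_id_of_split (hsplit : D.AllSplit) (hid : ∀ a, D.σk a = a) (z : D.Li i) : s z = z := by
  obtain ⟨a, rfl⟩ := (hsplit i).2 z
  rw [hs, hid]

theorem isConjugation_of_split (hsplit : D.AllSplit) (hne : ∃ a, D.σk a ≠ a) :
    D.IsConjugation s := by
  refine ⟨?_, fun z => ?_, fun z hz => ?_⟩
  · obtain ⟨a, ha⟩ := hne
    exact ⟨algebraMap k _ a, by rw [hs]; exact fun h => ha ((hsplit i).1 h)⟩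
  · obtain ⟨a, rfl⟩ := (hsplit i).2 z
    rw [hs, hs, σk_σk]
  · obtain ⟨a, rfl⟩ := (hsplit i).2 z
    rw [hs] at hz
    exact ⟨⟨a, (hsplit i).1 hz⟩, rfl⟩

theorem eq_id_of_quadratic (he : R.e = 2) (hid : ∀ a, D.σk a = a) (hb : s (D.bi i) = D.bi i)
    (z : D.Li i) : s z = z := by
  obtain ⟨x, y, rfl⟩ := exists_add_mul_bi R he i z
  rw [map_add, map_mul, hs, hs, hid, hid, hb]

theorem isConjugation_of_quadratic (he : R.e = 2) (hid : ∀ a, D.σk a = a)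
    (hb : s (D.bi i) = -D.bi i) : D.IsConjugation s := by
  have h0 : D.bi i ≠ 0 := by
    intro h
    have h1 := R.bi_pow i
    rw [h, he, zero_pow two_ne_zero, eq_comm, map_eq_zero] at h1
    exact R.ne_zero (R.rho_pow i) h1
  have : CharZero (D.Li i) := charZero_of_injective_algebraMap (algebraMap k (D.Li i)).injective
  refine ⟨⟨D.bi i, fun h => ?_⟩, fun z => ?_, fun z hz => ?_⟩
  · rw [hb] at h
    exact h0 (self_eq_neg.mp h.symm)
  · obtain ⟨x, y, rfl⟩ := exists_add_mul_bi R he i z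
    simp only [map_add, map_mul, map_neg, hs, hid, hb, neg_neg]
  · obtain ⟨x, y, rfl⟩ := exists_add_mul_bi R he i z
    rw [map_add, map_mul, hs, hs, hid, hid, hb, mul_neg, add_right_inj] at hz
    refine ⟨⟨x, hid x⟩, ?_⟩
    rw [self_eq_neg.mp hz.symm, add_zero]
    rfl

end Fields

section SigmaValues

theorem sigmaVertex_algebraMap {i : D.I} (h : D.dag i = i) (l : D.L) :
    D.sigmaVertex i h (algebraMap D.L (D.Li i) l) = algebraMap D.L (D.Li i) (D.sigmaC l) := rfl

theorem sigmaVertex_scalar {i : D.I} (h : D.dag i = i) (a : k) :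
    D.sigmaVertex i h (algebraMap k (D.Li i) a) = algebraMap k (D.Li i) (D.σk a) := by
  rw [IsScalarTower.algebraMap_apply k D.L, sigmaVertex_algebraMap, sigmaC_algebraMap,
    ← IsScalarTower.algebraMap_apply]

theorem sigmaArrow_scalar {j : D.I} (h : D.rot j = D.dag j) (a : k) :
    D.sigmaArrow j h (algebraMap k (D.Li j) a) = algebraMap k (D.Li j) (D.σk a) := by
  rw [IsScalarTower.algebraMap_apply k D.L, Choices.sigmaArrow_algebraMap, sigmaC_algebraMap, mu_algebraMap,
    ← IsScalarTower.algebraMap_apply]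

/-- For quadratic `L_i`, comparison with `b_i² = ±γ` shows whether `σ_c` fixes `b_i` or changes its
sign. -/
theorem bi_mul_sigmaVertex {i : D.I} (h : D.dag i = i) :
    D.bi i * D.sigmaVertex i h (D.bi i) = algebraMap k (D.Li i) D.γ := by
  have h1 : D.b * D.sigmaC D.b = algebraMap k D.L D.γ := by
    rw [sigmaC_b, mul_left_comm, D.b_mul_bInv, mul_one]
  rw [bi, sigmaVertex_algebraMap, ← map_mul, h1, ← IsScalarTower.algebraMap_apply]

theorem bi_mul_sigmaArrow {j : D.I} (h : D.rot j = D.dag j) :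
    D.bi j * D.sigmaArrow j h (D.bi j) = algebraMap k (D.Li j) (D.γ * D.ν⁻¹) := by
  have h1 : D.b * D.mu (D.sigmaC D.b) = algebraMap k D.L (D.γ * D.ν⁻¹) := by
    have h2 : algebraMap k D.L D.ν * D.b * D.mu D.bInv = 1 := by
      rw [← mu_b, ← map_mul, D.b_mul_bInv, map_one]
    have h3 : algebraMap k D.L D.ν⁻¹ * algebraMap k D.L D.ν = 1 := by
      rw [← map_mul, inv_mul_cancel₀ D.ν_ne_zero, map_one]
    rw [sigmaC_b, map_mul, mu_algebraMap, map_mul]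
    calc D.b * (algebraMap k D.L D.γ * D.mu D.bInv) = algebraMap k D.L D.γ *
          (algebraMap k D.L D.ν⁻¹ * algebraMap k D.L D.ν * D.b * D.mu D.bInv) := by
          rw [h3]; ring
      _ = _ := by rw [mul_assoc _ (algebraMap k D.L D.ν), mul_assoc, h2, mul_one]
  rw [bi, Choices.sigmaArrow_algebraMap, ← map_mul, h1, ← IsScalarTower.algebraMap_apply]

/-- If `x s(x) = ± x²` with `x ≠ 0`, then `s(x) = ± x`. -/
theorem eq_smul_of_mul_eq (he : R.e = 2) {i : D.I} {x : D.Li i} {u : ℤˣ} {a : k}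
    (h : D.bi i * x = algebraMap k (D.Li i) a) (ha : a = (u : ℤ) * R.rho i) :
    x = (u : ℤ) • D.bi i := by
  have h0 : D.bi i ≠ 0 := by
    intro h
    have h1 := R.bi_pow i
    rw [h, he, zero_pow two_ne_zero, eq_comm, map_eq_zero] at h1
    exact R.ne_zero (R.rho_pow i) h1
  apply mul_left_cancel₀ h0
  rw [h, ha, map_mul, ← R.bi_pow, he, map_intCast, zsmul_eq_mul]
  ring

end SigmaValues

end PolarizedDatum

end LoopGrading

end

/-! ### Fixed vertices and arrows in the split and in the quadratic case. -/

noncomputable section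

namespace LoopGrading

namespace PolarizedDatum

open CyclicDatum

section Split

variable {k : Type} [Field k] {F : Type u} [CommRing F] [Algebra k F]
  {D : PolarizedDatum.{u, v} k F} [Nontrivial F] [CharZero k] {R : D.toCyclicDatum.RootDatum}

theorem r_eq_of_e (he : R.e = 1) : R.g = D.r := by
  have h := R.r_eq
  rw [he, mul_one] at h
  exact h.symm

theorem isPrimitiveRoot_of_e (he : R.e = 1) (hξ : IsPrimitiveRoot D.ν D.r) :
    IsPrimitiveRoot (D.ν ^ R.e) R.g := by
  rw [he, pow_one, r_eq_of_e he]
  exact hξ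

/-- For `e = 1` the vertices are the roots `a` of `a^(m/n) = β` in `k`, and being fixed by `†` is
the other equation. -/
theorem isRoot_iff_vertex (he : R.e = 1) (a : k) :
    (a * D.σk a = D.γ ∧ a ^ D.r = D.β) ↔ ∃ i, D.dag i = i ∧ R.rho i = a := by
  constructor
  · rintro ⟨h1, h2⟩
    rw [← r_eq_of_e he] at h2
    obtain ⟨i, rfl⟩ := R.exists_rho_eq h2
    exact ⟨i, by rw [D.dag_eq_self_iff R, h1, he, pow_one], rfl⟩
  · rintro ⟨i, h, rfl⟩
    rw [D.dag_eq_self_iff R, he, pow_one] at h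
    exact ⟨h, by rw [← r_eq_of_e he, R.rho_pow]⟩

theorem isRoot_iff_arrow (he : R.e = 1) (a : k) :
    (a * D.σk a = D.γ * D.ν⁻¹ ∧ a ^ D.r = D.β) ↔ ∃ j, D.rot j = D.dag j ∧ R.rho j = a := by
  have hν : ∀ x, D.ν * x = D.γ ↔ x = D.γ * D.ν⁻¹ := fun x => by
    rw [eq_mul_inv_iff_mul_eq₀ D.ν_ne_zero, mul_comm]
  constructor
  · rintro ⟨h1, h2⟩
    rw [← r_eq_of_e he] at h2
    obtain ⟨j, rfl⟩ := R.exists_rho_eq h2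
    exact ⟨j, by rw [D.rot_eq_dag_iff R, he, pow_one, pow_one, hν, h1], rfl⟩
  · rintro ⟨j, h, rfl⟩
    rw [D.rot_eq_dag_iff R, he, pow_one, pow_one, hν] at h
    exact ⟨h, by rw [← r_eq_of_e he, R.rho_pow]⟩

theorem isVE_of_odd (hκ : IsPrimitiveRoot (D.ν ^ R.e) R.g) (hg : Odd R.g) :
    ∃ ℓ, 2 * ℓ + 1 = R.g ∧ D.IsVE ℓ := by
  obtain ⟨⟨i, hi⟩, -⟩ := exists_vertex_and_arrow R hκ hg
  obtain ⟨ℓ, hℓ⟩ := hg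
  exact ⟨ℓ, hℓ.symm, isVE_of_fixed R hκ hi hℓ.symm⟩

theorem exists_vertex_of_odd (he : R.e = 1) (hξ : IsPrimitiveRoot D.ν D.r) (hr : Odd D.r) :
    ∃ (i : D.I) (_ : D.dag i = i), (∀ i', D.dag i' = i' → i' = i) ∧
      ∃ a, algebraMap _ (D.Li i) a = D.bi i ∧
        ∀ a', (a' * D.σk a' = D.γ ∧ a' ^ D.r = D.β) ↔ a' = a := by
  have hκ := isPrimitiveRoot_of_e he hξ
  have hg : Odd R.g := by rwa [r_eq_of_e he]
  obtain ⟨⟨i, hi⟩, -⟩ := exists_vertex_and_arrow R hκ hg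
  refine ⟨i, hi, vertex_unique R hκ hg hi, R.rho i, bi_eq R he i, fun a => ?_⟩
  rw [isRoot_iff_vertex he]
  constructor
  · rintro ⟨i', hi', rfl⟩
    rw [vertex_unique R hκ hg hi i' hi']
  · rintro rfl
    exact ⟨i, hi, rfl⟩

theorem exists_arrow_of_odd (he : R.e = 1) (hξ : IsPrimitiveRoot D.ν D.r) (hr : Odd D.r) :
    ∃ (j : D.I) (_ : D.rot j = D.dag j), (∀ j', D.rot j' = D.dag j' → j' = j) ∧
      ∃ a, algebraMap _ (D.Li j) a = D.bi j ∧
        ∀ a', (a' * D.σk a' = D.γ * D.ν⁻¹ ∧ a' ^ D.r = D.β) ↔ a' = a := by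
  have hκ := isPrimitiveRoot_of_e he hξ
  have hg : Odd R.g := by rwa [r_eq_of_e he]
  obtain ⟨-, j, hj⟩ := exists_vertex_and_arrow R hκ hg
  refine ⟨j, hj, arrow_unique R hκ hg hj, R.rho j, bi_eq R he j, fun a => ?_⟩
  rw [isRoot_iff_arrow he]
  constructor
  · rintro ⟨j', hj', rfl⟩
    rw [arrow_unique R hκ hg hj j' hj']
  · rintro rfl
    exact ⟨j, hj, rfl⟩

theorem exists_vertices_of_even (he : R.e = 1) (hξ : IsPrimitiveRoot D.ν D.r) (hr : Even D.r)
    (hex : ∃ a, a * D.σk a = D.γ ∧ a ^ D.r = D.β) : D.IsVV (D.r / 2) ∧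
      ∃ (i i' : D.I) (_ : D.dag i = i) (_ : D.dag i' = i'), i ≠ i' ∧
        (∀ t, D.dag t = t → t = i ∨ t = i') ∧
        ∃ a, algebraMap _ (D.Li i) a = D.bi i ∧ algebraMap _ (D.Li i') (-a) = D.bi i' ∧
          ∀ a', (a' * D.σk a' = D.γ ∧ a' ^ D.r = D.β) ↔ (a' = a ∨ a' = -a) := by
  have hκ := isPrimitiveRoot_of_e he hξ
  have hg : Even R.g := by rwa [r_eq_of_e he]
  obtain ⟨a, ha⟩ := hex
  obtain ⟨i, hi, rfl⟩ := (isRoot_iff_vertex he a).mp ha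
  obtain ⟨i', h1, h2, h3, h4⟩ := exists_vertex_pair R hκ hg hi
  refine ⟨isVV_of_fixed R hκ hi (by rw [r_eq_of_e he, Nat.two_mul_div_two_of_even hr]), i, i', hi,
    h3, h2, h4, R.rho i, bi_eq R he i, by rw [← h1, bi_eq R he], fun a => ?_⟩
  rw [isRoot_iff_vertex he]
  constructor
  · rintro ⟨t, ht, rfl⟩
    rcases h4 t ht with rfl | rfl
    · exact Or.inl rfl
    · exact Or.inr h1
  · rintro (rfl | rfl)
    · exact ⟨i, hi, rfl⟩
    · exact ⟨i', h3, h1⟩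

theorem exists_arrows_of_even (he : R.e = 1) (hξ : IsPrimitiveRoot D.ν D.r) (hr : Even D.r)
    (hex : ∃ a, a * D.σk a = D.γ * D.ν⁻¹ ∧ a ^ D.r = D.β) : D.IsEE (D.r / 2) ∧
      ∃ (j j' : D.I) (_ : D.rot j = D.dag j) (_ : D.rot j' = D.dag j'), j ≠ j' ∧
        (∀ t, D.rot t = D.dag t → t = j ∨ t = j') ∧
        ∃ a, algebraMap _ (D.Li j) a = D.bi j ∧ algebraMap _ (D.Li j') (-a) = D.bi j' ∧
          ∀ a', (a' * D.σk a' = D.γ * D.ν⁻¹ ∧ a' ^ D.r = D.β) ↔ (a' = a ∨ a' = -a) := by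
  have hκ := isPrimitiveRoot_of_e he hξ
  have hg : Even R.g := by rwa [r_eq_of_e he]
  obtain ⟨a, ha⟩ := hex
  obtain ⟨j, hj, rfl⟩ := (isRoot_iff_arrow he a).mp ha
  obtain ⟨j', h1, h2, h3, h4⟩ := exists_arrow_pair R hκ hg hj
  refine ⟨isEE_of_fixed R hκ hj (by rw [r_eq_of_e he, Nat.two_mul_div_two_of_even hr]), j, j', hj,
    h3, h2, h4, R.rho j, bi_eq R he j, by rw [← h1, bi_eq R he], fun a => ?_⟩
  rw [isRoot_iff_arrow he]
  constructor
  · rintro ⟨t, ht, rfl⟩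
    rcases h4 t ht with rfl | rfl
    · exact Or.inl rfl
    · exact Or.inr h1
  · rintro (rfl | rfl)
    · exact ⟨j, hj, rfl⟩
    · exact ⟨j', h3, h1⟩

/-- There is a fixed vertex or a fixed arrow, and a fixed vertex would give a solution of the
excluded equations. -/
theorem exists_arrow_root (he : R.e = 1) (hξ : IsPrimitiveRoot D.ν D.r)
    (hex : ¬ ∃ a, a * D.σk a = D.γ ∧ a ^ D.r = D.β) :
    ∃ a, a * D.σk a = D.γ * D.ν⁻¹ ∧ a ^ D.r = D.β := by
  rcases exists_vertex_or_arrow R (isPrimitiveRoot_of_e he hξ) with ⟨i, hi⟩ | ⟨j, hj⟩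
  · exact absurd ⟨R.rho i, (isRoot_iff_vertex he _).mpr ⟨i, hi, rfl⟩⟩ hex
  · exact ⟨R.rho j, (isRoot_iff_arrow he _).mpr ⟨j, hj, rfl⟩⟩

end Split

section Quadratic

variable {k : Type} [Field k] {F : Type u} [CommRing F] [Algebra k F]
  {D : PolarizedDatum.{u, v} k F} [Nontrivial F] [CharZero k] {R : D.toCyclicDatum.RootDatum}
  [Module.Finite k F] (C : Choices.{u, v, w} D) (A : D.toCyclicDatum.Splitting)
  (he : R.e = 2) (hid : ∀ a, D.σk a = a)

include A he hid

/-- Take the vertex with `ρ_i = γ`: then `b_i σ_c(b_i) = b_i²`, so `σ_c` is trivial on `L_i`. The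
value `-γ` gives a conjugation instead, and `±γ ν⁻¹` play the same roles for arrows. -/
theorem exists_orthogonalOrSymplectic (h : D.γ ^ R.g = D.β) : ∃ (i : D.I) (h : D.dag i = i),
    R.rho i = D.γ ∧ D.bi i ^ 2 = algebraMap _ (D.Li i) D.γ ∧
      C.VertexOrthogonalOrSymplectic i h := by
  obtain ⟨i, hi⟩ := R.exists_rho_eq h
  have hd : D.dag i = i := by rw [D.dag_eq_self_iff R, hi, hid, he, sq]
  refine ⟨i, hd, hi, by rw [← hi, ← R.bi_pow, he], C.vertexOrthogonalOrSymplectic A hd ?_⟩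
  refine eq_id_of_quadratic R (sigmaVertex_scalar hd) he hid ?_
  have h1 := eq_smul_of_mul_eq R he (u := 1) (bi_mul_sigmaVertex hd) (by simp [hi])
  rwa [Units.val_one, one_smul] at h1

theorem exists_vertexUnitary (h : (-D.γ) ^ R.g = D.β) : ∃ (i : D.I) (h : D.dag i = i),
    R.rho i = -D.γ ∧ D.bi i ^ 2 = algebraMap _ (D.Li i) (-D.γ) ∧ C.VertexUnitary i h := by
  obtain ⟨i, hi⟩ := R.exists_rho_eq h
  have hd : D.dag i = i := by rw [D.dag_eq_self_iff R, hi, hid, he, sq, neg_mul_neg]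
  refine ⟨i, hd, hi, by rw [← hi, ← R.bi_pow, he], C.vertexUnitary A hd ?_⟩
  refine isConjugation_of_quadratic R (sigmaVertex_scalar hd) he hid ?_
  have h1 := eq_smul_of_mul_eq R he (u := -1) (bi_mul_sigmaVertex hd) (by simp [hi])
  rwa [Units.val_neg, Units.val_one, neg_smul, one_smul] at h1

theorem exists_arrowWedgeOrSym (h : (D.γ * D.ν⁻¹) ^ R.g = D.β) :
    ∃ (j : D.I) (h : D.rot j = D.dag j), R.rho j = D.γ * D.ν⁻¹ ∧
      D.bi j ^ 2 = algebraMap _ (D.Li j) (D.γ * D.ν⁻¹) ∧ C.ArrowWedgeOrSym j h := by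
  obtain ⟨j, hj⟩ := R.exists_rho_eq h
  have hν := D.ν_ne_zero
  have hd : D.rot j = D.dag j := by
    rw [D.rot_eq_dag_iff R, hj, hid, he]
    field_simp
  refine ⟨j, hd, hj, by rw [← hj, ← R.bi_pow, he], C.arrowWedgeOrSym hd ?_ A⟩
  refine eq_id_of_quadratic R (sigmaArrow_scalar hd) he hid ?_
  have h1 := eq_smul_of_mul_eq R he (u := 1) (bi_mul_sigmaArrow hd) (by simp [hj])
  rwa [Units.val_one, one_smul] at h1

theorem exists_arrowHermitian (h : (-D.γ * D.ν⁻¹) ^ R.g = D.β) :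
    ∃ (j : D.I) (h : D.rot j = D.dag j), R.rho j = -D.γ * D.ν⁻¹ ∧
      D.bi j ^ 2 = algebraMap _ (D.Li j) (-D.γ * D.ν⁻¹) ∧ C.ArrowHermitian j h := by
  obtain ⟨j, hj⟩ := R.exists_rho_eq h
  have hν := D.ν_ne_zero
  have hd : D.rot j = D.dag j := by
    rw [D.rot_eq_dag_iff R, hj, hid, he]
    field_simp
  refine ⟨j, hd, hj, by rw [← hj, ← R.bi_pow, he], C.arrowHermitian hd A ?_⟩
  refine isConjugation_of_quadratic R (sigmaArrow_scalar hd) he hid ?_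
  have h1 := eq_smul_of_mul_eq R he (u := -1) (bi_mul_sigmaArrow hd) (by simp [hj])
  rwa [Units.val_neg, Units.val_one, neg_smul, one_smul] at h1

end Quadratic

end PolarizedDatum

end LoopGrading

end

/-! ### Root data and valuations over `ℂ((τ))`. -/

noncomputable section

namespace LoopGrading

theorem nonempty_equiv_adjoinRoot_sq {K A : Type*} [Field K] [CommRing A] [Nontrivial A]
    [Algebra K A] {t : K} (ht : Irreducible (Polynomial.X ^ 2 - Polynomial.C t)) {x : A}
    (hx : x ^ 2 = algebraMap K A t) (hs : ∀ z, ∃ a c, z = algebraMap K A a + algebraMap K A c * x) :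
    Nonempty (A ≃ₐ[K] AdjoinRoot (Polynomial.X ^ 2 - Polynomial.C t)) := by
  have : Fact (Irreducible (Polynomial.X ^ 2 - Polynomial.C t)) := ⟨ht⟩
  let f : AdjoinRoot (Polynomial.X ^ 2 - Polynomial.C t) →ₐ[K] A :=
    AdjoinRoot.liftAlgHom _ (Algebra.ofId _ _) x (by
      rw [Polynomial.eval₂_sub, Polynomial.eval₂_pow, Polynomial.eval₂_X, Polynomial.eval₂_C, hx]
      exact sub_self _)
  have hf : f (AdjoinRoot.root _) = x := AdjoinRoot.liftAlgHom_root _ _ _ _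
  refine ⟨(AlgEquiv.ofBijective f ⟨RingHom.injective f.toRingHom, fun z => ?_⟩).symm⟩
  obtain ⟨a, c, rfl⟩ := hs z
  exact ⟨algebraMap _ _ a + algebraMap _ _ c * AdjoinRoot.root _, by
    rw [map_add, map_mul, AlgHom.commutes, AlgHom.commutes, hf]⟩

namespace PolarizedDatum

section Field

variable {k : Type} [Field k] {F : Type u} [CommRing F] [Algebra k F]
  {D : PolarizedDatum.{u, v} k F}

/-- Because of this sign, replacing `γ` by `γ ν⁻¹` exchanges the cases `β = γ^(m/2n)` and `β =
-γ^(m/2n)`, that is, the roles of vertices and arrows. -/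
theorem ν_inv_pow (hξ : IsPrimitiveRoot D.ν D.r) (hr : Even D.r) : D.ν⁻¹ ^ (D.r / 2) = -1 := by
  have h1 : (D.ν ^ (D.r / 2)) ^ 2 = 1 := by
    rw [← pow_mul, Nat.div_mul_cancel hr.two_dvd, D.ν_pow]
  have h2 : D.ν ^ (D.r / 2) ≠ 1 := by
    have := D.r_pos
    obtain ⟨d, hd⟩ := hr
    exact hξ.pow_ne_one_of_pos_of_lt (by omega) (by omega)
  rw [inv_pow, (sq_eq_sq_iff_eq_or_eq_neg.mp (h1.trans (one_pow 2).symm)).resolve_left h2, inv_neg,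
    inv_one]

theorem γν_pow (hξ : IsPrimitiveRoot D.ν D.r) (hr : Even D.r) :
    (D.γ * D.ν⁻¹) ^ (D.r / 2) = -D.γ ^ (D.r / 2) := by
  rw [mul_pow, ν_inv_pow hξ hr, mul_neg, mul_one]

end Field

open CyclicDatum

variable {F : Type u} [CommRing F] [Algebra (LaurentSeries ℂ) F]
  {D : PolarizedDatum.{u, v} (LaurentSeries ℂ) F}

/-- The roots of `ρ^{m/n} = β`, if there is one. -/
def splitRootDatum (hξ : IsPrimitiveRoot D.ν D.r) {ρ : LaurentSeries ℂ} (hρ : ρ ^ D.r = D.β) :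
    D.toCyclicDatum.RootDatum where
  g := D.r
  e := 1
  r_eq := (mul_one _).symm
  κ := D.ν
  isPrimitiveRoot := hξ
  ρ₀ := ρ
  ρ₀_pow := hρ
  irreducible ρ _ := by
    rw [pow_one]
    exact Polynomial.irreducible_X_sub_C ρ

theorem order_root {ρ : LaurentSeries ℂ} {g : ℕ} (hg : 0 < g) {x : LaurentSeries ℂ}
    (h : ρ ^ g = x ^ g) : ρ.order = x.order := by
  have h1 := congrArg HahnSeries.order h
  rw [HahnSeries.order_pow, HahnSeries.order_pow, nsmul_eq_mul, nsmul_eq_mul] at h1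
  exact mul_left_cancel₀ (Int.natCast_ne_zero.mpr hg.ne') h1

theorem irreducible_of_odd_order {ρ : LaurentSeries ℂ} (h : Odd ρ.order) :
    Irreducible (Polynomial.X ^ 2 - Polynomial.C ρ) := by
  refine X_pow_sub_C_irreducible_of_prime Nat.prime_two fun b hb => ?_
  rw [← hb, HahnSeries.order_pow, two_nsmul] at h
  exact Int.not_odd_iff_even.mpr (Even.add_self _) h

/-- The roots of `ρ^{m/2n} = β`, if there is one and the valuation is odd. -/
def quadraticRootDatum (hξ : IsPrimitiveRoot D.ν D.r) {g : ℕ} (hr : D.r = g * 2)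
    {ρ : LaurentSeries ℂ} (hρ : ρ ^ g = D.β) (hodd : Odd ρ.order) :
    D.toCyclicDatum.RootDatum where
  g := g
  e := 2
  r_eq := hr
  κ := D.ν ^ 2
  isPrimitiveRoot := hξ.pow D.r_pos (hr.trans (mul_comm _ _))
  ρ₀ := ρ
  ρ₀_pow := hρ
  irreducible ρ' h := by
    have hg : 0 < g := Nat.pos_of_ne_zero fun h => D.r_pos.ne' (by rw [hr, h, zero_mul])
    refine irreducible_of_odd_order ?_
    rwa [order_root hg (h.trans hρ.symm)]

/-- The quotient `ρ_i / τ` has even valuation, so `ρ_i = τ y²` and `b_i / y` is a square root of `τ`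
generating `L_i`. -/
theorem allQuadratic {R : D.toCyclicDatum.RootDatum} (he : R.e = 2)
    (hodd : ∀ i, Odd (R.rho i).order) [Nontrivial F] : D.AllQuadratic := by
  intro i
  have h0 := R.ne_zero (R.rho_pow i)
  have h1 : (R.rho i * tau⁻¹).order = (R.rho i).order - 1 := by
    rw [HahnSeries.order_mul h0 (inv_ne_zero tau_ne_zero), ← zpow_neg_one, order_zpow tau_ne_zero,
      order_tau]
    ring
  obtain ⟨y, hy⟩ := laurent_exists_pow_eq (R.rho i * tau⁻¹) two_pos
    (mul_ne_zero h0 (inv_ne_zero tau_ne_zero)) (by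
      obtain ⟨d, hd⟩ := hodd i
      rw [h1, hd, add_sub_cancel_right]
      exact dvd_mul_right _ _)
  have hy0 : y ≠ 0 := by
    rintro rfl
    rw [zero_pow two_ne_zero] at hy
    exact mul_ne_zero h0 (inv_ne_zero tau_ne_zero) hy.symm
  let x : D.Li i := algebraMap _ _ y⁻¹ * D.bi i
  have hx : x ^ 2 = algebraMap _ _ tau := by
    have h2 := R.bi_pow i
    rw [he] at h2
    change (algebraMap _ _ y⁻¹ * D.bi i) ^ 2 = _
    rw [mul_pow, h2, ← map_pow, ← map_mul, inv_pow, hy]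
    congr 1
    field_simp [tau_ne_zero]
  have hbi : D.bi i = algebraMap _ _ y * x := by
    change _ = algebraMap _ _ y * (algebraMap _ _ y⁻¹ * D.bi i)
    rw [← mul_assoc, ← map_mul, mul_inv_cancel₀ hy0, map_one, one_mul]
  clear_value x
  refine nonempty_equiv_adjoinRoot_sq (irreducible_of_odd_order (show Odd tau.order by rw [order_tau]; decide)) hx
    fun z => ?_
  obtain ⟨a, c, rfl⟩ := exists_add_mul_bi R he i z
  exact ⟨a, c * y, by rw [hbi, map_mul, mul_assoc]⟩

section Orders

variable [Nontrivial F]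

theorem order_σk (x : LaurentSeries ℂ) : (D.σk x).order = x.order := order_map D.σk_σk x

/-- Compare valuations in `γ^(m/n) = β σ(β)`; `σ` preserves them. -/
theorem order_γ : (D.r : ℤ) * D.γ.order = 2 * D.β.order := by
  have h1 := congrArg HahnSeries.order D.γ_pow
  rw [HahnSeries.order_pow, HahnSeries.order_mul D.β_ne_zero (by simpa using D.β_ne_zero), order_σk,
    nsmul_eq_mul] at h1
  rw [h1, two_mul]

theorem order_ν : D.ν.order = 0 := by
  have h1 := congrArg HahnSeries.order D.ν_pow
  rw [HahnSeries.order_pow, HahnSeries.order_one, nsmul_eq_mul] at h1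
  exact (mul_eq_zero.mp h1).resolve_left (Int.natCast_ne_zero.mpr D.r_pos.ne')

theorem dvd_order_of_odd (h : Odd D.r) : (D.r : ℤ) ∣ D.β.order := by
  have hc : IsCoprime (D.r : ℤ) 2 := (Nat.coprime_two_right.mpr h).isCoprime
  exact hc.dvd_of_dvd_mul_left (Dvd.intro _ order_γ)

theorem dvd_order_of_even (h : Even D.γ.order) : (D.r : ℤ) ∣ D.β.order := by
  obtain ⟨d, hd⟩ := h
  refine ⟨d, ?_⟩
  have h1 := order_γ (D := D)
  rw [hd] at h1
  linarith

theorem even_order_γ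
    (hσ : ∀ z : ℂ, D.σk (algebraMap ℂ (LaurentSeries ℂ) z) = algebraMap ℂ (LaurentSeries ℂ) z)
    (hne : ∃ a, D.σk a ≠ a) : Even D.γ.order := by
  obtain ⟨t, ht, hst⟩ := exists_antiinvariant_uniformizer D.σk_σk hσ hne
  exact even_order_of_fixed D.σk_σk hσ ht hst D.σk_γ

theorem exists_root (h : (D.r : ℤ) ∣ D.β.order) : ∃ ρ, ρ ^ D.r = D.β :=
  laurent_exists_pow_eq D.β D.r_pos D.β_ne_zero h

theorem β_eq_or (hid : ∀ a, D.σk a = a) (hr : Even D.r) :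
    D.β = D.γ ^ (D.r / 2) ∨ D.β = -D.γ ^ (D.r / 2) := by
  apply sq_eq_sq_iff_eq_or_eq_neg.mp
  have h1 := D.γ_pow
  rw [hid, ← sq] at h1
  rw [← h1, ← pow_mul, Nat.div_mul_cancel hr.two_dvd]

theorem order_γν : (D.γ * D.ν⁻¹).order = D.γ.order := by
  rw [HahnSeries.order_mul D.γ_ne_zero (inv_ne_zero D.ν_ne_zero), ← zpow_neg_one,
    order_zpow D.ν_ne_zero, order_ν, mul_zero, add_zero]

/-- `β` is a power of exponent `m / 2n` if `σ` is trivial on `k` and `m / n` is even. -/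
theorem exists_half_root (hξ : IsPrimitiveRoot D.ν D.r) (hid : ∀ a, D.σk a = a) (hr : Even D.r) :
    ∃ ρ : LaurentSeries ℂ, ρ ^ (D.r / 2) = D.β ∧ ρ.order = D.γ.order := by
  rcases β_eq_or hid hr with h | h
  · exact ⟨D.γ, h.symm, rfl⟩
  · exact ⟨D.γ * D.ν⁻¹, (γν_pow hξ hr).trans h.symm, order_γν⟩

/-- If `val(γ)` is even or `m/n` is odd, `β` is an `(m/n)`-th power in `k`. Otherwise `σ|_k = id`,
since elements of `k^σ` have even valuation for non-trivial `σ|_k`, and `β` is the `(m/2n)`-th power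
of an element with the odd valuation of `γ`. -/
theorem exists_splitting [IsReduced F]
    (hσ : ∀ z : ℂ, D.σk (algebraMap ℂ (LaurentSeries ℂ) z) = algebraMap ℂ (LaurentSeries ℂ) z)
    (hξ : IsPrimitiveRoot D.ν D.r) : Nonempty D.toCyclicDatum.Splitting := by
  by_cases hs : Even D.γ.order
  · obtain ⟨ρ, hρ⟩ := exists_root (dvd_order_of_even hs)
    exact D.exists_splitting_of_pow hρ
  have hid : ∀ a, D.σk a = a := by
    by_contra! hne
    exact hs (even_order_γ hσ hne)
  rcases Nat.even_or_odd D.r with hr | hr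
  · obtain ⟨ρ, hρ, hord⟩ := exists_half_root hξ hid hr
    exact D.exists_splitting_of_odd (Nat.div_mul_cancel hr.two_dvd).symm hρ
      (hord ▸ Int.not_even_iff_odd.mp hs)
  · obtain ⟨ρ, hρ⟩ := exists_root (dvd_order_of_odd hr)
    exact D.exists_splitting_of_pow hρ

end Orders

end PolarizedDatum

end LoopGrading

end

/-! ### The individual cases of the classification. -/

noncomputable section

namespace LoopGrading

namespace PolarizedDatum

section Quadratic

variable {k : Type} [Field k] {F : Type u} [CommRing F] [Algebra k F]
  {D : PolarizedDatum.{u, v} k F} [Nontrivial F] [CharZero k] {R : D.toCyclicDatum.RootDatum}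
  [Module.Finite k F] (C : Choices.{u, v, w} D) (A : D.toCyclicDatum.Splitting)
  (he : R.e = 2) (hid : ∀ a, D.σk a = a) (hκ : IsPrimitiveRoot (D.ν ^ R.e) R.g)

include A he hid hκ

theorem exists_vertex_orthogonalOrSymplectic_of_odd (hg : Odd R.g) (h : D.γ ^ R.g = D.β) :
    ∃ (i : D.I) (h : D.dag i = i), (∀ i', D.dag i' = i' → i' = i) ∧
      D.bi i ^ 2 = algebraMap _ (D.Li i) D.γ ∧ C.VertexOrthogonalOrSymplectic i h := by
  obtain ⟨i, hi, -, hb, hC⟩ := exists_orthogonalOrSymplectic C A he hid h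
  exact ⟨i, hi, vertex_unique R hκ hg hi, hb, hC⟩

theorem exists_vertex_unitary_of_odd (hg : Odd R.g) (h : -D.γ ^ R.g = D.β) :
    ∃ (i : D.I) (h : D.dag i = i), (∀ i', D.dag i' = i' → i' = i) ∧
      D.bi i ^ 2 = algebraMap _ (D.Li i) (-D.γ) ∧ C.VertexUnitary i h := by
  obtain ⟨i, hi, -, hb, hC⟩ := exists_vertexUnitary C A he hid ((hg.neg_pow _).trans h)
  exact ⟨i, hi, vertex_unique R hκ hg hi, hb, hC⟩

theorem exists_arrow_wedgeOrSym_of_odd (hg : Odd R.g) (h : (D.γ * D.ν⁻¹) ^ R.g = D.β) :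
    ∃ (j : D.I) (h : D.rot j = D.dag j), (∀ j', D.rot j' = D.dag j' → j' = j) ∧
      D.bi j ^ 2 = algebraMap _ (D.Li j) (D.γ * D.ν⁻¹) ∧ C.ArrowWedgeOrSym j h := by
  obtain ⟨j, hj, -, hb, hC⟩ := exists_arrowWedgeOrSym C A he hid h
  exact ⟨j, hj, arrow_unique R hκ hg hj, hb, hC⟩

theorem exists_arrow_hermitian_of_odd (hg : Odd R.g) (h : -(D.γ * D.ν⁻¹) ^ R.g = D.β) :
    ∃ (j : D.I) (h : D.rot j = D.dag j), (∀ j', D.rot j' = D.dag j' → j' = j) ∧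
      D.bi j ^ 2 = algebraMap _ (D.Li j) (-D.γ * D.ν⁻¹) ∧ C.ArrowHermitian j h := by
  obtain ⟨j, hj, -, hb, hC⟩ := exists_arrowHermitian C A he hid
    (by rw [neg_mul, hg.neg_pow, h])
  exact ⟨j, hj, arrow_unique R hκ hg hj, hb, hC⟩

theorem exists_vertices_quadratic_of_even (hg : Even R.g) (h : D.γ ^ R.g = D.β) :
    (∃ ℓ, 2 * ℓ = R.g ∧ D.IsVV ℓ) ∧
    ∃ (i i' : D.I) (h : D.dag i = i) (h' : D.dag i' = i'), i ≠ i' ∧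
      (∀ t, D.dag t = t → t = i ∨ t = i') ∧
      D.bi i ^ 2 = algebraMap _ (D.Li i) D.γ ∧ C.VertexOrthogonalOrSymplectic i h ∧
      D.bi i' ^ 2 = algebraMap _ (D.Li i') (-D.γ) ∧ C.VertexUnitary i' h' := by
  obtain ⟨i, hi, h1, hb, hC⟩ := exists_orthogonalOrSymplectic C A he hid h
  obtain ⟨i', hi', h1', hb', hC'⟩ := exists_vertexUnitary C A he hid ((hg.neg_pow _).trans h)
  obtain ⟨t, ht, hne, -, hall⟩ := exists_vertex_pair R hκ hg hi
  obtain rfl : t = i' := R.rho_injective (by rw [ht, h1, h1'])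
  have h2 := Nat.two_mul_div_two_of_even hg
  exact ⟨⟨_, h2, isVV_of_fixed R hκ hi h2⟩, i, t, hi, hi', hne, hall, hb, hC, hb', hC'⟩

theorem exists_arrows_quadratic_of_even (hg : Even R.g) (h : (D.γ * D.ν⁻¹) ^ R.g = D.β) :
    (∃ ℓ, 2 * ℓ = R.g ∧ D.IsEE ℓ) ∧
    ∃ (j j' : D.I) (h : D.rot j = D.dag j) (h' : D.rot j' = D.dag j'), j ≠ j' ∧
      (∀ t, D.rot t = D.dag t → t = j ∨ t = j') ∧
      D.bi j ^ 2 = algebraMap _ (D.Li j) (D.γ * D.ν⁻¹) ∧ C.ArrowWedgeOrSym j h ∧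
      D.bi j' ^ 2 = algebraMap _ (D.Li j') (-D.γ * D.ν⁻¹) ∧ C.ArrowHermitian j' h' := by
  obtain ⟨j, hj, h1, hb, hC⟩ := exists_arrowWedgeOrSym C A he hid h
  obtain ⟨j', hj', h1', hb', hC'⟩ := exists_arrowHermitian C A he hid
    (by rw [neg_mul, hg.neg_pow, h])
  obtain ⟨t, ht, hne, -, hall⟩ := exists_arrow_pair R hκ hg hj
  obtain rfl : t = j' := R.rho_injective (by rw [ht, h1, h1', neg_mul])
  have h2 := Nat.two_mul_div_two_of_even hg
  exact ⟨⟨_, h2, isEE_of_fixed R hκ hj h2⟩, j, t, hj, hj', hne, hall, hb, hC, hb', hC'⟩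

end Quadratic

section Laurent

variable {F : Type u} [CommRing F] [Algebra (LaurentSeries ℂ) F]
  {D : PolarizedDatum.{u, v} (LaurentSeries ℂ) F} [Nontrivial F]

theorem exists_rootDatum_split (hξ : IsPrimitiveRoot D.ν D.r) (h : (D.r : ℤ) ∣ D.β.order) :
    ∃ R : D.toCyclicDatum.RootDatum, R.e = 1 := by
  obtain ⟨ρ, hρ⟩ := exists_root h
  exact ⟨splitRootDatum hξ hρ, rfl⟩

theorem exists_rootDatum_quadratic (hξ : IsPrimitiveRoot D.ν D.r) (hid : ∀ a, D.σk a = a)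
    (hr : Even D.r) (hodd : Odd D.γ.order) : ∃ R : D.toCyclicDatum.RootDatum, R.e = 2 ∧
      R.g = D.r / 2 ∧ IsPrimitiveRoot (D.ν ^ R.e) R.g ∧ D.AllQuadratic := by
  obtain ⟨ρ, hρ, hord⟩ := exists_half_root hξ hid hr
  have h2 := (Nat.div_mul_cancel hr.two_dvd).symm
  let R := quadraticRootDatum hξ h2 hρ (hord ▸ hodd)
  refine ⟨R, rfl, rfl, hξ.pow D.r_pos (h2.trans (mul_comm _ _)), allQuadratic (R := R) rfl fun i => ?_⟩
  rw [order_root R.g_pos ((R.rho_pow i).trans hρ.symm), hord]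
  exact hodd

/-- The solution is a square root of `γ`, which exists in `k` because the valuation is even. -/
theorem exists_vertex_root_of_even (hr : Even D.r) (h : Even D.γ.order)
    (hβ : D.β = D.γ ^ (D.r / 2)) : ∃ a, a ^ 2 = D.γ ∧ a ^ D.r = D.β := by
  obtain ⟨a, ha⟩ := laurent_exists_pow_eq D.γ two_pos D.γ_ne_zero h.two_dvd
  exact ⟨a, ha, by rw [hβ, ← ha, ← pow_mul, Nat.two_mul_div_two_of_even hr]⟩

theorem exists_arrow_root_of_even (hξ : IsPrimitiveRoot D.ν D.r) (hr : Even D.r)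
    (h : Even D.γ.order) (hβ : D.β = -D.γ ^ (D.r / 2)) :
    ∃ a, a ^ 2 = D.γ * D.ν⁻¹ ∧ a ^ D.r = D.β := by
  obtain ⟨a, ha⟩ := laurent_exists_pow_eq (D.γ * D.ν⁻¹) two_pos
    (mul_ne_zero D.γ_ne_zero (inv_ne_zero D.ν_ne_zero)) (order_γν (D := D) ▸ h.two_dvd)
  exact ⟨a, ha, by rw [hβ, ← γν_pow hξ hr, ← ha, ← pow_mul, Nat.two_mul_div_two_of_even hr]⟩

end Laurent

end PolarizedDatum

end LoopGrading

end

open LoopGrading LoopGrading.PolarizedDatum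

theorem mainTheorem4 {F : Type u} [CommRing F] [Nontrivial F] [Algebra (LaurentSeries ℂ) F]
    [Module.Finite (LaurentSeries ℂ) F] [Algebra.Etale (LaurentSeries ℂ) F]
    (D : LoopGrading.PolarizedDatum.{u, v} (LaurentSeries ℂ) F)
    (hσ : ∀ z : ℂ, D.σk (algebraMap ℂ (LaurentSeries ℂ) z) = algebraMap ℂ (LaurentSeries ℂ) z)
    (hξ : IsPrimitiveRoot D.ν D.r)
    (C : LoopGrading.PolarizedDatum.Choices.{u, v, w} D) :
    D.LIsProduct ∧ C.DivisionAlgebrasTrivial ∧ C.PairingsWellDefined ∧ C.HIsProduct ∧ C.GXiIsSum ∧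
    -- the case `σ|_k = id`, `m/n` odd
    ((∀ a, D.σk a = a) → Odd D.r →
      (D.r : ℤ) ∣ D.β.order ∧ D.AllSplit ∧ (∃ ℓ, 2 * ℓ + 1 = D.r ∧ D.IsVE ℓ) ∧
      (∃ (i : D.I) (h : D.dag i = i), (∀ i', D.dag i' = i' → i' = i) ∧
        (∃ a, algebraMap _ (D.Li i) a = D.bi i ∧
          ∀ a', (a' ^ 2 = D.γ ∧ a' ^ D.r = D.β) ↔ a' = a) ∧
        C.VertexOrthogonalOrSymplectic i h) ∧
      (∃ (j : D.I) (h : D.rot j = D.dag j), (∀ j', D.rot j' = D.dag j' → j' = j) ∧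
        (∃ a, algebraMap _ (D.Li j) a = D.bi j ∧
          ∀ a', (a' ^ 2 = D.γ * D.ν⁻¹ ∧ a' ^ D.r = D.β) ↔ a' = a) ∧
        C.ArrowWedgeOrSym j h)) ∧
    -- the case `σ|_k = id`, `m/n` even
    ((∀ a, D.σk a = a) → Even D.r →
      (D.β = D.γ ^ (D.r / 2) ∨ D.β = -D.γ ^ (D.r / 2)) ∧
      -- `val(γ)` even
      (Even D.γ.order → D.AllSplit ∧
        (D.β = D.γ ^ (D.r / 2) → D.IsVV (D.r / 2) ∧
          ∃ (i i' : D.I) (h : D.dag i = i) (h' : D.dag i' = i'), i ≠ i' ∧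
            (∀ t, D.dag t = t → t = i ∨ t = i') ∧
            C.VertexOrthogonalOrSymplectic i h ∧ C.VertexOrthogonalOrSymplectic i' h') ∧
        (D.β = -D.γ ^ (D.r / 2) → D.IsEE (D.r / 2) ∧
          ∀ (j : D.I) (h : D.rot j = D.dag j), C.ArrowWedgeOrSym j h)) ∧
      -- `val(γ)` odd
      (Odd D.γ.order → D.AllQuadratic ∧
        (Odd (D.r / 2) → D.β = D.γ ^ (D.r / 2) →
          (∃ ℓ, 2 * ℓ + 1 = D.r / 2 ∧ D.IsVE ℓ) ∧
          (∃ (i : D.I) (h : D.dag i = i), (∀ i', D.dag i' = i' → i' = i) ∧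
            D.bi i ^ 2 = algebraMap _ (D.Li i) D.γ ∧ C.VertexOrthogonalOrSymplectic i h) ∧
          (∃ (j : D.I) (h : D.rot j = D.dag j), (∀ j', D.rot j' = D.dag j' → j' = j) ∧
            D.bi j ^ 2 = algebraMap _ (D.Li j) (-D.γ * D.ν⁻¹) ∧ C.ArrowHermitian j h)) ∧
        (Odd (D.r / 2) → D.β = -D.γ ^ (D.r / 2) →
          (∃ ℓ, 2 * ℓ + 1 = D.r / 2 ∧ D.IsVE ℓ) ∧
          (∃ (i : D.I) (h : D.dag i = i), (∀ i', D.dag i' = i' → i' = i) ∧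
            D.bi i ^ 2 = algebraMap _ (D.Li i) (-D.γ) ∧ C.VertexUnitary i h) ∧
          (∃ (j : D.I) (h : D.rot j = D.dag j), (∀ j', D.rot j' = D.dag j' → j' = j) ∧
            D.bi j ^ 2 = algebraMap _ (D.Li j) (D.γ * D.ν⁻¹) ∧ C.ArrowWedgeOrSym j h)) ∧
        (Even (D.r / 2) → D.β = D.γ ^ (D.r / 2) →
          (∃ ℓ, 2 * ℓ = D.r / 2 ∧ D.IsVV ℓ) ∧
          ∃ (i i' : D.I) (h : D.dag i = i) (h' : D.dag i' = i'), i ≠ i' ∧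
            (∀ t, D.dag t = t → t = i ∨ t = i') ∧
            D.bi i ^ 2 = algebraMap _ (D.Li i) D.γ ∧ C.VertexOrthogonalOrSymplectic i h ∧
            D.bi i' ^ 2 = algebraMap _ (D.Li i') (-D.γ) ∧ C.VertexUnitary i' h') ∧
        (Even (D.r / 2) → D.β = -D.γ ^ (D.r / 2) →
          (∃ ℓ, 2 * ℓ = D.r / 2 ∧ D.IsEE ℓ) ∧
          ∃ (j j' : D.I) (h : D.rot j = D.dag j) (h' : D.rot j' = D.dag j'), j ≠ j' ∧
            (∀ t, D.rot t = D.dag t → t = j ∨ t = j') ∧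
            D.bi j ^ 2 = algebraMap _ (D.Li j) (D.γ * D.ν⁻¹) ∧ C.ArrowWedgeOrSym j h ∧
            D.bi j' ^ 2 = algebraMap _ (D.Li j') (-D.γ * D.ν⁻¹) ∧ C.ArrowHermitian j' h'))) ∧
    -- the case `σ|_k ≠ id`
    ((∃ a, D.σk a ≠ a) →
      LoopGrading.IsLaurentInSquare D.σk ∧ Even D.γ.order ∧ (D.r : ℤ) ∣ D.β.order ∧
      D.AllSplit ∧
      -- `m/n` odd
      (Odd D.r → (∃ ℓ, 2 * ℓ + 1 = D.r ∧ D.IsVE ℓ) ∧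
        (∃ (i : D.I) (h : D.dag i = i), (∀ i', D.dag i' = i' → i' = i) ∧
          (∃ a, algebraMap _ (D.Li i) a = D.bi i ∧
            ∀ a', (a' * D.σk a' = D.γ ∧ a' ^ D.r = D.β) ↔ a' = a) ∧
          C.VertexUnitary i h) ∧
        (∃ (j : D.I) (h : D.rot j = D.dag j), (∀ j', D.rot j' = D.dag j' → j' = j) ∧
          (∃ a, algebraMap _ (D.Li j) a = D.bi j ∧
            ∀ a', (a' * D.σk a' = D.γ * D.ν⁻¹ ∧ a' ^ D.r = D.β) ↔ a' = a) ∧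
          C.ArrowHermitian j h)) ∧
      -- `m/n` even
      (Even D.r →
        ((∃ a, a * D.σk a = D.γ ∧ a ^ D.r = D.β) → D.IsVV (D.r / 2) ∧
          ∃ (i i' : D.I) (h : D.dag i = i) (h' : D.dag i' = i'), i ≠ i' ∧
            (∀ t, D.dag t = t → t = i ∨ t = i') ∧
            (∃ a, algebraMap _ (D.Li i) a = D.bi i ∧ algebraMap _ (D.Li i') (-a) = D.bi i' ∧
              ∀ a', (a' * D.σk a' = D.γ ∧ a' ^ D.r = D.β) ↔ (a' = a ∨ a' = -a)) ∧
            C.VertexUnitary i h ∧ C.VertexUnitary i' h') ∧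
        ((¬ ∃ a, a * D.σk a = D.γ ∧ a ^ D.r = D.β) → D.IsEE (D.r / 2) ∧
          ∃ (j j' : D.I) (h : D.rot j = D.dag j) (h' : D.rot j' = D.dag j'), j ≠ j' ∧
            (∀ t, D.rot t = D.dag t → t = j ∨ t = j') ∧
            (∃ a, algebraMap _ (D.Li j) a = D.bi j ∧ algebraMap _ (D.Li j') (-a) = D.bi j' ∧
              ∀ a', (a' * D.σk a' = D.γ * D.ν⁻¹ ∧ a' ^ D.r = D.β) ↔ (a' = a ∨ a' = -a)) ∧
            C.ArrowHermitian j h ∧ C.ArrowHermitian j' h'))) := by 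
  -- Étaleness enters only through reducedness, which makes the eigenvectors of `ζ` invertible.
  have : IsReduced F := Algebra.FormallyUnramified.isReduced_of_field (LaurentSeries ℂ) F
  obtain ⟨A⟩ := exists_splitting hσ hξ
  refine ⟨D.toCyclicDatum.L_bijective, C.divisionAlgebrasTrivial A, C.pairingsWellDefined A,
    C.hIsProduct A, C.gXiIsSum A, fun hid hr => ?_, fun hid hr => ⟨β_eq_or hid hr, fun hγ => ?_,
    fun hγ => ?_⟩, fun hne => ?_⟩
  · have hd := dvd_order_of_odd hr
    obtain ⟨R, he⟩ := exists_rootDatum_split hξ hd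
    have hs := allSplit R he
    obtain ⟨i, hi, hi', ha⟩ := exists_vertex_of_odd he hξ hr
    obtain ⟨j, hj, hj', hc⟩ := exists_arrow_of_odd he hξ hr
    simp only [hid, ← sq] at ha hc
    have hve := isVE_of_odd (isPrimitiveRoot_of_e he hξ) (by rwa [r_eq_of_e he])
    rw [r_eq_of_e he] at hve
    exact ⟨hd, hs, hve,
      ⟨i, hi, hi', ha, C.vertexOrthogonalOrSymplectic A hi
        (eq_id_of_split (sigmaVertex_scalar hi) hs hid)⟩,
      ⟨j, hj, hj', hc, C.arrowWedgeOrSym hj (eq_id_of_split (sigmaArrow_scalar hj) hs hid) A⟩⟩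
  · obtain ⟨R, he⟩ := exists_rootDatum_split hξ (dvd_order_of_even hγ)
    have hs := allSplit R he
    refine ⟨hs, fun hβ => ?_, fun hβ => ?_⟩
    · obtain ⟨hvv, i, i', hi, hi', hii, hall, -⟩ := exists_vertices_of_even he hξ hr
        (by simpa only [hid, ← sq] using exists_vertex_root_of_even hr hγ hβ)
      exact ⟨hvv, i, i', hi, hi', hii, hall, C.vertexOrthogonalOrSymplectic A hi
        (eq_id_of_split (sigmaVertex_scalar hi) hs hid), C.vertexOrthogonalOrSymplectic A hi'
        (eq_id_of_split (sigmaVertex_scalar hi') hs hid)⟩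
    · exact ⟨(exists_arrows_of_even he hξ hr
        (by simpa only [hid, ← sq] using exists_arrow_root_of_even hξ hr hγ hβ)).1,
        fun j hj => C.arrowWedgeOrSym hj (eq_id_of_split (sigmaArrow_scalar hj) hs hid) A⟩
  · obtain ⟨R, he, hg, hκ, hq⟩ := exists_rootDatum_quadratic hξ hid hr hγ
    rw [← hg]
    -- This converts the hypothesis on `β` into the one on `γ ν⁻¹` that governs arrows.
    have hγν : (D.γ * D.ν⁻¹) ^ R.g = -D.γ ^ R.g := by rw [hg, γν_pow hξ hr]
    refine ⟨hq, fun ho hβ => ⟨isVE_of_odd hκ ho, ?_, ?_⟩, fun ho hβ => ⟨isVE_of_odd hκ ho, ?_, ?_⟩,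
      fun ho hβ => ?_, fun ho hβ => ?_⟩
    · exact exists_vertex_orthogonalOrSymplectic_of_odd C A he hid hκ ho hβ.symm
    · exact exists_arrow_hermitian_of_odd C A he hid hκ ho (by rw [hγν, hβ, neg_neg])
    · exact exists_vertex_unitary_of_odd C A he hid hκ ho hβ.symm
    · exact exists_arrow_wedgeOrSym_of_odd C A he hid hκ ho (hγν.trans hβ.symm)
    · exact exists_vertices_quadratic_of_even C A he hid hκ ho hβ.symm
    · exact exists_arrows_quadratic_of_even C A he hid hκ ho (hγν.trans hβ.symm)
  · have hγ := even_order_γ hσ hne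
    have hd := dvd_order_of_even hγ
    obtain ⟨R, he⟩ := exists_rootDatum_split hξ hd
    have hs := allSplit R he
    refine ⟨isLaurentInSquare D.σk_σk hσ hne, hγ, hd, hs, fun hr => ?_, fun hr =>
      ⟨fun hex => ?_, fun hex => ?_⟩⟩
    · obtain ⟨i, hi, hi', ha⟩ := exists_vertex_of_odd he hξ hr
      obtain ⟨j, hj, hj', hc⟩ := exists_arrow_of_odd he hξ hr
      have hve := isVE_of_odd (isPrimitiveRoot_of_e he hξ) (by rwa [r_eq_of_e he])
      rw [r_eq_of_e he] at hve
      exact ⟨hve,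
        ⟨i, hi, hi', ha, C.vertexUnitary A hi
          (isConjugation_of_split (sigmaVertex_scalar hi) hs hne)⟩,
        ⟨j, hj, hj', hc, C.arrowHermitian hj A
          (isConjugation_of_split (sigmaArrow_scalar hj) hs hne)⟩⟩
    · obtain ⟨hvv, i, i', hi, hi', hii, hall, ha⟩ := exists_vertices_of_even he hξ hr hex
      exact ⟨hvv, i, i', hi, hi', hii, hall, ha, C.vertexUnitary A hi
        (isConjugation_of_split (sigmaVertex_scalar hi) hs hne), C.vertexUnitary A hi'
        (isConjugation_of_split (sigmaVertex_scalar hi') hs hne)⟩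
    · obtain ⟨hee, j, j', hj, hj', hjj, hall, ha⟩ := exists_arrows_of_even he hξ hr
        (exists_arrow_root he hξ hex)
      exact ⟨hee, j, j', hj, hj', hjj, hall, ha, C.arrowHermitian hj A
        (isConjugation_of_split (sigmaArrow_scalar hj) hs hne), C.arrowHermitian hj' A
        (isConjugation_of_split (sigmaArrow_scalar hj') hs hne)⟩
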